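/- Let $n\ge 2$. Let $\mathbb S^{2n-1}\subset\mathbb C^n$ be the unit sphere with its round metric $\sigma$ and Hopf field $\xi(z)=iz$. For $\mu>0$ let $e_\mu$ be the Berger metric on $\mathbb S^{2n-1}$: it agrees with $\sigma$ on $\xi^{\perp}$, makes $\xi$ orthogonal to $\xi^\perp$, and satisfies $e_\mu(\xi,\xi)=\mu$. The complex hyperbolic space $\mathbb{CH}^n$ is $\mathbb C^n=\mathbb R^{2n}$ with the metric which in polar coordinates $(z,\rho)\in\mathbb S^{2n-1}\times(0,\infty)$ is $$\bar g=d\rho^2+\sinh^2(\rho)\,e_{\cosh^2(\rho)} .$$ Let $F_0:\mathbb S^{2n-1}\to\mathbb{CH}^n$ be a smooth embedding whose image is an $\mathbb S^1$-invariant star-shaped hypersurface, that is, $F_0(\mathbb S^{2n-1})=\{\rho_0(z)z : z\in\mathbb S^{2n-1}\}$ for a smooth function $\rho_0:\mathbb S^{2n-1}\to(0,\infty)$ with $\rho_0(e^{i\vartheta}z)=\rho_0(z)$ for all $\vartheta\in\mathbb R$. Let $\nu_0$ be its outward unit normal, i.e. the one with $\bar g(\partial/\partial\rho,\nu_0)>0$.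 For an immersion $F$ with unit normal $\nu$, put $g=F^*\bar g$, $h(X,Y)=-\bar g(\bar\nabla_X (F_*Y),\nu)$, where $\bar\nabla$ is the Levi-Civita connection of $\bar g$, and $H=g^{ij}h_{ij}$. Assume that $F_0$ is mean convex: $H>0$ everywhere. Then there are positive constants $c_1,c_2,c$, depending only on $n$ and the initial datum $F_0$, such that the following holds. For every $T\in(0,\infty]$ and every smooth solution $F:\mathbb S^{2n-1}\times[0,T)\to\mathbb{CH}^n$ of the inverse mean curvature flow $$\frac{\partial F}{\partial t}=\frac1H\,\nu,\qquad F(\cdot,0)=F_0,$$ by immersions $F_t=F(\cdot,t)$, where $\nu$ is the unit normal of $F_t$, smooth on $\mathbb S^{2n-1}\times[0,T)$ and equal to $\nu_0$ at $t=0$, the mean curvature $H$ of $F_t$ satisfies, at every point of $\mathbb S^{2n-1}$ and for every $t\in[0,T)$, $$0<c_1\le H\le c_2\qquad\text{and}\qquad |H-2n|\le c\,e^{-t/n}.$$ In particular mean convexity is preserved. -/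

import Mathlib

open scoped ContDiff

noncomputable section

/-- The model space `ℂⁿ = ℝ²ⁿ`, used as a real vector space with the Euclidean inner product
`inner ℝ X Y = Re ⟨X, Y⟩`. -/
abbrev Cn (n : ℕ) : Type := EuclideanSpace ℂ (Fin n)

/-- The unit sphere `𝕊²ⁿ⁻¹ ⊂ ℂⁿ`. -/
abbrev USphere (n : ℕ) : Type := Metric.sphere (0 : Cn n) 1

/-! ### Calculus on the unit sphere -/

/-- The extension of `f : 𝕊²ⁿ⁻¹ → V` to `ℂⁿ ∖ {0}` which is constant on rays,
`p ↦ f (p / |p|)`, with the irrelevant value `0` at the origin. The map `f` is smooth as a map on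
the manifold `𝕊²ⁿ⁻¹` if and only if `rayExt f` is smooth on `ℂⁿ ∖ {0}`, and the differential of
`f` at `z` is the restriction to `z^⊥` of the derivative of `rayExt f` at `z`. -/
def rayExt {n : ℕ} {V : Type*} [Zero V] (f : USphere n → V) (p : Cn n) : V :=
  open Classical in
  if h : p = 0 then 0
  else f ⟨‖p‖⁻¹ • p, by
    have hp : ‖p‖ ≠ 0 := norm_ne_zero_iff.mpr h
    simp [norm_smul, hp]⟩

/-- `f : 𝕊²ⁿ⁻¹ → V` is smooth. -/
def SphereSmooth {n : ℕ} {V : Type*} [NormedAddCommGroup V] [NormedSpace ℝ V]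
    (f : USphere n → V) : Prop :=
  ContDiffOn ℝ ∞ (rayExt f) {0}ᶜ

/-- The tangent space `T_z 𝕊²ⁿ⁻¹ = z^⊥` (orthogonal complement over `ℝ`). -/
def sphereTangent {n : ℕ} (z : USphere n) : Submodule ℝ (Cn n) :=
  (Submodule.span ℝ {(z : Cn n)})ᗮ

/-- The differential `F_* X` of `F : 𝕊²ⁿ⁻¹ → ℂⁿ` at `z` in the direction `X`. -/
def sphereDeriv {n : ℕ} (F : USphere n → Cn n) (z : USphere n) (X : Cn n) : Cn n :=
  fderiv ℝ (rayExt F) (z : Cn n) X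

/-! ### The complex hyperbolic space -/

/-- The Berger metric `e_μ` at the point `z` of the unit sphere, on vectors `U, V` tangent to the
sphere. With `ξ = i z` the Hopf field, `e_μ` is the round metric on `ξ^⊥`, makes `ξ` orthogonal
to `ξ^⊥`, and `e_μ(ξ, ξ) = μ`. -/
def bergerMetric {n : ℕ} (μ : ℝ) (z U V : Cn n) : ℝ :=
  inner ℝ U V + (μ - 1) * (inner ℝ U (Complex.I • z) * inner ℝ V (Complex.I • z))

/-- The differential at `p ≠ 0` of the angular polar coordinate `p ↦ p / |p|`. -/
def angularPart {n : ℕ} (p X : Cn n) : Cn n :=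
  ‖p‖⁻¹ • (X - inner ℝ (‖p‖⁻¹ • p) X • (‖p‖⁻¹ • p))

/-- The Bergman metric `dρ² + sinh²(ρ) e_{cosh²(ρ)}` of the complex hyperbolic space `ℂHⁿ`,
in polar coordinates `ρ = |p|`, `z = p / |p|` on `ℂⁿ = ℝ²ⁿ`. Its smooth extension to the origin is
the Euclidean inner product there. -/
def bergmanMetric {n : ℕ} (p X Y : Cn n) : ℝ :=
  open Classical in
  if p = 0 then inner ℝ X Y
  else
    inner ℝ (‖p‖⁻¹ • p) X * inner ℝ (‖p‖⁻¹ • p) Y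
      + Real.sinh ‖p‖ ^ 2 *
        bergerMetric (Real.cosh ‖p‖ ^ 2) (‖p‖⁻¹ • p) (angularPart p X) (angularPart p Y)

/-- The derivative `Z (ḡ(X, Y))` at `p`, for constant vector fields `X, Y`. -/
def bergmanDeriv {n : ℕ} (p Z X Y : Cn n) : ℝ :=
  fderiv ℝ (fun q => bergmanMetric q X Y) p Z

/-- `ḡ(∇̄_X Y, Z)` at `p` for constant vector fields `X, Y, Z` on `ℂⁿ` and the Levi-Civita
connection `∇̄` of the Bergman metric (Koszul formula): the Christoffel symbols of the first
kind. -/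
def bergmanChristoffel {n : ℕ} (p X Y Z : Cn n) : ℝ :=
  (bergmanDeriv p X Y Z + bergmanDeriv p Y X Z - bergmanDeriv p Z X Y) / 2

/-! ### Hypersurfaces parametrized by the sphere -/

/-- `F : 𝕊²ⁿ⁻¹ → ℂHⁿ` is an immersion: its differential is injective on each tangent space. -/
def SphereImmersion {n : ℕ} (F : USphere n → Cn n) : Prop :=
  ∀ z : USphere n, ∀ X ∈ sphereTangent z, sphereDeriv F z X = 0 → X = 0

/-- `N : 𝕊²ⁿ⁻¹ → ℂⁿ` is a unit normal field along `F` for the Bergman metric. -/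
def IsUnitNormal {n : ℕ} (F N : USphere n → Cn n) : Prop :=
  ∀ z : USphere n, bergmanMetric (F z) (N z) (N z) = 1 ∧
    ∀ X ∈ sphereTangent z, bergmanMetric (F z) (sphereDeriv F z X) (N z) = 0

/-- `N` points outward, i.e. away from the origin: `ḡ(∂/∂ρ, N) > 0` (the position vector is
`ρ ∂/∂ρ`, with `ρ > 0`). -/
def PointsOutward {n : ℕ} (F N : USphere n → Cn n) : Prop :=
  ∀ z : USphere n, 0 < bergmanMetric (F z) (F z) (N z)

/-- The induced metric `g = F^* ḡ`. -/
def inducedMetric {n : ℕ} (F : USphere n → Cn n) (z : USphere n) (X Y : Cn n) : ℝ :=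
  bergmanMetric (F z) (sphereDeriv F z X) (sphereDeriv F z Y)

/-- The second fundamental form `h(X, Y) = - ḡ(∇̄_X (F_* Y), N)` at `z`, for `X, Y ∈ T_z 𝕊²ⁿ⁻¹`.
Here `Y` is extended to the tangent field `w ↦ Y - ⟨Y, w⟩ w` of the sphere, whose image under `F_*`
at `w` is `D(rayExt F)(w) Y`, because `rayExt F` is constant on rays. -/
def secondFundamentalForm {n : ℕ} (F N : USphere n → Cn n) (z : USphere n) (X Y : Cn n) : ℝ :=
  -(bergmanMetric (F z)
        (fderiv ℝ (fun w : Cn n => fderiv ℝ (rayExt F) w Y) (z : Cn n) X) (N z)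
      + bergmanChristoffel (F z) (sphereDeriv F z X) (sphereDeriv F z Y) (N z))

/-- The mean curvature `H = g^{ij} h_{ij}` with respect to the unit normal `N`, i.e. the trace of
the second fundamental form with respect to the induced metric. It does not depend on the basis
of `T_z 𝕊²ⁿ⁻¹`, and is computed here in one that is orthonormal for the round metric. -/
def meanCurvature {n : ℕ} (F N : USphere n → Cn n) (z : USphere n) : ℝ :=
  let b := stdOrthonormalBasis ℝ (sphereTangent z)
  let g : Matrix (Fin (Module.finrank ℝ (sphereTangent z)))
      (Fin (Module.finrank ℝ (sphereTangent z))) ℝ :=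
    Matrix.of fun i j => inducedMetric F z (b i) (b j)
  let h : Matrix (Fin (Module.finrank ℝ (sphereTangent z)))
      (Fin (Module.finrank ℝ (sphereTangent z))) ℝ :=
    Matrix.of fun i j => secondFundamentalForm F N z (b i) (b j)
  (g⁻¹ * h).trace

/-- The function `ρ` on `𝕊²ⁿ⁻¹` is invariant under `(e^{iϑ}, z) ↦ e^{iϑ} z`. -/
def CircleInvariant {n : ℕ} (ρ : USphere n → ℝ) : Prop :=
  ∀ a : ℂ, ‖a‖ = 1 → ∀ z w : USphere n, (w : Cn n) = a • (z : Cn n) → ρ w = ρ z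

/-- A set in `ℂHⁿ` is an `𝕊¹`-invariant star-shaped hypersurface (with respect to the origin): in
polar coordinates it is the graph of a smooth positive `𝕊¹`-invariant radial function `ρ`. -/
def IsInvariantStarShaped {n : ℕ} (M : Set (Cn n)) : Prop :=
  ∃ ρ : USphere n → ℝ, (∀ z, 0 < ρ z) ∧ SphereSmooth ρ ∧ CircleInvariant ρ ∧
    M = Set.range fun z : USphere n => ρ z • (z : Cn n)

/-! ### Inverse mean curvature flow -/

/-- The time interval `[0, T)`, with `T = ∞` allowed. -/
def timeInterval (T : EReal) : Set ℝ := {t | 0 ≤ t ∧ (t : EReal) < T}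

/-- A time dependent map on the sphere is smooth on `[0, T) × 𝕊²ⁿ⁻¹` (up to `t = 0`). -/
def FlowSmooth {n : ℕ} (T : EReal) (F : ℝ → USphere n → Cn n) : Prop :=
  ContDiffOn ℝ ∞ (fun q : ℝ × Cn n => rayExt (F q.1) q.2) (timeInterval T ×ˢ {0}ᶜ)

/-- `F : 𝕊²ⁿ⁻¹ × [0, T) → ℂHⁿ` is a solution of the inverse mean curvature flow
`∂F/∂t = ν / H` with initial datum `F₀`. Here `ν` is a unit normal field of the immersions
`F_t = F t`, smooth in space and time, which at `t = 0` is the given normal `ν₀` of `F₀`. -/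
structure IsInverseMeanCurvatureFlow {n : ℕ} (F₀ ν₀ : USphere n → Cn n) (T : EReal)
    (F ν : ℝ → USphere n → Cn n) : Prop where
  time_pos : 0 < T
  smooth : FlowSmooth T F
  smooth_normal : FlowSmooth T ν
  immersion : ∀ t ∈ timeInterval T, SphereImmersion (F t)
  normal : ∀ t ∈ timeInterval T, IsUnitNormal (F t) (ν t)
  evolution : ∀ t ∈ timeInterval T, ∀ z : USphere n,
    HasDerivWithinAt (fun s => F s z) ((1 / meanCurvature (F t) (ν t) z) • ν t z)
      (timeInterval T) t
  initial : F 0 = F₀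
  initial_normal : ν 0 = ν₀

end

/-! Polar coordinates make the problem scalar. For the conformal radius φ = log tanh(ρ/2) one has dρ
= sinh ρ dφ, and a radial graph has induced metric sinh²ρ (dφ² + σ + sinh²ρ η²), where η is dual to
the Hopf field ξ. Its squared slope is V² = 1 + |∇φ|² - tanh²ρ φ_ξ², and inverse mean curvature flow
reads φ_t G = 1 with G = H sinh ρ / V (`graphCurv`, `IsOrientedGraphChart.meanCurvature_eq`). Since
φ is extended to be constant on rays, all derivatives are Euclidean ones at points of norm 1.

Symmetry. A skew map W commuting with i generates isometries of the ambient space that fix the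
origin, so φ_W + k φ_t solves the linearized equation. Ellipticity (`contraction_nonpos'`) gives
`IsGraphSolution.comparison`, a maximum principle for φ_W / φ_t. The choice W = ±i shows that circle
invariance is preserved (`GraphFlow.rot_eq_zero`). All terms with the Hopf field then drop out, and
the remaining equation is invariant under every rotation of ℝ²ⁿ. Choosing at each maximum the
rotation along the gradient bounds |∇φ|² / φ_t² and replaces the usual commutation of covariant
derivatives.

Estimates. Comparison with geodesic spheres at the extrema of ρ bounds sinh ρ below and cosh ρ above
by multiples of e^{t/2n}. The equation for φ_t bounds it on both sides by multiples of e^{-t/2n}.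
Hence P = |∇φ|² and 1/sinh²ρ are O(e^{-t/n}). In the invariant case H = √(1+P) / (φ_t sinh ρ). At
spatial maxima X = H/2n satisfies dX/dt ≤ -(X-1)/(nX) up to small errors, and (X-1)eˣ turns this
into linear decay. At minima the second order gradient terms of the exact H have the wrong sign, so
H is replaced by the smaller quantity e^{-βP/2} / (φ_t sinh ρ). `GraphFlow.exp_decay` absorbs the
errors in both cases and gives the rate e^{-t/n}.

Continuation. These bounds hold as long as the hypersurfaces are star-shaped and mean convex, that
is ⟨F, ν⟩ > 0 and H > 0. Both conditions are open, because ν and the velocity ν/H are continuous,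
and closed, because of the bounds, so there is no first bad time
(`IsInverseMeanCurvatureFlow.isOutwardConvex`). No global graph is needed: ⟨F, ν⟩ > 0 makes the
immersion transversal to the rays, hence locally a radial graph, and the maximum principle runs on
the compact parameter sphere. -/

noncomputable section DirectionalDerivatives

open Filter Topology

/-! ### Directional derivatives and the second derivative test along lines. -/

section Pd

variable {X : Type*} [NormedAddCommGroup X] [NormedSpace ℝ X]

/-- The directional derivative along a constant vector. -/
def pd (w : X) (f : X → ℝ) (x : X) : ℝ := fderiv ℝ f x w

/-- Smoothness of order ∞ at a point only gives, for each finite order, some neighbourhood depending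
on that order; therefore nearby points get finite orders only. -/
lemma eventually_contDiffAt_nat {V : Type*} [NormedAddCommGroup V] [NormedSpace ℝ V]
    {f : X → V} {x : X} (hf : ContDiffAt ℝ ∞ f x) (k : ℕ) :
    ∀ᶠ y in 𝓝 x, ContDiffAt ℝ k f y :=
  (hf.of_le (by exact_mod_cast le_top) : ContDiffAt ℝ k f x).eventually (by simp)

lemma ContDiffAt.pd {f : X → ℝ} {x : X} {m n : WithTop ℕ∞} (hf : ContDiffAt ℝ n f x)
    (h : m + 1 ≤ n) (w : X) : ContDiffAt ℝ m (pd w f) x :=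
  (hf.fderiv_right h).clm_apply contDiffAt_const

lemma ContDiffAt.pd_top {f : X → ℝ} {x : X} (hf : ContDiffAt ℝ ∞ f x) (w : X) :
    ContDiffAt ℝ ∞ (_root_.pd w f) x :=
  hf.pd (by simp) w

lemma ContDiffAt.diff_top {V : Type*} [NormedAddCommGroup V] [NormedSpace ℝ V]
    {f : X → V} {x : X} (hf : ContDiffAt ℝ ∞ f x) : DifferentiableAt ℝ f x :=
  hf.differentiableAt (by simp)

lemma pd_congr {f g : X → ℝ} {x : X} (h : f =ᶠ[𝓝 x] g) (w : X) : pd w f =ᶠ[𝓝 x] pd w g :=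
  (h.fderiv (𝕜 := ℝ)).mono fun y hy => by simp [pd, hy]

lemma pd_pd_eq {f : X → ℝ} {x : X} (hf : ContDiffAt ℝ 2 f x) (v w : X) :
    pd v (pd w f) x = fderiv ℝ (fderiv ℝ f) x v w := by
  have h1 : DifferentiableAt ℝ (fderiv ℝ f) x :=
    (hf.fderiv_right (m := 1) (by norm_num)).differentiableAt (by norm_num)
  have h2 : HasFDerivAt (pd w f) ((fderiv ℝ (fderiv ℝ f) x).flip w) x := by
    have := h1.hasFDerivAt.clm_apply (hasFDerivAt_const w x)
    rwa [ContinuousLinearMap.comp_zero, zero_add] at this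
  simp [pd, h2.fderiv]

lemma pd_comm {f : X → ℝ} {x : X} (hf : ContDiffAt ℝ 2 f x) (v w : X) :
    pd v (pd w f) x = pd w (pd v f) x := by
  rw [pd_pd_eq hf, pd_pd_eq hf]
  exact (hf.isSymmSndFDerivAt (by simp)).eq v w

lemma pd_mul {f g : X → ℝ} {x : X} (hf : DifferentiableAt ℝ f x) (hg : DifferentiableAt ℝ g x)
    (w : X) : pd w (fun y => f y * g y) x = pd w f x * g x + f x * pd w g x := by
  simp only [pd]
  rw [fderiv_fun_mul hf hg]
  simp
  ring

lemma pd_add {f g : X → ℝ} {x : X} (hf : DifferentiableAt ℝ f x) (hg : DifferentiableAt ℝ g x)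
    (w : X) : pd w (fun y => f y + g y) x = pd w f x + pd w g x := by
  simp only [pd]
  rw [fderiv_fun_add hf hg]
  simp

lemma pd_sum {ι : Type*} {s : Finset ι} {f : ι → X → ℝ} {x : X}
    (hf : ∀ i ∈ s, DifferentiableAt ℝ (f i) x)
    (w : X) : pd w (fun y => ∑ i ∈ s, f i y) x = ∑ i ∈ s, pd w (f i) x := by
  simp only [pd]
  rw [fderiv_fun_sum hf]
  simp

lemma pd_comp {f : X → ℝ} {g : ℝ → ℝ} {g' : ℝ} {x : X} (hf : DifferentiableAt ℝ f x)
    (hg : HasDerivAt g g' (f x)) (w : X) : pd w (fun y => g (f y)) x = g' * pd w f x := by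
  have := hg.comp_hasFDerivAt x hf.hasFDerivAt
  simp only [pd]
  rw [show (fun y => g (f y)) = g ∘ f from rfl, this.fderiv]
  simp

/-- A function whose restriction to a line has a local maximum has nonpositive second derivative
in the direction of this line. -/
lemma pd_pd_nonpos_of_isLocalMax {f : X → ℝ} {x : X} (hf : ContDiffAt ℝ 2 f x) (v : X)
    (h : IsLocalMax (fun s : ℝ => f (x + s • v)) 0) : pd v (pd v f) x ≤ 0 := by
  by_contra! hc
  set γ : ℝ → X := fun s => x + s • v with hγ
  have hγ0 : γ 0 = x := by simp [hγ]
  have hγd : ∀ s, HasDerivAt γ v s := fun s => by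
    have := ((hasDerivAt_id s).smul_const v).const_add x
    rwa [one_smul] at this
  have hγc : Tendsto γ (𝓝 0) (𝓝 x) := by
    have := (hγd 0).continuousAt.tendsto
    rwa [hγ0] at this
  have hev : ∀ᶠ s in 𝓝 (0 : ℝ), HasDerivAt (fun s => f (γ s)) (pd v f (γ s)) s := by
    have := hγc.eventually (hf.eventually (by simp))
    filter_upwards [this] with s hs
    exact (hs.differentiableAt (by simp)).hasFDerivAt.comp_hasDerivAt s (hγd s)
  have hd : deriv (fun s => f (γ s)) =ᶠ[𝓝 0] fun s => pd v f (γ s) :=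
    hev.mono fun s hs => hs.deriv
  have h2 : HasDerivAt (fun s => pd v f (γ s)) (pd v (pd v f) x) 0 := by
    have h3 : HasFDerivAt (pd v f) (fderiv ℝ (pd v f) x) (γ 0) := by
      rw [hγ0]
      exact ((hf.pd (m := 1) (by norm_num) v).differentiableAt (by simp)).hasFDerivAt
    exact h3.comp_hasDerivAt (0 : ℝ) (hγd 0)
  have h4 : deriv (deriv fun s => f (γ s)) 0 = pd v (pd v f) x := by
    rw [hd.deriv_eq, h2.deriv]
  -- A positive second derivative makes 0 a local minimum as well as a local maximum, so the
  -- restriction is constant near 0 and its second derivative vanishes.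
  have hmin : IsLocalMin (fun s => f (γ s)) 0 :=
    isLocalMin_of_deriv_deriv_pos (by rw [h4]; exact hc) h.deriv_eq_zero
      hev.self_of_nhds.continuousAt
  have hconst : (fun s => f (γ s)) =ᶠ[𝓝 0] fun _ => f (γ 0) := by
    filter_upwards [h, hmin] with s h1 h2
    exact le_antisymm h1 h2
  have : deriv (fun s => f (γ s)) =ᶠ[𝓝 0] fun _ => 0 := by
    have := hconst.deriv
    simpa using this
  rw [this.deriv_eq] at h4
  simp at h4
  linarith

end Pd

/-! ### Rotation fields of space-time and their commutation with gradient and Laplacian. -/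

section Rot

variable {E : Type*} [NormedAddCommGroup E] [InnerProductSpace ℝ E]

/-- The derivative along the vector field `(t, q) ↦ (k, W q)` of space-time. -/
def rotD (k : ℝ) (W : E →L[ℝ] E) (f : ℝ × E → ℝ) (x : ℝ × E) : ℝ := fderiv ℝ f x (k, W x.2)

lemma rotD_smooth {f : ℝ × E → ℝ} {x : ℝ × E} {m n : WithTop ℕ∞} (hf : ContDiffAt ℝ n f x)
    (h : m + 1 ≤ n) (k : ℝ) (W : E →L[ℝ] E) : ContDiffAt ℝ m (rotD k W f) x := by
  refine (hf.fderiv_right h).clm_apply (contDiffAt_const.prodMk ?_)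
  exact W.contDiff.contDiffAt.comp x contDiffAt_snd

lemma rotD_smooth_top {f : ℝ × E → ℝ} {x : ℝ × E} (hf : ContDiffAt ℝ ∞ f x) (k : ℝ)
    (W : E →L[ℝ] E) : ContDiffAt ℝ ∞ (rotD k W f) x :=
  rotD_smooth hf (by simp) k W

lemma rotD_congr {f g : ℝ × E → ℝ} {x : ℝ × E} (h : f =ᶠ[𝓝 x] g) (k : ℝ) (W : E →L[ℝ] E) :
    rotD k W f =ᶠ[𝓝 x] rotD k W g :=
  (h.fderiv (𝕜 := ℝ)).mono fun y hy => by simp [rotD, hy]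

lemma rotD_eq_pd (f : ℝ × E → ℝ) (x : ℝ × E) (k : ℝ) (W : E →L[ℝ] E) :
    rotD k W f x = pd (k, W x.2) f x := rfl

lemma rotD_hasFDerivAt {f : ℝ × E → ℝ} {x : ℝ × E} (hf : ContDiffAt ℝ 2 f x) (k : ℝ)
    (W : E →L[ℝ] E) (v : ℝ × E) : pd v (rotD k W f) x
      = fderiv ℝ (fderiv ℝ f) x v (k, W x.2) + fderiv ℝ f x (0, W v.2) := by
  have h1 : DifferentiableAt ℝ (fderiv ℝ f) x :=
    (hf.fderiv_right (m := 1) (by norm_num)).differentiableAt (by norm_num)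
  have h2 : HasFDerivAt (fun y : ℝ × E => (k, W y.2))
      ((0 : ℝ × E →L[ℝ] ℝ).prod (W.comp (ContinuousLinearMap.snd ℝ ℝ E))) x := by
    refine (hasFDerivAt_const k x).prodMk ?_
    exact W.hasFDerivAt.comp x hasFDerivAt_snd
  have h3 : HasFDerivAt (rotD k W f) _ x := h1.hasFDerivAt.clm_apply h2
  simp only [pd]
  rw [h3.fderiv]
  simp [add_comm]

/-- The bracket of the constant field v with the affine field (k, W q) is the constant field (0, W
v); this is the only correction term in the commutations below. -/
lemma pd_rotD {f : ℝ × E → ℝ} {x : ℝ × E} (hf : ContDiffAt ℝ 2 f x) (k : ℝ) (W : E →L[ℝ] E)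
    (v : ℝ × E) : pd v (rotD k W f) x = rotD k W (pd v f) x + pd (0, W v.2) f x := by
  rw [rotD_hasFDerivAt hf, rotD_eq_pd, pd_comm hf, pd_pd_eq hf]
  rfl

/-- Two of the vector fields `(k, W q)` with commuting `W` give commuting derivations. -/
lemma rotD_comm {f : ℝ × E → ℝ} {x : ℝ × E} (hf : ContDiffAt ℝ 2 f x) (k l : ℝ)
    (W U : E →L[ℝ] E) (hWU : ∀ v, W (U v) = U (W v)) :
    rotD k W (rotD l U f) x = rotD l U (rotD k W f) x := by
  rw [rotD_eq_pd, rotD_eq_pd, rotD_hasFDerivAt hf, rotD_hasFDerivAt hf,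
    (hf.isSymmSndFDerivAt (by simp)).eq]
  simp [hWU]

variable {ι : Type*} [Fintype ι] (b : OrthonormalBasis ι ℝ E)

/-- The product `⟨∇f, ∇g⟩` of the spatial gradients. -/
def gradProd (f g : ℝ × E → ℝ) (x : ℝ × E) : ℝ :=
  ∑ i, pd ((0 : ℝ), b i) f x * pd ((0 : ℝ), b i) g x

/-- The spatial Laplacian. -/
def laplace (f : ℝ × E → ℝ) (x : ℝ × E) : ℝ :=
  ∑ i, pd ((0 : ℝ), b i) (pd ((0 : ℝ), b i) f) x

lemma gradProd_comm (f g : ℝ × E → ℝ) : gradProd b f g = gradProd b g f := by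
  ext x
  simp [gradProd, mul_comm]

lemma gradProd_smooth {f g : ℝ × E → ℝ} {x : ℝ × E} {m n : WithTop ℕ∞} (hf : ContDiffAt ℝ n f x)
    (hg : ContDiffAt ℝ n g x) (h : m + 1 ≤ n) : ContDiffAt ℝ m (gradProd b f g) x :=
  ContDiffAt.sum fun _ _ => (hf.pd h _).mul (hg.pd h _)

lemma gradProd_smooth_top {f g : ℝ × E → ℝ} {x : ℝ × E} (hf : ContDiffAt ℝ ∞ f x)
    (hg : ContDiffAt ℝ ∞ g x) : ContDiffAt ℝ ∞ (gradProd b f g) x :=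
  gradProd_smooth b hf hg (by simp)

lemma laplace_smooth_top {f : ℝ × E → ℝ} {x : ℝ × E} (hf : ContDiffAt ℝ ∞ f x) :
    ContDiffAt ℝ ∞ (laplace b f) x :=
  ContDiffAt.sum fun _ _ => (hf.pd_top _).pd_top _

lemma pd_sum_repr (f : ℝ × E → ℝ) (x : ℝ × E) (w : E) :
    pd ((0 : ℝ), w) f x = ∑ i, inner ℝ (b i) w * pd ((0 : ℝ), b i) f x := by
  have h : ((0 : ℝ), w) = ∑ i, (inner ℝ (b i) w) • ((0 : ℝ), b i) := by
    refine Prod.ext ?_ ?_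
    · simp [Prod.fst_sum]
    · simp [Prod.snd_sum, b.sum_repr']
  simp only [pd]
  conv_lhs => rw [h]
  rw [map_sum]
  simp only [map_smul, smul_eq_mul]

/-- A skew W generates isometries of E, which preserve the gradient product. Concretely, the bracket
terms cancel in pairs because the matrix of W is antisymmetric. -/
lemma rotD_gradProd {f g : ℝ × E → ℝ} {x : ℝ × E} (hf : ContDiffAt ℝ 2 f x)
    (hg : ContDiffAt ℝ 2 g x) (k : ℝ) (W : E →L[ℝ] E)
    (hW : ∀ v w, inner ℝ (W v) w = -inner ℝ v (W w)) :
    rotD k W (gradProd b f g) x = gradProd b (rotD k W f) g x + gradProd b f (rotD k W g) x := by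
  have hd : ∀ {f : ℝ × E → ℝ}, ContDiffAt ℝ 2 f x → ∀ i,
      DifferentiableAt ℝ (pd ((0 : ℝ), b i) f) x :=
    fun hf i => (hf.pd (m := 1) (by norm_num) _).differentiableAt (by norm_num)
  have h1 : rotD k W (gradProd b f g) x = ∑ i,
      (rotD k W (pd ((0 : ℝ), b i) f) x * pd ((0 : ℝ), b i) g x
        + pd ((0 : ℝ), b i) f x * rotD k W (pd ((0 : ℝ), b i) g) x) := by
    rw [rotD_eq_pd, show gradProd b f g = fun y => ∑ i,
      pd ((0 : ℝ), b i) f y * pd ((0 : ℝ), b i) g y from rfl,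
      pd_sum fun i _ => (hd hf i).fun_mul (hd hg i)]
    refine Finset.sum_congr rfl fun i _ => ?_
    rw [pd_mul (hd hf i) (hd hg i)]
    rfl
  have h2 : ∑ i, (pd ((0 : ℝ), W (b i)) f x * pd ((0 : ℝ), b i) g x
      + pd ((0 : ℝ), b i) f x * pd ((0 : ℝ), W (b i)) g x) = 0 := by
    rw [Finset.sum_add_distrib]
    simp_rw [pd_sum_repr b f x (W _), pd_sum_repr b g x (W _), Finset.sum_mul, Finset.mul_sum]
    rw [Finset.sum_comm, ← Finset.sum_add_distrib]
    refine Finset.sum_eq_zero fun i _ => ?_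
    rw [← Finset.sum_add_distrib]
    refine Finset.sum_eq_zero fun j _ => ?_
    have : inner ℝ (b i) (W (b j)) = - inner ℝ (b j) (W (b i)) := by
      rw [real_inner_comm, hW]
    rw [this]
    ring
  rw [h1]
  simp only [gradProd]
  simp_rw [pd_rotD hf, pd_rotD hg]
  refine (add_zero _).symm.trans ?_
  rw [← Finset.sum_add_distrib]
  refine (congrArg₂ (· + ·) rfl h2.symm).trans ?_
  rw [← Finset.sum_add_distrib]
  refine Finset.sum_congr rfl fun i _ => ?_
  ring

/-- The Laplacian commutes with isometries. The bracket terms form the contraction of the symmetric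
Hessian with the antisymmetric matrix of W. -/
lemma rotD_laplace {f : ℝ × E → ℝ} {x : ℝ × E} (hf : ContDiffAt ℝ 3 f x) (k : ℝ) (W : E →L[ℝ] E)
    (hW : ∀ v w, inner ℝ (W v) w = -inner ℝ v (W w)) :
    rotD k W (laplace b f) x = laplace b (rotD k W f) x := by
  have hf2 : ContDiffAt ℝ 2 f x := hf.of_le (by norm_num)
  have hev : ∀ᶠ y in 𝓝 x, ContDiffAt ℝ 2 f y := hf2.eventually (by simp)
  have hd : ∀ v, ContDiffAt ℝ 2 (pd v f) x := fun v => hf.pd (by norm_num) v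
  have hdd : ∀ v w, DifferentiableAt ℝ (pd v (pd w f)) x := fun v w =>
    ((hd w).pd (m := 1) (by norm_num) v).differentiableAt (by norm_num)
  have hr : ContDiffAt ℝ 2 (rotD k W f) x := rotD_smooth hf (by norm_num) k W
  have h1 : rotD k W (laplace b f) x = ∑ i, rotD k W (pd ((0 : ℝ), b i) (pd ((0 : ℝ), b i) f)) x := by
    rw [rotD_eq_pd, show laplace b f = fun y => ∑ i,
      pd ((0 : ℝ), b i) (pd ((0 : ℝ), b i) f) y from rfl, pd_sum fun i _ => hdd _ _]
    rfl
  have h2 : ∀ v : ℝ × E, pd v (pd v (rotD k W f)) x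
      = rotD k W (pd v (pd v f)) x + 2 * pd ((0 : ℝ), W v.2) (pd v f) x := by
    intro v
    have : pd v (rotD k W f) =ᶠ[𝓝 x] fun y => rotD k W (pd v f) y + pd ((0 : ℝ), W v.2) f y :=
      hev.mono fun y hy => pd_rotD hy k W v
    rw [(pd_congr this v).self_of_nhds, pd_add ((rotD_smooth (hd v) (m := 1) (by norm_num) k W).differentiableAt
      (by norm_num)) ((hd _).differentiableAt (by norm_num)), pd_rotD (hd v), pd_comm hf2 v]
    ring
  -- Exchanging the two summation indices changes the sign of W and not that of the Hessian, so the
  -- sum equals its negative.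
  have h3 : ∑ i, pd ((0 : ℝ), W (b i)) (pd ((0 : ℝ), b i) f) x = 0 := by
    have key : ∑ i, pd ((0 : ℝ), W (b i)) (pd ((0 : ℝ), b i) f) x
        = - ∑ i, pd ((0 : ℝ), W (b i)) (pd ((0 : ℝ), b i) f) x := by
      simp_rw [pd_sum_repr b _ x (W _)]
      rw [← Finset.sum_neg_distrib]
      conv_rhs => 
        enter [2, i]
        rw [← Finset.sum_neg_distrib]
      rw [Finset.sum_comm]
      refine Finset.sum_congr rfl fun i _ => Finset.sum_congr rfl fun j _ => ?_
      have : inner ℝ (b i) (W (b j)) = - inner ℝ (b j) (W (b i)) := by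
        rw [real_inner_comm, hW]
      rw [this, pd_comm hf2]
      ring
    linarith
  rw [h1]
  simp only [laplace]
  simp_rw [h2]
  rw [Finset.sum_add_distrib, ← Finset.mul_sum, h3]
  simp

end Rot

end DirectionalDerivatives

noncomputable section GraphEquation

open Filter Topology

/-! ### Linear algebra of the elliptic symbol. -/

section Contraction

variable {E : Type*} [NormedAddCommGroup E] [InnerProductSpace ℝ E]
  {ι : Type*} [Fintype ι] (b : OrthonormalBasis ι ℝ E)

/-- The left side is the trace of B pulled back by the symmetric map 1 - c p ⊗ p. Suitable values of
c make the square of this map any prescribed rank one perturbation of the identity that is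
nonnegative. -/
lemma sum_bilin_shear (B : E →ₗ[ℝ] E →ₗ[ℝ] ℝ) (p : E) (c : ℝ) :
    ∑ i, B (b i - (c * inner ℝ p (b i)) • p) (b i - (c * inner ℝ p (b i)) • p)
      = ∑ i, B (b i) (b i) + (-2 * c + c ^ 2 * ‖p‖ ^ 2) * B p p := by
  have h1 : ∑ i, inner ℝ p (b i) * B (b i) p = B p p := by
    calc _ = B (∑ i, inner ℝ (b i) p • b i) p := by
          simp only [map_sum, map_smul, LinearMap.sum_apply, LinearMap.smul_apply, smul_eq_mul,
            real_inner_comm]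
      _ = _ := by rw [b.sum_repr']
  have h2 : ∑ i, inner ℝ p (b i) * B p (b i) = B p p := by
    conv_rhs => enter [2]; rw [← b.sum_repr' p]
    simp [real_inner_comm]
  have h3 : ∑ i, inner ℝ p (b i) ^ 2 = ‖p‖ ^ 2 := by
    rw [← b.sum_sq_norm_inner_left p]
    simp
  have h4 : ∀ i, B (b i - (c * inner ℝ p (b i)) • p) (b i - (c * inner ℝ p (b i)) • p)
      = B (b i) (b i) - c * (inner ℝ p (b i) * B (b i) p) - c * (inner ℝ p (b i) * B p (b i))
        + (c ^ 2 * B p p) * inner ℝ p (b i) ^ 2 := by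
    intro i
    simp only [map_sub, map_smul, LinearMap.sub_apply, LinearMap.smul_apply, smul_eq_mul]
    ring
  simp_rw [h4]
  rw [Finset.sum_add_distrib, Finset.sum_sub_distrib, Finset.sum_sub_distrib, ← Finset.mul_sum,
    ← Finset.mul_sum, ← Finset.mul_sum, h1, h2, h3]
  ring

/-- With v² = 1 + |p|² and c = 1/(v(v+1)), the square of 1 - c p ⊗ p is 1 - p ⊗ p / v². The
contraction is therefore the trace of a pullback of B, and pullbacks of nonpositive forms are
nonpositive. -/
lemma contraction_nonpos (B : E →ₗ[ℝ] E →ₗ[ℝ] ℝ) (hB : ∀ v, B v v ≤ 0) (p : E) :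
    ∑ i, B (b i) (b i) - B p p / (1 + ‖p‖ ^ 2) ≤ 0 := by
  set v := √(1 + ‖p‖ ^ 2) with hv
  have hv1 : v ^ 2 = 1 + ‖p‖ ^ 2 := Real.sq_sqrt (by positivity)
  have hv0 : 0 < v := Real.sqrt_pos.2 (by positivity)
  have h := sum_bilin_shear b B p (1 / (v * (v + 1)))
  have hc : -2 * (1 / (v * (v + 1))) + (1 / (v * (v + 1))) ^ 2 * ‖p‖ ^ 2 = -(1 / v ^ 2) := by
    rw [show ‖p‖ ^ 2 = v ^ 2 - 1 by linarith]
    field_simp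
    ring
  rw [hc, hv1] at h
  have : ∑ i, B (b i) (b i) - B p p / (1 + ‖p‖ ^ 2)
      = ∑ i, B (b i) (b i) + -(1 / (1 + ‖p‖ ^ 2)) * B p p := by ring
  rw [this, ← h]
  exact Finset.sum_nonpos fun i _ => hB _

/-- The contraction of a nonpositive form with `S - Sp ⊗ Sp / (1 + ⟨Sp, p⟩)`, where
`S = 1 - κ ξ ⊗ ξ`, is nonpositive. -/
lemma contraction_nonpos' (B : E →ₗ[ℝ] E →ₗ[ℝ] ℝ) (hB : ∀ v, B v v ≤ 0) (p ξ : E) {κ : ℝ}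
    (hκ1 : κ ≤ 1) (hξ : ‖ξ‖ ≤ 1) :
    ∑ i, B (b i) (b i) - κ * B ξ ξ
      - B (p - (κ * inner ℝ p ξ) • ξ) (p - (κ * inner ℝ p ξ) • ξ)
        / (1 + ‖p‖ ^ 2 - κ * inner ℝ p ξ ^ 2) ≤ 0 := by
  have hk : κ * ‖ξ‖ ^ 2 ≤ 1 := by
    have : ‖ξ‖ ^ 2 ≤ 1 := pow_le_one₀ (norm_nonneg _) hξ
    nlinarith
  set r := √(1 - κ * ‖ξ‖ ^ 2) with hr
  have hr0 : 0 ≤ r := Real.sqrt_nonneg _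
  have hr2 : r ^ 2 = 1 - κ * ‖ξ‖ ^ 2 := Real.sq_sqrt (by linarith)
  have hr1 : 1 + r ≠ 0 := by positivity
  -- For this c the map T = 1 - c ξ ⊗ ξ is a symmetric square root of S = 1 - κ ξ ⊗ ξ. The claim is
  -- then `contraction_nonpos` for the pullback of B by T and the vector T p, since T(T p) = S p and
  -- |T p|² = ⟨S p, p⟩.
  set c := κ / (1 + r) with hc
  have hcκ : -2 * c + c ^ 2 * ‖ξ‖ ^ 2 = -κ := by
    have h1 : c * (1 + r) = κ := by rw [hc]; field_simp
    have h2 : c * ‖ξ‖ ^ 2 = 1 - r := by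
      have : (1 + r) * (c * ‖ξ‖ ^ 2) = (1 + r) * (1 - r) := by
        calc (1 + r) * (c * ‖ξ‖ ^ 2) = (c * (1 + r)) * ‖ξ‖ ^ 2 := by ring
          _ = 1 - r ^ 2 := by rw [h1, hr2]; ring
          _ = _ := by ring
      exact mul_left_cancel₀ hr1 this
    calc _ = -2 * c + c * (c * ‖ξ‖ ^ 2) := by ring
      _ = -(c * (1 + r)) := by rw [h2]; ring
      _ = _ := by rw [h1]
  let T : E →ₗ[ℝ] E := LinearMap.id - c • (innerₛₗ ℝ ξ).smulRight ξ
  have hT : ∀ v, T v = v - (c * inner ℝ ξ v) • ξ := fun v => by simp [T, mul_smul]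
  have key := contraction_nonpos b (B.compl₁₂ T T) (fun v => by simpa using hB (T v)) (T p)
  have h1 : ‖T p‖ ^ 2 = ‖p‖ ^ 2 - κ * inner ℝ p ξ ^ 2 := by
    rw [hT, norm_sub_sq_real, norm_smul, inner_smul_right, real_inner_comm p ξ, mul_pow,
      Real.norm_eq_abs, sq_abs]
    linear_combination (inner ℝ p ξ ^ 2) * hcκ
  have h2 : T (T p) = p - (κ * inner ℝ p ξ) • ξ := by
    rw [hT (T p), hT p, inner_sub_right, inner_smul_right, real_inner_self_eq_norm_sq, sub_sub,
      ← add_smul, real_inner_comm p ξ]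
    congr 2
    linear_combination (-inner ℝ p ξ) * hcκ
  simp only [LinearMap.compl₁₂_apply, h2, h1] at key
  have h3 : ∑ i, B (T (b i)) (T (b i)) = ∑ i, B (b i) (b i) - κ * B ξ ξ := by
    simp_rw [hT]
    rw [sum_bilin_shear, hcκ]
    ring
  rw [h3] at key
  convert key using 3
  ring

end Contraction

/-! ### Hyperbolic functions of the conformal radius. -/

section Hyperbolic

/-- `sinh ρ` as a function of the conformal radius `y = log tanh (ρ / 2) < 0`. -/
def csinh (y : ℝ) : ℝ := -(Real.sinh y)⁻¹

/-- `cosh ρ` as a function of the conformal radius `y = log tanh (ρ / 2) < 0`. -/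
def ccosh (y : ℝ) : ℝ := -(Real.cosh y / Real.sinh y)

lemma csinh_pos {y : ℝ} (hy : y < 0) : 0 < csinh y :=
  neg_pos.2 (inv_lt_zero.2 (Real.sinh_neg_iff.2 hy))

lemma ccosh_pos {y : ℝ} (hy : y < 0) : 0 < ccosh y :=
  neg_pos.2 (div_neg_of_pos_of_neg (Real.cosh_pos y) (Real.sinh_neg_iff.2 hy))

lemma ccosh_sq {y : ℝ} (hy : y < 0) : ccosh y ^ 2 = 1 + csinh y ^ 2 := by
  have h := (Real.sinh_neg_iff.2 hy).ne
  simp only [ccosh, csinh]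
  field_simp
  linarith [Real.cosh_sq y]

lemma one_lt_ccosh {y : ℝ} (hy : y < 0) : 1 < ccosh y := by
  have h1 := ccosh_sq hy
  have h2 := csinh_pos hy
  have h3 := ccosh_pos hy
  nlinarith [sq_nonneg (ccosh y - 1)]

/-- The conformal radius satisfies dy = dρ / sinh ρ, so differentiation in y is sinh ρ times
differentiation in ρ. The same rule explains the other derivatives below. -/
lemma hasDerivAt_csinh {y : ℝ} (hy : y < 0) : HasDerivAt csinh (csinh y * ccosh y) y := by
  have h := (Real.sinh_neg_iff.2 hy).ne
  have := ((Real.hasDerivAt_sinh y).inv h).neg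
  refine this.congr_deriv ?_
  simp only [ccosh, csinh]
  field_simp

lemma hasDerivAt_ccosh {y : ℝ} (hy : y < 0) : HasDerivAt ccosh (csinh y ^ 2) y := by
  have h := (Real.sinh_neg_iff.2 hy).ne
  have := ((Real.hasDerivAt_cosh y).div (Real.hasDerivAt_sinh y) h).neg
  refine this.congr_deriv ?_
  simp only [csinh]
  field_simp
  linarith [Real.cosh_sq y]

lemma contDiffAt_csinh {y : ℝ} (hy : y < 0) {n : WithTop ℕ∞} : ContDiffAt ℝ n csinh y :=
  (Real.contDiff_sinh.contDiffAt.inv (Real.sinh_neg_iff.2 hy).ne).neg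

lemma contDiffAt_ccosh {y : ℝ} (hy : y < 0) {n : WithTop ℕ∞} : ContDiffAt ℝ n ccosh y :=
  (Real.contDiff_cosh.contDiffAt.div Real.contDiff_sinh.contDiffAt
    (Real.sinh_neg_iff.2 hy).ne).neg

/-- `tanh² ρ` as a function of the conformal radius. -/
def ctanhSq (y : ℝ) : ℝ := csinh y ^ 2 / ccosh y ^ 2

lemma ctanhSq_lt_one {y : ℝ} (hy : y < 0) : ctanhSq y < 1 := by
  have := ccosh_pos hy
  rw [ctanhSq, div_lt_one (by positivity), ccosh_sq hy]
  linarith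

lemma ctanhSq_nonneg (y : ℝ) : 0 ≤ ctanhSq y := by unfold ctanhSq; positivity

/-- `sinh ρ` times the mean curvature of the geodesic sphere of radius `ρ`. -/
def sphereCurv (n : ℕ) (y : ℝ) : ℝ := (2 * n - 1) * ccosh y + csinh y ^ 2 / ccosh y

/-- Positivity of this derivative gives the zeroth order term of the linearized flow its damping
sign; it is the source of the decay of the speed. -/
lemma hasDerivAt_sphereCurv (n : ℕ) {y : ℝ} (hy : y < 0) :
    HasDerivAt (sphereCurv n) (csinh y ^ 2 * (2 * n + 1 / ccosh y ^ 2)) y := by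
  have hC := (ccosh_pos hy).ne'
  have h1 := ((hasDerivAt_ccosh hy).const_mul (2 * (n : ℝ) - 1)).add
    (((hasDerivAt_csinh hy).pow 2).div (hasDerivAt_ccosh hy) hC)
  refine h1.congr_deriv ?_
  have h2 : csinh y ^ 2 = ccosh y ^ 2 - 1 := by linarith [ccosh_sq hy]
  have h4 : csinh y ^ 4 = (ccosh y ^ 2 - 1) ^ 2 := by rw [← h2]; ring
  simp only [Nat.cast_ofNat, Nat.add_one_sub_one, pow_one, Pi.pow_apply]
  field_simp
  ring_nf
  rw [h4, h2]
  ring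

end Hyperbolic

/-! ### The slope, the curvature expression and the scalar flow equation of a radial graph. -/

section Operators

variable {E : Type*} [NormedAddCommGroup E] [InnerProductSpace ℝ E]
  {ι : Type*} [Fintype ι] (b : OrthonormalBasis ι ℝ E) (I : E →L[ℝ] E)

/-- The squared slope `V²` of a radial graph with conformal radius `φ`. -/
def slopeSq (φ : ℝ × E → ℝ) (x : ℝ × E) : ℝ :=
  1 + gradProd b φ φ x - ctanhSq (φ x) * rotD 0 I φ x ^ 2

/-- The expression `H sinh ρ / V` of a radial graph, in terms of the conformal radius. -/
def graphCurv (n : ℕ) (φ : ℝ × E → ℝ) (x : ℝ × E) : ℝ :=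
  (sphereCurv n (φ x) - laplace b φ x + ctanhSq (φ x) * rotD 0 I (rotD 0 I φ) x) / slopeSq b I φ x
  + (rotD 0 I φ x ^ 2 * (csinh (φ x) ^ 2 / ccosh (φ x) ^ 3)
      + gradProd b φ (gradProd b φ φ) x / 2
      - 2 * ctanhSq (φ x) * rotD 0 I φ x * gradProd b φ (rotD 0 I φ) x
      + ctanhSq (φ x) ^ 2 * rotD 0 I φ x ^ 2 * rotD 0 I (rotD 0 I φ) x) / slopeSq b I φ x ^ 2

/-- `φ` is near `x` the conformal radius of a radial graph moving by inverse mean curvature. -/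
structure IsGraphSolution (n : ℕ) (φ : ℝ × E → ℝ) (x : ℝ × E) : Prop where
  smooth : ContDiffAt ℝ ∞ φ x
  homogeneous : ∀ (t : ℝ) (q : E) (c : ℝ), 0 < c → φ (t, c • q) = φ (t, q)
  neg : φ x < 0
  norm_eq : ‖x.2‖ = 1
  speed_pos : 0 < pd (1, 0) φ x
  -- The equation is imposed at unit vectors only: for a function constant on rays, the Euclidean
  -- gradient and Laplacian agree there with those of the sphere, while off the sphere they scale
  -- differently.
  equation : ∀ᶠ y in 𝓝 x, ‖y.2‖ = 1 → pd (1, 0) φ y * graphCurv b I n φ y = 1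

lemma hasDerivAt_line {X : Type*} [NormedAddCommGroup X] [NormedSpace ℝ X] {f : X → ℝ} {x : X}
    (hf : DifferentiableAt ℝ f x) (w : X) : HasDerivAt (fun s : ℝ => f (x + s • w)) (pd w f x) 0 := by
  have h1 : HasDerivAt (fun s : ℝ => x + s • w) w 0 := by
    have := ((hasDerivAt_id (0 : ℝ)).smul_const w).const_add x
    rwa [one_smul] at this
  have h2 : HasFDerivAt f (fderiv ℝ f x) (x + (0 : ℝ) • w) := by simpa using hf.hasFDerivAt
  exact h2.comp_hasDerivAt (0 : ℝ) h1

/-- A function which is constant on the unit sphere has vanishing tangential derivatives. -/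
lemma pd_eq_zero_of_const_on_sphere {f : ℝ × E → ℝ} {x : ℝ × E} (hf : DifferentiableAt ℝ f x)
    (hx : ‖x.2‖ = 1) {c : ℝ} (h : ∀ᶠ y in 𝓝 x, ‖y.2‖ = 1 → f y = c) (k : ℝ) {X : E}
    (hX : inner ℝ x.2 X = 0) : pd (k, X) f x = 0 := by
  have hne : x.2 + (0 : ℝ) • X ≠ 0 := by
    have : x.2 ≠ 0 := fun h0 => by simp [h0] at hx
    simpa using this
  have h1 : HasDerivAt (fun s : ℝ => x.2 + s • X) X 0 := by
    have := ((hasDerivAt_id (0 : ℝ)).smul_const X).const_add x.2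
    rwa [one_smul] at this
  have h2 : HasDerivAt (fun s : ℝ => ‖x.2 + s • X‖) 0 0 := by
    have h3 := (h1.norm_sq).sqrt (by positivity)
    simp only [Real.sqrt_sq (norm_nonneg _)] at h3
    refine h3.congr_deriv ?_
    simp [hX]
  have h4 : HasDerivAt (fun s : ℝ => ‖x.2 + s • X‖⁻¹) 0 0 := by
    refine (h2.inv (norm_ne_zero_iff.2 hne)).congr_deriv (by simp)
  -- The line in direction X leaves the sphere, so it is projected back. This does not change the
  -- velocity at s = 0, because the norm has derivative ⟨x, X⟩ = 0 there.
  have h5 : HasDerivAt (fun s : ℝ => ‖x.2 + s • X‖⁻¹ • (x.2 + s • X)) X 0 := by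
    refine (h4.smul h1).congr_deriv (by simp [hx])
  have h6 : HasDerivAt (fun s : ℝ => x.1 + s * k) k 0 := by
    have := ((hasDerivAt_id (0 : ℝ)).mul_const k).const_add x.1
    rwa [one_mul] at this
  have h7 := h6.prodMk h5
  have hγ0 : (x.1 + (0 : ℝ) * k, ‖x.2 + (0 : ℝ) • X‖⁻¹ • (x.2 + (0 : ℝ) • X)) = x := by
    simp [hx]
  have h8 : HasFDerivAt f (fderiv ℝ f x)
      (x.1 + (0 : ℝ) * k, ‖x.2 + (0 : ℝ) • X‖⁻¹ • (x.2 + (0 : ℝ) • X)) := by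
    rw [hγ0]; exact hf.hasFDerivAt
  have h9 := h8.comp_hasDerivAt (0 : ℝ) h7
  have h10 : Tendsto (fun s : ℝ => (x.1 + s * k, ‖x.2 + s • X‖⁻¹ • (x.2 + s • X))) (𝓝 0) (𝓝 x) := by
    have := h7.continuousAt.tendsto
    rwa [hγ0] at this
  have h11 : ∀ᶠ s in 𝓝 (0 : ℝ),
      (f ∘ fun s : ℝ => (x.1 + s * k, ‖x.2 + s • X‖⁻¹ • (x.2 + s • X))) s = c := by
    filter_upwards [h10.eventually h, h1.continuousAt.eventually_ne hne] with s hs hs'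
    refine hs ?_
    rw [norm_smul, norm_inv, norm_norm, inv_mul_cancel₀ (norm_ne_zero_iff.2 hs')]
  exact h9.unique ((hasDerivAt_const (0 : ℝ) c).congr_of_eventuallyEq h11)

end Operators

end GraphEquation

/-! ### Linearization along rotation fields and the comparison principle. -/

noncomputable section Linearization

open Filter Topology

variable {E : Type*} [NormedAddCommGroup E] [InnerProductSpace ℝ E]
  {ι : Type*} [Fintype ι] (b : OrthonormalBasis ι ℝ E) {I : E →L[ℝ] E}

/-- The spatial gradient. -/
def spGrad (f : ℝ × E → ℝ) (x : ℝ × E) : E := ∑ i, pd ((0 : ℝ), b i) f x • b i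

lemma inner_spGrad (f : ℝ × E → ℝ) (x : ℝ × E) (v : E) :
    inner ℝ (spGrad b f x) v = pd ((0 : ℝ), v) f x := by
  rw [pd_sum_repr b f x v, spGrad, sum_inner]
  refine Finset.sum_congr rfl fun i _ => ?_
  rw [real_inner_smul_left]
  ring

lemma inner_spGrad_spGrad (f g : ℝ × E → ℝ) (x : ℝ × E) :
    inner ℝ (spGrad b f x) (spGrad b g x) = gradProd b f g x := by
  rw [inner_spGrad, gradProd, pd_sum_repr b f x]
  refine Finset.sum_congr rfl fun i _ => ?_
  rw [← real_inner_comm, inner_spGrad]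
  ring

lemma norm_spGrad_sq (f : ℝ × E → ℝ) (x : ℝ × E) : ‖spGrad b f x‖ ^ 2 = gradProd b f f x := by
  rw [← real_inner_self_eq_norm_sq, inner_spGrad_spGrad]

lemma gradProd_self_nonneg (f : ℝ × E → ℝ) (x : ℝ × E) : 0 ≤ gradProd b f f x := by
  rw [← norm_spGrad_sq]; positivity

lemma gradProd_sq_le (f g : ℝ × E → ℝ) (x : ℝ × E) :
    gradProd b f g x ^ 2 ≤ gradProd b f f x * gradProd b g g x := by
  rw [← norm_spGrad_sq, ← norm_spGrad_sq, ← inner_spGrad_spGrad, ← mul_pow]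
  exact sq_le_sq' (by linarith [abs_le.1 (abs_real_inner_le_norm (spGrad b f x) (spGrad b g x))])
    (real_inner_le_norm _ _)

lemma gradProd_eq_pd (f g : ℝ × E → ℝ) (x : ℝ × E) :
    gradProd b f g x = pd ((0 : ℝ), spGrad b f x) g x := by
  rw [gradProd_comm, ← inner_spGrad_spGrad, inner_spGrad]

/-- The spatial Hessian. -/
def spHess (f : ℝ × E → ℝ) (x : ℝ × E) : E →ₗ[ℝ] E →ₗ[ℝ] ℝ :=
  LinearMap.mk₂ ℝ (fun v w => fderiv ℝ (fderiv ℝ f) x ((0 : ℝ), v) ((0 : ℝ), w))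
    (fun v v' w => by
      rw [show ((0 : ℝ), v + v') = ((0 : ℝ), v) + ((0 : ℝ), v') by simp, map_add]; rfl)
    (fun c v w => by
      rw [show ((0 : ℝ), c • v) = c • ((0 : ℝ), v) by simp, map_smul]; rfl)
    (fun v w w' => by
      rw [show ((0 : ℝ), w + w') = ((0 : ℝ), w) + ((0 : ℝ), w') by simp, map_add])
    (fun c v w => by
      rw [show ((0 : ℝ), c • w) = c • ((0 : ℝ), w) by simp, map_smul])

lemma spHess_apply {f : ℝ × E → ℝ} {x : ℝ × E} (hf : ContDiffAt ℝ 2 f x) (v w : E) :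
    spHess f x v w = pd ((0 : ℝ), v) (pd ((0 : ℝ), w) f) x := by
  rw [pd_pd_eq hf]; rfl

lemma spHess_comm {f : ℝ × E → ℝ} {x : ℝ × E} (hf : ContDiffAt ℝ 2 f x) (v w : E) :
    spHess f x v w = spHess f x w v := by
  rw [spHess_apply hf, spHess_apply hf, pd_comm hf]

lemma laplace_eq {f : ℝ × E → ℝ} {x : ℝ × E} (hf : ContDiffAt ℝ 2 f x) :
    laplace b f x = ∑ i, spHess f x (b i) (b i) := by
  simp_rw [spHess_apply hf]; rfl

lemma rotD_zero_sq_le (f : ℝ × E → ℝ) {x : ℝ × E} (hI : ‖I x.2‖ ≤ 1) :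
    rotD 0 I f x ^ 2 ≤ gradProd b f f x := by
  rw [rotD_eq_pd, ← inner_spGrad b, ← norm_spGrad_sq, ← sq_abs]
  refine pow_le_pow_left₀ (abs_nonneg _) ((abs_real_inner_le_norm _ _).trans ?_) 2
  exact mul_le_of_le_one_right (norm_nonneg _) hI

/-- The squared Hopf derivative is at most |∇φ|² by Cauchy–Schwarz and it enters with the factor
tanh²ρ < 1, so the subtraction never exceeds the gradient term. -/
lemma one_le_slopeSq {φ : ℝ × E → ℝ} {x : ℝ × E} (hI : ‖I x.2‖ ≤ 1) (hφ : φ x < 0) :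
    1 ≤ slopeSq b I φ x := by
  have h1 := rotD_zero_sq_le b φ hI
  have h2 := ctanhSq_lt_one hφ
  have h3 := ctanhSq_nonneg (φ x)
  unfold slopeSq
  nlinarith [sq_nonneg (rotD 0 I φ x)]

lemma pd_gradProd {f g : ℝ × E → ℝ} {x : ℝ × E} (hf : ContDiffAt ℝ 2 f x)
    (hg : ContDiffAt ℝ 2 g x) (v : E) :
    pd ((0 : ℝ), v) (gradProd b f g) x = spHess f x v (spGrad b g x) + spHess g x v (spGrad b f x) := by
  have hd : ∀ {f : ℝ × E → ℝ}, ContDiffAt ℝ 2 f x → ∀ i,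
      DifferentiableAt ℝ (pd ((0 : ℝ), b i) f) x :=
    fun hf i => (hf.pd (m := 1) (by norm_num) _).differentiableAt (by norm_num)
  rw [show gradProd b f g = fun y => ∑ i,
      pd ((0 : ℝ), b i) f y * pd ((0 : ℝ), b i) g y from rfl,
      pd_sum fun i _ => (hd hf i).fun_mul (hd hg i)]
  simp only [spGrad, map_sum, map_smul, smul_eq_mul]
  simp only [spHess_apply hf, spHess_apply hg]
  rw [← Finset.sum_add_distrib]
  refine Finset.sum_congr rfl fun i _ => ?_
  rw [pd_mul (hd hf i) (hd hg i)]
  ring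

lemma gradProd_gradProd {f g h : ℝ × E → ℝ} {x : ℝ × E} (hf : ContDiffAt ℝ 2 f x)
    (hg : ContDiffAt ℝ 2 g x) :
    gradProd b h (gradProd b f g) x = spHess f x (spGrad b h x) (spGrad b g x)
      + spHess g x (spGrad b h x) (spGrad b f x) := by
  rw [gradProd_eq_pd, pd_gradProd b hf hg]

section Derivation

variable {φ : ℝ × E → ℝ} {x : ℝ × E} (hφ : ContDiffAt ℝ ∞ φ x) (k : ℝ) (W : E →L[ℝ] E)
  (hW : ∀ v w, inner ℝ (W v) w = -inner ℝ v (W w))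

include hφ

lemma contDiffAt_nat (k : ℕ) : ContDiffAt ℝ k φ x := hφ.of_le (by exact_mod_cast le_top)

include hW

lemma rotD_gradProd_self :
    rotD k W (gradProd b φ φ) x = 2 * gradProd b φ (rotD k W φ) x := by
  rw [rotD_gradProd b (contDiffAt_nat hφ 2) (contDiffAt_nat hφ 2) k W hW, gradProd_comm b (rotD k W φ)]
  ring

/-- The function ⟨∇φ, ∇|∇φ|²⟩ is 2 Hess φ(∇φ, ∇φ). Its variation is sorted so that the second
derivatives of the variation field occur only as a Hessian evaluated on ∇φ; the remaining term is of
first order in the variation field. -/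
lemma rotD_gradProd_gradProd : rotD k W (gradProd b φ (gradProd b φ φ)) x
    = 2 * spHess (rotD k W φ) x (spGrad b φ x) (spGrad b φ x)
      + 2 * gradProd b (rotD k W φ) (gradProd b φ φ) x := by
  have hP := gradProd_smooth_top b hφ hφ
  have he := rotD_smooth_top hφ k W
  rw [rotD_gradProd b (contDiffAt_nat hφ 2) (contDiffAt_nat hP 2) k W hW]
  have h1 : rotD k W (gradProd b φ φ) =ᶠ[𝓝 x]
      fun y => gradProd b (rotD k W φ) φ y + gradProd b φ (rotD k W φ) y :=
    (eventually_contDiffAt_nat hφ 2).mono fun y hy => rotD_gradProd b hy hy k W hW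
  have h2 : gradProd b φ (rotD k W (gradProd b φ φ)) x
      = 2 * gradProd b φ (gradProd b φ (rotD k W φ)) x := by
    rw [gradProd_eq_pd, (pd_congr h1 _).self_of_nhds, pd_add, gradProd_comm b (rotD k W φ),
      gradProd_eq_pd]
    · ring
    · exact (gradProd_smooth_top b he hφ).diff_top
    · exact (gradProd_smooth_top b hφ he).diff_top
  rw [h2, gradProd_gradProd b (contDiffAt_nat hφ 2) (contDiffAt_nat he 2),
    gradProd_gradProd b (contDiffAt_nat hφ 2) (contDiffAt_nat hφ 2), spHess_comm (contDiffAt_nat hφ 2)]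
  ring

omit hW in
lemma rotD_rotD_comm {k' : ℝ} {U : E →L[ℝ] E} (hWU : ∀ v, W (U v) = U (W v)) :
    rotD k W (rotD k' U φ) =ᶠ[𝓝 x] rotD k' U (rotD k W φ) :=
  (eventually_contDiffAt_nat hφ 2).mono fun _ hy => rotD_comm hy k k' W U hWU

end Derivation

lemma slopeSq_smooth {φ : ℝ × E → ℝ} {x : ℝ × E} (hφ : ContDiffAt ℝ ∞ φ x) (h0 : φ x < 0) :
    ContDiffAt ℝ ∞ (slopeSq b I φ) x := by
  have h1 : ContDiffAt ℝ ∞ (fun y => ctanhSq (φ y)) x :=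
    (((contDiffAt_csinh h0).comp x hφ).pow 2).div (((contDiffAt_ccosh h0).comp x hφ).pow 2)
      (pow_ne_zero _ (ccosh_pos h0).ne')
  exact (contDiffAt_const.add (gradProd_smooth_top b hφ hφ)).sub
    (h1.mul ((rotD_smooth_top hφ 0 I).pow 2))

lemma graphCurv_smooth {n : ℕ} {φ : ℝ × E → ℝ} {x : ℝ × E} (hφ : ContDiffAt ℝ ∞ φ x)
    (h0 : φ x < 0) (hI : ‖I x.2‖ ≤ 1) : ContDiffAt ℝ ∞ (graphCurv b I n φ) x := by
  have hS := (contDiffAt_csinh h0 (n := ∞)).comp x hφ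
  have hC := (contDiffAt_ccosh h0 (n := ∞)).comp x hφ
  have hC0 := (ccosh_pos h0).ne'
  have hκ : ContDiffAt ℝ ∞ (fun y => ctanhSq (φ y)) x :=
    (hS.pow 2).div (hC.pow 2) (pow_ne_zero _ hC0)
  have hK : ContDiffAt ℝ ∞ (fun y => sphereCurv n (φ y)) x :=
    (contDiffAt_const.mul hC).add ((hS.pow 2).div hC hC0)
  have hV := slopeSq_smooth b (I := I) hφ h0
  have hV0 : slopeSq b I φ x ≠ 0 := (zero_lt_one.trans_le (one_le_slopeSq b hI h0)).ne'
  have hτ := rotD_smooth_top hφ 0 I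
  have hττ := rotD_smooth_top hτ 0 I
  have hP := gradProd_smooth_top b hφ hφ
  have hSC : ContDiffAt ℝ ∞ (fun y => csinh (φ y) ^ 2 / ccosh (φ y) ^ 3) x :=
    (hS.pow 2).div (hC.pow 3) (pow_ne_zero _ hC0)
  refine (((hK.sub (laplace_smooth_top b hφ)).add (hκ.mul hττ)).div hV hV0).add
    (ContDiffAt.div ?_ (hV.pow 2) (pow_ne_zero _ hV0))
  refine ((((hτ.pow 2).mul hSC).add ((gradProd_smooth_top b hφ hP).div_const 2)).sub
    (((contDiffAt_const.mul hκ).mul hτ).mul (gradProd_smooth_top b hφ hτ))).add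
    (((hκ.pow 2).mul (hτ.pow 2)).mul hττ)

/-- Since W is skew, (k, W q) is tangent to the product of the time axis and the unit sphere, where
the equation holds identically; so the equation may be differentiated along it. -/
lemma IsGraphSolution.rotD_equation {n : ℕ} {φ : ℝ × E → ℝ} {x : ℝ × E}
    (h : IsGraphSolution b I n φ x) (hI : ‖I x.2‖ ≤ 1) (k : ℝ) (W : E →L[ℝ] E)
    (hW : ∀ v w, inner ℝ (W v) w = -inner ℝ v (W w)) :
    pd (1, 0) (rotD k W φ) x * graphCurv b I n φ x
      + pd (1, 0) φ x * rotD k W (graphCurv b I n φ) x = 0 := by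
  have hG := graphCurv_smooth b (n := n) h.smooth h.neg hI
  have hu := h.smooth.pd_top ((1 : ℝ), (0 : E))
  have hx : inner ℝ x.2 (W x.2) = 0 := by
    have := hW x.2 x.2
    rw [real_inner_comm] at this
    linarith
  have h1 := pd_eq_zero_of_const_on_sphere (hu.diff_top.fun_mul hG.diff_top) h.norm_eq h.equation k hx
  rw [pd_mul hu.diff_top hG.diff_top] at h1
  rw [pd_rotD (contDiffAt_nat h.smooth 2)]
  rw [show ((0 : ℝ), W ((1 : ℝ), (0 : E)).2) = 0 by simp, show pd (0 : ℝ × E) φ x = 0 by simp [pd],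
    add_zero]
  exact h1

lemma IsGraphSolution.graphCurv_eq {n : ℕ} {φ : ℝ × E → ℝ} {x : ℝ × E}
    (h : IsGraphSolution b I n φ x) : graphCurv b I n φ x = 1 / pd (1, 0) φ x := by
  have := h.equation.self_of_nhds h.norm_eq
  rw [eq_div_iff h.speed_pos.ne', mul_comm]
  exact this

/-- Comparison of the time derivative with a rotation field: if the variation field
`e = φ_W + k φ_t` touches zero from below, then its time derivative is nonpositive. -/
theorem IsGraphSolution.comparison {n : ℕ} {φ : ℝ × E → ℝ} {x : ℝ × E}
    (h : IsGraphSolution b I n φ x) (hI : ‖I x.2‖ ≤ 1) (k : ℝ) (W : E →L[ℝ] E)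
    (hW : ∀ v w, inner ℝ (W v) w = -inner ℝ v (W w)) (hWI : ∀ v, W (I v) = I (W v))
    (h0 : rotD k W φ x = 0) (h1 : ∀ v, pd ((0 : ℝ), v) (rotD k W φ) x = 0)
    (h2 : ∀ v, pd ((0 : ℝ), v) (pd ((0 : ℝ), v) (rotD k W φ)) x ≤ 0) :
    pd (1, 0) (rotD k W φ) x ≤ 0 := by
  have hφ := h.smooth
  have hC0 := (ccosh_pos h.neg).ne'
  set e := rotD k W φ with he
  have hes : ContDiffAt ℝ ∞ e x := rotD_smooth_top hφ k W
  have hV1 := one_le_slopeSq b hI h.neg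
  have hV0 : slopeSq b I φ x ≠ 0 := (zero_lt_one.trans_le hV1).ne'
  have hτs := rotD_smooth_top hφ 0 I
  have hττs := rotD_smooth_top hτs 0 I
  have hPs := gradProd_smooth_top b hφ hφ
  set w : ℝ × E := (k, W x.2) with hw
  set p := spGrad b φ x with hp
  -- At the contact point e and its spatial gradient vanish, so only second derivatives of e survive
  -- when `graphCurv` is differentiated.
  have hge : ∀ f, gradProd b f e x = 0 := fun f => by rw [gradProd_eq_pd, h1]
  have hge' : ∀ f, gradProd b e f x = 0 := fun f => by rw [gradProd_comm, hge]
  -- derivatives of the ingredients along `w`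
  have dφ : HasDerivAt (fun s : ℝ => φ (x + s • w)) 0 0 := by
    have := hasDerivAt_line hφ.diff_top w
    rwa [show pd w φ x = 0 from h0] at this
  -- The hypothesis that W commutes with I enters here and in the other terms with the Hopf field:
  -- it lets the variation pass through the Hopf derivative.
  have dτ : HasDerivAt (fun s : ℝ => rotD 0 I φ (x + s • w)) 0 0 := by
    refine (hasDerivAt_line hτs.diff_top w).congr_deriv ?_
    rw [show pd w (rotD 0 I φ) x = rotD k W (rotD 0 I φ) x from rfl,
      (rotD_rotD_comm hφ k W hWI).self_of_nhds]
    exact h1 _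
  have dττ : HasDerivAt (fun s : ℝ => rotD 0 I (rotD 0 I φ) (x + s • w))
      (spHess e x (I x.2) (I x.2)) 0 := by
    refine (hasDerivAt_line hττs.diff_top w).congr_deriv ?_
    rw [show pd w (rotD 0 I (rotD 0 I φ)) x = rotD k W (rotD 0 I (rotD 0 I φ)) x from rfl,
      (rotD_rotD_comm hτs k W hWI).self_of_nhds,
      (rotD_congr (rotD_rotD_comm hφ k W hWI) 0 I).self_of_nhds, rotD_eq_pd,
      rotD_hasFDerivAt (contDiffAt_nat hes 2)]
    have := h1 (I (I x.2))
    simp only [pd] at this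
    rw [this, add_zero]
    rfl
  have dP : HasDerivAt (fun s : ℝ => gradProd b φ φ (x + s • w)) 0 0 := by
    refine (hasDerivAt_line hPs.diff_top w).congr_deriv ?_
    rw [show pd w (gradProd b φ φ) x = rotD k W (gradProd b φ φ) x from rfl,
      rotD_gradProd_self b hφ k W hW, hge, mul_zero]
  have dΔ : HasDerivAt (fun s : ℝ => laplace b φ (x + s • w)) (∑ i, spHess e x (b i) (b i)) 0 := by
    refine (hasDerivAt_line (laplace_smooth_top b hφ).diff_top w).congr_deriv ?_
    rw [show pd w (laplace b φ) x = rotD k W (laplace b φ) x from rfl,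
      rotD_laplace b (contDiffAt_nat hφ 3) k W hW, laplace_eq b (contDiffAt_nat hes 2)]
  have dQ : HasDerivAt (fun s : ℝ => gradProd b φ (gradProd b φ φ) (x + s • w))
      (2 * spHess e x p p) 0 := by
    refine (hasDerivAt_line (gradProd_smooth_top b hφ hPs).diff_top w).congr_deriv ?_
    rw [show pd w (gradProd b φ (gradProd b φ φ)) x = rotD k W (gradProd b φ (gradProd b φ φ)) x
      from rfl, rotD_gradProd_gradProd b hφ k W hW, ← he, hge', mul_zero, add_zero]
  have dR : HasDerivAt (fun s : ℝ => gradProd b φ (rotD 0 I φ) (x + s • w))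
      (spHess e x p (I x.2)) 0 := by
    refine (hasDerivAt_line (gradProd_smooth_top b hφ hτs).diff_top w).congr_deriv ?_
    rw [show pd w (gradProd b φ (rotD 0 I φ)) x = rotD k W (gradProd b φ (rotD 0 I φ)) x
      from rfl, rotD_gradProd b (contDiffAt_nat hφ 2) (contDiffAt_nat hτs 2) k W hW, ← he, hge', zero_add,
      gradProd_eq_pd, (pd_congr (rotD_rotD_comm hφ k W hWI) _).self_of_nhds,
      rotD_hasFDerivAt (contDiffAt_nat hes 2)]
    have := h1 (I p)
    simp only [pd] at this
    rw [← hp]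
    simp only
    rw [this, add_zero]
    rfl
  have hx0 : x + (0 : ℝ) • w = x := by simp
  have dS : HasDerivAt (fun s : ℝ => csinh (φ (x + s • w))) 0 0 := by
    have := (show HasDerivAt csinh _ (φ (x + (0 : ℝ) • w)) by
      rw [hx0]; exact hasDerivAt_csinh h.neg).comp (0 : ℝ) dφ
    rwa [mul_zero] at this
  have dC : HasDerivAt (fun s : ℝ => ccosh (φ (x + s • w))) 0 0 := by
    have := (show HasDerivAt ccosh _ (φ (x + (0 : ℝ) • w)) by
      rw [hx0]; exact hasDerivAt_ccosh h.neg).comp (0 : ℝ) dφ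
    rwa [mul_zero] at this
  have dK : HasDerivAt (fun s : ℝ => sphereCurv n (φ (x + s • w))) 0 0 := by
    have := (show HasDerivAt (sphereCurv n) _ (φ (x + (0 : ℝ) • w)) by
      rw [hx0]; exact hasDerivAt_sphereCurv n h.neg).comp (0 : ℝ) dφ
    rwa [mul_zero] at this
  have dκ : HasDerivAt (fun s : ℝ => ctanhSq (φ (x + s • w))) 0 0 := by
    refine ((dS.pow 2).div (dC.pow 2) ?_).congr_deriv ?_
    · simpa using hC0
    · simp
  have dSC : HasDerivAt (fun s : ℝ => csinh (φ (x + s • w)) ^ 2 / ccosh (φ (x + s • w)) ^ 3) 0 0 := by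
    refine ((dS.pow 2).div (dC.pow 3) ?_).congr_deriv ?_
    · simpa using hC0
    · simp
  have dV : HasDerivAt (fun s : ℝ => slopeSq b I φ (x + s • w)) 0 0 := by
    refine ((dP.const_add 1).sub (dκ.mul (dτ.pow 2))).congr_deriv ?_
    simp
  set κ := ctanhSq (φ x) with hκ
  set τ := rotD 0 I φ x with hτ
  set V := slopeSq b I φ x with hV
  set B := spHess e x with hB
  have dG : HasDerivAt (fun s : ℝ => graphCurv b I n φ (x + s • w))
      (-(∑ i, B (b i) (b i) - κ * B (I x.2) (I x.2)) / V
        + (B p p - 2 * κ * τ * B p (I x.2) + κ ^ 2 * τ ^ 2 * B (I x.2) (I x.2)) / V ^ 2) 0 := by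
    refine ((((dK.sub dΔ).add (dκ.mul dττ)).div dV (by simpa using hV0)).add
      (HasDerivAt.div (((((dτ.pow 2).mul dSC).add (dQ.div_const 2)).sub
        (((dκ.const_mul 2).mul dτ).mul dR)).add (((dκ.pow 2).mul (dτ.pow 2)).mul dττ))
        (dV.pow 2) (by simpa using hV0))).congr_deriv ?_
    simp only [hx0, ← hκ, ← hτ, ← hV, Pi.pow_apply, Pi.mul_apply]
    field_simp
    ring
  have hGs := graphCurv_smooth b (n := n) hφ h.neg hI
  have hDG : rotD k W (graphCurv b I n φ) x = _ := (hasDerivAt_line hGs.diff_top w).unique dG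
  have hBn : ∀ v, B v v ≤ 0 := fun v => by
    rw [hB, spHess_apply (contDiffAt_nat hes 2)]; exact h2 v
  have hτp : inner ℝ p (I x.2) = τ := inner_spGrad b _ _ _
  -- The derivative `dG` is -1/V times the contraction of B = Hess e with S - Sp ⊗ Sp / V, where S =
  -- 1 - κ ξ ⊗ ξ and V is the squared slope. As B is nonpositive, the derivative of `graphCurv` is
  -- nonnegative, and the differentiated equation forces e_t ≤ 0.
  have hcon := contraction_nonpos' b B hBn p (I x.2) (ctanhSq_lt_one h.neg).le hI
  rw [← hκ, hτp, hp, norm_spGrad_sq, ← hp] at hcon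
  have hVdef : 1 + gradProd b φ φ x - κ * τ ^ 2 = V := rfl
  rw [hVdef] at hcon
  have hBY : B (p - (κ * τ) • I x.2) (p - (κ * τ) • I x.2)
      = B p p - 2 * κ * τ * B p (I x.2) + κ ^ 2 * τ ^ 2 * B (I x.2) (I x.2) := by
    simp only [map_sub, map_smul, LinearMap.sub_apply, LinearMap.smul_apply, smul_eq_mul]
    rw [show B (I x.2) p = B p (I x.2) from spHess_comm (contDiffAt_nat hes 2) _ _]
    ring
  rw [hBY] at hcon
  have hDG0 : 0 ≤ rotD k W (graphCurv b I n φ) x := by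
    rw [hDG]
    have : -(∑ i, B (b i) (b i) - κ * B (I x.2) (I x.2)) / V
        + (B p p - 2 * κ * τ * B p (I x.2) + κ ^ 2 * τ ^ 2 * B (I x.2) (I x.2)) / V ^ 2
        = -(∑ i, B (b i) (b i) - κ * B (I x.2) (I x.2)
          - (B p p - 2 * κ * τ * B p (I x.2) + κ ^ 2 * τ ^ 2 * B (I x.2) (I x.2)) / V) / V := by
      field_simp
      ring
    rw [this]
    exact div_nonneg (by linarith) (by linarith)
  have heq := h.rotD_equation b hI k W hW
  rw [h.graphCurv_eq] at heq
  have hu := h.speed_pos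
  have : pd (1, 0) (rotD k W φ) x
      = - (pd (1, 0) φ x) ^ 2 * rotD k W (graphCurv b I n φ) x := by
    field_simp at heq
    linarith
  rw [he, this]
  have := mul_nonneg (sq_nonneg (pd (1, 0) φ x)) hDG0
  linarith

end Linearization

/-! ### Pointwise consequences at spatial extrema. -/

noncomputable section PointwiseEstimates

open Filter Topology

variable {E : Type*} [NormedAddCommGroup E] [InnerProductSpace ℝ E]
  {ι : Type*} [Fintype ι] (b : OrthonormalBasis ι ℝ E)

omit [InnerProductSpace ℝ E] in
lemma pd_zero_vec [NormedSpace ℝ E] (f : ℝ × E → ℝ) (x : ℝ × E) : pd ((0 : ℝ), (0 : E)) f x = 0 :=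
  map_zero (fderiv ℝ f x)

lemma rotD_zero_zero (f : ℝ × E → ℝ) (x : ℝ × E) : rotD 0 (0 : E →L[ℝ] E) f x = 0 :=
  map_zero (fderiv ℝ f x)

lemma slopeSq_zero (φ : ℝ × E → ℝ) (x : ℝ × E) :
    slopeSq b 0 φ x = 1 + gradProd b φ φ x := by
  simp [slopeSq, rotD_zero_zero]

lemma graphCurv_zero (n : ℕ) (φ : ℝ × E → ℝ) (x : ℝ × E) :
    graphCurv b 0 n φ x = (sphereCurv n (φ x) - laplace b φ x) / (1 + gradProd b φ φ x)
      + gradProd b φ (gradProd b φ φ) x / 2 / (1 + gradProd b φ φ x) ^ 2 := by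
  simp only [graphCurv, slopeSq_zero, rotD_zero_zero]
  ring

lemma spatial_isLocalMax {f : ℝ × E → ℝ} {x : ℝ × E} (hf : ContDiffAt ℝ 2 f x)
    (h : IsLocalMax (fun q => f (x.1, q)) x.2) :
    (∀ v, pd ((0 : ℝ), v) f x = 0) ∧ ∀ v, pd ((0 : ℝ), v) (pd ((0 : ℝ), v) f) x ≤ 0 := by
  have hl : ∀ v, IsLocalMax (fun s : ℝ => f (x + s • ((0 : ℝ), v))) 0 := by
    intro v
    have h1 : Tendsto (fun s : ℝ => x.2 + s • v) (𝓝 0) (𝓝 x.2) := by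
      have : Continuous fun s : ℝ => x.2 + s • v := by fun_prop
      simpa using this.tendsto 0
    filter_upwards [h1.eventually h] with s hs
    simpa [Prod.add_def] using hs
  refine ⟨fun v => ?_, fun v => pd_pd_nonpos_of_isLocalMax hf _ (hl v)⟩
  exact (hl v).hasDerivAt_eq_zero (hasDerivAt_line (hf.differentiableAt (by norm_num)) _)

namespace IsGraphSolution

variable {b} {n : ℕ} {φ : ℝ × E → ℝ} {x : ℝ × E}

lemma inner_spGrad_eq_zero {I : E →L[ℝ] E} (h : IsGraphSolution b I n φ x) :
    inner ℝ (spGrad b φ x) x.2 = 0 := by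
  rw [inner_spGrad]
  have h1 := hasDerivAt_line h.smooth.diff_top ((0 : ℝ), x.2)
  have h2 : ∀ᶠ s in 𝓝 (0 : ℝ), φ (x + s • ((0 : ℝ), x.2)) = φ x := by
    filter_upwards [lt_mem_nhds (show (-1 : ℝ) < 0 by norm_num)] with s hs
    have := h.homogeneous x.1 x.2 (1 + s) (by linarith)
    rw [add_smul, one_smul] at this
    simpa [Prod.add_def] using this
  exact h1.unique ((hasDerivAt_const (0 : ℝ) (φ x)).congr_of_eventuallyEq h2)

/-- A quotient of a rotational derivative by the speed does not increase at its maxima. -/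
theorem ratio {I : E →L[ℝ] E} (h : IsGraphSolution b I n φ x) (hI : ‖I x.2‖ ≤ 1) (W : E →L[ℝ] E)
    (hW : ∀ v w, inner ℝ (W v) w = -inner ℝ v (W w)) (hWI : ∀ v, W (I v) = I (W v))
    (hmax : IsLocalMax (fun q => rotD 0 W φ (x.1, q) / pd (1, 0) φ (x.1, q)) x.2) :
    pd (1, 0) (rotD 0 W φ) x * pd (1, 0) φ x ≤ rotD 0 W φ x * pd (1, 0) (pd (1, 0) φ) x := by
  set u := pd ((1 : ℝ), (0 : E)) φ with hu
  have hus : ContDiffAt ℝ ∞ u x := h.smooth.pd_top _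
  have hgs : ContDiffAt ℝ ∞ (rotD 0 W φ) x := rotD_smooth_top h.smooth 0 W
  -- With k the maximal value of the quotient, φ_W - k φ_t is at most zero near the point and
  -- vanishes at it. The comparison principle for this field gives the numerator of the quotient
  -- rule.
  set k := rotD 0 W φ x / u x with hk
  have hu0 : 0 < u x := h.speed_pos
  have he : rotD (-k) W φ = fun y => rotD 0 W φ y - k * u y := by
    ext y
    simp only [rotD, hu, pd]
    rw [show ((-k, W y.2) : ℝ × E) = (0, W y.2) - k • ((1 : ℝ), (0 : E)) by simp, map_sub, map_smul]
    rfl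
  have hes := rotD_smooth_top h.smooth (-k) W
  have he0 : rotD (-k) W φ x = 0 := by
    rw [he, hk]; field_simp; ring
  have hlm : IsLocalMax (fun q => rotD (-k) W φ (x.1, q)) x.2 := by
    have hpos : ∀ᶠ q in 𝓝 x.2, 0 < u (x.1, q) := by
      have : ContinuousAt (fun q => u (x.1, q)) x.2 :=
        ContinuousAt.comp (f := fun q => (x.1, q)) (g := u) hus.continuousAt (by fun_prop)
      exact this.eventually (lt_mem_nhds hu0)
    filter_upwards [hmax, hpos] with q hq hq'
    rw [show (x.1, x.2) = x from rfl, he0, he]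
    simp only
    have : rotD 0 W φ (x.1, q) / u (x.1, q) ≤ k := hq
    rw [div_le_iff₀ hq'] at this
    linarith
  obtain ⟨h1, h2⟩ := spatial_isLocalMax (contDiffAt_nat hes 2) hlm
  have key := h.comparison b hI (-k) W hW hWI he0 h1 h2
  have : pd (1, 0) (rotD (-k) W φ) x = pd (1, 0) (rotD 0 W φ) x - k * pd (1, 0) u x := by
    have h3 := ((hasDerivAt_line hgs.diff_top ((1 : ℝ), (0 : E))).sub
      ((hasDerivAt_line hus.diff_top ((1 : ℝ), (0 : E))).const_mul k))
    have h4 := hasDerivAt_line hes.diff_top ((1 : ℝ), (0 : E))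
    rw [he] at h4 ⊢
    exact h4.unique h3
  rw [this, hk] at key
  have h5 : pd (1, 0) (rotD 0 W φ) x ≤ rotD 0 W φ x / u x * pd (1, 0) u x := by linarith
  calc _ ≤ rotD 0 W φ x / u x * pd (1, 0) u x * u x := mul_le_mul_of_nonneg_right h5 hu0.le
    _ = _ := by field_simp

/-- The rotation field in the plane spanned by two vectors. -/
def _root_.planeRotation (q r : E) : E →L[ℝ] E :=
  (innerSL ℝ q).smulRight r - (innerSL ℝ r).smulRight q

omit [Fintype ι] in
lemma _root_.planeRotation_apply (q r v : E) :
    planeRotation q r v = (inner ℝ q v : ℝ) • r - (inner ℝ r v : ℝ) • q := by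
  simp [planeRotation]

lemma _root_.planeRotation_skew (q r v w : E) :
    inner ℝ (planeRotation q r v) w = -inner ℝ v (planeRotation q r w) := by
  simp only [planeRotation_apply, inner_sub_left, inner_sub_right, real_inner_smul_left,
    real_inner_smul_right]
  rw [real_inner_comm v r, real_inner_comm v q]
  ring

lemma _root_.norm_planeRotation_le {q r : E} (hq : ‖q‖ = 1) (hr : ‖r‖ = 1) (hqr : inner ℝ q r = 0)
    (v : E) : ‖planeRotation q r v‖ ≤ ‖v‖ := by
  have hrq : inner ℝ r q = 0 := by rw [real_inner_comm]; exact hqr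
  have hon : Orthonormal ℝ ![q, r] := by
    rw [orthonormal_iff_ite]
    intro i j
    fin_cases i <;> fin_cases j <;> simp [hq, hr, hqr, hrq]
  have h1 := hon.sum_inner_products_le v (s := Finset.univ)
  simp only [Fin.sum_univ_two, Matrix.cons_val_zero, Matrix.cons_val_one, Real.norm_eq_abs,
    sq_abs] at h1
  have h2 : ‖planeRotation q r v‖ ^ 2 = inner ℝ q v ^ 2 + inner ℝ r v ^ 2 := by
    rw [planeRotation_apply, norm_sub_sq_real, norm_smul, norm_smul, hq, hr, real_inner_smul_left,
      real_inner_smul_right, hrq]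
    simp
  exact le_of_sq_le_sq (by rw [h2]; exact h1) (norm_nonneg _)

/-- An infinitesimal rotation moving `x` in the direction of the gradient. -/
lemma exists_rotation {I : E →L[ℝ] E} (h : IsGraphSolution b I n φ x) :
    ∃ W : E →L[ℝ] E, (∀ v w, inner ℝ (W v) w = -inner ℝ v (W w)) ∧ (∀ v, ‖W v‖ ≤ ‖v‖) ∧
      spGrad b φ x = rotD 0 W φ x • W x.2 := by
  by_cases hp : spGrad b φ x = 0
  · refine ⟨0, by simp, by simp, by simp [hp]⟩
  · have hp' : ‖spGrad b φ x‖ ≠ 0 := norm_ne_zero_iff.2 hp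
    set r := ‖spGrad b φ x‖⁻¹ • spGrad b φ x with hr
    have hr1 : ‖r‖ = 1 := by rw [hr, norm_smul, norm_inv, norm_norm, inv_mul_cancel₀ hp']
    have hrq : inner ℝ r x.2 = 0 := by
      rw [hr, real_inner_smul_left, h.inner_spGrad_eq_zero, mul_zero]
    have hqr : inner ℝ x.2 r = 0 := by rw [real_inner_comm]; exact hrq
    have hW : planeRotation x.2 r x.2 = r := by
      rw [planeRotation_apply, hrq, real_inner_self_eq_norm_sq, h.norm_eq]
      simp
    refine ⟨planeRotation x.2 r, planeRotation_skew _ _, norm_planeRotation_le h.norm_eq hr1 hqr, ?_⟩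
    rw [rotD_eq_pd, hW, ← inner_spGrad b, hr, real_inner_smul_right, real_inner_self_eq_norm_sq,
      smul_smul]
    field_simp
    simp

/-- Together with `rotD_sq_eq` this makes the square of φ_W a lower barrier for ‖q‖² |∇φ|², with
equality at the chosen point. The factor ‖q‖² makes the right side constant on rays and compensates
for the linear growth of the rotation field. -/
lemma rotD_sq_le (φ : ℝ × E → ℝ) {W : E →L[ℝ] E} (hW : ∀ v, ‖W v‖ ≤ ‖v‖) (y : ℝ × E) :
    rotD 0 W φ y ^ 2 ≤ ‖y.2‖ ^ 2 * gradProd b φ φ y := by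
  rw [rotD_eq_pd, ← inner_spGrad b, ← norm_spGrad_sq, ← mul_pow, ← sq_abs]
  refine pow_le_pow_left₀ (abs_nonneg _) ((abs_real_inner_le_norm _ _).trans ?_) 2
  rw [mul_comm]
  exact mul_le_mul_of_nonneg_right (hW _) (norm_nonneg _)

lemma rotD_sq_eq {W : E →L[ℝ] E} (hW : spGrad b φ x = rotD 0 W φ x • W x.2) :
    rotD 0 W φ x ^ 2 = gradProd b φ φ x := by
  rw [← norm_spGrad_sq, ← real_inner_self_eq_norm_sq]
  conv_rhs => enter [3]; rw [hW]
  rw [real_inner_smul_right, inner_spGrad, sq]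
  rfl

/-- The ratio of the gradient to the speed does not increase at its maxima. -/
theorem gradient_ratio (h : IsGraphSolution b 0 n φ x)
    (hmax : IsLocalMax (fun q => ‖q‖ ^ 2 * gradProd b φ φ (x.1, q) / pd (1, 0) φ (x.1, q) ^ 2) x.2) :
    pd (1, 0) (gradProd b φ φ) x * pd (1, 0) φ x
      ≤ 2 * gradProd b φ φ x * pd (1, 0) (pd (1, 0) φ) x := by
  obtain ⟨W₀, hW₀, hWn₀, hWp₀⟩ := h.exists_rotation
  -- choose the sign of the rotation so that the rotational derivative is nonnegative
  obtain ⟨W, hW, hWn, hWp, hpos⟩ : ∃ W : E →L[ℝ] E, (∀ v w, inner ℝ (W v) w = -inner ℝ v (W w)) ∧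
      (∀ v, ‖W v‖ ≤ ‖v‖) ∧ spGrad b φ x = rotD 0 W φ x • W x.2 ∧ 0 ≤ rotD 0 W φ x := by
    have hneg : rotD 0 (-W₀) φ x = -rotD 0 W₀ φ x := by
      rw [rotD_eq_pd, rotD_eq_pd, ← inner_spGrad b, ← inner_spGrad b]
      simp
    rcases le_total 0 (rotD 0 W₀ φ x) with h0 | h0
    · exact ⟨W₀, hW₀, hWn₀, hWp₀, h0⟩
    · refine ⟨-W₀, fun v w => by simp [hW₀], fun v => by simpa using hWn₀ v, ?_, ?_⟩
      · rw [hneg]; simpa using hWp₀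
      · rw [hneg]; linarith
  set u := pd ((1 : ℝ), (0 : E)) φ with hu
  have hu0 : 0 < u x := h.speed_pos
  have hus : ContDiffAt ℝ ∞ u x := h.smooth.pd_top _
  have hsq := rotD_sq_eq hWp
  have hposu : ∀ᶠ q in 𝓝 x.2, 0 < u (x.1, q) := by
    have : ContinuousAt (fun q => u (x.1, q)) x.2 :=
      ContinuousAt.comp (f := fun q => (x.1, q)) (g := u) hus.continuousAt (by fun_prop)
    exact this.eventually (lt_mem_nhds hu0)
  -- The barrier transfers the maximum: the squared quotient φ_W²/u² lies below the given function
  -- and agrees with it at x, where φ_W is nonnegative.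
  have hlm : IsLocalMax (fun q => rotD 0 W φ (x.1, q) / u (x.1, q)) x.2 := by
    filter_upwards [hmax, hposu] with q hq hq'
    have h1 := rotD_sq_le (b := b) φ hWn (x.1, q)
    rw [h.norm_eq] at hq
    simp only [one_pow, one_mul] at hq
    rw [show (x.1, x.2) = x from rfl] at hq ⊢
    refine le_of_sq_le_sq ?_ (div_nonneg hpos hu0.le)
    rw [div_pow, div_pow, hsq]
    refine le_trans ?_ hq
    exact div_le_div_of_nonneg_right h1 (sq_nonneg _)
  have key := h.ratio (by simp) W hW (by simp) hlm
  -- At x the gradient is φ_W times W x, so ∂_t |∇φ|² = 2⟨∇φ, ∇φ_t⟩ becomes 2 φ_W ∂_t φ_W.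
  have hPt : pd (1, 0) (gradProd b φ φ) x = 2 * rotD 0 W φ x * pd (1, 0) (rotD 0 W φ) x := by
    have h1 : pd (1, 0) (gradProd b φ φ) x = rotD 1 0 (gradProd b φ φ) x := by
      rw [rotD_eq_pd]; simp
    have h2 : rotD 1 (0 : E →L[ℝ] E) φ = u := by ext y; rw [rotD_eq_pd]; simp [hu]
    rw [h1, rotD_gradProd_self b h.smooth 1 0 (by simp), h2, gradProd_eq_pd, hWp,
      pd_rotD (contDiffAt_nat h.smooth 2), ← hu]
    have h3 : ((0 : ℝ), rotD 0 W φ x • W x.2) = rotD 0 W φ x • ((0 : ℝ), W x.2) := by simp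
    have h4 : pd ((0 : ℝ), W ((1 : ℝ), (0 : E)).2) φ x = 0 := by simpa using pd_zero_vec φ x
    rw [h4, add_zero, show pd ((0 : ℝ), rotD 0 W φ x • W x.2) u x
      = rotD 0 W φ x * rotD 0 W u x by rw [h3]; simp only [pd, map_smul, smul_eq_mul]; rfl]
    ring
  rw [hPt, ← hsq]
  have := mul_le_mul_of_nonneg_left key hpos
  nlinarith

/-- The linearized equation. -/
theorem linearized (h : IsGraphSolution b 0 n φ x) (k : ℝ) (W : E →L[ℝ] E)
    (hW : ∀ v w, inner ℝ (W v) w = -inner ℝ v (W w)) {j : ℝ × E → ℝ} (hj : j = rotD k W φ)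
    {u v : ℝ} (hu : u = pd (1, 0) φ x) (hv : v = 1 + gradProd b φ φ x) :
    pd (1, 0) j x = -u ^ 2 *
      ((csinh (φ x) ^ 2 * (2 * n + 1 / ccosh (φ x) ^ 2) * j x - laplace b j x) / v
        + (spHess j x (spGrad b φ x) (spGrad b φ x) + gradProd b j (gradProd b φ φ) x) / v ^ 2
        - 2 * gradProd b φ j x / (u * v)
        - gradProd b φ (gradProd b φ φ) x * gradProd b φ j x / v ^ 3) := by
  have hφ := h.smooth
  have hPs := gradProd_smooth_top b hφ hφ
  have hv1 : 0 < v := by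
    have := gradProd_self_nonneg b φ x
    linarith
  have hu0 : 0 < u := hu ▸ h.speed_pos
  have heq := h.rotD_equation b (by simp) k W hW
  have hGe := h.graphCurv_eq
  rw [hGe, ← hu, ← hj] at heq
  set w : ℝ × E := (k, W x.2) with hw
  have hx0 : x + (0 : ℝ) • w = x := by simp
  have dφ : HasDerivAt (fun s : ℝ => φ (x + s • w)) (j x) 0 := by
    rw [hj]; exact hasDerivAt_line hφ.diff_top w
  have dK : HasDerivAt (fun s : ℝ => sphereCurv n (φ (x + s • w)))
      (csinh (φ x) ^ 2 * (2 * n + 1 / ccosh (φ x) ^ 2) * j x) 0 := by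
    have h1 : HasDerivAt (sphereCurv n) (csinh (φ x) ^ 2 * (2 * n + 1 / ccosh (φ x) ^ 2))
        (φ (x + (0 : ℝ) • w)) := by rw [hx0]; exact hasDerivAt_sphereCurv n h.neg
    exact h1.comp (0 : ℝ) dφ
  have dP : HasDerivAt (fun s : ℝ => 1 + gradProd b φ φ (x + s • w)) (2 * gradProd b φ j x) 0 := by
    refine ((hasDerivAt_line hPs.diff_top w).const_add 1).congr_deriv ?_
    rw [hj]; exact rotD_gradProd_self b hφ k W hW
  have dΔ : HasDerivAt (fun s : ℝ => laplace b φ (x + s • w)) (laplace b j x) 0 := by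
    refine (hasDerivAt_line (laplace_smooth_top b hφ).diff_top w).congr_deriv ?_
    rw [hj]; exact rotD_laplace b (contDiffAt_nat hφ 3) k W hW
  have dQ : HasDerivAt (fun s : ℝ => gradProd b φ (gradProd b φ φ) (x + s • w))
      (2 * spHess j x (spGrad b φ x) (spGrad b φ x) + 2 * gradProd b j (gradProd b φ φ) x) 0 := by
    refine (hasDerivAt_line (gradProd_smooth_top b hφ hPs).diff_top w).congr_deriv ?_
    rw [hj]; exact rotD_gradProd_gradProd b hφ k W hW
  have dG := ((dK.sub dΔ).div dP (by rw [hx0, ← hv]; exact hv1.ne')).add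
    ((dQ.div_const 2).div (dP.pow 2) (by
      simp only [Pi.pow_apply]; rw [hx0, ← hv]; exact pow_ne_zero _ hv1.ne'))
  have hGs := graphCurv_smooth b (I := 0) (n := n) hφ h.neg (by simp)
  have dG' := hasDerivAt_line hGs.diff_top w
  have hfun : (fun s : ℝ => graphCurv b 0 n φ (x + s • w)) = fun s : ℝ =>
      (sphereCurv n (φ (x + s • w)) - laplace b φ (x + s • w)) / (1 + gradProd b φ φ (x + s • w))
      + gradProd b φ (gradProd b φ φ) (x + s • w) / 2 / (1 + gradProd b φ φ (x + s • w)) ^ 2 := by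
    ext s; rw [graphCurv_zero]
  rw [hfun] at dG'
  have hDG : rotD k W (graphCurv b 0 n φ) x = _ := dG'.unique dG
  rw [hDG] at heq
  rw [graphCurv_zero, ← hu, ← hv] at hGe
  simp only [hx0, ← hv, Pi.pow_apply, Pi.sub_apply] at heq
  set A := gradProd b φ (gradProd b φ φ) x
  set D := laplace b φ x
  set K := sphereCurv n (φ x)
  -- The undifferentiated equation eliminates the combination of curvature and Laplacian of φ that
  -- multiplies the derivative of v; this is where the term with 1/(uv) comes from.
  have hK : K - D = v / u - A / 2 / v := by
    field_simp at hGe ⊢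
    linarith
  rw [hK] at heq
  have hui : u * (1 / u) = 1 := by field_simp
  have hsolve : ∀ a X : ℝ, a * (1 / u) + u * X = 0 → a = -u ^ 2 * X := fun a X hX => by
    linear_combination u * hX - a * hui
  rw [hsolve _ _ heq]
  field_simp
  ring

/-- At a spatial maximum of the radius the speed is at most that of a geodesic sphere. -/
theorem speed_le_of_isLocalMax (h : IsGraphSolution b 0 n φ x)
    (hmax : IsLocalMax (fun q => φ (x.1, q)) x.2) :
    pd (1, 0) φ x * sphereCurv n (φ x) ≤ 1 := by
  obtain ⟨h1, h2⟩ := spatial_isLocalMax (contDiffAt_nat h.smooth 2) hmax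
  have hg : ∀ f, gradProd b φ f x = 0 := fun f => by rw [gradProd_comm, gradProd_eq_pd, h1]
  have hL : laplace b φ x ≤ 0 := Finset.sum_nonpos fun i _ => h2 _
  have := h.graphCurv_eq
  rw [graphCurv_zero, hg, hg] at this
  have hu := h.speed_pos
  rw [eq_div_iff hu.ne'] at this
  have h3 := mul_nonneg hu.le (neg_nonneg.2 hL)
  ring_nf at this
  linarith

/-- At a minimum of the radius the gradient vanishes and the Laplacian is nonnegative, so the graph
is at most as curved as the geodesic sphere touching it and moves at least as fast. -/
theorem le_speed_of_isLocalMin (h : IsGraphSolution b 0 n φ x)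
    (hmin : IsLocalMin (fun q => φ (x.1, q)) x.2) :
    1 ≤ pd (1, 0) φ x * sphereCurv n (φ x) := by
  have hneg : ∀ w, pd w (fun y => -φ y) = fun y => -pd w φ y := fun w => by
    ext y; simp [pd, fderiv_fun_neg]
  have hneg' : ∀ w, pd w (fun y => -pd w φ y) x = -pd w (pd w φ) x := fun w => by
    rw [pd, fderiv_fun_neg]; rfl
  obtain ⟨h1, h2⟩ := spatial_isLocalMax (f := fun y => -φ y) (contDiffAt_nat h.smooth 2).neg hmin.neg
  simp only [hneg, hneg', neg_eq_zero, Left.neg_nonpos_iff] at h1 h2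
  have hg : ∀ f, gradProd b φ f x = 0 := fun f => by rw [gradProd_comm, gradProd_eq_pd, h1]
  have hL : 0 ≤ laplace b φ x := Finset.sum_nonneg fun i _ => h2 _
  have := h.graphCurv_eq
  rw [graphCurv_zero, hg, hg] at this
  have hu := h.speed_pos
  rw [eq_div_iff hu.ne'] at this
  have h3 := mul_nonneg hu.le hL
  ring_nf at this
  linarith

end IsGraphSolution

end PointwiseEstimates

/-! ### Evolution of the speed and of functions of speed, radius and gradient. -/

noncomputable section SpeedEstimates

open Filter Topology

variable {E : Type*} [NormedAddCommGroup E] [InnerProductSpace ℝ E]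
  {ι : Type*} [Fintype ι] {b : OrthonormalBasis ι ℝ E}

lemma rotD_one_zero (φ : ℝ × E → ℝ) : rotD 1 (0 : E →L[ℝ] E) φ = pd (1, 0) φ := by
  ext y; rw [rotD_eq_pd]; simp

lemma spatial_isLocalMin {f : ℝ × E → ℝ} {x : ℝ × E} (hf : ContDiffAt ℝ 2 f x)
    (h : IsLocalMin (fun q => f (x.1, q)) x.2) :
    (∀ v, pd ((0 : ℝ), v) f x = 0) ∧ ∀ v, 0 ≤ pd ((0 : ℝ), v) (pd ((0 : ℝ), v) f) x := by
  have hneg : ∀ w, pd w (fun y => -f y) = fun y => -pd w f y := fun w => by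
    ext y; simp [pd, fderiv_fun_neg]
  have hneg' : ∀ w, pd w (fun y => -pd w f y) x = -pd w (pd w f) x := fun w => by
    rw [pd, fderiv_fun_neg]; rfl
  have := spatial_isLocalMax (f := fun y => -f y) hf.neg h.neg
  simpa only [hneg, hneg', neg_eq_zero, Left.neg_nonpos_iff] using this

namespace IsGraphSolution

variable {n : ℕ} {φ : ℝ × E → ℝ} {x : ℝ × E}

/-- Invariance under time translation makes φ_t itself a solution of the linearized equation. At a
maximum its gradient terms vanish and the second order part is nonpositive, which leaves the damping
term coming from `hasDerivAt_sphereCurv`. -/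
theorem speed_deriv_le_of_isLocalMax (h : IsGraphSolution b 0 n φ x)
    (hmax : IsLocalMax (fun q => pd (1, 0) φ (x.1, q)) x.2) :
    pd (1, 0) (pd (1, 0) φ) x ≤ -(pd (1, 0) φ x ^ 3
      * (csinh (φ x) ^ 2 * (2 * n + 1 / ccosh (φ x) ^ 2)) / (1 + gradProd b φ φ x)) := by
  have hus := h.smooth.pd_top ((1 : ℝ), (0 : E))
  obtain ⟨h1, h2⟩ := spatial_isLocalMax (contDiffAt_nat hus 2) hmax
  have hlin := h.linearized 1 0 (by simp) (rotD_one_zero φ).symm rfl rfl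
  have hg : ∀ f, gradProd b f (pd (1, 0) φ) x = 0 := fun f => by rw [gradProd_eq_pd, h1]
  have hcon := contraction_nonpos b (spHess (pd (1, 0) φ) x)
    (fun v => by rw [spHess_apply (contDiffAt_nat hus 2)]; exact h2 v) (spGrad b φ x)
  rw [norm_spGrad_sq, ← laplace_eq b (contDiffAt_nat hus 2)] at hcon
  rw [hlin, gradProd_comm b (pd (1, 0) φ), hg, hg]
  have hP := gradProd_self_nonneg b φ x
  set v := 1 + gradProd b φ φ x
  have hv : 0 < v := by positivity
  have := mul_nonneg (div_nonneg (sq_nonneg (pd (1, 0) φ x)) hv.le) (neg_nonneg.2 hcon)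
  rw [← sub_nonneg]
  refine this.trans_eq ?_
  field_simp
  ring

theorem le_speed_deriv_of_isLocalMin (h : IsGraphSolution b 0 n φ x)
    (hmin : IsLocalMin (fun q => pd (1, 0) φ (x.1, q)) x.2) :
    -(pd (1, 0) φ x ^ 3
      * (csinh (φ x) ^ 2 * (2 * n + 1 / ccosh (φ x) ^ 2)) / (1 + gradProd b φ φ x))
      ≤ pd (1, 0) (pd (1, 0) φ) x := by
  have hus := h.smooth.pd_top ((1 : ℝ), (0 : E))
  obtain ⟨h1, h2⟩ := spatial_isLocalMin (contDiffAt_nat hus 2) hmin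
  have hlin := h.linearized 1 0 (by simp) (rotD_one_zero φ).symm rfl rfl
  have hg : ∀ f, gradProd b f (pd (1, 0) φ) x = 0 := fun f => by rw [gradProd_eq_pd, h1]
  have hcon := contraction_nonpos b (-spHess (pd (1, 0) φ) x)
    (fun v => by
      have := h2 v
      rw [← spHess_apply (contDiffAt_nat hus 2)] at this
      simpa using this) (spGrad b φ x)
  simp only [LinearMap.neg_apply, Finset.sum_neg_distrib] at hcon
  rw [norm_spGrad_sq, ← laplace_eq b (contDiffAt_nat hus 2)] at hcon
  rw [hlin, gradProd_comm b (pd (1, 0) φ), hg, hg]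
  have hP := gradProd_self_nonneg b φ x
  set v := 1 + gradProd b φ φ x
  have hv : 0 < v := by positivity
  have := mul_nonneg (div_nonneg (sq_nonneg (pd (1, 0) φ x)) hv.le) (neg_nonneg.2 hcon)
  rw [← sub_nonneg]
  refine this.trans_eq ?_
  field_simp
  ring

lemma _root_.pd_log_comb {X : Type*} [NormedAddCommGroup X] [NormedSpace ℝ X] {u f g : X → ℝ}
    {B B₁ : ℝ → ℝ} {y : X} (hu : DifferentiableAt ℝ u y) (hf : DifferentiableAt ℝ f y)
    (hg : DifferentiableAt ℝ g y) (hu0 : 0 < u y) (hf0 : f y < 0)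
    (hB : ∀ s, HasDerivAt B (B₁ s) s) (w : X) :
    pd w (fun z => Real.log (u z) + Real.log (csinh (f z)) + B (g z)) y
      = pd w u y / u y + ccosh (f y) * pd w f y + B₁ (g y) * pd w g y := by
  have hS := csinh_pos hf0
  have h1 := (hasDerivAt_line hu w).log (by simpa using hu0.ne')
  have h2 : HasDerivAt (fun s : ℝ => Real.log (csinh (f (y + s • w)))) (ccosh (f y) * pd w f y) 0 := by
    have h3 : HasDerivAt csinh (csinh (f y) * ccosh (f y)) (f (y + (0 : ℝ) • w)) := by
      simpa using hasDerivAt_csinh hf0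
    refine ((h3.comp (0 : ℝ) (hasDerivAt_line hf w)).log (by simpa using hS.ne')).congr_deriv ?_
    simp only [Function.comp_apply, zero_smul, add_zero]
    field_simp
  have h4 : HasDerivAt (fun s : ℝ => B (g (y + s • w))) (B₁ (g y) * pd w g y) 0 := by
    have h3 : HasDerivAt B (B₁ (g y)) (g (y + (0 : ℝ) • w)) := by simpa using hB (g y)
    exact h3.comp (0 : ℝ) (hasDerivAt_line hg w)
  have h5 := (h1.add h2).add h4
  have hd : DifferentiableAt ℝ (fun z => Real.log (u z) + Real.log (csinh (f z)) + B (g z)) y := by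
    refine ((hu.log hu0.ne').add (DifferentiableAt.log ?_ hS.ne')).add ?_
    · exact (hasDerivAt_csinh hf0).differentiableAt.comp y hf
    · exact (hB _).differentiableAt.comp y hg
  have h6 := (hasDerivAt_line hd w).unique h5
  simpa using h6

/-- The evolution of `log (φ_t sinh ρ) + B (φ_W)` at its extrema (maxima for `ε = 1`, minima for
`ε = -1`), where `W` is an infinitesimal rotation in the direction of the gradient. -/
theorem log_speed_deriv (h : IsGraphSolution b 0 n φ x) {W : E →L[ℝ] E}
    (hW : ∀ v w, inner ℝ (W v) w = -inner ℝ v (W w))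
    (hWp : spGrad b φ x = rotD 0 W φ x • W x.2) {B B₁ B₂ : ℝ → ℝ}
    (hBs : ContDiff ℝ ∞ B) (hB : ∀ s, HasDerivAt B (B₁ s) s) (hB₁ : ∀ s, HasDerivAt B₁ (B₂ s) s)
    {ε : ℝ} (hmax : IsLocalMax (fun q => ε * (Real.log (pd (1, 0) φ (x.1, q))
      + Real.log (csinh (φ (x.1, q))) + B (rotD 0 W φ (x.1, q)))) x.2)
    {u S C g P v d Γ K' : ℝ} (hu : u = pd (1, 0) φ x) (hS : S = csinh (φ x)) (hC : C = ccosh (φ x))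
    (hg : g = rotD 0 W φ x) (hP : P = gradProd b φ φ x) (hv : v = 1 + P)
    (hd : d = gradProd b φ (rotD 0 W φ) x) (hΓ : Γ = gradProd b (rotD 0 W φ) (rotD 0 W φ) x)
    (hK' : K' = S ^ 2 * (2 * n + 1 / C ^ 2)) :
    ε * pd (1, 0) (fun y => Real.log (pd (1, 0) φ y) + Real.log (csinh (φ y))
        + B (rotD 0 W φ y)) x
      ≤ ε * (u ^ 2 * P / v ^ 2 + 2 * C * u / v
          - u ^ 2 * (K' + C * ((2 * n - 1) * C + S ^ 2 / C)) / v
          + 2 * C * u ^ 2 * g * d / v ^ 3 + 2 * C * B₁ g * u ^ 2 * d / v ^ 2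
          - B₁ g * u ^ 2 * K' * g / v)
        + ε * (B₁ g ^ 2 - B₂ g) * (u ^ 2 / v * (Γ - d ^ 2 / v)) := by
  have hφ := h.smooth
  have hus : ContDiffAt ℝ ∞ (pd ((1 : ℝ), (0 : E)) φ) x := hφ.pd_top _
  have hgs : ContDiffAt ℝ ∞ (rotD 0 W φ) x := rotD_smooth_top hφ 0 W
  have hPs := gradProd_smooth_top b hφ hφ
  have hu0 := h.speed_pos
  have hS0 := csinh_pos h.neg
  have hC0 := ccosh_pos h.neg
  have hP0 := gradProd_self_nonneg b φ x
  have hsq : g ^ 2 = P := by rw [hg, hP]; exact rotD_sq_eq hWp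
  set U := pd ((1 : ℝ), (0 : E)) φ with hU
  set G := rotD 0 W φ with hG
  set p := spGrad b φ x with hp
  set Q : ℝ × E → ℝ := fun y => Real.log (U y) + Real.log (csinh (φ y)) + B (G y) with hQ
  have hQs : ContDiffAt ℝ ∞ Q x := by
    refine ((hus.log hu0.ne').add (ContDiffAt.log ?_ hS0.ne')).add ?_
    · exact (contDiffAt_csinh h.neg).comp x hφ
    · exact hBs.contDiffAt.comp x hgs
  -- first derivatives of `Q`
  have hev : ∀ᶠ y in 𝓝 x, ∀ w, pd w Q y
      = pd w U y / U y + ccosh (φ y) * pd w φ y + B₁ (G y) * pd w G y := by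
    filter_upwards [hus.continuousAt.eventually (lt_mem_nhds hu0),
      hφ.continuousAt.eventually (gt_mem_nhds h.neg), eventually_contDiffAt_nat hφ 1,
      eventually_contDiffAt_nat hus 1, eventually_contDiffAt_nat hgs 1] with y h1 h2 h3 h4 h5 w
    exact pd_log_comb (h4.differentiableAt (by norm_num)) (h3.differentiableAt (by norm_num))
      (h5.differentiableAt (by norm_num)) h1 h2 hB w
  have hQ1 := hev.self_of_nhds
  have hQ2 : ∀ v, spHess Q x v v = spHess U x v v / u - pd (0, v) U x ^ 2 / u ^ 2
      + C * spHess φ x v v + S ^ 2 * pd (0, v) φ x ^ 2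
      + B₁ g * spHess G x v v + B₂ g * pd (0, v) G x ^ 2 := by
    intro v
    rw [spHess_apply (contDiffAt_nat hQs 2), spHess_apply (contDiffAt_nat hus 2),
      spHess_apply (contDiffAt_nat hφ 2), spHess_apply (contDiffAt_nat hgs 2)]
    have h0 : pd ((0 : ℝ), v) Q =ᶠ[𝓝 x] fun y => pd ((0 : ℝ), v) U y / U y
        + ccosh (φ y) * pd ((0 : ℝ), v) φ y + B₁ (G y) * pd ((0 : ℝ), v) G y :=
      hev.mono fun y hy => hy _
    rw [(pd_congr h0 _).self_of_nhds]
    set w : ℝ × E := ((0 : ℝ), v)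
    have hx0 : x + (0 : ℝ) • w = x := by simp
    have dC : HasDerivAt (fun s : ℝ => ccosh (φ (x + s • w))) (csinh (φ x) ^ 2 * pd w φ x) 0 := by
      have h3 : HasDerivAt ccosh (csinh (φ x) ^ 2) (φ (x + (0 : ℝ) • w)) := by
        rw [hx0]; exact hasDerivAt_ccosh h.neg
      exact HasDerivAt.comp (h₂ := ccosh) (0 : ℝ) h3 (hasDerivAt_line hφ.diff_top w)
    have dB : HasDerivAt (fun s : ℝ => B₁ (G (x + s • w))) (B₂ (G x) * pd w G x) 0 := by
      have h3 : HasDerivAt B₁ (B₂ (G x)) (G (x + (0 : ℝ) • w)) := by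
        rw [hx0]; exact hB₁ _
      exact h3.comp (0 : ℝ) (hasDerivAt_line hgs.diff_top w)
    have h5 := (((hasDerivAt_line (hus.pd_top w).diff_top w).div (hasDerivAt_line hus.diff_top w)
      (by rw [hx0]; exact hu0.ne')).add (dC.mul (hasDerivAt_line (hφ.pd_top w).diff_top w))).add
      (dB.mul (hasDerivAt_line (hgs.pd_top w).diff_top w))
    have hd : DifferentiableAt ℝ (fun y => pd w U y / U y
        + ccosh (φ y) * pd w φ y + B₁ (G y) * pd w G y) x := by
      refine (((hus.pd_top w).div hus hu0.ne').diff_top.add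
        (DifferentiableAt.mul ?_ (hφ.pd_top w).diff_top)).add
        (DifferentiableAt.mul ?_ (hgs.pd_top w).diff_top)
      · exact (hasDerivAt_ccosh h.neg).differentiableAt.comp x hφ.diff_top
      · exact (hB₁ _).differentiableAt.comp x hgs.diff_top
    have h6 := (hasDerivAt_line hd w).unique h5
    rw [h6]
    simp only [hx0, hu, hS, hC, hg]
    field_simp
    ring
  -- the conditions at a maximum
  have hεQ : ∀ (f : ℝ × E → ℝ) w, pd w (fun y => ε * f y) = fun y => ε * pd w f y := fun f w => by
    ext y
    have := congrFun (fderiv_const_smul_field (𝕜 := ℝ) (f := f) ε) y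
    simp only [pd]
    rw [show (fun y => ε * f y) = ε • f from rfl, this]
    rfl
  obtain ⟨hm1, hm2⟩ := spatial_isLocalMax (f := fun y => ε * Q y)
    (contDiffAt_nat (contDiffAt_const.mul hQs) 2) hmax
  simp only [hεQ] at hm1 hm2
  have hcon := contraction_nonpos b (ε • spHess Q x) (fun w => by
    have := hm2 w
    rw [← spHess_apply (contDiffAt_nat hQs 2)] at this
    simpa using this) p
  rw [hQ1]
  rcases eq_or_ne ε 0 with hε | hε
  · simp [hε]
  -- Vanishing of the gradient of the test function expresses ∇φ_t through ∇φ and ∇φ_W, which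
  -- eliminates all first derivatives of the speed.
  have hgrad : ∀ w, pd ((0 : ℝ), w) U x = -u * (C * pd ((0 : ℝ), w) φ x + B₁ g * pd ((0 : ℝ), w) G x) := by
    intro w
    have := hm1 w
    rw [mul_eq_zero, or_iff_right hε, hQ1, ← hu, ← hC, ← hg] at this
    have hu' : u ≠ 0 := by rw [hu]; exact hu0.ne'
    field_simp at this
    linarith
  have hprod : ∀ f, gradProd b U f x = -u * (C * gradProd b φ f x + B₁ g * gradProd b G f x) := by
    intro f
    simp only [gradProd, hgrad, Finset.mul_sum, ← Finset.sum_add_distrib]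
    refine Finset.sum_congr rfl fun i _ => ?_
    ring
  have hprod' : gradProd b φ U x = -u * (C * P + B₁ g * d) := by
    rw [gradProd_comm, hprod, hd, hP, gradProd_comm b G]
  have hφpp : gradProd b φ (gradProd b φ φ) x = 2 * spHess φ x p p := by
    rw [gradProd_gradProd b (contDiffAt_nat hφ 2) (contDiffAt_nat hφ 2)]
    ring
  have hd' : d = spHess φ x p (W x.2) := by
    rw [hd, gradProd_eq_pd, rotD_hasFDerivAt (contDiffAt_nat hφ 2)]
    have h1 : fderiv ℝ φ x ((0 : ℝ), W p) = inner ℝ p (W p) := by rw [inner_spGrad]; rfl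
    have h2 : inner ℝ p (W p) = 0 := by
      have := hW p p
      rw [real_inner_comm] at this
      linarith
    simp only
    rw [← hp, h1, h2, add_zero]
    rfl
  -- Because the gradient p is g times W x, the Hessian on the gradient is g ⟨∇φ, ∇φ_W⟩; the bracket
  -- term ⟨p, W p⟩ vanishes by skewness.
  have hgd : spHess φ x p p = g * d := by
    have : spHess φ x p (g • W x.2) = g * d := by rw [map_smul, hd', smul_eq_mul]
    rw [← this, hg, ← hWp]
  have hlinU := h.linearized 1 0 (by simp) (rotD_one_zero φ).symm hu (hP ▸ hv)
  have hlinG := h.linearized 0 W hW hG hu (hP ▸ hv)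
  have hGe := h.graphCurv_eq
  rw [graphCurv_zero, hφpp, ← hP, ← hv, ← hU, ← hu, hgd] at hGe
  rw [hφpp, hgd, hprod', hprod, hφpp, hgd, ← hU, ← hu, ← hC, ← hS, ← hp, ← hK'] at hlinU
  rw [hφpp, hgd, ← hd, ← hg, ← hC, ← hS, ← hp, ← hK'] at hlinG
  have htr : ∑ i, spHess Q x (b i) (b i) = laplace b U x / u - gradProd b U U x / u ^ 2
      + C * laplace b φ x + S ^ 2 * P + B₁ g * laplace b G x + B₂ g * Γ := by
    rw [laplace_eq b (contDiffAt_nat hus 2), laplace_eq b (contDiffAt_nat hφ 2),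
      laplace_eq b (contDiffAt_nat hgs 2), hP, hΓ]
    simp only [hQ2, gradProd, Finset.sum_add_distrib, Finset.sum_sub_distrib, Finset.mul_sum,
      Finset.sum_div, sq]
  have hUU : gradProd b U U x = u ^ 2 * (C ^ 2 * P + 2 * C * B₁ g * d + B₁ g ^ 2 * Γ) := by
    rw [hprod, hprod', gradProd_comm b G U, hprod, hΓ, ← hd]
    ring
  have hpp : spHess Q x p p = spHess U x p p / u - (C * P + B₁ g * d) ^ 2
      + C * (g * d) + S ^ 2 * P ^ 2 + B₁ g * spHess G x p p + B₂ g * d ^ 2 := by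
    have hu' : u ≠ 0 := by rw [hu]; exact hu0.ne'
    rw [hQ2, hgd, hp, ← gradProd_eq_pd, ← gradProd_eq_pd, ← gradProd_eq_pd, ← hP, ← hd, hprod', ← hp]
    field_simp
  simp only [LinearMap.smul_apply, smul_eq_mul, ← Finset.mul_sum] at hcon
  rw [htr, hUU, hpp, hp, norm_spGrad_sq, ← hp, ← hP, ← hv] at hcon
  rw [hlinU, hlinG, ← hu, ← hC, ← hg]
  rw [show pd (1, 0) φ x = u from hu.symm]
  have hC2 : C ^ 2 = 1 + S ^ 2 := by rw [hC, hS]; exact ccosh_sq h.neg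
  have hCpos : C ≠ 0 := by rw [hC]; exact hC0.ne'
  have hupos : 0 < u := by rw [hu]; exact hu0
  have hvpos : 0 < v := by rw [hv, hP]; positivity
  have hKdef : sphereCurv n (φ x) = (2 * n - 1) * C + S ^ 2 / C := by rw [hC, hS]; rfl
  rw [hKdef] at hGe
  generalize (2 * (n : ℝ) - 1) * C + S ^ 2 / C = K at hGe ⊢
  generalize laplace b φ x = Tφ at *
  generalize laplace b U x = TU at *
  generalize laplace b G x = TG at *
  generalize spHess U x p p = UU at *
  generalize spHess G x p p = GG at *
  generalize gradProd b G (gradProd b φ φ) x = m at *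
  generalize B₁ g = b₁ at *
  generalize B₂ g = b₂ at *
  clear hlinU hlinG htr hUU hpp hprod' hprod hgrad hm1 hm2 hQ2 hQ1 hev hmax hεQ
  -- The flow equation eliminates the Laplacian of φ.
  have hTφ : Tφ = K + g * d / v - v / u := by
    field_simp at hGe ⊢
    linarith
  -- After all substitutions the right side minus the left side is exactly -u²/v times the
  -- contraction of ε Hess Q, which is nonnegative.
  have hfac := mul_nonpos_of_nonneg_of_nonpos (div_nonneg (sq_nonneg u) hvpos.le) hcon
  rw [← sub_nonneg]
  refine (neg_nonneg.2 hfac).trans_eq ?_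
  have hS2 : S ^ 2 = C ^ 2 - 1 := by linarith
  have hPv : P = v - 1 := by linarith
  rw [hTφ, hS2, hPv]
  field_simp
  ring

end IsGraphSolution

end SpeedEstimates

/-! ### The maximum principle for flows that are locally radial graphs. -/

noncomputable section GraphFlows

open Filter Topology Set

/-- The weak maximum principle on a compact space: if a continuous function does not increase in
time at its spatial maxima above the level `M`, then it stays below `M`. -/
theorem parametric_max_principle {S : Type*} [TopologicalSpace S] [CompactSpace S] {Q : ℝ → S → ℝ}
    {t₂ M : ℝ} (hc : ContinuousOn (Function.uncurry Q) (Ico 0 t₂ ×ˢ univ)) (h0 : ∀ z, Q 0 z ≤ M)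
    (h : ∀ t ∈ Ioo 0 t₂, ∀ z, (∀ w, Q t w ≤ Q t z) → M < Q t z →
      ∃ d ≤ 0, HasDerivAt (fun s => Q s z) d t) :
    ∀ t ∈ Ico 0 t₂, ∀ z, Q t z ≤ M := by
  intro t₁ ht₁ z₁
  by_contra! hlt
  -- The penalty -δt makes the differential inequality strict. The constant δ is small enough that
  -- the penalized value at the offending point is still above M, so the maximum is not attained at
  -- time 0.
  obtain ⟨δ, hδ, hδ'⟩ : ∃ δ > 0, M < Q t₁ z₁ - δ * t₁ := by
    refine ⟨(Q t₁ z₁ - M) / (2 * (t₁ + 1)), div_pos (by linarith) (by linarith [ht₁.1]), ?_⟩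
    have h1 : (0 : ℝ) < t₁ + 1 := by linarith [ht₁.1]
    have h2 : (Q t₁ z₁ - M) / (2 * (t₁ + 1)) * t₁ ≤ (Q t₁ z₁ - M) / 2 := by
      rw [div_mul_eq_mul_div, div_le_div_iff₀ (by positivity) (by norm_num)]
      nlinarith [ht₁.1]
    linarith
  have hsub : Icc 0 t₁ ×ˢ (univ : Set S) ⊆ Ico 0 t₂ ×ˢ univ := by
    rintro ⟨t, z⟩ ⟨ht, -⟩
    exact ⟨⟨ht.1, ht.2.trans_lt ht₁.2⟩, mem_univ _⟩
  have hcomp : IsCompact (Icc 0 t₁ ×ˢ (univ : Set S)) := isCompact_Icc.prod isCompact_univ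
  have hcont : ContinuousOn (fun y : ℝ × S => Q y.1 y.2 - δ * y.1) (Icc 0 t₁ ×ˢ univ) :=
    (hc.mono hsub).sub (by fun_prop)
  obtain ⟨⟨t, z⟩, ⟨ht, -⟩, hmax⟩ := hcomp.exists_isMaxOn
    ⟨(t₁, z₁), ⟨⟨ht₁.1, le_rfl⟩, mem_univ _⟩⟩ hcont
  replace ht : t ∈ Icc 0 t₁ := ht
  have hmax' : ∀ s ∈ Icc 0 t₁, ∀ w, Q s w - δ * s ≤ Q t z - δ * t :=
    fun s hs w => hmax (show (s, w) ∈ Icc 0 t₁ ×ˢ univ from ⟨hs, mem_univ _⟩)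
  have hgt : M < Q t z - δ * t := hδ'.trans_le (hmax' t₁ ⟨ht₁.1, le_rfl⟩ z₁)
  have htpos : 0 < t := by
    rcases ht.1.eq_or_lt with h' | h'
    · rw [← h'] at hgt
      have := h0 z
      simp only [mul_zero, sub_zero] at hgt
      linarith
    · exact h'
  have hMt : M < Q t z := by nlinarith
  obtain ⟨d, hd, hder⟩ := h t ⟨htpos, ht.2.trans_lt ht₁.2⟩ z
    (fun w => by have := hmax' t ht w; linarith) hMt
  have hder' : HasDerivAt (fun s => Q s z - δ * s) (d - δ) t := by
    have := hder.sub ((hasDerivAt_id t).const_mul δ)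
    rwa [mul_one] at this
  -- At a maximum over [0, t₁] the difference quotients from the left are nonnegative, whereas the
  -- derivative of the penalized function is at most -δ. Only earlier times are used, so t = t₁ is
  -- allowed.
  have hslope := hder'.hasDerivWithinAt (s := Iio t)
  rw [hasDerivWithinAt_iff_tendsto_slope' (by simp)] at hslope
  have hnonneg : ∀ᶠ s in 𝓝[<] t, 0 ≤ slope (fun s => Q s z - δ * s) t s := by
    filter_upwards [Ioo_mem_nhdsLT htpos] with s hs
    rw [slope_def_field]
    have h1 := hmax' s ⟨hs.1.le, hs.2.le.trans ht.2⟩ z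
    exact div_nonneg_of_nonpos (by linarith) (by linarith [hs.2])
  have := ge_of_tendsto hslope hnonneg
  linarith

variable {E : Type*} [NormedAddCommGroup E] [InnerProductSpace ℝ E]
  {ι : Type*} [Fintype ι] (b : OrthonormalBasis ι ℝ E)

/-- The values at `y` of the conformal radius, the squared gradient, the derivative along the
field `I` and the speed agree with those of the parametrized flow at the parameter `z`. -/
def JetMatch {S : Type*} (I : E →L[ℝ] E) (fφ fP fτ fu : ℝ → S → ℝ) (φ : ℝ × E → ℝ) (y : ℝ × E)
    (z : S) : Prop :=
  φ y = fφ y.1 z ∧ ‖y.2‖ ^ 2 * gradProd b φ φ y = fP y.1 z ∧ rotD 0 I φ y = fτ y.1 z ∧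
    pd (1, 0) φ y = fu y.1 z

/-- Near the parameter `z₀` and the time `t₀` the flow is a radial graph. -/
def HasGraphChart {S : Type*} (I : E →L[ℝ] E) (n : ℕ) (fφ fP fτ fu : ℝ → S → ℝ) (t₀ : ℝ) (z₀ : S) :
    Prop :=
  ∃ (φ : ℝ × E → ℝ) (x : ℝ × E), x.1 = t₀ ∧ IsGraphSolution b I n φ x ∧
    (∀ᶠ y in 𝓝 x, ∃ z, JetMatch b I fφ fP fτ fu φ y z) ∧
    ∃ γ : ℝ → E, γ t₀ = x.2 ∧ DifferentiableAt ℝ γ t₀ ∧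
      ∀ᶠ t in 𝓝 t₀, JetMatch b I fφ fP fτ fu φ (t, γ t) z₀

/-- A flow by hypersurfaces which are locally radial graphs moving by inverse mean curvature. -/
structure GraphFlow {S : Type*} [TopologicalSpace S] (I : E →L[ℝ] E) (n : ℕ) (t₂ : ℝ)
    (fφ fP fτ fu : ℝ → S → ℝ) : Prop where
  cont_radius : ContinuousOn (Function.uncurry fφ) (Ico 0 t₂ ×ˢ univ)
  cont_grad : ContinuousOn (Function.uncurry fP) (Ico 0 t₂ ×ˢ univ)
  cont_rot : ContinuousOn (Function.uncurry fτ) (Ico 0 t₂ ×ˢ univ)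
  cont_speed : ContinuousOn (Function.uncurry fu) (Ico 0 t₂ ×ˢ univ)
  neg : ∀ t ∈ Ico 0 t₂, ∀ z, fφ t z < 0
  pos : ∀ t ∈ Ico 0 t₂, ∀ z, 0 < fu t z
  nonneg : ∀ t ∈ Ico 0 t₂, ∀ z, 0 ≤ fP t z
  chart : ∀ t ∈ Ioo 0 t₂, ∀ z, HasGraphChart b I n fφ fP fτ fu t z

lemma pd_eq_of_hasDerivAt {X : Type*} [NormedAddCommGroup X] [NormedSpace ℝ X] {f : X → ℝ} {x w : X}
    {d : ℝ} (hf : DifferentiableAt ℝ f x) (h : HasDerivAt (fun s : ℝ => f (x + s • w)) d 0) :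
    pd w f x = d :=
  (hasDerivAt_line hf w).unique h

namespace GraphFlow

variable {b} {S : Type*} [TopologicalSpace S] [CompactSpace S] {I : E →L[ℝ] E} {n : ℕ} {t₂ : ℝ}
  {fφ fP fτ fu : ℝ → S → ℝ}

/-- The maximum principle for functions of the time, the conformal radius, the gradient, the
derivative along `I` and the speed. -/
theorem max_principle (h : GraphFlow b I n t₂ fφ fP fτ fu) (F : ℝ → ℝ → ℝ → ℝ → ℝ → ℝ) (M : ℝ)
    (hc : ContinuousOn (fun y : ℝ × S => F y.1 (fφ y.1 y.2) (fP y.1 y.2) (fτ y.1 y.2) (fu y.1 y.2))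
      (Ico 0 t₂ ×ˢ univ))
    (h0 : ∀ z, F 0 (fφ 0 z) (fP 0 z) (fτ 0 z) (fu 0 z) ≤ M)
    (hd : ∀ (φ : ℝ × E → ℝ) (x : ℝ × E) (z : S) (Q : ℝ × E → ℝ), IsGraphSolution b I n φ x →
      x.1 ∈ Ioo 0 t₂ → JetMatch b I fφ fP fτ fu φ x z →
      (∀ᶠ y in 𝓝 x, ∃ z, JetMatch b I fφ fP fτ fu φ y z) →
      (Q = fun y => F y.1 (φ y) (‖y.2‖ ^ 2 * gradProd b φ φ y) (rotD 0 I φ y) (pd (1, 0) φ y)) →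
      ContDiffAt ℝ 2 Q x ∧ (M < Q x → IsLocalMax (fun q => Q (x.1, q)) x.2 → pd (1, 0) Q x ≤ 0)) :
    ∀ t ∈ Ico 0 t₂, ∀ z, F t (fφ t z) (fP t z) (fτ t z) (fu t z) ≤ M := by
  refine parametric_max_principle (Q := fun t z => F t (fφ t z) (fP t z) (fτ t z) (fu t z)) hc h0 ?_
  intro t ht z hmax hM
  obtain ⟨φ, x, rfl, hφ, hnear, γ, hγ0, hγd, hγ⟩ := h.chart t ht z
  set Q : ℝ × E → ℝ := fun y =>
    F y.1 (φ y) (‖y.2‖ ^ 2 * gradProd b φ φ y) (rotD 0 I φ y) (pd (1, 0) φ y) with hQ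
  have hQm : ∀ {y z}, JetMatch b I fφ fP fτ fu φ y z →
      Q y = F y.1 (fφ y.1 z) (fP y.1 z) (fτ y.1 z) (fu y.1 z) := by
    rintro y z ⟨h1, h2, h3, h4⟩
    simp only [hQ, h1, h2, h3, h4]
  have hx0 : (x.1, γ x.1) = x := by rw [hγ0]
  have hm0 : JetMatch b I fφ fP fτ fu φ x z := by
    have := hγ.self_of_nhds
    rwa [hx0] at this
  obtain ⟨hs, hle⟩ := hd φ x z Q hφ ht hm0 hnear hQ
  -- Every point of the chart near x carries the data of some parameter w, so a global maximum over
  -- the parameters is a local maximum in the chart.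
  have hlm : IsLocalMax (fun q => Q (x.1, q)) x.2 := by
    have h1 : Tendsto (fun q : E => (x.1, q)) (𝓝 x.2) (𝓝 x) := by
      have : Continuous fun q : E => (x.1, q) := by fun_prop
      exact this.tendsto x.2
    filter_upwards [h1.eventually hnear] with q hq
    obtain ⟨w, hw⟩ := hq
    rw [hQm hw, show (x.1, x.2) = x from rfl, hQm hm0]
    exact hmax w
  refine ⟨_, hle (by rw [hQm hm0]; exact hM) hlm, ?_⟩
  have hsp := (spatial_isLocalMax hs hlm).1
  have hd1 : HasFDerivAt Q (fderiv ℝ Q x) (x.1, γ x.1) := by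
    rw [hx0]; exact (hs.differentiableAt (by norm_num)).hasFDerivAt
  have h2 := hd1.comp_hasDerivAt x.1 ((hasDerivAt_id x.1).prodMk hγd.hasDerivAt)
  -- A fixed parameter moves along the direction curve γ and not along a fixed ray. At a spatial
  -- maximum this drift does not contribute, so the derivative at a fixed parameter is the graphical
  -- time derivative.
  have h3 : fderiv ℝ Q x (1, deriv γ x.1) = pd (1, 0) Q x := by
    have h4 := hsp (deriv γ x.1)
    rw [show ((1 : ℝ), deriv γ x.1) = (1, 0) + (0, deriv γ x.1) by simp, map_add]
    simp only [pd] at h4 ⊢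
    rw [h4, add_zero]
  rw [h3] at h2
  refine h2.congr_of_eventuallyEq ?_
  filter_upwards [hγ] with s hs
  exact (hQm hs).symm

lemma contDiffAt_normSq (x : ℝ × E) {m : WithTop ℕ∞} :
    ContDiffAt ℝ m (fun y : ℝ × E => ‖y.2‖ ^ 2) x :=
  contDiffAt_snd.norm_sq ℝ

/-- Invariance under the field `I` is preserved. -/
theorem rot_eq_zero (h : GraphFlow b I n t₂ fφ fP fτ fu) (hI : ∀ v, ‖I v‖ ≤ ‖v‖)
    (hIs : ∀ v w, inner ℝ (I v) w = -inner ℝ v (I w)) (h0 : ∀ z, fτ 0 z = 0) :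
    ∀ t ∈ Ico 0 t₂, ∀ z, fτ t z = 0 := by
  -- The fields I and -I are skew and commute with I. The ratio estimate for both signs keeps φ_ξ /
  -- φ_t below and above its initial value 0.
  have main : ∀ σ : ℝ, σ = 1 ∨ σ = -1 → ∀ t ∈ Ico 0 t₂, ∀ z, σ * fτ t z / fu t z ≤ 0 := by
    intro σ hσ
    refine h.max_principle (fun _ _ _ τ u => σ * τ / u) 0 ?_ (fun z => by simp [h0]) ?_
    · refine ContinuousOn.div (continuousOn_const.mul h.cont_rot) h.cont_speed ?_
      rintro ⟨t, z⟩ ⟨ht, -⟩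
      exact (h.pos t ht z).ne'
    · rintro φ x z Q hφ hx hm - rfl
      have hu := hφ.smooth.pd_top ((1 : ℝ), (0 : E))
      have hτ := rotD_smooth_top hφ.smooth 0 I
      refine ⟨contDiffAt_nat ((contDiffAt_const.mul hτ).div hu hφ.speed_pos.ne') 2, fun _ hmax => ?_⟩
      have hW : rotD 0 (σ • I) φ = fun y => σ * rotD 0 I φ y := by
        ext y
        rw [rotD_eq_pd, rotD_eq_pd]
        simp only [pd]
        rw [show ((0 : ℝ), (σ • I) y.2) = σ • ((0 : ℝ), I y.2) by simp, map_smul, smul_eq_mul]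
      have key := hφ.ratio (by simpa [hφ.norm_eq] using hI x.2) (σ • I)
        (fun v w => by simp [real_inner_smul_left, real_inner_smul_right, hIs]) (by simp)
        (by rw [hW]; exact hmax)
      rw [hW] at key
      have hτ' : ContDiffAt ℝ ∞ (fun y => σ * rotD 0 I φ y) x := contDiffAt_const.mul hτ
      have hd := (hasDerivAt_line hτ'.diff_top ((1 : ℝ), (0 : E))).div
        (hasDerivAt_line hu.diff_top ((1 : ℝ), (0 : E))) (by simpa using hφ.speed_pos.ne')
      have hQ : DifferentiableAt ℝ (fun y => σ * rotD 0 I φ y / pd (1, 0) φ y) x :=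
        (hτ'.div hu hφ.speed_pos.ne').diff_top
      rw [pd_eq_of_hasDerivAt hQ hd]
      simp only [zero_smul, add_zero]
      exact div_nonpos_of_nonpos_of_nonneg (by linarith) (sq_nonneg _)
  intro t ht z
  have h1 := main 1 (Or.inl rfl) t ht z
  have h2 := main (-1) (Or.inr rfl) t ht z
  have hu := h.pos t ht z
  rw [div_le_iff₀ hu] at h1 h2
  linarith

omit [CompactSpace S] in
/-- An invariant flow is a flow by radial graphs for the simplified equation. -/
theorem of_rot_eq_zero (h : GraphFlow b I n t₂ fφ fP fτ fu) (h0 : ∀ t ∈ Ico 0 t₂, ∀ z, fτ t z = 0) :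
    GraphFlow b 0 n t₂ fφ fP (fun _ _ => 0) fu := by
  refine ⟨h.cont_radius, h.cont_grad, continuousOn_const, h.cont_speed, h.neg, h.pos, h.nonneg, ?_⟩
  intro t ht z
  obtain ⟨φ, x, rfl, hφ, hnear, γ, hγ0, hγd, hγ⟩ := h.chart t ht z
  have hτ : rotD 0 I φ =ᶠ[𝓝 x] fun _ => 0 := by
    have h1 : ∀ᶠ y in 𝓝 x, y.1 ∈ Ioo 0 t₂ :=
      continuousAt_fst.eventually (Ioo_mem_nhds ht.1 ht.2)
    filter_upwards [hnear, h1] with y ⟨z, hz⟩ hy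
    rw [hz.2.2.1, h0 _ ⟨hy.1.le, hy.2⟩]
  -- The Hopf derivative vanishes on a whole neighbourhood in space-time, so its derivatives vanish
  -- too and every anisotropic term of the curvature expression disappears.
  have hττ : rotD 0 I (rotD 0 I φ) =ᶠ[𝓝 x] fun _ => 0 := by
    filter_upwards [rotD_congr hτ 0 I] with y hy
    rw [hy]
    simp [rotD]
  have hG : ∀ᶠ y in 𝓝 x, graphCurv b I n φ y = graphCurv b 0 n φ y := by
    filter_upwards [hτ, hττ] with y h1 h2
    rw [graphCurv_zero]
    simp only [graphCurv, slopeSq, h1, h2]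
    ring
  refine ⟨φ, x, rfl, ⟨hφ.smooth, hφ.homogeneous, hφ.neg, hφ.norm_eq, hφ.speed_pos, ?_⟩, ?_, γ, hγ0,
    hγd, ?_⟩
  · filter_upwards [hφ.equation, hG] with y h1 h2 h3
    rw [← h2]; exact h1 h3
  · filter_upwards [hnear] with y ⟨z, hz⟩
    exact ⟨z, hz.1, hz.2.1, rotD_zero_zero _ _, hz.2.2.2⟩
  · filter_upwards [hγ] with s hz
    exact ⟨hz.1, hz.2.1, rotD_zero_zero _ _, hz.2.2.2⟩

end GraphFlow

lemma strictMonoOn_csinh : StrictMonoOn csinh (Iio 0) := by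
  refine strictMonoOn_of_deriv_pos (convex_Iio 0) ?_ ?_
  · exact fun y hy => (hasDerivAt_csinh hy).continuousAt.continuousWithinAt
  · intro y hy
    rw [interior_Iio] at hy
    rw [(hasDerivAt_csinh hy).deriv]
    exact mul_pos (csinh_pos hy) (ccosh_pos hy)

lemma strictMonoOn_ccosh : StrictMonoOn ccosh (Iio 0) := by
  refine strictMonoOn_of_deriv_pos (convex_Iio 0) ?_ ?_
  · exact fun y hy => (hasDerivAt_ccosh hy).continuousAt.continuousWithinAt
  · intro y hy
    rw [interior_Iio] at hy
    rw [(hasDerivAt_ccosh hy).deriv]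
    exact pow_pos (csinh_pos hy) 2

end GraphFlows

/-! ### Bounds for the radius, the gradient and the speed. -/

noncomputable section FlowEstimates

open Filter Topology Set

variable {E : Type*} [NormedAddCommGroup E] [InnerProductSpace ℝ E]

lemma hasDerivAt_line_comp {X : Type*} [NormedAddCommGroup X] [NormedSpace ℝ X] {f : X → ℝ} {x : X}
    {g : ℝ → ℝ} {g' : ℝ} (hf : DifferentiableAt ℝ f x) (hg : HasDerivAt g g' (f x)) (w : X) :
    HasDerivAt (fun s : ℝ => g (f (x + s • w))) (g' * pd w f x) 0 := by
  have h3 : HasDerivAt g g' (f (x + (0 : ℝ) • w)) := by simpa using hg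
  exact HasDerivAt.comp (h₂ := g) (0 : ℝ) h3 (hasDerivAt_line hf w)

lemma hasDerivAt_line_time (x : ℝ × E) :
    HasDerivAt (fun s : ℝ => (x + s • ((1 : ℝ), (0 : E))).1) 1 0 := by
  simpa using (hasDerivAt_id (0 : ℝ)).const_add x.1

omit [NormedAddCommGroup E] [InnerProductSpace ℝ E] in
lemma continuousAt_slice [TopologicalSpace E] {f : ℝ × E → ℝ} {x : ℝ × E} (hf : ContinuousAt f x) :
    ContinuousAt (fun q => f (x.1, q)) x.2 :=
  ContinuousAt.comp (f := fun q => (x.1, q)) (g := f) hf (by fun_prop)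

variable {ι : Type*} [Fintype ι] {b : OrthonormalBasis ι ℝ E}

namespace GraphFlow

variable {S : Type*} [TopologicalSpace S] [CompactSpace S] {n : ℕ} {t₂ : ℝ}
  {fφ fP fτ fu : ℝ → S → ℝ} (h : GraphFlow b 0 n t₂ fφ fP fτ fu)

include h

omit [CompactSpace S] in
lemma continuousOn_radius_comp {g : ℝ → ℝ} (hg : ∀ y < 0, ContinuousAt g y) :
    ContinuousOn (fun y : ℝ × S => g (fφ y.1 y.2)) (Ico 0 t₂ ×ˢ univ) := by
  rintro ⟨t, z⟩ ⟨ht, hz⟩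
  exact ContinuousAt.comp_continuousWithinAt (g := g) (f := fun y : ℝ × S => fφ y.1 y.2)
    (hg _ (h.neg t ht z)) (h.cont_radius (t, z) ⟨ht, hz⟩)

/-- At a minimum of the radius the speed is at least 1/K, and K = (2n-1) cosh ρ + sinh²ρ / cosh ρ is
at most 2n cosh ρ. Hence log sinh ρ, with time derivative φ_t cosh ρ, grows at least at rate 1/(2n).
-/
theorem radius_lower (hn : 1 ≤ n) {L₀ : ℝ} (hL : 0 < L₀) (h0 : ∀ z, L₀ ≤ csinh (fφ 0 z)) :
    ∀ t ∈ Ico 0 t₂, ∀ z, L₀ * Real.exp (t / (2 * n)) ≤ csinh (fφ t z) := by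
  have hn' : (0 : ℝ) < n := by exact_mod_cast hn
  have key := h.max_principle (fun t φ _ _ _ => t / (2 * n) - Real.log (csinh φ)) (-Real.log L₀)
    ((by fun_prop : Continuous fun y : ℝ × S => y.1 / (2 * (n : ℝ))).continuousOn.sub
      (h.continuousOn_radius_comp fun y hy =>
        (hasDerivAt_csinh hy).continuousAt.log (csinh_pos hy).ne'))
    (fun z => by
      have := Real.log_le_log hL (h0 z)
      simpa using this) ?_
  · intro t ht z
    have h1 := key t ht z
    have hS := csinh_pos (h.neg t ht z)
    rw [← Real.log_le_log_iff (by positivity) hS, Real.log_mul hL.ne' (Real.exp_pos _).ne',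
      Real.log_exp]
    linarith
  · rintro φ x z Q hφ hx hm - rfl
    have hS := csinh_pos hφ.neg
    have hC := ccosh_pos hφ.neg
    have hu := hφ.speed_pos
    have hQs : ContDiffAt ℝ ∞ (fun y : ℝ × E => y.1 / (2 * (n : ℝ)) - Real.log (csinh (φ y))) x :=
      (contDiffAt_fst.div_const _).sub
        (ContDiffAt.log ((contDiffAt_csinh hφ.neg).comp x hφ.smooth) hS.ne')
    refine ⟨contDiffAt_nat hQs 2, fun _ hmax => ?_⟩
    have hmin : IsLocalMin (fun q => φ (x.1, q)) x.2 := by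
      filter_upwards [hmax, (continuousAt_slice hφ.smooth.continuousAt).eventually
        (gt_mem_nhds hφ.neg)] with q hq hq'
      have h1 : Real.log (csinh (φ x)) ≤ Real.log (csinh (φ (x.1, q))) := by
        have h2 := hq
        simp only [Prod.mk.eta] at h2
        linarith
      rw [Real.log_le_log_iff hS (csinh_pos hq')] at h1
      exact (strictMonoOn_csinh.le_iff_le hφ.neg hq').1 h1
    have hKu := hφ.le_speed_of_isLocalMin hmin
    have hd := ((hasDerivAt_line_time x).div_const (2 * (n : ℝ))).sub
      ((hasDerivAt_line_comp hφ.smooth.diff_top (hasDerivAt_csinh hφ.neg) (1, 0)).log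
        (by simpa using hS.ne'))
    rw [pd_eq_of_hasDerivAt hQs.diff_top hd]
    simp only [zero_smul, add_zero]
    have hK : sphereCurv n (φ x) ≤ 2 * n * ccosh (φ x) := by
      have : csinh (φ x) ^ 2 / ccosh (φ x) ≤ ccosh (φ x) := by
        rw [div_le_iff₀ hC]
        nlinarith [ccosh_sq hφ.neg]
      unfold sphereCurv
      linarith
    have h2 : 1 ≤ pd (1, 0) φ x * (2 * n * ccosh (φ x)) :=
      hKu.trans (mul_le_mul_of_nonneg_left hK hu.le)
    have h3 : csinh (φ x) * ccosh (φ x) * pd (1, 0) φ x / csinh (φ x)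
        = ccosh (φ x) * pd (1, 0) φ x := by field_simp
    rw [h3, sub_nonpos, div_le_iff₀ (by positivity)]
    linarith

/-- At a maximum of the radius the speed is at most 1/K, and K ≥ 2n sinh²ρ / cosh ρ. Passing to log
cosh ρ, with time derivative φ_t sinh²ρ / cosh ρ, gives the same exponent as the lower bound, with
no loss. -/
theorem radius_upper (hn : 1 ≤ n) {C₀ : ℝ} (h0 : ∀ z, ccosh (fφ 0 z) ≤ C₀) :
    ∀ t ∈ Ico 0 t₂, ∀ z, ccosh (fφ t z) ≤ C₀ * Real.exp (t / (2 * n)) := by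
  have hn' : (0 : ℝ) < n := by exact_mod_cast hn
  intro t ht z
  have hC₀ : 0 < C₀ := (ccosh_pos (h.neg 0 ⟨le_rfl, ht.1.trans_lt ht.2⟩ z)).trans_le (h0 z)
  have key := h.max_principle (fun t φ _ _ _ => Real.log (ccosh φ) - t / (2 * n)) (Real.log C₀)
    ((h.continuousOn_radius_comp fun y hy =>
        (hasDerivAt_ccosh hy).continuousAt.log (ccosh_pos hy).ne').sub
      (by fun_prop : Continuous fun y : ℝ × S => y.1 / (2 * (n : ℝ))).continuousOn)
    (fun z => by
      have := Real.log_le_log (ccosh_pos (h.neg 0 ⟨le_rfl, ht.1.trans_lt ht.2⟩ z)) (h0 z)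
      simpa using this) ?_
  · have h1 := key t ht z
    have hS := ccosh_pos (h.neg t ht z)
    rw [← Real.log_le_log_iff hS (by positivity), Real.log_mul hC₀.ne' (Real.exp_pos _).ne',
      Real.log_exp]
    linarith
  · rintro φ x z Q hφ hx hm - rfl
    have hS := csinh_pos hφ.neg
    have hC := ccosh_pos hφ.neg
    have hu := hφ.speed_pos
    have hQs : ContDiffAt ℝ ∞ (fun y : ℝ × E => Real.log (ccosh (φ y)) - y.1 / (2 * (n : ℝ))) x :=
      (ContDiffAt.log ((contDiffAt_ccosh hφ.neg).comp x hφ.smooth) hC.ne').sub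
        (contDiffAt_fst.div_const _)
    refine ⟨contDiffAt_nat hQs 2, fun _ hmax => ?_⟩
    have hmax' : IsLocalMax (fun q => φ (x.1, q)) x.2 := by
      filter_upwards [hmax, (continuousAt_slice hφ.smooth.continuousAt).eventually
        (gt_mem_nhds hφ.neg)] with q hq hq'
      have h1 : Real.log (ccosh (φ (x.1, q))) ≤ Real.log (ccosh (φ x)) := by
        have h2 := hq
        simp only [Prod.mk.eta] at h2
        linarith
      rw [Real.log_le_log_iff (ccosh_pos hq') hC] at h1
      exact (strictMonoOn_ccosh.le_iff_le hq' hφ.neg).1 h1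
    have hKu := hφ.speed_le_of_isLocalMax hmax'
    have hd := ((hasDerivAt_line_comp hφ.smooth.diff_top (hasDerivAt_ccosh hφ.neg) (1, 0)).log
        (by simpa using hC.ne')).sub ((hasDerivAt_line_time x).div_const (2 * (n : ℝ)))
    rw [pd_eq_of_hasDerivAt hQs.diff_top hd]
    simp only [zero_smul, add_zero]
    have hK : 2 * n * (csinh (φ x) ^ 2 / ccosh (φ x)) ≤ sphereCurv n (φ x) := by
      have h1 : csinh (φ x) ^ 2 / ccosh (φ x) ≤ ccosh (φ x) := by
        rw [div_le_iff₀ hC]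
        nlinarith [ccosh_sq hφ.neg]
      have hn1 : (1 : ℝ) ≤ n := by exact_mod_cast hn
      unfold sphereCurv
      nlinarith
    have h2 : pd (1, 0) φ x * (2 * n * (csinh (φ x) ^ 2 / ccosh (φ x))) ≤ 1 :=
      (mul_le_mul_of_nonneg_left hK hu.le).trans hKu
    rw [sub_nonpos, le_div_iff₀ (by positivity)]
    calc csinh (φ x) ^ 2 * pd (1, 0) φ x / ccosh (φ x) * (2 * n)
        = pd (1, 0) φ x * (2 * n * (csinh (φ x) ^ 2 / ccosh (φ x))) := by ring
      _ ≤ 1 := h2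

/-- Division by the squared speed removes the reaction terms: a quotient of two solutions of the
linearized equation has none. The gradient therefore inherits any decay of the speed. -/
theorem gradient_le (M : ℝ) (h0 : ∀ z, fP 0 z / fu 0 z ^ 2 ≤ M) :
    ∀ t ∈ Ico 0 t₂, ∀ z, fP t z / fu t z ^ 2 ≤ M := by
  refine h.max_principle (fun _ _ P _ u => P / u ^ 2) M ?_ h0 ?_
  · refine h.cont_grad.div (h.cont_speed.pow 2) ?_
    rintro ⟨t, z⟩ ⟨ht, -⟩
    exact pow_ne_zero _ (h.pos t ht z).ne'
  · rintro φ x z Q hφ hx hm - rfl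
    have hu := hφ.smooth.pd_top ((1 : ℝ), (0 : E))
    have hP := gradProd_smooth_top b hφ.smooth hφ.smooth
    have hQs : ContDiffAt ℝ ∞ (fun y : ℝ × E => ‖y.2‖ ^ 2 * gradProd b φ φ y / pd (1, 0) φ y ^ 2) x :=
      ((contDiffAt_normSq x).mul hP).div (hu.pow 2) (pow_ne_zero _ hφ.speed_pos.ne')
    refine ⟨contDiffAt_nat hQs 2, fun _ hmax => ?_⟩
    have key := hφ.gradient_ratio hmax
    have hn : HasDerivAt (fun s : ℝ => ‖(x + s • ((1 : ℝ), (0 : E))).2‖ ^ 2) 0 0 := by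
      simpa using hasDerivAt_const (0 : ℝ) (‖x.2‖ ^ 2)
    have hd := (hn.mul (hasDerivAt_line hP.diff_top ((1 : ℝ), (0 : E)))).div
      ((hasDerivAt_line hu.diff_top ((1 : ℝ), (0 : E))).pow 2)
      (by simp only [Pi.pow_apply, zero_smul, add_zero]; exact pow_ne_zero _ hφ.speed_pos.ne')
    rw [pd_eq_of_hasDerivAt hQs.diff_top hd]
    have hu0 := hφ.speed_pos
    simp only [zero_smul, add_zero, hφ.norm_eq, Pi.mul_apply, Pi.pow_apply]
    refine div_nonpos_of_nonpos_of_nonneg ?_ (by positivity)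
    have := mul_le_mul_of_nonneg_right key hu0.le
    norm_num
    linarith

theorem speed_le (M : ℝ) (h0 : ∀ z, fu 0 z ≤ M) : ∀ t ∈ Ico 0 t₂, ∀ z, fu t z ≤ M := by
  refine h.max_principle (fun _ _ _ _ u => u) M h.cont_speed h0 ?_
  rintro φ x z Q hφ hx hm - rfl
  have hu := hφ.smooth.pd_top ((1 : ℝ), (0 : E))
  refine ⟨contDiffAt_nat hu 2, fun _ hmax => (hφ.speed_deriv_le_of_isLocalMax hmax).trans ?_⟩
  have hu0 := hφ.speed_pos
  have := gradProd_self_nonneg b φ x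
  have : 0 ≤ pd (1, 0) φ x ^ 3
      * (csinh (φ x) ^ 2 * (2 * n + 1 / ccosh (φ x) ^ 2)) / (1 + gradProd b φ φ x) := by positivity
  linarith

/-- Where φ_t e^{t/2n} exceeds M, the radius bound gives φ_t sinh ρ ≥ M L₀, so the damping term is
at least φ_t/(2n) as soon as 1 + P₀ ≤ 4n²M²L₀². This beats the growth of the exponential factor. -/
theorem speed_upper (hn : 1 ≤ n) {L₀ P₀ M : ℝ} (hL : 0 < L₀)
    (hφL : ∀ t ∈ Ico 0 t₂, ∀ z, L₀ * Real.exp (t / (2 * n)) ≤ csinh (fφ t z))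
    (hP : ∀ t ∈ Ico 0 t₂, ∀ z, fP t z ≤ P₀) (h0 : ∀ z, fu 0 z ≤ M) (hM : 0 ≤ M)
    (hMP : 1 + P₀ ≤ 4 * n ^ 2 * M ^ 2 * L₀ ^ 2) :
    ∀ t ∈ Ico 0 t₂, ∀ z, fu t z * Real.exp (t / (2 * n)) ≤ M := by
  have hn' : (0 : ℝ) < n := by exact_mod_cast hn
  refine h.max_principle (fun t _ _ _ u => u * Real.exp (t / (2 * n))) M
    (h.cont_speed.mul (by fun_prop)) (fun z => by simpa using h0 z) ?_
  rintro φ x z Q hφ hx hm - rfl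
  have hu := hφ.smooth.pd_top ((1 : ℝ), (0 : E))
  have hQs : ContDiffAt ℝ ∞ (fun y : ℝ × E => pd (1, 0) φ y * Real.exp (y.1 / (2 * n))) x :=
    hu.mul (Real.contDiff_exp.contDiffAt.comp x (contDiffAt_fst.div_const _))
  refine ⟨contDiffAt_nat hQs 2, fun hgt hmax => ?_⟩
  have hmax' : IsLocalMax (fun q => pd (1, 0) φ (x.1, q)) x.2 := by
    filter_upwards [hmax] with q hq
    exact le_of_mul_le_mul_right hq (Real.exp_pos _)
  have key := hφ.speed_deriv_le_of_isLocalMax hmax'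
  have hd := (hasDerivAt_line hu.diff_top ((1 : ℝ), (0 : E))).mul
    (((hasDerivAt_line_time x).div_const (2 * (n : ℝ))).exp)
  rw [pd_eq_of_hasDerivAt hQs.diff_top hd]
  simp only [zero_smul, add_zero] at hgt ⊢
  have hIco : x.1 ∈ Ico 0 t₂ := ⟨hx.1.le, hx.2⟩
  have hPx : gradProd b φ φ x ≤ P₀ := by
    have h1 := hm.2.1
    rw [hφ.norm_eq, one_pow, one_mul] at h1
    rw [h1]; exact hP _ hIco z
  have hSx : L₀ * Real.exp (x.1 / (2 * n)) ≤ csinh (φ x) := by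
    rw [hm.1]; exact hφL _ hIco z
  have hu0 := hφ.speed_pos
  have hP0 := gradProd_self_nonneg b φ x
  set u := pd (1, 0) φ x
  set e := Real.exp (x.1 / (2 * n)) with he
  have he0 : 0 < e := Real.exp_pos _
  set v := 1 + gradProd b φ φ x
  have hv : 0 < v := by positivity
  have hvP : v ≤ 1 + P₀ := by simp only [v]; linarith
  have h1 : M * L₀ ≤ u * csinh (φ x) := by
    have := mul_le_mul_of_nonneg_right hgt.le hL.le
    calc M * L₀ ≤ u * e * L₀ := this
      _ = u * (L₀ * e) := by ring
      _ ≤ _ := mul_le_mul_of_nonneg_left hSx hu0.le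
  have h2 : v ≤ 4 * n ^ 2 * (u * csinh (φ x)) ^ 2 := by
    have : (M * L₀) ^ 2 ≤ (u * csinh (φ x)) ^ 2 := pow_le_pow_left₀ (by positivity) h1 2
    nlinarith [sq_nonneg (n : ℝ)]
  have h3 : u / (2 * n) ≤ u ^ 3 * (csinh (φ x) ^ 2 * (2 * n + 1 / ccosh (φ x) ^ 2)) / v := by
    have h4 : u ^ 3 * (csinh (φ x) ^ 2 * (2 * n)) / v
        ≤ u ^ 3 * (csinh (φ x) ^ 2 * (2 * n + 1 / ccosh (φ x) ^ 2)) / v := by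
      have : (0 : ℝ) ≤ 1 / ccosh (φ x) ^ 2 := by positivity
      gcongr
      linarith
    refine le_trans ?_ h4
    rw [div_le_div_iff₀ (by positivity) hv]
    have := mul_le_mul_of_nonneg_left h2 hu0.le
    linarith
  have h5 : pd (1, 0) (pd (1, 0) φ) x + u / (2 * n) ≤ 0 := by linarith
  calc _ = e * (pd (1, 0) (pd (1, 0) φ) x + u / (2 * n)) := by ring
    _ ≤ 0 := mul_nonpos_of_nonneg_of_nonpos he0.le h5

/-- Where φ_t e^{t/2n} is below M, one has φ_t sinh ρ ≤ M C₀. Bounding v below by 1 and 1/cosh²ρ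
above by 1 makes the damping at most φ_t/(2n), which the exponential factor compensates. -/
theorem speed_lower (hn : 1 ≤ n) {C₀ M : ℝ}
    (hφC : ∀ t ∈ Ico 0 t₂, ∀ z, ccosh (fφ t z) ≤ C₀ * Real.exp (t / (2 * n)))
    (h0 : ∀ z, M ≤ fu 0 z) (hMC : 2 * n * (2 * n + 1) * M ^ 2 * C₀ ^ 2 ≤ 1) :
    ∀ t ∈ Ico 0 t₂, ∀ z, M ≤ fu t z * Real.exp (t / (2 * n)) := by
  have hn' : (0 : ℝ) < n := by exact_mod_cast hn
  suffices ∀ t ∈ Ico 0 t₂, ∀ z, -(fu t z * Real.exp (t / (2 * n))) ≤ -M from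
    fun t ht z => by have := this t ht z; linarith
  refine h.max_principle (fun t _ _ _ u => -(u * Real.exp (t / (2 * n)))) (-M)
    (h.cont_speed.mul (by fun_prop)).neg (fun z => by simpa using h0 z) ?_
  rintro φ x z Q hφ hx hm - rfl
  have hu := hφ.smooth.pd_top ((1 : ℝ), (0 : E))
  have hQs : ContDiffAt ℝ ∞ (fun y : ℝ × E => -(pd (1, 0) φ y * Real.exp (y.1 / (2 * n)))) x :=
    (hu.mul (Real.contDiff_exp.contDiffAt.comp x (contDiffAt_fst.div_const _))).neg
  refine ⟨contDiffAt_nat hQs 2, fun hgt hmax => ?_⟩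
  have hmin : IsLocalMin (fun q => pd (1, 0) φ (x.1, q)) x.2 := by
    filter_upwards [hmax] with q hq
    exact le_of_mul_le_mul_right (neg_le_neg_iff.1 hq) (Real.exp_pos _)
  have key := hφ.le_speed_deriv_of_isLocalMin hmin
  have hd := ((hasDerivAt_line hu.diff_top ((1 : ℝ), (0 : E))).mul
    (((hasDerivAt_line_time x).div_const (2 * (n : ℝ))).exp)).neg
  rw [pd_eq_of_hasDerivAt hQs.diff_top hd]
  simp only [zero_smul, add_zero] at hgt ⊢
  have hIco : x.1 ∈ Ico 0 t₂ := ⟨hx.1.le, hx.2⟩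
  have hCx : ccosh (φ x) ≤ C₀ * Real.exp (x.1 / (2 * n)) := by
    rw [hm.1]; exact hφC _ hIco z
  have hu0 := hφ.speed_pos
  have hP0 := gradProd_self_nonneg b φ x
  have hC1 := one_lt_ccosh hφ.neg
  have hS0 := csinh_pos hφ.neg
  have hCS := ccosh_sq hφ.neg
  set u := pd (1, 0) φ x
  set e := Real.exp (x.1 / (2 * n)) with he
  have he0 : 0 < e := Real.exp_pos _
  set v := 1 + gradProd b φ φ x
  have hv : 1 ≤ v := by simp only [v]; linarith
  have hC₀ : 0 < C₀ := by
    by_contra! hneg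
    nlinarith
  have h1 : (u * csinh (φ x)) ^ 2 ≤ M ^ 2 * C₀ ^ 2 := by
    have h2 : u * csinh (φ x) ≤ M * C₀ := by
      have h3 : csinh (φ x) ≤ ccosh (φ x) := by nlinarith
      calc u * csinh (φ x) ≤ u * (C₀ * e) := mul_le_mul_of_nonneg_left (h3.trans hCx) hu0.le
        _ = (u * e) * C₀ := by ring
        _ ≤ M * C₀ := mul_le_mul_of_nonneg_right (by linarith) hC₀.le
    rw [← mul_pow]
    exact pow_le_pow_left₀ (by positivity) h2 2
  have h3 : u ^ 3 * (csinh (φ x) ^ 2 * (2 * n + 1 / ccosh (φ x) ^ 2)) / v ≤ u / (2 * n) := by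
    have h4 : u ^ 3 * (csinh (φ x) ^ 2 * (2 * n + 1 / ccosh (φ x) ^ 2)) / v
        ≤ u ^ 3 * (csinh (φ x) ^ 2 * (2 * n + 1)) := by
      have h5 : 1 / ccosh (φ x) ^ 2 ≤ 1 := by
        rw [div_le_one (by positivity)]
        nlinarith
      refine (div_le_self (by positivity) hv).trans ?_
      gcongr
    refine h4.trans ?_
    rw [le_div_iff₀ (by positivity)]
    have h6 : (2 * n * (2 * n + 1)) * (u * csinh (φ x)) ^ 2 ≤ 1 := by
      refine le_trans ?_ hMC
      rw [mul_assoc _ (M ^ 2)]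
      exact mul_le_mul_of_nonneg_left h1 (by positivity)
    have := mul_le_mul_of_nonneg_left h6 hu0.le
    linarith
  have h5 : 0 ≤ pd (1, 0) (pd (1, 0) φ) x + u / (2 * n) := by linarith
  calc _ = -(e * (pd (1, 0) (pd (1, 0) φ) x + u / (2 * n))) := by ring
    _ ≤ 0 := neg_nonpos.2 (mul_nonneg he0.le h5)

end GraphFlow

end FlowEstimates

/-! ### Differential inequalities for the mean curvature at its extrema. -/

noncomputable section SpeedEvolution

open Filter Topology Set

variable {E : Type*} [NormedAddCommGroup E] [InnerProductSpace ℝ E]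
  {ι : Type*} [Fintype ι] {b : OrthonormalBasis ι ℝ E}

namespace IsGraphSolution

variable {n : ℕ} {φ : ℝ × E → ℝ} {x : ℝ × E}

/-- The evolution of `log (φ_t sinh ρ) + D (|∇φ|²)` at its extrema. -/
theorem log_speed_grad_deriv (h : IsGraphSolution b 0 n φ x) {B B₁ B₂ D : ℝ → ℝ} {ε : ℝ}
    (hBs : ContDiff ℝ ∞ B) (hB : ∀ s, HasDerivAt B (B₁ s) s) (hB₁ : ∀ s, HasDerivAt B₁ (B₂ s) s)
    (hBD : ∀ s, B s = D (s ^ 2)) (hD : ∀ s t, 0 ≤ s → s ≤ t → ε * D s ≤ ε * D t)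
    (hDs : ∀ s, 0 ≤ s → ContDiffAt ℝ ∞ D s)
    (hmax : IsLocalMax (fun q => ε * (Real.log (pd (1, 0) φ (x.1, q))
      + Real.log (csinh (φ (x.1, q))) + D (‖q‖ ^ 2 * gradProd b φ φ (x.1, q)))) x.2)
    {u S C P v K' : ℝ} (hu : u = pd (1, 0) φ x) (hS : S = csinh (φ x)) (hC : C = ccosh (φ x))
    (hP : P = gradProd b φ φ x) (hv : v = 1 + P)
    (hK' : K' = S ^ 2 * (2 * n + 1 / C ^ 2)) :
    ∃ g d Γ : ℝ, g ^ 2 = P ∧ d ^ 2 ≤ P * Γ ∧ 0 ≤ Γ ∧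
    ε * pd (1, 0) (fun y => Real.log (pd (1, 0) φ y) + Real.log (csinh (φ y))
        + D (‖y.2‖ ^ 2 * gradProd b φ φ y)) x
      ≤ ε * (u ^ 2 * P / v ^ 2 + 2 * C * u / v
          - u ^ 2 * (K' + C * ((2 * n - 1) * C + S ^ 2 / C)) / v
          + 2 * C * u ^ 2 * g * d / v ^ 3 + 2 * C * B₁ g * u ^ 2 * d / v ^ 2
          - B₁ g * u ^ 2 * K' * g / v)
        + ε * (B₁ g ^ 2 - B₂ g) * (u ^ 2 / v * (Γ - d ^ 2 / v)) := by
  obtain ⟨W, hW, hWn, hWp⟩ := h.exists_rotation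
  have hsq : rotD 0 W φ x ^ 2 = gradProd b φ φ x := rotD_sq_eq hWp
  -- The gradient function is replaced by a function of the single rotational derivative φ_W, which
  -- solves the linearized equation. With the sign ε it lies below, and it touches at x.
  have hle : ∀ y, ε * B (rotD 0 W φ y) ≤ ε * D (‖y.2‖ ^ 2 * gradProd b φ φ y) := fun y => by
    rw [hBD]; exact hD _ _ (sq_nonneg _) (rotD_sq_le φ hWn y)
  have heq : B (rotD 0 W φ x) = D (‖x.2‖ ^ 2 * gradProd b φ φ x) := by
    rw [hBD, hsq, h.norm_eq]; simp
  have hφ := h.smooth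
  have hus : ContDiffAt ℝ ∞ (pd ((1 : ℝ), (0 : E)) φ) x := hφ.pd_top _
  have hPs := gradProd_smooth_top b hφ hφ
  have h1 : ContDiffAt ℝ ∞ (fun y => Real.log (pd (1, 0) φ y) + Real.log (csinh (φ y))) x :=
    (hus.log h.speed_pos.ne').add
      (ContDiffAt.log ((contDiffAt_csinh h.neg).comp x hφ) (csinh_pos h.neg).ne')
  have h2 : ContDiffAt ℝ ∞ (fun y => Real.log (pd (1, 0) φ y) + Real.log (csinh (φ y))
      + B (rotD 0 W φ y)) x := h1.add (hBs.contDiffAt.comp x (rotD_smooth_top hφ 0 W))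
  have h3 : ContDiffAt ℝ ∞ (fun y => Real.log (pd (1, 0) φ y) + Real.log (csinh (φ y))
      + D (‖y.2‖ ^ 2 * gradProd b φ φ y)) x := by
    refine h1.add (ContDiffAt.comp (g := D) x (hDs _ ?_) ((GraphFlow.contDiffAt_normSq x).mul hPs))
    have := gradProd_self_nonneg b φ x
    positivity
  have hpd : ε * pd (1, 0) (fun y => Real.log (pd (1, 0) φ y) + Real.log (csinh (φ y))
        + D (‖y.2‖ ^ 2 * gradProd b φ φ y)) x
      = ε * pd (1, 0) (fun y => Real.log (pd (1, 0) φ y) + Real.log (csinh (φ y))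
        + B (rotD 0 W φ y)) x := by
    -- The difference of the two test functions is nonnegative and vanishes at x, so their time
    -- derivatives at x coincide.
    have hmin : IsLocalMin (fun y => ε * (Real.log (pd (1, 0) φ y) + Real.log (csinh (φ y))
        + D (‖y.2‖ ^ 2 * gradProd b φ φ y)) - ε * (Real.log (pd (1, 0) φ y)
        + Real.log (csinh (φ y)) + B (rotD 0 W φ y))) x := by
      refine Eventually.of_forall fun y => ?_
      have := hle y
      simp only [heq]
      linarith
    have h4 := hmin.hasFDerivAt_eq_zero
      ((h3.diff_top.hasFDerivAt.const_mul ε).sub (h2.diff_top.hasFDerivAt.const_mul ε))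
    have h5 := congrArg (fun L : ℝ × E →L[ℝ] ℝ => L (1, 0)) h4
    simp only [sub_apply, smul_apply, smul_eq_mul, zero_apply] at h5
    exact sub_eq_zero.1 h5
  refine ⟨rotD 0 W φ x, gradProd b φ (rotD 0 W φ) x, gradProd b (rotD 0 W φ) (rotD 0 W φ) x,
    by rw [hsq, hP], by rw [hP]; exact gradProd_sq_le b _ _ x,
    gradProd_self_nonneg _ _ _, ?_⟩
  rw [hpd]
  refine h.log_speed_deriv hW hWp hBs hB hB₁ ?_ hu hS hC rfl hP hv rfl rfl hK'
  filter_upwards [hmax] with q hq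
  have h6 := hle (x.1, q)
  simp only [Prod.mk.eta] at hq h6 ⊢
  rw [heq]
  linarith

end IsGraphSolution

/-- Taylor bound for c = √(1+e). It is applied with c = coth ρ and e = 1/sinh²ρ, where second order
accuracy in e is needed. -/
lemma one_add_half_sub_le {c e : ℝ} (hc : 0 ≤ c) (he : 0 ≤ e) (h : c ^ 2 = 1 + e) :
    1 + e / 2 - e ^ 2 / 8 ≤ c := by
  rcases le_or_gt (1 + e / 2 - e ^ 2 / 8) 0 with h0 | h0
  · exact h0.trans hc
  · refine le_of_sq_le_sq ?_ hc
    have h8 : e ≤ 8 := by nlinarith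
    rw [h]
    nlinarith [mul_nonneg (pow_nonneg he 3) (sub_nonneg.2 h8)]

lemma le_one_add_half {c e : ℝ} (he : 0 ≤ e) (h : c ^ 2 = 1 + e) : c ≤ 1 + e / 2 := by
  refine le_of_sq_le_sq ?_ (by linarith)
  rw [h]; nlinarith [sq_nonneg e]

lemma one_sub_half_le {r P : ℝ} (hr : 0 ≤ r) (hP : 0 ≤ P) (h : r ^ 2 * (1 + P) = 1) :
    1 - P / 2 ≤ r := by
  rcases le_or_gt (1 - P / 2) 0 with h0 | h0
  · exact h0.trans hr
  · refine le_of_sq_le_sq ?_ hr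
    have h1 : (1 - P / 2) ^ 2 * (1 + P) ≤ r ^ 2 * (1 + P) := by
      rw [h]
      nlinarith [mul_nonneg (sq_nonneg P) (show 0 ≤ 3 - P by linarith)]
    exact le_of_mul_le_mul_right h1 (by linarith)

/-- Here a = 2n/H, e = 1/sinh²ρ, r = (1+P)^{-1/2} and c = coth ρ. The first order terms in e and P
appear only through the factor 1 - a, which vanishes at the limit curvature; everything else is
quadratic in (e, P), hence of order e^{-2t/n}. -/
lemma max_bracket_le {a e P r c : ℝ} (ha : a ≤ 1) (he : 0 ≤ e) (hP : 0 ≤ P)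
    (hr : 0 ≤ r) (hr1 : r ≤ 1) (hr2 : 1 - P / 2 ≤ r) (hc : 1 + e / 2 - e ^ 2 / 8 ≤ c) :
    (1 - a) * (2 - P) - (P ^ 2 + e * P + e ^ 2) ≤ 2 * c * r - a * (1 + r ^ 2) - a * e := by
  have h1 : (1 - a) * (2 - P) ≤ (1 - a) * (r * (2 + e)) := by
    refine mul_le_mul_of_nonneg_left ?_ (by linarith)
    nlinarith [mul_nonneg hr he]
  have h2 : a * (1 - r) ^ 2 ≤ P ^ 2 := by
    have : (1 - r) ^ 2 ≤ P ^ 2 := pow_le_pow_left₀ (by linarith) (by linarith) 2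
    nlinarith [sq_nonneg (1 - r)]
  have h3 : a * e * (1 - r) ≤ e * P := by
    have : a * e ≤ e := by nlinarith
    calc a * e * (1 - r) ≤ e * (1 - r) := mul_le_mul_of_nonneg_right this (by linarith)
      _ ≤ e * P := mul_le_mul_of_nonneg_left (by linarith) he
  have h4 : (2 + e - e ^ 2 / 4) * r ≤ 2 * c * r := mul_le_mul_of_nonneg_right (by linarith) hr
  have h5 : e ^ 2 / 4 * r ≤ e ^ 2 := by nlinarith [sq_nonneg e]
  nlinarith

set_option maxHeartbeats 1000000 in
/-- The algebraic estimate for the evolution of the mean curvature at its maxima. -/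
lemma curvature_max_estimate {n u S C P r K' g d Γ : ℝ} (hu : 0 < u) (hS : 0 < S)
    (hC : 0 < C) (hCS : C ^ 2 = 1 + S ^ 2) (hP : 0 ≤ P) (hr : 0 < r) (hrP : r ^ 2 * (1 + P) = 1)
    (hK' : K' = S ^ 2 * (2 * n + 1 / C ^ 2)) (hg : g ^ 2 = P) (hd : d ^ 2 ≤ P * Γ) (hΓ : 0 ≤ Γ)
    (ha : 2 * n * (u * S * r) ≤ 1) :
    (-1) * (u ^ 2 * P / (1 + P) ^ 2 + 2 * C * u / (1 + P)
          - u ^ 2 * (K' + C * ((2 * n - 1) * C + S ^ 2 / C)) / (1 + P)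
          + 2 * C * u ^ 2 * g * d / (1 + P) ^ 3
          + 2 * C * (-(g / (1 + g ^ 2))) * u ^ 2 * d / (1 + P) ^ 2
          - (-(g / (1 + g ^ 2))) * u ^ 2 * K' * g / (1 + P))
        + (-1) * ((-(g / (1 + g ^ 2))) ^ 2 - (-((1 - g ^ 2) / (1 + g ^ 2) ^ 2))) *
          (u ^ 2 / (1 + P) * (Γ - d ^ 2 / (1 + P)))
      ≤ -(u * S * r) * ((1 - 2 * n * (u * S * r)) * (2 - P)
          - (P ^ 2 + 1 / S ^ 2 * P + (1 / S ^ 2) ^ 2)) := by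
  have hv : 0 < 1 + P := by linarith
  have he0 : 0 < 1 / S ^ 2 := by positivity
  have hs0 : 0 < u * S * r := by positivity
  have hc2 : (C / S) ^ 2 = 1 + 1 / S ^ 2 := by rw [div_pow, hCS]; field_simp; ring
  have hcl := one_add_half_sub_le (by positivity) he0.le hc2
  have hr2 := one_sub_half_le hr.le hP hrP
  have hr1 : r ≤ 1 := by
    refine le_of_sq_le_sq ?_ zero_le_one
    nlinarith [mul_nonneg (sq_nonneg r) hP]
  have hvi : (1 + P)⁻¹ = r ^ 2 := by field_simp; linarith
  have hT : 0 ≤ u ^ 2 / (1 + P) * (Γ - d ^ 2 / (1 + P)) := by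
    have hcancel : Γ - d ^ 2 / (1 + P) = (Γ + (P * Γ - d ^ 2)) / (1 + P) := by field_simp; ring
    have : 0 ≤ P * Γ - d ^ 2 := by linarith
    rw [hcancel]
    positivity
  -- The choice B(s) = -log(1+s²)/2 corresponds to the exact mean curvature. Then the two terms
  -- linear in d cancel, and B₁² - B₂ = (1+P)⁻² is positive, so with the sign ε = -1 the second
  -- order gradient term is nonpositive.
  have key : (-1) * (u ^ 2 * P / (1 + P) ^ 2 + 2 * C * u / (1 + P)
          - u ^ 2 * (K' + C * ((2 * n - 1) * C + S ^ 2 / C)) / (1 + P)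
          + 2 * C * u ^ 2 * g * d / (1 + P) ^ 3
          + 2 * C * (-(g / (1 + g ^ 2))) * u ^ 2 * d / (1 + P) ^ 2
          - (-(g / (1 + g ^ 2))) * u ^ 2 * K' * g / (1 + P))
        + (-1) * ((-(g / (1 + g ^ 2))) ^ 2 - (-((1 - g ^ 2) / (1 + g ^ 2) ^ 2))) *
          (u ^ 2 / (1 + P) * (Γ - d ^ 2 / (1 + P)))
      = -(2 * C * u * r ^ 2) + u ^ 2 * r ^ 2 * ((2 * n - 1) * C ^ 2 + S ^ 2) + u ^ 2 * r ^ 4 * K'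
        - u ^ 2 * P * r ^ 4 - r ^ 4 * (u ^ 2 / (1 + P) * (Γ - d ^ 2 / (1 + P))) := by
    have hgg : g * g = P := by rw [← hg]; ring
    have hsp : C * ((2 * n - 1) * C + S ^ 2 / C) = (2 * n - 1) * C ^ 2 + S ^ 2 := by field_simp
    rw [hg, hsp, show (-((1 - P) / (1 + P) ^ 2)) = -((1 - P) * ((1 + P)⁻¹) ^ 2) by
      rw [div_eq_mul_inv, inv_pow]]
    generalize u ^ 2 / (1 + P) * (Γ - d ^ 2 / (1 + P)) = T
    simp only [div_eq_mul_inv, ← inv_pow, hvi]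
    have hP' : r ^ 2 * P = 1 - r ^ 2 := by linarith
    have e1 : (-(g * r ^ 2)) ^ 2 - -((1 - P) * (r ^ 2) ^ 2) = r ^ 4 := by
      linear_combination r ^ 4 * hgg
    rw [e1]
    linear_combination (u ^ 2 * K' * r ^ 4 * (-1)) * hgg - u ^ 2 * K' * r ^ 2 * hP'
  rw [key]
  have h1 : u ^ 2 * r ^ 4 * K' ≤ u ^ 2 * r ^ 4 * (2 * n * S ^ 2 + 1) := by
    refine mul_le_mul_of_nonneg_left ?_ (by positivity)
    have : S ^ 2 * (1 / C ^ 2) ≤ 1 := by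
      rw [mul_one_div, div_le_one (by positivity)]; linarith
    rw [hK']; linarith
  have h2 : 0 ≤ u ^ 2 * P * r ^ 4 := by positivity
  have h3 : 0 ≤ r ^ 4 * (u ^ 2 / (1 + P) * (Γ - d ^ 2 / (1 + P))) := by positivity
  have h4 := max_bracket_le (a := 2 * n * (u * S * r)) ha he0.le hP hr.le hr1 hr2 hcl
  have h5 := mul_le_mul_of_nonneg_left h4 hs0.le
  have h6 : u ^ 2 * r ^ 4 ≤ u ^ 2 * r ^ 2 := by
    have : r ^ 2 ≤ 1 := pow_le_one₀ hr.le hr1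
    nlinarith [mul_nonneg (sq_nonneg u) (sq_nonneg r)]
  have h7 : u * S * r * (2 * (C / S) * r - 2 * n * (u * S * r) * (1 + r ^ 2)
      - 2 * n * (u * S * r) * (1 / S ^ 2))
      = 2 * C * u * r ^ 2 - 2 * n * u ^ 2 * S ^ 2 * r ^ 2 * (1 + r ^ 2) - 2 * n * u ^ 2 * r ^ 2 := by
    field_simp
  rw [h7] at h5
  rw [hCS]
  linarith

/-- The condition βP ≤ 1/2 gives (βg)² - β ≤ -β/2. The resulting negative multiple of Γ absorbs the
terms linear in d by Young's inequality and d² ≤ PΓ, and leaves an error quadratic in P. -/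
lemma gradient_terms_le {β u C P w g d Γ : ℝ} (hβ : 0 < β) (hC : 0 < C) (hP : 0 ≤ P)
    (hβP : β * P ≤ 1 / 2) (hw : 0 < w) (hw1 : w ≤ 1) (hwP : w * (1 + P) = 1) (hg : g ^ 2 = P)
    (hd : d ^ 2 ≤ P * Γ) (hΓ : 0 ≤ Γ) :
    2 * C * u ^ 2 * g * d * w ^ 3 + 2 * C * (β * g) * u ^ 2 * d * w ^ 2
      + ((β * g) ^ 2 - β) * (u ^ 2 * w * (Γ - d ^ 2 * w))
      ≤ 2 * u ^ 2 * C ^ 2 * (1 + β) ^ 2 * P ^ 2 / β := by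
  have h1 : w * Γ ≤ Γ - d ^ 2 * w := by nlinarith
  have h2 : (β * g) ^ 2 - β ≤ -(β / 2) := by rw [mul_pow, hg]; nlinarith
  have h3 : ((β * g) ^ 2 - β) * (u ^ 2 * w * (Γ - d ^ 2 * w)) ≤ -(β / 2) * (u ^ 2 * w * (w * Γ)) := by
    have h4 : 0 ≤ u ^ 2 * w * (w * Γ) := by positivity
    have h5 : u ^ 2 * w * (w * Γ) ≤ u ^ 2 * w * (Γ - d ^ 2 * w) :=
      mul_le_mul_of_nonneg_left h1 (by positivity)
    calc _ ≤ -(β / 2) * (u ^ 2 * w * (Γ - d ^ 2 * w)) :=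
          mul_le_mul_of_nonneg_right h2 (h4.trans h5)
      _ ≤ _ := by nlinarith
  set A := C * (w + β) with hA
  have hA0 : 0 < A := by positivity
  have hAC : A ^ 2 ≤ C ^ 2 * (1 + β) ^ 2 := by
    rw [hA, mul_pow]
    gcongr
  have h6 : 2 * A * (g * d) ≤ β / 2 * Γ + 2 * A ^ 2 * P ^ 2 / β := by
    rcases hP.eq_or_lt with h0 | h0
    · have : g = 0 := by rw [← h0] at hg; exact pow_eq_zero_iff (two_ne_zero) |>.1 hg
      rw [this]
      have : 0 ≤ 2 * A ^ 2 * P ^ 2 / β := by positivity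
      have : 0 ≤ β / 2 * Γ := by positivity
      linarith
    · have h7 : 4 * β * P * A * (g * d) ≤ β ^ 2 * (P * Γ) + 4 * A ^ 2 * P ^ 3 := by
        have h8 := sq_nonneg (β * d - 2 * A * P * g)
        have h9 : β ^ 2 * d ^ 2 ≤ β ^ 2 * (P * Γ) := mul_le_mul_of_nonneg_left hd (sq_nonneg β)
        have h10 : (2 * A * P * g) ^ 2 = 4 * A ^ 2 * P ^ 3 := by
          linear_combination 4 * A ^ 2 * P ^ 2 * hg
        nlinarith
      have h11 : β / 2 * Γ + 2 * A ^ 2 * P ^ 2 / β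
          = (β ^ 2 * (P * Γ) + 4 * A ^ 2 * P ^ 3) / (2 * β * P) := by
        field_simp
        ring
      rw [h11, le_div_iff₀ (by positivity)]
      linarith
  have h12 : 2 * A ^ 2 * P ^ 2 / β ≤ 2 * C ^ 2 * (1 + β) ^ 2 * P ^ 2 / β := by
    rw [show 2 * A ^ 2 * P ^ 2 / β = A ^ 2 * (2 * P ^ 2 / β) by ring,
      show 2 * C ^ 2 * (1 + β) ^ 2 * P ^ 2 / β = C ^ 2 * (1 + β) ^ 2 * (2 * P ^ 2 / β) by ring]
    exact mul_le_mul_of_nonneg_right hAC (by positivity)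
  have h13 : u ^ 2 * w ^ 2 * (2 * A * (g * d) - β / 2 * Γ)
      ≤ u ^ 2 * (2 * C ^ 2 * (1 + β) ^ 2 * P ^ 2 / β) := by
    have hw2 : w ^ 2 ≤ 1 := pow_le_one₀ hw.le hw1
    have h14 : 0 ≤ 2 * C ^ 2 * (1 + β) ^ 2 * P ^ 2 / β := by positivity
    calc _ ≤ u ^ 2 * w ^ 2 * (2 * C ^ 2 * (1 + β) ^ 2 * P ^ 2 / β) :=
          mul_le_mul_of_nonneg_left (by linarith) (by positivity)
      _ ≤ u ^ 2 * 1 * (2 * C ^ 2 * (1 + β) ^ 2 * P ^ 2 / β) := by gcongr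
      _ = _ := by ring
  calc _ ≤ 2 * C * u ^ 2 * g * d * w ^ 3 + 2 * C * (β * g) * u ^ 2 * d * w ^ 2
        + -(β / 2) * (u ^ 2 * w * (w * Γ)) := by linarith
    _ = u ^ 2 * w ^ 2 * (2 * A * (g * d) - β / 2 * Γ) := by rw [hA]; ring
    _ ≤ _ := h13
    _ = _ := by ring

set_option maxHeartbeats 1000000 in
/-- The algebraic estimate for the evolution of the mean curvature at its minima. -/
lemma curvature_min_estimate {n β u S C P m K' g d Γ : ℝ} (hn : 1 ≤ n) (hβ : 0 < β) (hu : 0 < u)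
    (hS : 0 < S) (hC : 0 < C) (hCS : C ^ 2 = 1 + S ^ 2) (hP : 0 ≤ P) (hβP : β * P ≤ 1 / 2)
    (hm : 0 < m) (hm1 : m ≤ 1) (hmP : 1 - β * P / 2 ≤ m)
    (hK' : K' = S ^ 2 * (2 * n + 1 / C ^ 2)) (hg : g ^ 2 = P) (hd : d ^ 2 ≤ P * Γ) (hΓ : 0 ≤ Γ)
    (ha : 1 ≤ 2 * n * (u * S / m)) :
    1 * (u ^ 2 * P / (1 + P) ^ 2 + 2 * C * u / (1 + P)
          - u ^ 2 * (K' + C * ((2 * n - 1) * C + S ^ 2 / C)) / (1 + P)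
          + 2 * C * u ^ 2 * g * d / (1 + P) ^ 3
          + 2 * C * (β * g) * u ^ 2 * d / (1 + P) ^ 2
          - (β * g) * u ^ 2 * K' * g / (1 + P))
        + 1 * ((β * g) ^ 2 - β) *
          (u ^ 2 / (1 + P) * (Γ - d ^ 2 / (1 + P)))
      ≤ (u * S / m) * (2 * (1 - 2 * n * (u * S / m)) * (1 - (1 + β) * P)
          + 2 * n * (u * S / m) * (β ^ 2 * P ^ 2 + 1 / S ^ 2 * (β * P) + (1 / S ^ 2) ^ 2
            + 1 / S ^ 2 * P + (1 + 1 / S ^ 2) * ((1 + β) ^ 2 * P ^ 2 / β))) := by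
  have hv : 0 < 1 + P := by linarith
  set e := 1 / S ^ 2 with he
  have he0 : 0 < e := by positivity
  set σ := u * S / m with hσ
  have hσ0 : 0 < σ := by positivity
  set c := C / S with hc
  have hc0 : 0 < c := by positivity
  have hc2 : c ^ 2 = 1 + e := by rw [hc, he, div_pow, hCS]; field_simp; ring
  have hcu := le_one_add_half he0.le hc2
  set w := (1 + P)⁻¹ with hw
  have hw0 : 0 < w := by positivity
  have hwP : w * (1 + P) = 1 := inv_mul_cancel₀ hv.ne'
  have hw1 : w ≤ 1 := by nlinarith [mul_nonneg hw0.le hP]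
  have hwl : 1 - P ≤ w := by nlinarith [mul_nonneg hw0.le hP]
  have hβP0 : 0 ≤ β * P := by positivity
  have hG := gradient_terms_le (u := u) hβ hC hP hβP hw0 hw1 hwP hg hd hΓ
  have hSe : S ^ 2 * e = 1 := by rw [he]; field_simp
  have hσm : σ * m = u * S := by rw [hσ]; field_simp
  -- All terms are expressed through σ = uS/m, since 2nσ is the reciprocal of the normalized test
  -- curvature, and through the small quantities e = 1/sinh²ρ and P.
  have hu2 : u ^ 2 = σ ^ 2 * m ^ 2 * e := by
    have : (σ * m) ^ 2 * e = u ^ 2 * (S ^ 2 * e) := by rw [hσm]; ring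
    rw [hSe] at this; linarith
  have hCu : C * u = c * σ * m := by
    rw [mul_assoc, hσm, hc]; field_simp
  have hsp : C * ((2 * n - 1) * C + S ^ 2 / C) = (2 * n - 1) * C ^ 2 + S ^ 2 := by field_simp
  have hgg : g * g = P := by rw [← hg]; ring
  have key : 1 * (u ^ 2 * P / (1 + P) ^ 2 + 2 * C * u / (1 + P)
          - u ^ 2 * (K' + C * ((2 * n - 1) * C + S ^ 2 / C)) / (1 + P)
          + 2 * C * u ^ 2 * g * d / (1 + P) ^ 3
          + 2 * C * (β * g) * u ^ 2 * d / (1 + P) ^ 2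
          - (β * g) * u ^ 2 * K' * g / (1 + P))
        + 1 * ((β * g) ^ 2 - β) *
          (u ^ 2 / (1 + P) * (Γ - d ^ 2 / (1 + P)))
      = u ^ 2 * P * w ^ 2 + 2 * (C * u) * w - u ^ 2 * (K' + ((2 * n - 1) * C ^ 2 + S ^ 2)) * w
        - β * P * (u ^ 2 * K') * w
        + (2 * C * u ^ 2 * g * d * w ^ 3 + 2 * C * (β * g) * u ^ 2 * d * w ^ 2
          + ((β * g) ^ 2 - β) * (u ^ 2 * w * (Γ - d ^ 2 * w))) := by
    rw [hsp]
    simp only [div_eq_mul_inv, ← inv_pow, ← hw]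
    linear_combination -(β * u ^ 2 * K' * w) * hgg
  rw [key]
  have hCi : S ^ 2 * (1 / C ^ 2) = 1 - 1 / C ^ 2 := by
    field_simp; linarith
  have hCe : 1 / C ^ 2 ≤ e := by
    rw [he]; exact one_div_le_one_div_of_le (by positivity) (by linarith)
  have hK1 : 2 * n * S ^ 2 ≤ K' := by
    rw [hK']
    have : 0 ≤ S ^ 2 * (1 / C ^ 2) := by positivity
    linarith
  have hK2 : 4 * n * S ^ 2 + 2 * n - e ≤ K' + ((2 * n - 1) * C ^ 2 + S ^ 2) := by
    have h1 : (2 * n - 1) * C ^ 2 = (2 * n - 1) * (1 + S ^ 2) := by rw [hCS]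
    rw [hK', mul_add, hCi, h1]
    linarith
  have t1 : u ^ 2 * P * w ^ 2 ≤ σ ^ 2 * (e * P) := by
    rw [hu2]
    have h1 : m ^ 2 ≤ 1 := pow_le_one₀ hm.le hm1
    have h2 : w ^ 2 ≤ 1 := pow_le_one₀ hw0.le hw1
    have h3 : m ^ 2 * w ^ 2 ≤ 1 := mul_le_one₀ h1 (sq_nonneg w) h2
    calc _ = σ ^ 2 * (e * P) * (m ^ 2 * w ^ 2) := by ring
      _ ≤ σ ^ 2 * (e * P) * 1 := mul_le_mul_of_nonneg_left h3 (by positivity)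
      _ = _ := by ring
  have t2 : 2 * (C * u) * w ≤ (2 + e) * (σ * m * w) := by
    rw [hCu]
    have := mul_le_mul_of_nonneg_right hcu (show 0 ≤ 2 * (σ * m * w) by positivity)
    linarith
  have t3 : σ ^ 2 * m ^ 2 * w * (4 * n + 2 * n * e) - σ ^ 2 * e ^ 2
      ≤ u ^ 2 * (K' + ((2 * n - 1) * C ^ 2 + S ^ 2)) * w := by
    have h1 : u ^ 2 * (4 * n * S ^ 2 + 2 * n - e) * w
        = σ ^ 2 * m ^ 2 * w * (4 * n + 2 * n * e) - σ ^ 2 * e ^ 2 * (m ^ 2 * w) := by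
      rw [hu2]; linear_combination (4 * n * σ ^ 2 * m ^ 2 * w) * hSe
    have h2 : m ^ 2 * w ≤ 1 := mul_le_one₀ (pow_le_one₀ hm.le hm1) hw0.le hw1
    have h3 : σ ^ 2 * e ^ 2 * (m ^ 2 * w) ≤ σ ^ 2 * e ^ 2 * 1 :=
      mul_le_mul_of_nonneg_left h2 (by positivity)
    have h4 : u ^ 2 * (4 * n * S ^ 2 + 2 * n - e) * w
        ≤ u ^ 2 * (K' + ((2 * n - 1) * C ^ 2 + S ^ 2)) * w := by gcongr
    linarith
  have t4 : σ ^ 2 * m ^ 2 * w * (2 * n * (β * P)) ≤ β * P * (u ^ 2 * K') * w := by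
    have h1 : β * P * (u ^ 2 * (2 * n * S ^ 2)) * w ≤ β * P * (u ^ 2 * K') * w := by gcongr
    refine le_trans (le_of_eq ?_) h1
    rw [hu2]; linear_combination (-(2 * n * σ ^ 2 * m ^ 2 * w * (β * P))) * hSe
  have t5 : 2 * u ^ 2 * C ^ 2 * (1 + β) ^ 2 * P ^ 2 / β
      ≤ 2 * σ ^ 2 * ((1 + e) * ((1 + β) ^ 2 * P ^ 2 / β)) := by
    have h1 : u ^ 2 * C ^ 2 ≤ σ ^ 2 * (1 + e) := by
      have h2 : u ^ 2 * C ^ 2 = σ ^ 2 * (1 + e) * m ^ 2 := by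
        rw [← hc2, ← mul_pow, mul_comm u C, hCu]; ring
      rw [h2]
      exact mul_le_of_le_one_right (by positivity) (pow_le_one₀ hm.le hm1)
    calc _ = u ^ 2 * C ^ 2 * (2 * ((1 + β) ^ 2 * P ^ 2 / β)) := by ring
      _ ≤ σ ^ 2 * (1 + e) * (2 * ((1 + β) ^ 2 * P ^ 2 / β)) :=
        mul_le_mul_of_nonneg_right h1 (by positivity)
      _ = _ := by ring
  -- the leading terms
  set a := 2 * n * σ with hadef
  -- The weight satisfies m ≥ 1 - βP/2, and the product (1 - βP/2)(2 + e + βP) has no term linear in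
  -- P alone; what remains is quadratic in (e, P).
  have t6 : 2 + e - (β ^ 2 * P ^ 2 / 2 + e * (β * P) / 2) ≤ m * (2 + e + β * P) := by
    have := mul_le_mul_of_nonneg_right hmP (show 0 ≤ 2 + e + β * P by positivity)
    linarith only [this]
  have hmw0 : 0 < m * w := by positivity
  have hmw1 : m * w ≤ 1 := mul_le_one₀ hm1 hw0.le hw1
  have t7 : 1 - (1 + β) * P ≤ m * w := by
    have h1 : (1 - β * P / 2) * (1 - P) ≤ (1 - β * P / 2) * w :=
      mul_le_mul_of_nonneg_left hwl (by linarith)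
    have h2 : (1 - β * P / 2) * w ≤ m * w := mul_le_mul_of_nonneg_right hmP hw0.le
    have h3 : 0 ≤ β * P * P := by positivity
    linarith only [h1, h2, h3, hβP0]
  have ha0 : 0 < a := by linarith
  have t8 : (m * w) * (2 + e - a * (m * (2 + e + β * P)))
      ≤ 2 * (1 - a) * (1 - (1 + β) * P) + a * (β ^ 2 * P ^ 2 / 2 + e * (β * P) / 2) := by
    have h1 : (m * w) * (2 + e - a * (m * (2 + e + β * P)))
        ≤ (m * w) * ((2 + e) * (1 - a) + a * (β ^ 2 * P ^ 2 / 2 + e * (β * P) / 2)) := by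
      refine mul_le_mul_of_nonneg_left ?_ hmw0.le
      have := mul_le_mul_of_nonneg_left t6 ha0.le
      linarith only [this]
    have h2 : (m * w) * ((2 + e) * (1 - a)) ≤ 2 * (1 - a) * (1 - (1 + β) * P) := by
      have h3 : (m * w) * ((2 + e) * (a - 1)) ≥ (m * w) * (2 * (a - 1)) := by
        refine mul_le_mul_of_nonneg_left ?_ hmw0.le
        exact mul_le_mul_of_nonneg_right (by linarith only [he0]) (by linarith only [ha])
      have h4 : (1 - (1 + β) * P) * (2 * (a - 1)) ≤ (m * w) * (2 * (a - 1)) :=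
        mul_le_mul_of_nonneg_right t7 (by linarith only [ha])
      linarith only [h3, h4]
    have h5 : (m * w) * (a * (β ^ 2 * P ^ 2 / 2 + e * (β * P) / 2))
        ≤ a * (β ^ 2 * P ^ 2 / 2 + e * (β * P) / 2) :=
      mul_le_of_le_one_left (by positivity) hmw1
    linarith only [h1, h2, h5]
  have t9 := mul_le_mul_of_nonneg_left t8 hσ0.le
  have hσa : σ ^ 2 ≤ σ * a / 2 := by
    have : σ * σ ≤ σ * (n * σ) :=
      mul_le_mul_of_nonneg_left (le_mul_of_one_le_left hσ0.le hn) hσ0.le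
    rw [hadef]; linarith only [this]
  have t10 : σ ^ 2 * (e * P + e ^ 2 + 2 * ((1 + e) * ((1 + β) ^ 2 * P ^ 2 / β)))
      ≤ σ * a / 2 * (e * P + e ^ 2 + 2 * ((1 + e) * ((1 + β) ^ 2 * P ^ 2 / β))) :=
    mul_le_mul_of_nonneg_right hσa (by positivity)
  have t11 : σ * a / 2 * (e * P + e ^ 2) + σ * (a * (β ^ 2 * P ^ 2 / 2 + e * (β * P) / 2))
      ≤ σ * (a * (β ^ 2 * P ^ 2 + e * (β * P) + e ^ 2 + e * P)) := by
    have : 0 ≤ σ * a * (e ^ 2 + e * P) := by positivity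
    have : 0 ≤ σ * a * (β ^ 2 * P ^ 2 + e * (β * P)) := by positivity
    linarith only [this, ‹0 ≤ σ * a * (e ^ 2 + e * P)›]
  have t12 : σ * ((m * w) * (2 + e - a * (m * (2 + e + β * P))))
      = (2 + e) * (σ * m * w) - σ ^ 2 * m ^ 2 * w * (4 * n + 2 * n * e)
        - σ ^ 2 * m ^ 2 * w * (2 * n * (β * P)) := by
    rw [hadef]; ring
  linarith only [t1, t2, t3, t4, t5, t9, t10, t11, t12, hG]

end SpeedEvolution

/-! ### From differential inequalities to exponential decay. -/

noncomputable section CurvatureDecay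

open Filter Topology Set

variable {E : Type*} [NormedAddCommGroup E] [InnerProductSpace ℝ E]
  {ι : Type*} [Fintype ι] {b : OrthonormalBasis ι ℝ E}

namespace GraphFlow

variable {S : Type*} [TopologicalSpace S] [CompactSpace S] {n : ℕ} {t₂ : ℝ}
  {fφ fP fτ fu : ℝ → S → ℝ} (h : GraphFlow b 0 n t₂ fφ fP fτ fu)

include h

/-- A function `ψ` of `Q = log (φ_t sinh ρ) + D (|∇φ|²)` with an almost linear decay at its positive
maxima decays exponentially. -/
theorem exp_decay (hn : 1 ≤ n) {D ψ ψ' : ℝ → ℝ} {ε κ M : ℝ}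
    (hDs : ∀ s, 0 ≤ s → ContDiffAt ℝ ∞ D s) (hψs : ContDiff ℝ ∞ ψ)
    (hψ : ∀ s, HasDerivAt ψ (ε * ψ' s) s) (hκ : 0 ≤ κ)
    (hψm : ∀ s t, ψ s ≤ ψ t → ε * s ≤ ε * t)
    (h0 : ∀ z, (1 + ψ (Real.log (fu 0 z) + Real.log (csinh (fφ 0 z)) + D (fP 0 z)))
      * Real.exp κ ≤ M)
    (hM : Real.exp κ ≤ M)
    (key : ∀ (φ : ℝ × E → ℝ) (x : ℝ × E) (z : S), IsGraphSolution b 0 n φ x → x.1 ∈ Ioo 0 t₂ →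
      JetMatch b 0 fφ fP fτ fu φ x z → ∀ q₀,
      q₀ = Real.log (pd (1, 0) φ x) + Real.log (csinh (φ x)) + D (gradProd b φ φ x) → 0 < ψ q₀ →
      IsLocalMax (fun q => ε * (Real.log (pd (1, 0) φ (x.1, q))
        + Real.log (csinh (φ (x.1, q))) + D (‖q‖ ^ 2 * gradProd b φ φ (x.1, q)))) x.2 →
      ψ q₀ / n + ψ' q₀ * (ε * pd (1, 0) (fun y => Real.log (pd (1, 0) φ y) + Real.log (csinh (φ y))
        + D (‖y.2‖ ^ 2 * gradProd b φ φ y)) x)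
        ≤ κ / n * Real.exp (-(x.1 / n)) * (Real.exp (-(x.1 / n)) + ψ q₀)) :
    ∀ t ∈ Ico 0 t₂, ∀ z, ψ (Real.log (fu t z) + Real.log (csinh (fφ t z)) + D (fP t z))
      ≤ M * Real.exp (-(t / n)) := by
  have hn' : (0 : ℝ) < n := by exact_mod_cast hn
  -- Write δ = e^{-t/n}. The factor e^{t/n} compensates for the linear decay. The summand 1 accounts
  -- for the inhomogeneous error κδ²/n, and the weight exp(κδ), with logarithmic derivative -κδ/n,
  -- absorbs the entire error because κδ is integrable in time.
  have hmain := h.max_principle (fun t φ P _ u => (1 + Real.exp (t / n)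
    * ψ (Real.log u + Real.log (csinh φ) + D P)) * Real.exp (κ * Real.exp (-(t / n)))) M ?_ ?_ ?_
  · intro t ht z
    have h1 := hmain t ht z
    set w := ψ (Real.log (fu t z) + Real.log (csinh (fφ t z)) + D (fP t z))
    have h2 : 1 ≤ Real.exp (κ * Real.exp (-(t / n))) :=
      Real.one_le_exp (by positivity)
    have hM0 : 0 < M := (Real.exp_pos _).trans_le hM
    have h3 : Real.exp (t / n) * w ≤ M := by
      rcases le_or_gt (1 + Real.exp (t / n) * w) 0 with h4 | h4
      · linarith
      · have : 1 + Real.exp (t / n) * w ≤ M := by nlinarith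
        linarith
    rw [Real.exp_neg, ← div_eq_mul_inv, le_div_iff₀ (Real.exp_pos _)]
    linarith
  · refine ContinuousOn.mul (continuousOn_const.add ((Continuous.continuousOn (by fun_prop)).mul
      (hψs.continuous.comp_continuousOn ?_))) (Continuous.continuousOn (by fun_prop))
    refine ((h.cont_speed.log ?_).add (h.continuousOn_radius_comp (g := fun y => Real.log (csinh y))
      fun y hy => (hasDerivAt_csinh hy).continuousAt.log (csinh_pos hy).ne')).add ?_
    · rintro ⟨t, z⟩ ⟨ht, -⟩
      exact (h.pos t ht z).ne'
    · rintro ⟨t, z⟩ ⟨ht, hz⟩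
      exact ContinuousAt.comp_continuousWithinAt (g := D) (f := fun y : ℝ × S => fP y.1 y.2)
        (hDs _ (h.nonneg t ht z)).continuousAt (h.cont_grad (t, z) ⟨ht, hz⟩)
  · intro z
    simpa using h0 z
  · rintro φ x z Q hφ hx hm - rfl
    have hus : ContDiffAt ℝ ∞ (pd ((1 : ℝ), (0 : E)) φ) x := hφ.smooth.pd_top _
    have hPs := gradProd_smooth_top b hφ.smooth hφ.smooth
    have hP0 := gradProd_self_nonneg b φ x
    set q : ℝ × E → ℝ := fun y => Real.log (pd (1, 0) φ y) + Real.log (csinh (φ y))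
      + D (‖y.2‖ ^ 2 * gradProd b φ φ y) with hq
    have hqs : ContDiffAt ℝ ∞ q x := by
      refine ((hus.log hφ.speed_pos.ne').add (ContDiffAt.log ((contDiffAt_csinh hφ.neg).comp x
        hφ.smooth) (csinh_pos hφ.neg).ne')).add (ContDiffAt.comp (g := D) x (hDs _ ?_)
        ((contDiffAt_normSq x).mul hPs))
      positivity
    have he : ContDiffAt ℝ ∞ (fun y : ℝ × E => Real.exp (y.1 / n)) x :=
      Real.contDiff_exp.contDiffAt.comp x (contDiffAt_fst.div_const _)
    have he' : ContDiffAt ℝ ∞ (fun y : ℝ × E => Real.exp (κ * Real.exp (-(y.1 / n)))) x :=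
      Real.contDiff_exp.contDiffAt.comp x (contDiffAt_const.mul
        (Real.contDiff_exp.contDiffAt.comp x (contDiffAt_fst.div_const _).neg))
    have hQs : ContDiffAt ℝ ∞ (fun y : ℝ × E => (1 + Real.exp (y.1 / n) * ψ (q y))
        * Real.exp (κ * Real.exp (-(y.1 / n)))) x :=
      (contDiffAt_const.add (he.mul (hψs.contDiffAt.comp x hqs))).mul he'
    refine ⟨contDiffAt_nat hQs 2, fun hgt hmax => ?_⟩
    have hqx : q x = Real.log (pd (1, 0) φ x) + Real.log (csinh (φ x)) + D (gradProd b φ φ x) := by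
      simp only [hq, hφ.norm_eq, one_pow, one_mul]
    -- A value above M ≥ e^κ forces ψ > 0, because the weight never exceeds e^κ. So the differential
    -- inequality is only needed at positive values of ψ.
    have hpos : 0 < ψ (q x) := by
      have h1 : Real.exp κ < (1 + Real.exp (x.1 / n) * ψ (q x))
        * Real.exp (κ * Real.exp (-(x.1 / n))) := hM.trans_lt hgt
      have h2 : Real.exp (κ * Real.exp (-(x.1 / n))) ≤ Real.exp κ := by
        refine Real.exp_le_exp.2 (mul_le_of_le_one_right hκ (Real.exp_le_one_iff.2 ?_))
        have := div_nonneg hx.1.le hn'.le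
        linarith
      have h3 : 1 < 1 + Real.exp (x.1 / n) * ψ (q x) := by
        by_contra! h4
        have := mul_le_mul_of_nonneg_right h4 (Real.exp_pos (κ * Real.exp (-(x.1 / n)))).le
        linarith
      have h4 : 0 < Real.exp (x.1 / n) * ψ (q x) := by linarith
      exact pos_of_mul_pos_right h4 (Real.exp_pos _).le
    have hk := key φ x z hφ hx hm (q x) hqx hpos (by
      filter_upwards [hmax] with y hy
      have h1 := le_of_mul_le_mul_right hy (Real.exp_pos _)
      have h2 : ψ (q (x.1, y)) ≤ ψ (q x) :=
        le_of_mul_le_mul_left (by simp only [Prod.mk.eta] at h1; linarith) (Real.exp_pos (x.1 / n))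
      exact hψm _ _ h2)
    have hd1 := hasDerivAt_line_time x
    have hd := (((hd1.div_const (n : ℝ)).exp.mul
      (hasDerivAt_line_comp hqs.diff_top (hψ (q x)) (1, 0))).const_add 1).mul
      ((hd1.div_const (n : ℝ)).neg.exp.const_mul κ).exp
    rw [pd_eq_of_hasDerivAt hQs.diff_top hd]
    simp only [Pi.neg_apply, Pi.mul_apply, zero_smul, add_zero]
    have hexp : Real.exp (x.1 / n) * Real.exp (-(x.1 / n)) = 1 := by
      rw [← Real.exp_add, add_neg_cancel, Real.exp_zero]
    set e := Real.exp (x.1 / n)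
    set e' := Real.exp (-(x.1 / n))
    have he0 : 0 < e := Real.exp_pos _
    have hmul := mul_le_mul_of_nonneg_left hk he0.le
    have hfac : e * (κ / n * e' * (e' + ψ (q x))) = κ / n * e' * (1 + e * ψ (q x)) := by
      linear_combination (κ / n * e') * hexp
    rw [hfac] at hmul
    calc _ = Real.exp (κ * e') * (e * (ψ (q x) / n + ψ' (q x) * (ε * pd (1, 0) q x))
          - κ / n * e' * (1 + e * ψ (q x))) := by ring
      _ ≤ 0 := mul_nonpos_of_nonneg_of_nonpos (Real.exp_pos _).le (by linarith)

end GraphFlow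
end CurvatureDecay

/-! ### Two-sided exponential convergence of the mean curvature. -/

noncomputable section CurvatureBounds

open Filter Topology Set

variable {E : Type*} [NormedAddCommGroup E] [InnerProductSpace ℝ E]
  {ι : Type*} [Fintype ι] {b : OrthonormalBasis ι ℝ E}

lemma hasDerivAt_exp_neg_div (c s : ℝ) :
    HasDerivAt (fun s : ℝ => Real.exp (-s) / c) (-(Real.exp (-s) / c)) s := by
  refine ((hasDerivAt_neg s).exp.div_const c).congr_deriv ?_
  ring

namespace GraphFlow

variable {S : Type*} [TopologicalSpace S] [CompactSpace S] {n : ℕ} {t₂ : ℝ}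
  {fφ fP fτ fu : ℝ → S → ℝ} (h : GraphFlow b 0 n t₂ fφ fP fτ fu)

include h

-- The left side is H/2n - 1 exactly, since Q = log(φ_t sinh ρ) - log(1+P)/2 satisfies e^{-Q} = H.
-- The gradient terms have a favourable sign at maxima of H, so no modification of H is needed.
set_option maxHeartbeats 800000 in
theorem curvature_upper (hn : 1 ≤ n) {D₀ X₂ κ M : ℝ} (hD₀ : 0 ≤ D₀)
    (hP : ∀ t ∈ Ico 0 t₂, ∀ z, fP t z ≤ D₀ * Real.exp (-(t / n)))
    (hS : ∀ t ∈ Ico 0 t₂, ∀ z, 1 / csinh (fφ t z) ^ 2 ≤ D₀ * Real.exp (-(t / n)))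
    (hX : ∀ t ∈ Ico 0 t₂, ∀ z, √(1 + fP t z) / (fu t z * csinh (fφ t z)) / (2 * n) ≤ X₂)
    (hκ : κ = (D₀ + 3 * D₀ ^ 2 * X₂ * Real.exp X₂) / 2)
    (hM : M = (1 + X₂ * Real.exp X₂) * Real.exp κ) :
    ∀ t ∈ Ico 0 t₂, ∀ z, √(1 + fP t z) / (fu t z * csinh (fφ t z)) / (2 * n) - 1
      ≤ M * Real.exp (-(t / n)) := by
  have hn' : (0 : ℝ) < n := by exact_mod_cast hn
  intro t₁ ht₁ z₁
  have hX₂ : 0 ≤ X₂ := by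
    have h1 := hX t₁ ht₁ z₁
    have h2 := h.pos t₁ ht₁ z₁
    have h3 := csinh_pos (h.neg t₁ ht₁ z₁)
    exact le_trans (by positivity) h1
  have hκ0 : 0 ≤ κ := by rw [hκ]; positivity
  -- the inverse of the mean curvature
  have hexp : ∀ {P u S : ℝ}, 0 ≤ P → 0 < u → 0 < S →
      Real.exp (-(Real.log u + Real.log S + -(Real.log (1 + P) / 2))) = √(1 + P) / (u * S) := by
    intro P u S hP hu hS
    rw [Real.sqrt_eq_rpow, Real.rpow_def_of_pos (by linarith), ← Real.exp_log (mul_pos hu hS),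
      ← Real.exp_sub, Real.log_mul hu.ne' hS.ne']
    congr 1; ring
  set X : ℝ → ℝ := fun s => Real.exp (-s) / (2 * n) with hXdef
  have hX0 : ∀ s, 0 < X s := fun s => by positivity
  have hXd : ∀ s, HasDerivAt X (-X s) s := fun s => hasDerivAt_exp_neg_div (2 * (n : ℝ)) s
  -- The model equation at maxima is dX/dt = -(X-1)/(nX), and (X-1)eˣ is the function of X that it
  -- makes decay exactly like e^{-t/n}.
  set ψ : ℝ → ℝ := fun s => (X s - 1) * Real.exp (X s) with hψdef
  have hψ : ∀ s, HasDerivAt ψ ((-1) * (X s ^ 2 * Real.exp (X s))) s := fun s => by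
    refine (((hXd s).sub_const 1).mul (hXd s).exp).congr_deriv ?_
    ring
  have hψa : StrictAnti ψ := strictAnti_of_deriv_neg fun s => by
    rw [(hψ s).deriv]
    have := hX0 s
    have : 0 < X s ^ 2 * Real.exp (X s) := by positivity
    linarith
  have hψs : ContDiff ℝ ∞ ψ := by
    simp only [hψdef, hXdef]
    fun_prop
  have hD : ∀ s : ℝ, 0 ≤ s → ContDiffAt ℝ ∞ (fun s : ℝ => -(Real.log (1 + s) / 2)) s := fun s hs =>
    ((ContDiffAt.log (contDiffAt_const.add contDiffAt_id) (by simp; linarith)).div_const 2).neg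
  have hM1 : Real.exp κ ≤ M := by
    rw [hM]
    have : 0 ≤ X₂ * Real.exp X₂ := by positivity
    nlinarith [Real.exp_pos κ]
  have main := h.exp_decay hn (D := fun s => -(Real.log (1 + s) / 2)) (ψ := ψ)
    (ψ' := fun s => X s ^ 2 * Real.exp (X s)) (ε := -1) (κ := κ) (M := M) hD hψs hψ hκ0
    (fun s t hst => by have := hψa.le_iff_ge.1 hst; linarith) ?_ hM1 ?_
  · have h1 := main t₁ ht₁ z₁
    have h2 := h.pos t₁ ht₁ z₁
    have h3 := csinh_pos (h.neg t₁ ht₁ z₁)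
    simp only [hψdef, hXdef, hexp (h.nonneg t₁ ht₁ z₁) h2 h3] at h1
    set w := √(1 + fP t₁ z₁) / (fu t₁ z₁ * csinh (fφ t₁ z₁)) / (2 * n)
    have hM0 : 0 < M := (Real.exp_pos _).trans_le hM1
    rcases le_or_gt (w - 1) 0 with h4 | h4
    · exact h4.trans (by positivity)
    · refine le_trans ?_ h1
      exact le_mul_of_one_le_right h4.le (Real.one_le_exp (by linarith))
  · intro z
    have h00 : (0 : ℝ) ∈ Ico 0 t₂ := ⟨le_rfl, ht₁.1.trans_lt ht₁.2⟩
    have h2 := h.pos 0 h00 z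
    have h3 := csinh_pos (h.neg 0 h00 z)
    have h4 := hX 0 h00 z
    rw [hM]
    refine mul_le_mul_of_nonneg_right ?_ (Real.exp_pos _).le
    simp only [hψdef, hXdef, hexp (h.nonneg 0 h00 z) h2 h3]
    set w := √(1 + fP 0 z) / (fu 0 z * csinh (fφ 0 z)) / (2 * n)
    have hw : 0 ≤ w := by positivity
    have h5 : (w - 1) * Real.exp w ≤ w * Real.exp w :=
      mul_le_mul_of_nonneg_right (by linarith) (Real.exp_pos _).le
    have h6 : w * Real.exp w ≤ X₂ * Real.exp X₂ := by gcongr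
    linarith
  · intro φ x z hφ hx hm q₀ hq₀ hpos hmax
    have hIco : x.1 ∈ Ico 0 t₂ := ⟨hx.1.le, hx.2⟩
    have hu0 := hφ.speed_pos
    have hS0 := csinh_pos hφ.neg
    have hC0 := ccosh_pos hφ.neg
    have hP0 := gradProd_self_nonneg b φ x
    obtain ⟨g, d, Γ, hg, hd, hΓ, hkey⟩ := hφ.log_speed_grad_deriv
      (B := fun s => -(Real.log (1 + s ^ 2) / 2)) (B₁ := fun s => -(s / (1 + s ^ 2)))
      (B₂ := fun s => -((1 - s ^ 2) / (1 + s ^ 2) ^ 2)) (D := fun s => -(Real.log (1 + s) / 2))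
      (ε := -1)
      (((ContDiff.log (by fun_prop) (fun s => by positivity)).div_const 2).neg)
      (fun s => by
        have h1 : HasDerivAt (fun s : ℝ => 1 + s ^ 2) (2 * s) s := by
          simpa using (hasDerivAt_pow 2 s).const_add 1
        refine ((h1.log (by positivity)).div_const 2).neg.congr_deriv ?_
        field_simp)
      (fun s => by
        have h1 : HasDerivAt (fun s : ℝ => 1 + s ^ 2) (2 * s) s := by
          simpa using (hasDerivAt_pow 2 s).const_add 1
        refine ((hasDerivAt_id s).div h1 (by positivity)).neg.congr_deriv ?_
        simp only [id]
        ring)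
      (fun s => rfl)
      (fun s t hs hst => by
        have := Real.log_le_log (by linarith : 0 < 1 + s) (by linarith : 1 + s ≤ 1 + t)
        linarith)
      hD hmax rfl rfl rfl rfl rfl rfl
    have hmP : gradProd b φ φ x = fP x.1 z := by
      have := hm.2.1
      rwa [hφ.norm_eq, one_pow, one_mul] at this
    have hPb : gradProd b φ φ x ≤ D₀ * Real.exp (-(x.1 / n)) := by rw [hmP]; exact hP _ hIco z
    have hSb : 1 / csinh (φ x) ^ 2 ≤ D₀ * Real.exp (-(x.1 / n)) := by rw [hm.1]; exact hS _ hIco z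
    have hXq : X q₀ = √(1 + gradProd b φ φ x) / (pd (1, 0) φ x * csinh (φ x)) / (2 * n) := by
      rw [hXdef, hq₀, ← hexp hP0 hu0 hS0]
    have hXb : X q₀ ≤ X₂ := by
      rw [hXq, hmP, hm.1, hm.2.2.2]; exact hX _ hIco z
    set u := pd (1, 0) φ x
    set L := csinh (φ x)
    set P := gradProd b φ φ x
    set ε := Real.exp (-(x.1 / n)) with hε
    have hε0 : 0 < ε := Real.exp_pos _
    have hsqrt : 0 < √(1 + P) := Real.sqrt_pos.2 (by linarith)
    have hXr : u * L * (√(1 + P))⁻¹ * (2 * n * X q₀) = 1 := by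
      rw [hXq]; field_simp
    have hX1 : 1 < X q₀ := by
      by_contra! hle
      have : ψ q₀ ≤ 0 := mul_nonpos_of_nonpos_of_nonneg (by linarith) (Real.exp_pos _).le
      linarith
    have ha : 2 * n * (u * L * (√(1 + P))⁻¹) = 1 / X q₀ := by
      rw [eq_div_iff (hX0 _).ne']; linarith
    have hest := curvature_max_estimate (n := n) hu0 hS0 hC0 (ccosh_sq hφ.neg) hP0
      (inv_pos.2 hsqrt) (by rw [inv_pow, Real.sq_sqrt (by linarith)]; field_simp) rfl hg hd hΓ
      (by rw [ha, div_le_one (hX0 _)]; exact hX1.le)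
    have hd1 := hkey.trans hest
    have hs : u * L * (√(1 + P))⁻¹ = 1 / (2 * n * X q₀) := by
      rw [eq_div_iff (mul_pos (by positivity) (hX0 _)).ne']; exact hXr
    rw [ha, hs] at hd1
    have hXq0 := hX0 q₀
    set Y := X q₀
    have h1 := mul_le_mul_of_nonneg_left hd1 (show 0 ≤ Y ^ 2 * Real.exp Y by positivity)
    have hψq : ψ q₀ = (Y - 1) * Real.exp Y := rfl
    set A := P ^ 2 + 1 / L ^ 2 * P + (1 / L ^ 2) ^ 2
    have hA : A ≤ 3 * D₀ ^ 2 * ε ^ 2 := by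
      have e0 : 0 ≤ 1 / L ^ 2 := by positivity
      have e1 : P ^ 2 ≤ (D₀ * ε) ^ 2 := pow_le_pow_left₀ hP0 hPb 2
      have e2 : (1 / L ^ 2) ^ 2 ≤ (D₀ * ε) ^ 2 := pow_le_pow_left₀ e0 hSb 2
      have e3 : 1 / L ^ 2 * P ≤ (D₀ * ε) * (D₀ * ε) := mul_le_mul hSb hPb hP0 (by positivity)
      linarith
    -- By the choice of ψ the leading terms cancel identically. The remainder is ψP plus a multiple
    -- of A, and A is quadratic in the decaying quantities; half the sum of the two coefficients is
    -- κ.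
    have h2 : ψ q₀ / n + Y ^ 2 * Real.exp Y * (-(1 / (2 * n * Y)) * ((1 - 1 / Y) * (2 - P) - A))
        = (ψ q₀ * P + Y * Real.exp Y * A) / (2 * n) := by
      rw [hψq]; field_simp; ring
    have h3 : ψ q₀ * P ≤ ψ q₀ * (D₀ * ε) := mul_le_mul_of_nonneg_left hPb hpos.le
    have h4 : Y * Real.exp Y * A ≤ X₂ * Real.exp X₂ * (3 * D₀ ^ 2 * ε ^ 2) := by
      have e1 : Y * Real.exp Y ≤ X₂ * Real.exp X₂ := by gcongr
      have e2 : 0 ≤ A := by positivity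
      exact mul_le_mul e1 hA e2 (by positivity)
    calc _ ≤ (ψ q₀ * P + Y * Real.exp Y * A) / (2 * n) := by rw [← h2]; linarith
      _ ≤ (ψ q₀ * (D₀ * ε) + X₂ * Real.exp X₂ * (3 * D₀ ^ 2 * ε ^ 2)) / (2 * n) := by gcongr
      _ ≤ κ / n * ε * (ε + ψ q₀) := by
        rw [hκ, div_le_iff₀ (by positivity)]
        have e1 : (D₀ + 3 * D₀ ^ 2 * X₂ * Real.exp X₂) / 2 / n * ε * (ε + ψ q₀) * (2 * n)
          = (D₀ + 3 * D₀ ^ 2 * X₂ * Real.exp X₂) * ε * (ε + ψ q₀) := by field_simp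
        rw [e1]
        have e2 : 0 ≤ D₀ * ε * ε := by positivity
        have e3 : 0 ≤ 3 * D₀ ^ 2 * X₂ * Real.exp X₂ * ε * ψ q₀ := by positivity
        linarith

-- At minima of H the term with B₁² - B₂ would have the wrong sign for the exact mean curvature. The
-- weight e^{-βP/2} in place of √(1+P) corresponds to B(s) = βs²/2, for which B₁² - B₂ is negative
-- when βP ≤ 1/2. The a priori bound X₁ is needed because the errors are divided by the test
-- curvature.
set_option maxHeartbeats 800000 in
theorem curvature_lower (hn : 1 ≤ n) {D₀ X₁ β κ M : ℝ} (hD₀ : 0 ≤ D₀) (hX₁ : 0 < X₁) (hβ : 0 < β)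
    (hP : ∀ t ∈ Ico 0 t₂, ∀ z, fP t z ≤ D₀ * Real.exp (-(t / n)))
    (hS : ∀ t ∈ Ico 0 t₂, ∀ z, 1 / csinh (fφ t z) ^ 2 ≤ D₀ * Real.exp (-(t / n)))
    (hβP : ∀ t ∈ Ico 0 t₂, ∀ z, β * fP t z ≤ 1 / 2)
    (hX : ∀ t ∈ Ico 0 t₂, ∀ z,
      X₁ ≤ Real.exp (-(β * fP t z / 2)) / (fu t z * csinh (fφ t z)) / (2 * n))
    (hκ : κ = (2 * (1 + β) * D₀
      + D₀ ^ 2 * (β ^ 2 + β + 2 + (1 + D₀) * ((1 + β) ^ 2 / β))) / (2 * X₁))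
    (hM : M = 2 * Real.exp κ) :
    ∀ t ∈ Ico 0 t₂, ∀ z, 1 - Real.exp (-(β * fP t z / 2)) / (fu t z * csinh (fφ t z)) / (2 * n)
      ≤ M * Real.exp (-(t / n)) := by
  have hn' : (0 : ℝ) < n := by exact_mod_cast hn
  have hκ0 : 0 ≤ κ := by rw [hκ]; positivity
  have hexp : ∀ {P u S : ℝ}, 0 < u → 0 < S →
      Real.exp (-(Real.log u + Real.log S + β * P / 2)) = Real.exp (-(β * P / 2)) / (u * S) := by
    intro P u S hu hS
    rw [← Real.exp_log (mul_pos hu hS), ← Real.exp_sub, Real.log_mul hu.ne' hS.ne']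
    congr 1; ring
  set X : ℝ → ℝ := fun s => Real.exp (-s) / (2 * n) with hXdef
  have hX0 : ∀ s, 0 < X s := fun s => by positivity
  have hXd : ∀ s, HasDerivAt X (-X s) s := fun s => hasDerivAt_exp_neg_div (2 * (n : ℝ)) s
  have hψ : ∀ s, HasDerivAt (fun s => 1 - X s) (1 * X s) s := fun s =>
    ((hXd s).const_sub 1).congr_deriv (by ring)
  have hψs : ContDiff ℝ ∞ (fun s => 1 - X s) := by
    simp only [hXdef]
    fun_prop
  have hD : ∀ s : ℝ, 0 ≤ s → ContDiffAt ℝ ∞ (fun s : ℝ => β * s / 2) s := fun s _ => by fun_prop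
  have hM1 : Real.exp κ ≤ M := by
    rw [hM]; linarith [Real.exp_pos κ]
  intro t₁ ht₁ z₁
  have main := h.exp_decay hn (D := fun s => β * s / 2) (ψ := fun s => 1 - X s)
    (ψ' := X) (ε := 1) (κ := κ) (M := M) hD hψs hψ hκ0
    (fun s t hst => by
      have h1 : X t ≤ X s := by linarith
      have h2 := Real.exp_le_exp.1 (le_of_mul_le_mul_right (by simpa [X, div_eq_mul_inv] using h1)
        (show (0 : ℝ) < (n : ℝ)⁻¹ * 2⁻¹ by positivity))
      linarith) ?_ hM1 ?_
  · have h1 := main t₁ ht₁ z₁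
    have h2 := h.pos t₁ ht₁ z₁
    have h3 := csinh_pos (h.neg t₁ ht₁ z₁)
    simpa only [hXdef, hexp h2 h3] using h1
  · intro z
    rw [hM]
    refine mul_le_mul_of_nonneg_right ?_ (Real.exp_pos _).le
    have := hX0 (Real.log (fu 0 z) + Real.log (csinh (fφ 0 z)) + β * fP 0 z / 2)
    linarith
  · intro φ x z hφ hx hm q₀ hq₀ hpos hmax
    have hIco : x.1 ∈ Ico 0 t₂ := ⟨hx.1.le, hx.2⟩
    have hu0 := hφ.speed_pos
    have hS0 := csinh_pos hφ.neg
    have hC0 := ccosh_pos hφ.neg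
    have hP0 := gradProd_self_nonneg b φ x
    obtain ⟨g, d, Γ, hg, hd, hΓ, hkey⟩ := hφ.log_speed_grad_deriv
      (B := fun s => β * s ^ 2 / 2) (B₁ := fun s => β * s)
      (B₂ := fun _ => β) (D := fun s => β * s / 2) (ε := 1)
      (by fun_prop)
      (fun s => by
        refine (((hasDerivAt_pow 2 s).const_mul β).div_const 2).congr_deriv ?_
        norm_num
        ring)
      (fun s => by simpa using (hasDerivAt_id s).const_mul β)
      (fun s => rfl)
      (fun s t hs hst => by
        have := mul_le_mul_of_nonneg_left hst hβ.le
        linarith)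
      hD hmax rfl rfl rfl rfl rfl rfl
    have hmP : gradProd b φ φ x = fP x.1 z := by
      have := hm.2.1
      rwa [hφ.norm_eq, one_pow, one_mul] at this
    have hPb : gradProd b φ φ x ≤ D₀ * Real.exp (-(x.1 / n)) := by rw [hmP]; exact hP _ hIco z
    have hPβ : β * gradProd b φ φ x ≤ 1 / 2 := by rw [hmP]; exact hβP _ hIco z
    have hSb : 1 / csinh (φ x) ^ 2 ≤ D₀ * Real.exp (-(x.1 / n)) := by rw [hm.1]; exact hS _ hIco z
    have hXq : X q₀ = Real.exp (-(β * gradProd b φ φ x / 2)) / (pd (1, 0) φ x * csinh (φ x))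
        / (2 * n) := by
      rw [hXdef, hq₀, ← hexp hu0 hS0]
    have hXb : X₁ ≤ X q₀ := by
      rw [hXq, hmP, hm.1, hm.2.2.2]; exact hX _ hIco z
    set u := pd (1, 0) φ x
    set L := csinh (φ x)
    set P := gradProd b φ φ x
    set ε := Real.exp (-(x.1 / n)) with hε
    have hε0 : 0 < ε := Real.exp_pos _
    have hε1 : ε ≤ 1 := Real.exp_le_one_iff.2 (by
      have := div_nonneg hx.1.le hn'.le
      linarith)
    set m := Real.exp (-(β * P / 2)) with hmdef
    have hm0 : 0 < m := Real.exp_pos _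
    have hβP0 : 0 ≤ β * P := by positivity
    have hm1 : m ≤ 1 := Real.exp_le_one_iff.2 (by linarith)
    have hmP2 : 1 - β * P / 2 ≤ m := by
      have := Real.add_one_le_exp (-(β * P / 2))
      linarith
    have hX1 : X q₀ < 1 := by linarith
    have hXq0 := hX0 q₀
    have ha : 2 * n * (u * L / m) = 1 / X q₀ := by
      rw [hXq]; field_simp
    have hs : u * L / m = 1 / (2 * n * X q₀) := by
      rw [hXq]; field_simp
    have hest := curvature_min_estimate (n := n) (by exact_mod_cast hn) hβ hu0 hS0 hC0
      (ccosh_sq hφ.neg) hP0 hPβ hm0 hm1 hmP2 rfl hg hd hΓ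
      (by rw [ha, le_div_iff₀ (hX0 _)]; linarith)
    have hd1 := hkey.trans hest
    rw [ha, hs] at hd1
    set Y := X q₀
    set e := 1 / L ^ 2
    have he0 : 0 < e := by positivity
    set A := β ^ 2 * P ^ 2 + e * (β * P) + e ^ 2 + e * P + (1 + e) * ((1 + β) ^ 2 * P ^ 2 / β)
    set A₀ := D₀ ^ 2 * (β ^ 2 + β + 2 + (1 + D₀) * ((1 + β) ^ 2 / β)) with hA₀
    have hA : A ≤ A₀ * ε ^ 2 := by
      have e1 : P ^ 2 ≤ (D₀ * ε) ^ 2 := pow_le_pow_left₀ hP0 hPb 2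
      have e2 : e ^ 2 ≤ (D₀ * ε) ^ 2 := pow_le_pow_left₀ he0.le hSb 2
      have e3 : e * P ≤ (D₀ * ε) ^ 2 := by
        rw [sq]; exact mul_le_mul hSb hPb hP0 (by positivity)
      have e4 : 1 + e ≤ 1 + D₀ := by
        have : D₀ * ε ≤ D₀ := mul_le_of_le_one_right hD₀ hε1
        linarith
      have e5 : (1 + e) * ((1 + β) ^ 2 * P ^ 2 / β)
          ≤ (1 + D₀) * ((1 + β) ^ 2 * (D₀ * ε) ^ 2 / β) := by gcongr
      have e6 : β ^ 2 * P ^ 2 ≤ β ^ 2 * (D₀ * ε) ^ 2 := by gcongr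
      have e7 : β * (e * P) ≤ β * (D₀ * ε) ^ 2 := by gcongr
      calc A = β ^ 2 * P ^ 2 + β * (e * P) + e ^ 2 + e * P
            + (1 + e) * ((1 + β) ^ 2 * P ^ 2 / β) := by simp only [A]; ring
        _ ≤ β ^ 2 * (D₀ * ε) ^ 2 + β * (D₀ * ε) ^ 2 + (D₀ * ε) ^ 2 + (D₀ * ε) ^ 2
            + (1 + D₀) * ((1 + β) ^ 2 * (D₀ * ε) ^ 2 / β) := by linarith
        _ = A₀ * ε ^ 2 := by rw [hA₀]; ring
    have h1 := mul_le_mul_of_nonneg_left hd1 hXq0.le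
    have h2 : (1 - Y) / n + Y * (1 / (2 * n * Y) * (2 * (1 - 1 / Y) * (1 - (1 + β) * P) + 1 / Y * A))
        = (2 * (1 - Y) * Y - 2 * (1 - Y) + 2 * (1 - Y) * ((1 + β) * P) + A) / (2 * n * Y) := by
      field_simp
      ring
    have hY1 : 0 < 1 - Y := by linarith
    -- The expression is -2(1-Y)². Below the limit value the model equation dY/dt = (1-Y)/(nY)
    -- converges faster than rate 1/n, so 1 - Y needs no change of variable.
    have h3 : 2 * (1 - Y) * Y - 2 * (1 - Y) ≤ 0 := by
      have := mul_self_nonneg (1 - Y)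
      linarith only [this]
    have h4 : (1 - Y) * ((1 + β) * P) ≤ (1 - Y) * ((1 + β) * (D₀ * ε)) := by gcongr
    have hA₀0 : 0 ≤ A₀ := by rw [hA₀]; positivity
    calc _ ≤ (2 * (1 - Y) * Y - 2 * (1 - Y) + 2 * (1 - Y) * ((1 + β) * P) + A) / (2 * n * Y) := by
          rw [← h2]; linarith
      _ ≤ (2 * ((1 - Y) * ((1 + β) * (D₀ * ε))) + A₀ * ε ^ 2) / (2 * n * Y) := by
          gcongr; linarith
      _ ≤ (2 * ((1 - Y) * ((1 + β) * (D₀ * ε))) + A₀ * ε ^ 2) / (2 * n * X₁) := by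
          gcongr
      _ ≤ κ / n * ε * (ε + (1 - Y)) := by
        rw [hκ, div_le_iff₀ (by positivity)]
        have e1 : (2 * (1 + β) * D₀ + A₀) / (2 * X₁) / n * ε * (ε + (1 - Y)) * (2 * n * X₁)
          = (2 * (1 + β) * D₀ + A₀) * ε * (ε + (1 - Y)) := by field_simp
        rw [e1]
        have e2 : 0 ≤ 2 * (1 + β) * D₀ * ε * ε := by positivity
        have e3 : 0 ≤ A₀ * ε * (1 - Y) := by positivity
        linarith

end GraphFlow
end CurvatureBounds

/-! ### Choice of the uniform constants. -/

noncomputable section UniformEstimates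

open Filter Topology Set

variable {E : Type*} [NormedAddCommGroup E] [InnerProductSpace ℝ E]
  {ι : Type*} [Fintype ι] {b : OrthonormalBasis ι ℝ E}

set_option maxHeartbeats 1000000 in
/-- Estimates of a flow by invariant radial graphs which only depend on bounds for its initial
hypersurface. -/
theorem GraphFlow.exists_uniform_bounds {n : ℕ} (hn : 1 ≤ n) {I : E →L[ℝ] E}
    (hI : ∀ v, ‖I v‖ ≤ ‖v‖) (hIs : ∀ v w, inner ℝ (I v) w = -inner ℝ v (I w))
    {L₀ C₀ ua ub P₀ : ℝ} (hL₀ : 0 < L₀) (hC₀ : 0 < C₀) (hua : 0 < ua) (hub : 0 < ub)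
    (hP₀ : 0 ≤ P₀) :
    ∃ c₁ c₂ c P₁ : ℝ, 0 < c₁ ∧ 0 < c₂ ∧ 0 < c ∧
      ∀ {S : Type*} [TopologicalSpace S] [CompactSpace S] {t₂ : ℝ} {fφ fP fτ fu : ℝ → S → ℝ},
        GraphFlow b I n t₂ fφ fP fτ fu → (∀ z, L₀ ≤ csinh (fφ 0 z)) → (∀ z, ccosh (fφ 0 z) ≤ C₀) →
        (∀ z, ua ≤ fu 0 z) → (∀ z, fu 0 z ≤ ub) → (∀ z, fP 0 z ≤ P₀) → (∀ z, fτ 0 z = 0) →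
        ∀ t ∈ Ico 0 t₂, ∀ z, fτ t z = 0 ∧ fP t z ≤ P₁ ∧
          c₁ ≤ √(1 + fP t z) / (fu t z * csinh (fφ t z)) ∧
          √(1 + fP t z) / (fu t z * csinh (fφ t z)) ≤ c₂ ∧
          |√(1 + fP t z) / (fu t z * csinh (fφ t z)) - 2 * n| ≤ c * Real.exp (-(t / n)) := by
  have hn' : (0 : ℝ) < n := by exact_mod_cast hn
  -- G bounds |∇φ|² / φ_t² initially and hence at all times. With φ_t ≤ ub this gives the gradient
  -- bound P₁.
  set G := P₀ / ua ^ 2 with hG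
  have hG0 : 0 ≤ G := by positivity
  set P₁ := G * ub ^ 2 with hP₁
  have hP₁0 : 0 ≤ P₁ := by positivity
  -- This M₁ dominates the initial speed and satisfies M₁L₀ ≥ 1 + P₁, which implies the threshold
  -- required by `speed_upper`.
  set M₁ := ub + (1 + P₁) / L₀ with hM₁
  have hM₁0 : 0 < M₁ := by positivity
  -- This M₀ is below the initial speed and satisfies (2n+1) M₀ C₀ ≤ 1, which implies the threshold
  -- required by `speed_lower`.
  set M₀ := min ua (1 / ((2 * n + 1) * C₀)) with hM₀
  have hM₀0 : 0 < M₀ := lt_min hua (by positivity)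
  set D₀ := G * M₁ ^ 2 + 1 / L₀ ^ 2 with hD₀
  have hD₀0 : 0 ≤ D₀ := by positivity
  -- Chosen so that βP ≤ 1/2 along the flow. Then e^{-βP/2} ≥ 3/4, which justifies the factor 1/2 in
  -- X₁.
  set β := 1 / (2 * P₁ + 2) with hβ
  have hβ0 : 0 < β := by positivity
  set X₂ := (1 + P₁) / (M₀ * L₀) / (2 * n) with hX₂
  set X₁ := 1 / 2 / (M₁ * C₀) / (2 * n) with hX₁
  have hX₁0 : 0 < X₁ := by positivity
  have hX₂0 : 0 < X₂ := by positivity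
  obtain ⟨κ, hκ⟩ : ∃ κ, κ = (D₀ + 3 * D₀ ^ 2 * X₂ * Real.exp X₂) / 2 := ⟨_, rfl⟩
  obtain ⟨Ma, hMa⟩ : ∃ M, M = (1 + X₂ * Real.exp X₂) * Real.exp κ := ⟨_, rfl⟩
  obtain ⟨κ', hκ'⟩ : ∃ κ', κ' = (2 * (1 + β) * D₀
      + D₀ ^ 2 * (β ^ 2 + β + 2 + (1 + D₀) * ((1 + β) ^ 2 / β))) / (2 * X₁) := ⟨_, rfl⟩
  obtain ⟨Mb, hMb⟩ : ∃ M, M = 2 * Real.exp κ' := ⟨_, rfl⟩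
  have hMa0 : 0 < Ma := by rw [hMa]; positivity
  have hMb0 : 0 < Mb := by rw [hMb]; positivity
  refine ⟨1 / (M₁ * C₀), 2 * n * X₂, 2 * n * (Ma + Mb), P₁, by positivity, by positivity,
    by positivity, ?_⟩
  intro S _ _ t₂ fφ fP fτ fu hflow hL hC hu₀ hu₁ hP hτ
  have hτ0 := hflow.rot_eq_zero hI hIs hτ
  have h := hflow.of_rot_eq_zero hτ0
  have b1 := h.radius_lower hn hL₀ hL
  have b2 := h.radius_upper hn hC
  have b3 := h.gradient_le G (fun z => by
    rw [hG]
    have := hu₀ z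
    gcongr
    · exact hP z)
  have b4 := h.speed_le ub hu₁
  have b5 : ∀ t ∈ Ico 0 t₂, ∀ z, fP t z ≤ P₁ := fun t ht z => by
    have h1 := h.pos t ht z
    have h2 := b3 t ht z
    rw [div_le_iff₀ (by positivity)] at h2
    refine h2.trans ?_
    have := b4 t ht z
    rw [hP₁]
    gcongr
  have b6 := h.speed_upper hn hL₀ b1 b5 (M := M₁) (fun z => (hu₁ z).trans (by
    rw [hM₁]; have : 0 ≤ (1 + P₁) / L₀ := by positivity
    linarith)) hM₁0.le (by
    have h1 : 1 + P₁ ≤ M₁ * L₀ := by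
      rw [hM₁, add_mul, div_mul_cancel₀ _ hL₀.ne']
      have : 0 ≤ ub * L₀ := by positivity
      linarith
    have h2 : 1 + P₁ ≤ (M₁ * L₀) ^ 2 := by
      have : 1 ≤ M₁ * L₀ := by linarith
      nlinarith
    have hn1 : (1 : ℝ) ≤ n := by exact_mod_cast hn
    have h3 : (1 : ℝ) ≤ 4 * n ^ 2 := by nlinarith
    have h4 : 0 ≤ (M₁ * L₀) ^ 2 := sq_nonneg _
    nlinarith)
  have b7 := h.speed_lower hn b2 (M := M₀) (fun z => (min_le_left _ _).trans (hu₀ z)) (by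
    have h1 : M₀ * ((2 * n + 1) * C₀) ≤ 1 := by
      rw [← le_div_iff₀ (by positivity)]
      exact min_le_right _ _
    have h2 : (M₀ * ((2 * n + 1) * C₀)) ^ 2 ≤ 1 := pow_le_one₀ (by positivity) h1
    have h3 : 0 ≤ (2 * (n : ℝ) + 1) * M₀ ^ 2 * C₀ ^ 2 := by positivity
    nlinarith)
  have hε : ∀ t : ℝ, Real.exp (t / (2 * n)) ^ 2 * Real.exp (-(t / n)) = 1 := fun t => by
    rw [sq, ← Real.exp_add, ← Real.exp_add, Real.exp_eq_one_iff]
    field_simp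
    ring
  have b8 : ∀ t ∈ Ico 0 t₂, ∀ z, fP t z ≤ D₀ * Real.exp (-(t / n)) := fun t ht z => by
    have h1 := h.pos t ht z
    have h2 := b3 t ht z
    rw [div_le_iff₀ (by positivity)] at h2
    have h3 := pow_le_pow_left₀ (by positivity) (b6 t ht z) 2
    have h4 : fu t z ^ 2 ≤ M₁ ^ 2 * Real.exp (-(t / n)) := by
      have := mul_le_mul_of_nonneg_right h3 (Real.exp_pos (-(t / n))).le
      rwa [mul_pow, mul_assoc, hε, mul_one] at this
    calc fP t z ≤ G * fu t z ^ 2 := h2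
      _ ≤ G * (M₁ ^ 2 * Real.exp (-(t / n))) := by gcongr
      _ = G * M₁ ^ 2 * Real.exp (-(t / n)) := by ring
      _ ≤ D₀ * Real.exp (-(t / n)) := by
        refine mul_le_mul_of_nonneg_right ?_ (Real.exp_pos _).le
        rw [hD₀]
        have : 0 ≤ 1 / L₀ ^ 2 := by positivity
        linarith
  have b9 : ∀ t ∈ Ico 0 t₂, ∀ z, 1 / csinh (fφ t z) ^ 2 ≤ D₀ * Real.exp (-(t / n)) :=
    fun t ht z => by
    have hS := csinh_pos (h.neg t ht z)
    have h3 := pow_le_pow_left₀ (by positivity) (b1 t ht z) 2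
    have h4 : 1 / csinh (fφ t z) ^ 2 ≤ 1 / L₀ ^ 2 * Real.exp (-(t / n)) := by
      rw [div_le_iff₀ (by positivity)]
      calc (1 : ℝ) = 1 / L₀ ^ 2 * Real.exp (-(t / n)) * (L₀ * Real.exp (t / (2 * n))) ^ 2 := by
            rw [mul_pow, show ∀ l e x : ℝ, 1 / l * e * (l * x) = x * e * (1 / l * l) by
              intros; ring, hε, one_div_mul_cancel (by positivity), mul_one]
        _ ≤ _ := by gcongr
    refine h4.trans (mul_le_mul_of_nonneg_right ?_ (Real.exp_pos _).le)
    rw [hD₀]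
    have : 0 ≤ G * M₁ ^ 2 := by positivity
    linarith
  have b10 : ∀ t ∈ Ico 0 t₂, ∀ z, M₀ * L₀ ≤ fu t z * csinh (fφ t z) := fun t ht z => by
    have h1 := h.pos t ht z
    have hS := csinh_pos (h.neg t ht z)
    calc M₀ * L₀ ≤ (fu t z * Real.exp (t / (2 * n))) * L₀ := by
          have := b7 t ht z
          gcongr
      _ = fu t z * (L₀ * Real.exp (t / (2 * n))) := by ring
      _ ≤ _ := by have := b1 t ht z; gcongr
  have b11 : ∀ t ∈ Ico 0 t₂, ∀ z, fu t z * csinh (fφ t z) ≤ M₁ * C₀ := fun t ht z => by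
    have h1 := h.pos t ht z
    have hS := csinh_pos (h.neg t ht z)
    have hC' := ccosh_pos (h.neg t ht z)
    have hSC : csinh (fφ t z) ≤ ccosh (fφ t z) := by
      refine le_of_sq_le_sq ?_ hC'.le
      rw [ccosh_sq (h.neg t ht z)]; linarith
    calc fu t z * csinh (fφ t z) ≤ fu t z * (C₀ * Real.exp (t / (2 * n))) := by
          have := hSC.trans (b2 t ht z)
          gcongr
      _ = (fu t z * Real.exp (t / (2 * n))) * C₀ := by ring
      _ ≤ _ := by have := b6 t ht z; gcongr
  have hsq : ∀ t ∈ Ico 0 t₂, ∀ z, 1 ≤ √(1 + fP t z) ∧ √(1 + fP t z) ≤ 1 + P₁ := fun t ht z => by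
    have h1 := h.nonneg t ht z
    have h2 := b5 t ht z
    refine ⟨Real.one_le_sqrt.2 (by linarith), ?_⟩
    refine (Real.sqrt_le_sqrt (by linarith : 1 + fP t z ≤ 1 + P₁)).trans ?_
    rw [Real.sqrt_le_left (by linarith)]
    nlinarith
  have b12 : ∀ t ∈ Ico 0 t₂, ∀ z, √(1 + fP t z) / (fu t z * csinh (fφ t z)) / (2 * n) ≤ X₂ :=
    fun t ht z => by
    have := b10 t ht z
    have := (hsq t ht z).2
    rw [hX₂]
    gcongr
  have hβP : ∀ t ∈ Ico 0 t₂, ∀ z, β * fP t z ≤ 1 / 2 := fun t ht z => by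
    rw [hβ, one_div_mul_eq_div, div_le_iff₀ (by positivity)]
    have := b5 t ht z
    linarith
  have b13 : ∀ t ∈ Ico 0 t₂, ∀ z,
      X₁ ≤ Real.exp (-(β * fP t z / 2)) / (fu t z * csinh (fφ t z)) / (2 * n) := fun t ht z => by
    have h1 := b11 t ht z
    have h2 : 1 / 2 ≤ Real.exp (-(β * fP t z / 2)) := by
      have := Real.add_one_le_exp (-(β * fP t z / 2))
      have := hβP t ht z
      linarith
    have h3 := h.pos t ht z
    have hS := csinh_pos (h.neg t ht z)
    rw [hX₁]
    gcongr
  have e1 := h.curvature_upper hn hD₀0 b8 b9 b12 hκ hMa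
  have e2 := h.curvature_lower hn hD₀0 hX₁0 hβ0 b8 b9 hβP b13 hκ' hMb
  intro t ht z
  have hu := h.pos t ht z
  have hS := csinh_pos (h.neg t ht z)
  have hs := hsq t ht z
  refine ⟨hτ0 t ht z, b5 t ht z, ?_, ?_, ?_⟩
  · have := b11 t ht z
    exact div_le_div₀ (zero_le_one.trans hs.1) hs.1 (mul_pos hu hS) this
  · have := b12 t ht z
    rw [div_le_iff₀ (by positivity)] at this
    linarith
  · have h1 := e1 t ht z
    have h2 := e2 t ht z
    -- The modified quotient lies below the true one, because e^{-βP/2} ≤ 1 ≤ √(1+P); its lower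
    -- bound therefore passes to H/2n.
    have h3 : Real.exp (-(β * fP t z / 2)) / (fu t z * csinh (fφ t z)) / (2 * n)
        ≤ √(1 + fP t z) / (fu t z * csinh (fφ t z)) / (2 * n) := by
      have : Real.exp (-(β * fP t z / 2)) ≤ √(1 + fP t z) := by
        refine le_trans (Real.exp_le_one_iff.2 ?_) hs.1
        have := h.nonneg t ht z
        have : 0 ≤ β * fP t z := by positivity
        linarith
      gcongr
    set w := √(1 + fP t z) / (fu t z * csinh (fφ t z))
    have h4 : w = w / (2 * n) * (2 * n) := by field_simp
    have h5 : 0 < Ma * Real.exp (-(t / n)) := by positivity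
    have h6 : 0 < Mb * Real.exp (-(t / n)) := by positivity
    have h7 : w - 2 * n = 2 * n * (w / (2 * n) - 1) := by field_simp
    rw [h7, abs_mul, abs_of_pos (by positivity : (0 : ℝ) < 2 * n), mul_assoc (2 * (n : ℝ)) (Ma + Mb)]
    have h8 : |w / (2 * n) - 1| ≤ (Ma + Mb) * Real.exp (-(t / n)) := by
      rw [abs_le]
      constructor <;> linarith
    exact mul_le_mul_of_nonneg_left h8 (mul_pos two_pos hn').le

end UniformEstimates

/-! ### The Bergman metric in Euclidean coordinates and its Christoffel symbols. -/

noncomputable section BergmanMetric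

open Filter Topology Set

variable {n : ℕ}

/-- The complex structure of `ℂⁿ` as a real linear map. -/
def mulI (n : ℕ) : Cn n →L[ℝ] Cn n := Complex.I • ContinuousLinearMap.id ℝ (Cn n)

lemma mulI_apply (v : Cn n) : mulI n v = Complex.I • v := rfl

lemma mulI_mulI (v : Cn n) : mulI n (mulI n v) = -v := by
  rw [mulI_apply, mulI_apply, smul_smul, Complex.I_mul_I, neg_one_smul]

lemma norm_mulI (v : Cn n) : ‖mulI n v‖ = ‖v‖ := by
  rw [mulI_apply, norm_smul, Complex.norm_I, one_mul]

lemma inner_mulI_left (v w : Cn n) : inner ℝ (mulI n v) w = -inner ℝ v (mulI n w) := by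
  simp only [PiLp.inner_apply, mulI_apply, PiLp.smul_apply, smul_eq_mul, Complex.inner,
    ← Finset.sum_neg_distrib]
  refine Finset.sum_congr rfl fun i _ => ?_
  simp
  ring

lemma inner_mulI_self (v : Cn n) : inner ℝ (mulI n v) v = 0 := by
  have h := inner_mulI_left v v
  rw [real_inner_comm] at h
  rw [real_inner_comm]
  linarith

/-- The conformal factor of the Bergman metric on the directions orthogonal to the complex
line through the position vector. -/
def bergmanFactor (p : Cn n) : ℝ := Real.sinh ‖p‖ / ‖p‖

/-- Replacing cosh² by 1 + sinh² splits the Berger metric into the round metric and a multiple of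
the squared Hopf form. In terms of a = sinh r / r the Hopf coefficient is a⁴, and the formula can be
differentiated without polar coordinates. -/
lemma bergmanMetric_eq {p : Cn n} (hp : p ≠ 0) (X Y : Cn n) :
    bergmanMetric p X Y = bergmanFactor p ^ 2 * inner ℝ X Y
      + (1 - bergmanFactor p ^ 2) / ‖p‖ ^ 2 * (inner ℝ p X * inner ℝ p Y)
      + bergmanFactor p ^ 4 * (inner ℝ (mulI n p) X * inner ℝ (mulI n p) Y) := by
  have hr : ‖p‖ ≠ 0 := norm_ne_zero_iff.2 hp
  have hI : ∀ Z : Cn n, inner ℝ (angularPart p Z) (Complex.I • (‖p‖⁻¹ • p))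
      = (‖p‖ ^ 2)⁻¹ * inner ℝ (mulI n p) Z := by
    intro Z
    have h1 : Complex.I • (‖p‖⁻¹ • p) = ‖p‖⁻¹ • mulI n p := by
      rw [← mulI_apply, map_smul]
    rw [h1, angularPart]
    simp only [real_inner_smul_left, real_inner_smul_right, inner_sub_left]
    rw [real_inner_comm (mulI n p) p, inner_mulI_self, real_inner_comm]
    field_simp
    ring
  have hA : inner ℝ (angularPart p X) (angularPart p Y)
      = (inner ℝ X Y - inner ℝ p X * inner ℝ p Y / ‖p‖ ^ 2) / ‖p‖ ^ 2 := by
    simp only [angularPart, real_inner_smul_left, real_inner_smul_right, inner_sub_left,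
      inner_sub_right, real_inner_self_eq_norm_sq, real_inner_comm p X]
    field_simp
    ring
  rw [bergmanMetric, if_neg hp, bergerMetric, hI, hI, hA, bergmanFactor, Real.cosh_sq]
  simp only [real_inner_smul_left]
  field_simp
  ring

lemma bergmanMetric_comm (p X Y : Cn n) : bergmanMetric p X Y = bergmanMetric p Y X := by
  by_cases hp : p = 0
  · simp only [bergmanMetric, if_pos hp, real_inner_comm]
  · rw [bergmanMetric_eq hp, bergmanMetric_eq hp, real_inner_comm]
    ring

lemma bergmanMetric_add_left {p : Cn n} (hp : p ≠ 0) (X X' Y : Cn n) :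
    bergmanMetric p (X + X') Y = bergmanMetric p X Y + bergmanMetric p X' Y := by
  simp only [bergmanMetric_eq hp, inner_add_left, inner_add_right]
  ring

lemma bergmanMetric_smul_left {p : Cn n} (hp : p ≠ 0) (c : ℝ) (X Y : Cn n) :
    bergmanMetric p (c • X) Y = c * bergmanMetric p X Y := by
  simp only [bergmanMetric_eq hp, real_inner_smul_left, real_inner_smul_right]
  ring

/-- The Bergman metric away from the origin, as a bilinear form. -/
def bergmanBilin {p : Cn n} (hp : p ≠ 0) : Cn n →ₗ[ℝ] Cn n →ₗ[ℝ] ℝ :=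
  LinearMap.mk₂ ℝ (bergmanMetric p) (bergmanMetric_add_left hp) (bergmanMetric_smul_left hp)
    (fun X Y Y' => by
      simp only [bergmanMetric_comm p X, bergmanMetric_add_left hp])
    (fun c X Y => by
      simp only [bergmanMetric_comm p X, bergmanMetric_smul_left hp, smul_eq_mul])

/-- This is the Gauss lemma for rays from the origin. It allows outwardness of a normal to be tested
with the Euclidean product. -/
lemma bergmanMetric_position {p : Cn n} (hp : p ≠ 0) (X : Cn n) :
    bergmanMetric p p X = inner ℝ p X := by
  have hr : ‖p‖ ≠ 0 := norm_ne_zero_iff.2 hp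
  rw [bergmanMetric_eq hp, inner_mulI_self, real_inner_self_eq_norm_sq]
  field_simp
  ring

lemma hasDerivAt_norm_line {p : Cn n} (hp : p ≠ 0) (Z : Cn n) :
    HasDerivAt (fun s : ℝ => ‖p + s • Z‖) (inner ℝ p Z / ‖p‖) 0 := by
  have hr : ‖p‖ ≠ 0 := norm_ne_zero_iff.2 hp
  have h1 : HasDerivAt (fun s : ℝ => p + s • Z) Z 0 := by
    have := ((hasDerivAt_id (0 : ℝ)).smul_const Z).const_add p
    rwa [one_smul] at this
  have h3 := (h1.norm_sq).sqrt (by simpa using hr)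
  simp only [Real.sqrt_sq (norm_nonneg _)] at h3
  refine h3.congr_deriv ?_
  simp only [zero_smul, add_zero]
  field_simp

lemma contDiffAt_bergmanFactor {p : Cn n} (hp : p ≠ 0) {m : WithTop ℕ∞} :
    ContDiffAt ℝ m bergmanFactor p :=
  (Real.contDiff_sinh.contDiffAt.comp p (contDiffAt_norm ℝ hp)).div (contDiffAt_norm ℝ hp)
    (norm_ne_zero_iff.2 hp)

lemma contDiffAt_bergmanMetric {X : Type*} [NormedAddCommGroup X] [NormedSpace ℝ X]
    {P U V : X → Cn n} {x : X} {m : WithTop ℕ∞} (hP : ContDiffAt ℝ m P x) (hU : ContDiffAt ℝ m U x)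
    (hV : ContDiffAt ℝ m V x) (h0 : P x ≠ 0) :
    ContDiffAt ℝ m (fun y => bergmanMetric (P y) (U y) (V y)) x := by
  have ha : ContDiffAt ℝ m (fun y => bergmanFactor (P y)) x :=
    (contDiffAt_bergmanFactor h0).comp x hP
  have hI : ContDiffAt ℝ m (fun y => mulI n (P y)) x := (mulI n).contDiff.contDiffAt.comp x hP
  have h1 : ContDiffAt ℝ m (fun y => bergmanFactor (P y) ^ 2 * inner ℝ (U y) (V y)
      + (1 - bergmanFactor (P y) ^ 2) / ‖P y‖ ^ 2 * (inner ℝ (P y) (U y) * inner ℝ (P y) (V y))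
      + bergmanFactor (P y) ^ 4
        * (inner ℝ (mulI n (P y)) (U y) * inner ℝ (mulI n (P y)) (V y))) x := by
    refine (((ha.pow 2).mul (hU.inner ℝ hV)).add (((contDiffAt_const.sub (ha.pow 2)).div
      (hP.norm_sq ℝ) (pow_ne_zero _ (norm_ne_zero_iff.2 h0))).mul
      ((hP.inner ℝ hU).mul (hP.inner ℝ hV)))).add ((ha.pow 4).mul ((hI.inner ℝ hU).mul
      (hI.inner ℝ hV)))
  refine h1.congr_of_eventuallyEq ?_
  filter_upwards [hP.continuousAt.eventually_ne h0] with y hy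
  exact bergmanMetric_eq hy _ _

/-- The closed form is differentiated along a line; a' stands for the derivative of a = sinh r / r
in r, and z for the derivative of r in the direction Z. -/
lemma bergmanDeriv_eq {p : Cn n} (hp : p ≠ 0) (Z X Y : Cn n) {a a' z : ℝ}
    (ha : a = bergmanFactor p) (ha' : a' = (Real.cosh ‖p‖ - a) / ‖p‖)
    (hz : z = inner ℝ p Z / ‖p‖) :
    bergmanDeriv p Z X Y = 2 * a * a' * z * inner ℝ X Y
      + (-(2 * a * a' * z) / ‖p‖ ^ 2 - 2 * (1 - a ^ 2) * z / ‖p‖ ^ 3)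
        * (inner ℝ p X * inner ℝ p Y)
      + (1 - a ^ 2) / ‖p‖ ^ 2 * (inner ℝ Z X * inner ℝ p Y + inner ℝ p X * inner ℝ Z Y)
      + 4 * a ^ 3 * a' * z * (inner ℝ (mulI n p) X * inner ℝ (mulI n p) Y)
      + a ^ 4 * (inner ℝ (mulI n Z) X * inner ℝ (mulI n p) Y
        + inner ℝ (mulI n p) X * inner ℝ (mulI n Z) Y) := by
  have hr : ‖p‖ ≠ 0 := norm_ne_zero_iff.2 hp
  have hsm : DifferentiableAt ℝ (fun q => bergmanMetric q X Y) p :=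
    (contDiffAt_bergmanMetric (m := 1) contDiffAt_id contDiffAt_const contDiffAt_const
      hp).differentiableAt (by norm_num)
  have hline : HasDerivAt (fun s : ℝ => p + s • Z) Z 0 := by
    have := ((hasDerivAt_id (0 : ℝ)).smul_const Z).const_add p
    rwa [one_smul] at this
  have hn : HasDerivAt (fun s : ℝ => ‖p + s • Z‖) z 0 := by
    rw [hz]; exact hasDerivAt_norm_line hp Z
  have hfac : HasDerivAt (fun s : ℝ => bergmanFactor (p + s • Z)) (a' * z) 0 := by
    refine (hn.sinh.div hn (by simpa using hr)).congr_deriv ?_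
    simp only [zero_smul, add_zero]
    rw [ha', ha, bergmanFactor]
    field_simp
  have hin : ∀ W : Cn n, HasDerivAt (fun s : ℝ => inner ℝ (p + s • Z) W) (inner ℝ Z W) 0 := by
    intro W
    simpa using hline.inner ℝ (hasDerivAt_const (0 : ℝ) W)
  have hIn : ∀ W : Cn n, HasDerivAt (fun s : ℝ => inner ℝ (mulI n (p + s • Z)) W)
      (inner ℝ (mulI n Z) W) 0 := by
    intro W
    have h1 : HasDerivAt (fun s : ℝ => mulI n (p + s • Z)) (mulI n Z) 0 :=
      (mulI n).hasFDerivAt.comp_hasDerivAt (0 : ℝ) hline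
    simpa using h1.inner ℝ (hasDerivAt_const (0 : ℝ) W)
  have hmain := (((hfac.pow 2).mul_const (inner ℝ X Y)).add
    ((((hfac.pow 2).const_sub 1).div (hn.pow 2) (by simpa using hr)).mul
      ((hin X).mul (hin Y)))).add ((hfac.pow 4).mul ((hIn X).mul (hIn Y)))
  have hev : (fun s : ℝ => bergmanMetric (p + s • Z) X Y) =ᶠ[𝓝 0]
      fun s => bergmanFactor (p + s • Z) ^ 2 * inner ℝ X Y
      + (1 - bergmanFactor (p + s • Z) ^ 2) / ‖p + s • Z‖ ^ 2
        * (inner ℝ (p + s • Z) X * inner ℝ (p + s • Z) Y)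
      + bergmanFactor (p + s • Z) ^ 4
        * (inner ℝ (mulI n (p + s • Z)) X * inner ℝ (mulI n (p + s • Z)) Y) := by
    have : ∀ᶠ s in 𝓝 (0 : ℝ), p + s • Z ≠ 0 :=
      hline.continuousAt.eventually_ne (by simpa using hp)
    filter_upwards [this] with s hs
    exact bergmanMetric_eq hs X Y
  have h3 := (hasDerivAt_line hsm Z).unique (hmain.congr_of_eventuallyEq hev)
  rw [bergmanDeriv, show fderiv ℝ (fun q => bergmanMetric q X Y) p Z
    = pd Z (fun q => bergmanMetric q X Y) p from rfl, h3]
  simp only [Pi.mul_apply, Pi.pow_apply, Pi.div_apply, zero_smul, add_zero, ← ha]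
  field_simp
  ring

/-- The Christoffel symbols as a bilinear form in the first two arguments. -/
def bergmanChristoffelBilin {p : Cn n} (hp : p ≠ 0) (N : Cn n) : Cn n →ₗ[ℝ] Cn n →ₗ[ℝ] ℝ :=
  LinearMap.mk₂ ℝ (fun X Y => bergmanChristoffel p X Y N)
    (fun X X' Y => by
      simp only [bergmanChristoffel, bergmanDeriv_eq hp _ _ _ rfl rfl rfl, map_add, inner_add_left,
        inner_add_right]
      ring)
    (fun c X Y => by
      simp only [bergmanChristoffel, bergmanDeriv_eq hp _ _ _ rfl rfl rfl, map_smul,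
        real_inner_smul_left, real_inner_smul_right, smul_eq_mul]
      ring)
    (fun X Y Y' => by
      simp only [bergmanChristoffel, bergmanDeriv_eq hp _ _ _ rfl rfl rfl, map_add, inner_add_left,
        inner_add_right]
      ring)
    (fun c X Y => by
      simp only [bergmanChristoffel, bergmanDeriv_eq hp _ _ _ rfl rfl rfl, map_smul,
        real_inner_smul_left, real_inner_smul_right, smul_eq_mul]
      ring)

/-- The diagonal values suffice, because the mean curvature is computed below as a weighted sum of
h(y, y) over a frame. -/
lemma bergmanChristoffel_self {p : Cn n} (hp : p ≠ 0) (X N : Cn n) {a a' r x ν ξ ζ : ℝ}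
    (ha : a = bergmanFactor p) (ha' : a' = (Real.cosh ‖p‖ - a) / ‖p‖) (hr : r = ‖p‖)
    (hx : x = inner ℝ p X) (hν : ν = inner ℝ p N) (hξ : ξ = inner ℝ (mulI n p) X)
    (hζ : ζ = inner ℝ (mulI n p) N) :
    bergmanChristoffel p X X N = 2 * a * a' * x / r * inner ℝ X N - a * a' * ν / r * inner ℝ X X
      + (-(a * a' / r ^ 3) - (1 - a ^ 2) / r ^ 4) * (ν * x ^ 2)
      + (1 - a ^ 2) / r ^ 2 * (inner ℝ X X * ν)
      + 4 * a ^ 3 * a' * x / r * (ξ * ζ) - 2 * a ^ 3 * a' * ν / r * ξ ^ 2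
      + 2 * a ^ 4 * (inner ℝ (mulI n X) N * ξ) := by
  have hr0 : ‖p‖ ≠ 0 := norm_ne_zero_iff.2 hp
  have h1 : inner ℝ (mulI n N) X = -inner ℝ (mulI n X) N := by
    rw [inner_mulI_left, real_inner_comm]
  rw [bergmanChristoffel, bergmanDeriv_eq hp X X N ha ha' rfl, bergmanDeriv_eq hp N X X ha ha' rfl,
    inner_mulI_self, h1, ← hx, ← hν, ← hξ, ← hζ, ← hr, real_inner_comm X N]
  have hr1 : r ≠ 0 := by rw [hr]; exact hr0
  field_simp
  ring

end BergmanMetric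

/-! ### The mean curvature as a trace in an arbitrary weighted frame. -/

noncomputable section MeanCurvatureTrace

open Filter Topology Set

/-- The trace of a bilinear form with respect to a Gram matrix, computed in a frame. -/
lemma trace_inv_gram_mul {T : Type*} [AddCommGroup T] [Module ℝ T] {m : ℕ}
    (b : Module.Basis (Fin m) ℝ T) (G H : T →ₗ[ℝ] T →ₗ[ℝ] ℝ) {A : Type*} [Fintype A] (c : A → ℝ)
    (y : A → T) (hy : ∀ X, ∑ a, (c a * G (y a) X) • y a = X) :
    ((Matrix.of fun i j => G (b i) (b j))⁻¹ * Matrix.of fun i j => H (b i) (b j)).trace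
      = ∑ a, c a * H (y a) (y a) := by
  have hexp : ∀ (B : T →ₗ[ℝ] T →ₗ[ℝ] ℝ) (X Y : T), B X Y = ∑ k, b.repr X k * B (b k) Y := by
    intro B X Y
    have h0 := congrArg (fun V => B V Y) (b.sum_repr X)
    simp only [map_sum, map_smul, LinearMap.sum_apply, LinearMap.smul_apply, smul_eq_mul] at h0
    exact h0.symm
  -- The hypothesis says that the tensor ∑ c_a y_a ⊗ y_a inverts G. The y_a need be neither
  -- independent nor orthogonal, and the weights may be negative.
  have hinv : (Matrix.of fun i j => G (b i) (b j))⁻¹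
      = Matrix.of fun i j => ∑ a, c a * (b.repr (y a) i * b.repr (y a) j) := by
    refine Matrix.inv_eq_left_inv ?_
    ext i j
    rw [Matrix.mul_apply, Matrix.one_apply]
    have h1 := congrArg (fun X => b.repr X i) (hy (b j))
    simp only [map_sum, map_smul, Finsupp.coe_finsetSum, Finset.sum_apply, Finsupp.smul_apply,
      smul_eq_mul, b.repr_self, Finsupp.single_apply] at h1
    rw [show (if i = j then (1 : ℝ) else 0) = if j = i then 1 else 0 by simp [eq_comm], ← h1]
    simp only [Matrix.of_apply, Finset.sum_mul]
    rw [Finset.sum_comm]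
    refine Finset.sum_congr rfl fun a _ => ?_
    rw [hexp G (y a) (b j), Finset.mul_sum, Finset.sum_mul]
    refine Finset.sum_congr rfl fun k _ => by ring
  rw [hinv, Matrix.trace]
  simp only [Matrix.diag_apply, Matrix.mul_apply, Matrix.of_apply]
  have h2 : ∀ a, H (y a) (y a) = ∑ i, ∑ k, b.repr (y a) i * b.repr (y a) k * H (b k) (b i) := by
    intro a
    rw [hexp H (y a) (y a), Finset.sum_comm]
    refine Finset.sum_congr rfl fun k _ => ?_
    have h3 := hexp H.flip (y a) (b k)
    simp only [LinearMap.flip_apply] at h3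
    rw [h3, Finset.mul_sum]
    refine Finset.sum_congr rfl fun i _ => by ring
  simp only [h2, Finset.mul_sum, Finset.sum_mul]
  calc _ = ∑ i, ∑ a, ∑ k, c a * (b.repr (y a) i * b.repr (y a) k) * H (b k) (b i) :=
        Finset.sum_congr rfl fun i _ => Finset.sum_comm
    _ = _ := by
        rw [Finset.sum_comm]
        refine Finset.sum_congr rfl fun a _ => Finset.sum_congr rfl fun i _ =>
          Finset.sum_congr rfl fun k _ => by ring

variable {n : ℕ}

/-- The second fundamental form as a bilinear form. -/
def secondFormBilin (F N : USphere n → Cn n) (z : USphere n) (hF : F z ≠ 0) :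
    Cn n →ₗ[ℝ] Cn n →ₗ[ℝ] ℝ :=
  -((LinearMap.mk₂ ℝ (fun X Y => bergmanBilin hF (fderiv ℝ (fderiv ℝ (rayExt F)) (z : Cn n) X Y) (N z))
      (fun X X' Y => by simp) (fun c X Y => by simp) (fun X Y Y' => by simp)
      (fun c X Y => by simp))
    + (bergmanChristoffelBilin hF (N z)).compl₁₂ (fderiv ℝ (rayExt F) (z : Cn n)).toLinearMap
      (fderiv ℝ (rayExt F) (z : Cn n)).toLinearMap)

lemma secondFormBilin_apply {F N : USphere n → Cn n} {z : USphere n} (hF : F z ≠ 0)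
    (hs : ContDiffAt ℝ 2 (rayExt F) (z : Cn n)) (X Y : Cn n) :
    secondFormBilin F N z hF X Y = secondFundamentalForm F N z X Y := by
  have h1 : DifferentiableAt ℝ (fderiv ℝ (rayExt F)) (z : Cn n) :=
    (hs.fderiv_right (m := 1) (by norm_num)).differentiableAt (by norm_num)
  have h2 : fderiv ℝ (fun w : Cn n => fderiv ℝ (rayExt F) w Y) (z : Cn n) X
      = fderiv ℝ (fderiv ℝ (rayExt F)) (z : Cn n) X Y := by
    have := h1.hasFDerivAt.clm_apply (hasFDerivAt_const Y (z : Cn n))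
    rw [this.fderiv]
    simp
  rw [secondFundamentalForm, h2]
  rfl

/-- The induced metric as a bilinear form. -/
def inducedBilin (F : USphere n → Cn n) (z : USphere n) (hF : F z ≠ 0) :
    Cn n →ₗ[ℝ] Cn n →ₗ[ℝ] ℝ :=
  (bergmanBilin hF).compl₁₂ (fderiv ℝ (rayExt F) (z : Cn n)).toLinearMap
    (fderiv ℝ (rayExt F) (z : Cn n)).toLinearMap

lemma inducedBilin_apply {F : USphere n → Cn n} {z : USphere n} (hF : F z ≠ 0) (X Y : Cn n) :
    inducedBilin F z hF X Y = inducedMetric F z X Y := rfl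

/-- The mean curvature as a sum over a tangential frame. -/
theorem meanCurvature_eq_sum {F N : USphere n → Cn n} {z : USphere n} (hF : F z ≠ 0)
    (hs : ContDiffAt ℝ 2 (rayExt F) (z : Cn n)) {A : Type*} [Fintype A] (c : A → ℝ) (y : A → Cn n)
    (hyT : ∀ a, y a ∈ sphereTangent z)
    (hy : ∀ X ∈ sphereTangent z, ∑ a, (c a * inducedMetric F z (y a) X) • y a = X) :
    meanCurvature F N z = ∑ a, c a * secondFundamentalForm F N z (y a) (y a) := by
  set T := sphereTangent z
  have key := trace_inv_gram_mul (stdOrthonormalBasis ℝ T).toBasis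
    ((inducedBilin F z hF).compl₁₂ T.subtype T.subtype)
    ((secondFormBilin F N z hF).compl₁₂ T.subtype T.subtype) c (fun a => ⟨y a, hyT a⟩) (by
      intro X
      refine Subtype.ext ?_
      have := hy X X.2
      simpa [inducedBilin_apply] using this)
  simp only [LinearMap.compl₁₂_apply, Submodule.subtype_apply, inducedBilin_apply,
    secondFormBilin_apply hF hs, OrthonormalBasis.coe_toBasis] at key
  exact key

end MeanCurvatureTrace

/-! ### Normal and second fundamental form of a radial graph at one point. -/

noncomputable section RadialGraphAlgebra

open Filter Topology Set

variable {n : ℕ} {q p : Cn n} {ρ L C τ : ℝ}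

lemma bergmanFactor_smul (hq : ‖q‖ = 1) (hρ : 0 < ρ) : bergmanFactor (ρ • q) = Real.sinh ρ / ρ := by
  rw [bergmanFactor, norm_smul, hq, mul_one, Real.norm_of_nonneg hρ.le]

lemma smul_ne_zero_of_norm_eq_one (hq : ‖q‖ = 1) (hρ : 0 < ρ) : ρ • q ≠ 0 :=
  smul_ne_zero hρ.ne' (fun h => by simp [h] at hq)

lemma bergmanMetric_smul_unit (hq : ‖q‖ = 1) (hρ : 0 < ρ) (hL : L = Real.sinh ρ) (X Y : Cn n) :
    bergmanMetric (ρ • q) X Y = L ^ 2 / ρ ^ 2 * inner ℝ X Y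
      + (1 - L ^ 2 / ρ ^ 2) * (inner ℝ q X * inner ℝ q Y)
      + L ^ 4 / ρ ^ 2 * (inner ℝ (mulI n q) X * inner ℝ (mulI n q) Y) := by
  rw [bergmanMetric_eq (smul_ne_zero_of_norm_eq_one hq hρ), bergmanFactor_smul hq hρ, norm_smul, hq,
    mul_one, Real.norm_of_nonneg hρ.le, map_smul, ← hL]
  simp only [real_inner_smul_left]
  field_simp

/-- The tangential part of the (Euclidean) direction of the normal of a radial graph. -/
def graphCovector (q p : Cn n) (κ τ : ℝ) : Cn n := p - (κ * τ) • mulI n q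

/-- The metric product with the normal direction of a radial graph. -/
lemma bergmanMetric_graph_normal (hq : ‖q‖ = 1) (hρ : 0 < ρ) (hL : L = Real.sinh ρ) (hC0 : 0 < C)
    (hL0 : 0 < L) (hCL : C ^ 2 = 1 + L ^ 2) (hp : inner ℝ q p = 0) (hτ : τ = inner ℝ p (mulI n q))
    (m : ℝ) (Z : Cn n) :
    bergmanMetric (ρ • q) Z (m • (q - (ρ / L) • graphCovector q p (L ^ 2 / C ^ 2) τ))
      = m * (inner ℝ q Z - L / ρ * inner ℝ p Z) := by
  have h1 : inner ℝ q (mulI n q) = 0 := by rw [real_inner_comm, inner_mulI_self]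
  have h2 : inner ℝ (mulI n q) (mulI n q) = 1 := by
    rw [real_inner_self_eq_norm_sq, norm_mulI, hq, one_pow]
  have h3 : inner ℝ q q = 1 := by rw [real_inner_self_eq_norm_sq, hq, one_pow]
  have h4 : inner ℝ (mulI n q) p = τ := by rw [hτ, real_inner_comm]
  rw [bergmanMetric_smul_unit hq hρ hL]
  simp only [graphCovector, inner_sub_right, real_inner_smul_right, h1, h2, h3, h4, hp,
    inner_mulI_self, real_inner_comm q Z, real_inner_comm p Z, real_inner_comm (mulI n q) Z]
  have : L ^ 2 = C ^ 2 - 1 := by linarith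
  have h5 : L ^ 4 = (C ^ 2 - 1) ^ 2 := by rw [← this]; ring
  field_simp
  simp only [this, h5]
  linear_combination (-(m * C ^ 2 * ρ * inner ℝ p Z)) * hCL

/-- The unit normal of a radial graph. -/
lemma graph_normal_eq (hq : ‖q‖ = 1) (hρ : 0 < ρ) (hL : L = Real.sinh ρ) (hC0 : 0 < C)
    (hL0 : 0 < L) (hCL : C ^ 2 = 1 + L ^ 2) (hp : inner ℝ q p = 0) (hτ : τ = inner ℝ p (mulI n q))
    {N : Cn n} {m : ℝ} (hm : m = inner ℝ q N)
    (hN : ∀ X, inner ℝ q X = 0 →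
      bergmanMetric (ρ • q) ((L * inner ℝ p X) • q + ρ • X) N = 0)
    (hN1 : bergmanMetric (ρ • q) N N = 1) :
    N = m • (q - (ρ / L) • graphCovector q p (L ^ 2 / C ^ 2) τ) ∧
      m ^ 2 * (1 + inner ℝ p p - L ^ 2 / C ^ 2 * τ ^ 2) = 1 := by
  have h1 : inner ℝ q (mulI n q) = 0 := by rw [real_inner_comm, inner_mulI_self]
  have h2 : inner ℝ (mulI n q) (mulI n q) = 1 := by
    rw [real_inner_self_eq_norm_sq, norm_mulI, hq, one_pow]
  have h3 : inner ℝ q q = 1 := by rw [real_inner_self_eq_norm_sq, hq, one_pow]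
  have h4 : inner ℝ (mulI n q) p = τ := by rw [hτ, real_inner_comm]
  have h5 : ∀ X, inner ℝ q X = 0 → L * inner ℝ p X * m + L ^ 2 / ρ * inner ℝ X N
      + L ^ 4 / ρ * (inner ℝ (mulI n q) X * inner ℝ (mulI n q) N) = 0 := by
    intro X hX
    have h := hN X hX
    rw [bergmanMetric_smul_unit hq hρ hL] at h
    simp only [inner_add_left, inner_add_right, real_inner_smul_left, real_inner_smul_right, h3, hX,
      ← hm, inner_mulI_self] at h
    rw [← h]
    field_simp
    ring
  set ζ := inner ℝ (mulI n q) N with hζ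
  -- Testing orthogonality on the Hopf direction determines the Hopf component of the normal; the
  -- factor C² = 1 + L² is the stretching of that direction. Tangential parts of arbitrary vectors
  -- then determine the rest.
  have h6 : ζ * C ^ 2 = -(ρ / L * τ * m) := by
    have h := h5 _ h1
    rw [h2, ← hτ, ← hζ] at h
    have h7 : L * (τ * m + L / ρ * (ζ * C ^ 2)) = 0 := by
      rw [← h, hCL]; ring
    have h8 : τ * m + L / ρ * (ζ * C ^ 2) = 0 := (mul_eq_zero.1 h7).resolve_left hL0.ne'
    field_simp at h8 ⊢
    linarith
  have h7 : N = m • (q - (ρ / L) • graphCovector q p (L ^ 2 / C ^ 2) τ) := by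
    refine ext_inner_left ℝ fun Z => ?_
    have h8 := h5 (Z - inner ℝ q Z • q) (by
      rw [inner_sub_right, real_inner_smul_right, h3, mul_one, sub_self])
    simp only [inner_sub_left, inner_sub_right, real_inner_smul_left, real_inner_smul_right, ← hm,
      inner_mulI_self, real_inner_comm q p, hp, mul_zero, sub_zero] at h8
    simp only [graphCovector, inner_sub_right, real_inner_smul_right, real_inner_comm q Z,
      real_inner_comm p Z, real_inner_comm (mulI n q) Z]
    have h9 : ζ = -(ρ / L * τ * m) / C ^ 2 := by
      rw [← h6]; field_simp
    rw [h9] at h8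
    rw [real_inner_comm N Z] at h8 ⊢
    have h10 : L ^ 2 / ρ * (inner ℝ N Z - m * (inner ℝ q Z - ρ / L * (inner ℝ p Z
        - L ^ 2 / C ^ 2 * τ * inner ℝ (mulI n q) Z))) = 0 := by
      rw [← h8]
      field_simp
      ring
    have h11 := (mul_eq_zero.1 h10).resolve_left (by positivity)
    linarith
  refine ⟨h7, ?_⟩
  have h8 := bergmanMetric_graph_normal hq hρ hL hC0 hL0 hCL hp hτ m N
  rw [← h7, hN1, ← hm] at h8
  have h9 : inner ℝ p N = -(m * (ρ / L) * (inner ℝ p p - L ^ 2 / C ^ 2 * τ ^ 2)) := by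
    rw [h7]
    simp only [graphCovector, inner_sub_right, real_inner_smul_right, real_inner_comm q p, hp, ← hτ]
    ring
  rw [h9] at h8
  field_simp at h8 ⊢
  linarith

/-- The second fundamental form of a radial graph in the direction `X`, where `a` stands for the
second derivative of the conformal radius. -/
lemma graph_second_form (hq : ‖q‖ = 1) (hρ : 0 < ρ) (hL : L = Real.sinh ρ) (hC : C = Real.cosh ρ)
    (hp : inner ℝ q p = 0) (hτ : τ = inner ℝ p (mulI n q)) (m : ℝ) {X : Cn n}
    (hX : inner ℝ q X = 0) (a : ℝ) {f η : ℝ} (hf : f = inner ℝ p X) (hη : η = inner ℝ (mulI n q) X) :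
    -(m * (L * a + L * C * f ^ 2 - ρ * inner ℝ X X - 2 * L ^ 2 * f ^ 2 / ρ)
      + bergmanChristoffel (ρ • q) ((L * f) • q + ρ • X) ((L * f) • q + ρ • X)
        (m • (q - (ρ / L) • graphCovector q p (L ^ 2 / C ^ 2) τ)))
      = m * L * (-a + C * f ^ 2 + C * inner ℝ X X + 2 * L ^ 2 * C * η ^ 2
        + 2 * (L ^ 2 / C) * τ * η * f + 2 * L ^ 2 * η * inner ℝ p (mulI n X)) := by
  have hL0 : 0 < L := by rw [hL]; exact Real.sinh_pos_iff.2 hρ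
  have hC0 : 0 < C := by rw [hC]; exact Real.cosh_pos ρ
  have hCL : C ^ 2 = 1 + L ^ 2 := by rw [hC, hL, Real.cosh_sq]; ring
  have hne := smul_ne_zero_of_norm_eq_one hq hρ
  have h1 : inner ℝ q (mulI n q) = 0 := by rw [real_inner_comm, inner_mulI_self]
  have h2 : inner ℝ (mulI n q) (mulI n q) = 1 := by
    rw [real_inner_self_eq_norm_sq, norm_mulI, hq, one_pow]
  have h3 : inner ℝ q q = 1 := by rw [real_inner_self_eq_norm_sq, hq, one_pow]
  have h4 : inner ℝ (mulI n q) p = τ := by rw [hτ, real_inner_comm]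
  have h5 : inner ℝ (mulI n X) q = -η := by rw [inner_mulI_left, hη, real_inner_comm]
  have h6 : inner ℝ (mulI n X) (mulI n q) = 0 := by
    rw [inner_mulI_left, mulI_mulI, inner_neg_right, real_inner_comm, hX]; simp
  have h7 : inner ℝ X q = 0 := by rw [real_inner_comm, hX]
  have h8 : inner ℝ X p = f := by rw [hf, real_inner_comm]
  have h9 : inner ℝ X (mulI n q) = η := by rw [hη, real_inner_comm]
  have h10 : ‖ρ • q‖ = ρ := by rw [norm_smul, hq, mul_one, Real.norm_of_nonneg hρ.le]
  set κ := L ^ 2 / C ^ 2 with hκ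
  set A := (L * f) • q + ρ • X with hA
  set N := m • (q - (ρ / L) • graphCovector q p κ τ) with hN
  have n1 : inner ℝ (ρ • q) A = ρ * L * f := by
    simp only [hA, inner_add_right, real_inner_smul_left, real_inner_smul_right, h3, hX]; ring
  have n2 : inner ℝ (ρ • q) N = ρ * m := by
    simp only [hN, graphCovector, inner_sub_right, real_inner_smul_left, real_inner_smul_right, h3,
      hp, h1]
    ring
  have n3 : inner ℝ (mulI n (ρ • q)) A = ρ ^ 2 * η := by
    simp only [hA, map_smul, inner_add_right, real_inner_smul_left, real_inner_smul_right,
      inner_mulI_self, ← hη]; ring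
  have n4 : inner ℝ (mulI n (ρ • q)) N = -(ρ ^ 2 * m / L * (τ - κ * τ)) := by
    simp only [hN, graphCovector, map_smul, inner_sub_right, real_inner_smul_left,
      real_inner_smul_right, inner_mulI_self, h4, h2]
    ring
  have n5 : inner ℝ A N = m * (L * f - ρ ^ 2 / L * (f - κ * τ * η)) := by
    simp only [hA, hN, graphCovector, inner_sub_right, inner_add_left, real_inner_smul_left,
      real_inner_smul_right, h1, h3, h7, h8, h9, hp]
    ring
  have n6 : inner ℝ A A = L ^ 2 * f ^ 2 + ρ ^ 2 * inner ℝ X X := by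
    simp only [hA, inner_add_right, inner_add_left, real_inner_smul_left,
      real_inner_smul_right, h3, h7, hX]
    ring
  have n7 : inner ℝ (mulI n A) N = m * (-(ρ * η) - ρ / L * (L * f * (τ - κ * τ)
      + ρ * inner ℝ p (mulI n X))) := by
    simp only [hA, hN, graphCovector, map_add, map_smul, inner_sub_right, inner_add_left,
      real_inner_smul_left, real_inner_smul_right, inner_mulI_self, h2, h4, h5, h6,
      real_inner_comm p (mulI n X)]
    ring
  rw [bergmanChristoffel_self hne A N (bergmanFactor_smul hq hρ).symm rfl h10.symm n1.symm n2.symm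
    n3.symm n4.symm, n5, n6, n7, h10, ← hL, ← hC, hκ]
  field_simp
  linear_combination (m * f * τ * η * (4 * C * ρ ^ 3 * L ^ 3 - 2 * ρ ^ 2 * L ^ 4)) * hCL

end RadialGraphAlgebra

/-! ### Graph charts and their first two derivatives. -/

noncomputable section GraphCharts

open Filter Topology Set

/-- The geodesic radius as a function of the conformal radius. -/
def geodesicRadius (y : ℝ) : ℝ := Real.arsinh (csinh y)

/-- The conformal radius `log tanh (ρ / 2)` as a function of the geodesic radius. -/
def conformalRadius (ρ : ℝ) : ℝ := -Real.arsinh (Real.sinh ρ)⁻¹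

lemma geodesicRadius_pos {y : ℝ} (hy : y < 0) : 0 < geodesicRadius y :=
  Real.arsinh_pos_iff.2 (csinh_pos hy)

lemma sinh_geodesicRadius (y : ℝ) : Real.sinh (geodesicRadius y) = csinh y := Real.sinh_arsinh _

lemma cosh_geodesicRadius {y : ℝ} (hy : y < 0) : Real.cosh (geodesicRadius y) = ccosh y := by
  have h := Real.cosh_sq (geodesicRadius y)
  rw [sinh_geodesicRadius] at h
  have h2 := ccosh_sq hy
  exact (pow_left_inj₀ (Real.cosh_pos _).le (ccosh_pos hy).le two_ne_zero).1 (by rw [h, h2]; ring)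

lemma hasDerivAt_geodesicRadius {y : ℝ} (hy : y < 0) : HasDerivAt geodesicRadius (csinh y) y := by
  have h := (hasDerivAt_csinh hy).arsinh
  refine h.congr_deriv ?_
  rw [← ccosh_sq hy, Real.sqrt_sq (ccosh_pos hy).le, smul_eq_mul]
  have := (ccosh_pos hy).ne'
  field_simp

lemma contDiffAt_geodesicRadius {y : ℝ} (hy : y < 0) {m : WithTop ℕ∞} :
    ContDiffAt ℝ m geodesicRadius y :=
  Real.contDiff_arsinh.contDiffAt.comp y (contDiffAt_csinh hy)

lemma conformalRadius_neg {ρ : ℝ} (hρ : 0 < ρ) : conformalRadius ρ < 0 :=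
  neg_neg_of_pos (Real.arsinh_pos_iff.2 (inv_pos.2 (Real.sinh_pos_iff.2 hρ)))

lemma csinh_conformalRadius (ρ : ℝ) : csinh (conformalRadius ρ) = Real.sinh ρ := by
  rw [csinh, conformalRadius, Real.sinh_neg, Real.sinh_arsinh, inv_neg, inv_inv, neg_neg]

lemma ccosh_conformalRadius {ρ : ℝ} (hρ : 0 < ρ) : ccosh (conformalRadius ρ) = Real.cosh ρ := by
  have h2 := ccosh_sq (conformalRadius_neg hρ)
  rw [csinh_conformalRadius] at h2
  exact (pow_left_inj₀ (ccosh_pos (conformalRadius_neg hρ)).le (Real.cosh_pos _).le two_ne_zero).1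
    (by rw [h2, Real.cosh_sq]; ring)

lemma geodesicRadius_conformalRadius (ρ : ℝ) : geodesicRadius (conformalRadius ρ) = ρ := by
  rw [geodesicRadius, csinh_conformalRadius, Real.arsinh_sinh]

lemma contDiffAt_conformalRadius {ρ : ℝ} (hρ : 0 < ρ) {m : WithTop ℕ∞} :
    ContDiffAt ℝ m conformalRadius ρ :=
  (Real.contDiff_arsinh.contDiffAt.comp ρ
    (Real.contDiff_sinh.contDiffAt.inv (Real.sinh_pos_iff.2 hρ).ne')).neg

section Pd

variable {X : Type*} [NormedAddCommGroup X] [NormedSpace ℝ X]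

lemma pd_pd_mul {f g : X → ℝ} {x : X} (hf : ContDiffAt ℝ 2 f x) (hg : ContDiffAt ℝ 2 g x) (w : X) :
    pd w (pd w (fun y => f y * g y)) x
      = pd w (pd w f) x * g x + 2 * pd w f x * pd w g x + f x * pd w (pd w g) x := by
  have hd : ∀ {f : X → ℝ}, ContDiffAt ℝ 2 f x → ∀ᶠ y in 𝓝 x, DifferentiableAt ℝ f y := fun hf =>
    (hf.eventually (by simp)).mono fun y hy => hy.differentiableAt (by norm_num)
  have hd' : ∀ {f : X → ℝ}, ContDiffAt ℝ 2 f x → DifferentiableAt ℝ (pd w f) x := fun hf =>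
    (hf.pd (m := 1) (by norm_num) w).differentiableAt (by norm_num)
  have h1 : pd w (fun y => f y * g y) =ᶠ[𝓝 x] fun y => pd w f y * g y + f y * pd w g y := by
    filter_upwards [hd hf, hd hg] with y h1 h2
    exact pd_mul h1 h2 w
  have f0 := (hd hf).self_of_nhds
  have g0 := (hd hg).self_of_nhds
  rw [(pd_congr h1 w).self_of_nhds, pd_add ((hd' hf).fun_mul g0) (f0.fun_mul (hd' hg)),
    pd_mul (hd' hf) g0, pd_mul f0 (hd' hg)]
  ring

end Pd

section Norm

variable {E : Type*} [NormedAddCommGroup E] [InnerProductSpace ℝ E]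

lemma pd_norm {w : E} (hw : w ≠ 0) (X : E) : pd X (fun w => ‖w‖) w = inner ℝ w X / ‖w‖ := by
  have hr : ‖w‖ ≠ 0 := norm_ne_zero_iff.2 hw
  refine pd_eq_of_hasDerivAt ((contDiffAt_norm ℝ hw (n := 1)).differentiableAt (by norm_num)) ?_
  have h1 : HasDerivAt (fun s : ℝ => w + s • X) X 0 := by
    have := ((hasDerivAt_id (0 : ℝ)).smul_const X).const_add w
    rwa [one_smul] at this
  have h3 := (h1.norm_sq).sqrt (by simpa using hr)
  simp only [Real.sqrt_sq (norm_nonneg _)] at h3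
  refine h3.congr_deriv ?_
  simp only [zero_smul, add_zero]
  field_simp

lemma pd_inner_left (m w X : E) : pd X (fun w => inner ℝ m w) w = inner ℝ m X := by
  have : (fun w => inner ℝ m w) = innerSL ℝ m := by ext; simp
  rw [pd, this, ContinuousLinearMap.fderiv]
  simp

lemma pd_pd_norm {q : E} (hq : ‖q‖ = 1) {X : E} (hX : inner ℝ q X = 0) :
    pd X (pd X fun w => ‖w‖) q = inner ℝ X X := by
  have hq0 : q ≠ 0 := fun h => by simp [h] at hq
  have h1 : pd X (fun w : E => ‖w‖) =ᶠ[𝓝 q] fun w => inner ℝ w X / ‖w‖ := by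
    filter_upwards [isOpen_ne.mem_nhds hq0] with w hw
    exact pd_norm hw X
  have hn := (contDiffAt_norm ℝ hq0 (n := 1)).differentiableAt (by norm_num)
  have hi : DifferentiableAt ℝ (fun w : E => inner ℝ w X) q :=
    differentiableAt_id.inner ℝ (differentiableAt_const X)
  rw [(pd_congr h1 X).self_of_nhds]
  refine pd_eq_of_hasDerivAt (by
    simpa only [div_eq_mul_inv] using hi.fun_mul (hn.fun_inv (norm_ne_zero_iff.2 hq0))) ?_
  have h2 := (hasDerivAt_line hi X).div (hasDerivAt_line hn X)
    (by simpa using norm_ne_zero_iff.2 hq0)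
  refine h2.congr_deriv ?_
  have h3 : pd X (fun w : E => inner ℝ w X) q = inner ℝ X X := by
    have : (fun w : E => inner ℝ w X) = fun w => inner ℝ X w := by
      ext; rw [real_inner_comm]
    rw [this, pd_inner_left]
  rw [h3, pd_norm hq0]
  simp [hq, hX]

end Norm

variable {n : ℕ}

lemma rayExt_coe {V : Type*} [Zero V] (f : USphere n → V) (z : USphere n) :
    rayExt f (z : Cn n) = f z := by
  have hz : ‖(z : Cn n)‖ = 1 := by simp
  have h0 : (z : Cn n) ≠ 0 := fun h => by simp [h] at hz
  rw [rayExt, dif_neg h0]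
  congr 1
  ext1
  simp [hz]

lemma rayExt_smul {V : Type*} [Zero V] (f : USphere n → V) {c : ℝ} (hc : 0 < c) (p : Cn n) :
    rayExt f (c • p) = rayExt f p := by
  by_cases hp : p = 0
  · simp [hp]
  · have hcp : c • p ≠ 0 := smul_ne_zero hc.ne' hp
    rw [rayExt, rayExt, dif_neg hcp, dif_neg hp]
    congr 1
    ext1
    simp only [norm_smul, Real.norm_of_nonneg hc.le, smul_smul]
    congr 1
    field_simp

/-- A parametrization of a part of the hypersurface `F` as a radial graph with conformal
radius `f`. -/
structure IsRadialGraphChart (F : USphere n → Cn n) (f : Cn n → ℝ) (ζ : Cn n → Cn n) (q : Cn n)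
    (z : USphere n) : Prop where
  norm_eq : ‖q‖ = 1
  map_eq : ζ q = z
  smooth_map : ContDiffAt ℝ 2 (rayExt F) (z : Cn n)
  smooth_chart : ContDiffAt ℝ 2 ζ q
  smooth_radius : ContDiffAt ℝ 2 f q
  neg : f q < 0
  -- The parameter ζ w is the one whose image lies on the ray through w. Multiplying by ‖w‖ keeps
  -- the relation valid for directions w that are not normalized and avoids a quotient.
  graph : ∀ᶠ w in 𝓝 q, ‖w‖ • rayExt F (ζ w) = geodesicRadius (f w) • w
  tangent : ∀ X, inner ℝ (z : Cn n) (fderiv ℝ ζ q X) = 0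

namespace IsRadialGraphChart

variable {F : USphere n → Cn n} {f : Cn n → ℝ} {ζ : Cn n → Cn n} {q : Cn n} {z : USphere n}
  (h : IsRadialGraphChart F f ζ q z)

include h

lemma apply_eq : F z = geodesicRadius (f q) • q := by
  have := h.graph.self_of_nhds
  rwa [h.norm_eq, one_smul, h.map_eq, rayExt_coe] at this

lemma ne_zero : q ≠ 0 := fun h0 => by have := h.norm_eq; simp [h0] at this

lemma smooth_comp : ContDiffAt ℝ 2 (fun w => rayExt F (ζ w)) q := by
  refine ContDiffAt.comp (g := rayExt F) (f := ζ) q ?_ h.smooth_chart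
  rw [h.map_eq]; exact h.smooth_map

lemma graph_inner (m : Cn n) : (fun w => ‖w‖ * inner ℝ m (rayExt F (ζ w)))
    =ᶠ[𝓝 q] fun w => geodesicRadius (f w) * inner ℝ m w := by
  filter_upwards [h.graph] with w hw
  have := congrArg (fun v => inner ℝ m v) hw
  simpa only [real_inner_smul_right] using this

lemma smooth_geodesicRadius : ContDiffAt ℝ 2 (fun w => geodesicRadius (f w)) q :=
  (contDiffAt_geodesicRadius h.neg).comp q h.smooth_radius

/-- The first derivative of a radial graph. -/
lemma deriv_eq (X : Cn n) : fderiv ℝ (rayExt F) (z : Cn n) (fderiv ℝ ζ q X)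
    = (csinh (f q) * fderiv ℝ f q X) • q + geodesicRadius (f q) • (X - inner ℝ q X • q) := by
  have hc := h.smooth_comp.differentiableAt (by norm_num)
  refine ext_inner_left ℝ fun m => ?_
  have h1 := (pd_congr (h.graph_inner m) X).self_of_nhds
  have hn := (contDiffAt_norm ℝ h.ne_zero (n := 1)).differentiableAt (by norm_num)
  have hG : HasFDerivAt (fun w => inner ℝ m (rayExt F (ζ w)))
      ((innerSL ℝ m).comp ((fderiv ℝ (rayExt F) (z : Cn n)).comp (fderiv ℝ ζ q))) q := by
    have h2 : HasFDerivAt (rayExt F) (fderiv ℝ (rayExt F) (z : Cn n)) (ζ q) := by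
      rw [h.map_eq]; exact (h.smooth_map.differentiableAt (by norm_num)).hasFDerivAt
    exact (innerSL ℝ m).hasFDerivAt.comp q
      (h2.comp q (h.smooth_chart.differentiableAt (by norm_num)).hasFDerivAt)
  rw [pd_mul hn hG.differentiableAt, pd_mul (h.smooth_geodesicRadius.differentiableAt (by norm_num))
    (g := fun w => inner ℝ m w) (innerSL ℝ m).differentiableAt, pd_comp (h.smooth_radius.differentiableAt (by norm_num))
    (hasDerivAt_geodesicRadius h.neg), pd_norm h.ne_zero, pd_inner_left, h.norm_eq, h.map_eq,
    rayExt_coe, h.apply_eq] at h1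
  simp only [pd, hG.fderiv, real_inner_smul_right] at h1
  simp only [inner_add_right, inner_sub_right, real_inner_smul_right]
  simp at h1
  linarith

/-- The second derivative of a radial graph. -/
lemma second_deriv_eq {X : Cn n} (hX : inner ℝ q X = 0) : ∃ W : Cn n,
    fderiv ℝ (fun w : Cn n => fderiv ℝ (rayExt F) w (fderiv ℝ ζ q X)) (z : Cn n) (fderiv ℝ ζ q X)
      + fderiv ℝ (rayExt F) (z : Cn n) W
    = (csinh (f q) * pd X (pd X f) q + csinh (f q) * ccosh (f q) * pd X f q ^ 2
        - geodesicRadius (f q) * inner ℝ X X) • q + (2 * (csinh (f q) * pd X f q)) • X := by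
  have hq0 := h.ne_zero
  have hζ1 : DifferentiableAt ℝ ζ q := h.smooth_chart.differentiableAt (by norm_num)
  have hζ2 : DifferentiableAt ℝ (fun w => fderiv ℝ ζ w X) q :=
    ((h.smooth_chart.fderiv_right (m := 1) (by norm_num)).differentiableAt (by norm_num)).clm_apply
      (differentiableAt_const X)
  have hF2 : DifferentiableAt ℝ (fderiv ℝ (rayExt F)) (z : Cn n) :=
    (h.smooth_map.fderiv_right (m := 1) (by norm_num)).differentiableAt (by norm_num)
  -- W is the second derivative of the chart ζ. Its image under the differential of F is tangent to
  -- the hypersurface, so it disappears after pairing with the normal. Pairing with a constant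
  -- vector m reduces the identity to scalar functions.
  refine ⟨fderiv ℝ (fun w => fderiv ℝ ζ w X) q X, ext_inner_left ℝ fun m => ?_⟩
  set G : Cn n → ℝ := fun w => inner ℝ m (rayExt F (ζ w)) with hG
  have hGs : ContDiffAt ℝ 2 G q := contDiffAt_const.inner ℝ h.smooth_comp
  have hev : pd X G =ᶠ[𝓝 q] fun w => inner ℝ m (fderiv ℝ (rayExt F) (ζ w) (fderiv ℝ ζ w X)) := by
    have e1 : ∀ᶠ w in 𝓝 q, ContDiffAt ℝ 2 (rayExt F) (ζ w) := by
      have : Tendsto ζ (𝓝 q) (𝓝 (z : Cn n)) := by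
        rw [← h.map_eq]; exact h.smooth_chart.continuousAt
      exact this.eventually (h.smooth_map.eventually (by simp))
    filter_upwards [e1, h.smooth_chart.eventually (by simp)] with w h1 h2
    have h3 : HasFDerivAt G ((innerSL ℝ m).comp ((fderiv ℝ (rayExt F) (ζ w)).comp (fderiv ℝ ζ w))) w :=
      (innerSL ℝ m).hasFDerivAt.comp w ((h1.differentiableAt (by norm_num)).hasFDerivAt.comp w
        (h2.differentiableAt (by norm_num)).hasFDerivAt)
    rw [pd, h3.fderiv]
    simp
  have hD : HasFDerivAt (fun w => fderiv ℝ (rayExt F) (ζ w))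
      ((fderiv ℝ (fderiv ℝ (rayExt F)) (z : Cn n)).comp (fderiv ℝ ζ q)) q := by
    have h2 : HasFDerivAt (fderiv ℝ (rayExt F)) (fderiv ℝ (fderiv ℝ (rayExt F)) (z : Cn n)) (ζ q) := by
      rw [h.map_eq]; exact hF2.hasFDerivAt
    exact h2.comp q hζ1.hasFDerivAt
  have hG2 : pd X (pd X G) q = inner ℝ m
      (fderiv ℝ (fun w : Cn n => fderiv ℝ (rayExt F) w (fderiv ℝ ζ q X)) (z : Cn n) (fderiv ℝ ζ q X)
      + fderiv ℝ (rayExt F) (z : Cn n) (fderiv ℝ (fun w => fderiv ℝ ζ w X) q X)) := by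
    rw [(pd_congr hev X).self_of_nhds]
    have h1 := (innerSL ℝ m).hasFDerivAt.comp q (hD.clm_apply hζ2.hasFDerivAt)
    have h2 : fderiv ℝ (fun w : Cn n => fderiv ℝ (rayExt F) w (fderiv ℝ ζ q X)) (z : Cn n)
        (fderiv ℝ ζ q X) = fderiv ℝ (fderiv ℝ (rayExt F)) (z : Cn n) (fderiv ℝ ζ q X)
          (fderiv ℝ ζ q X) := by
      rw [(hF2.hasFDerivAt.clm_apply (hasFDerivAt_const (fderiv ℝ ζ q X) (z : Cn n))).fderiv]
      simp
    rw [pd, show (fun w => inner ℝ m (fderiv ℝ (rayExt F) (ζ w) (fderiv ℝ ζ w X))) =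
      innerSL ℝ m ∘ fun w => fderiv ℝ (rayExt F) (ζ w) (fderiv ℝ ζ w X) from rfl, h1.fderiv, h2]
    simp [h.map_eq, add_comm, inner_add_right]
  rw [← hG2]
  have hR := h.smooth_geodesicRadius
  have hmul := ((pd_congr (pd_congr (h.graph_inner m) X) X)).self_of_nhds
  have hRX : pd X (fun w => geodesicRadius (f w)) =ᶠ[𝓝 q] fun w => csinh (f w) * pd X f w := by
    filter_upwards [h.smooth_radius.eventually (by simp),
      h.smooth_radius.continuousAt.eventually (gt_mem_nhds h.neg)] with w h1 h2
    exact pd_comp (h1.differentiableAt (by norm_num)) (hasDerivAt_geodesicRadius h2) X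
  have hf1 := h.smooth_radius.differentiableAt (by norm_num)
  have hRXX : pd X (pd X fun w => geodesicRadius (f w)) q
      = csinh (f q) * pd X (pd X f) q + csinh (f q) * ccosh (f q) * pd X f q ^ 2 := by
    rw [(pd_congr hRX X).self_of_nhds, pd_mul
      (f := fun w => csinh (f w)) ((hasDerivAt_csinh h.neg).differentiableAt.comp q hf1)
      ((h.smooth_radius.pd (m := 1) (by norm_num) X).differentiableAt (by norm_num)),
      pd_comp hf1 (hasDerivAt_csinh h.neg)]
    ring
  have hlin : pd X (pd X fun w => inner ℝ m w) q = 0 := by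
    have : pd X (fun w : Cn n => inner ℝ m w) = fun _ => inner ℝ m X := by
      ext w; exact pd_inner_left m w X
    rw [this]; simp [pd]
  rw [pd_pd_mul (contDiffAt_norm ℝ hq0) hGs, pd_pd_mul hR (g := fun w => inner ℝ m w)
    (innerSL ℝ m).contDiff.contDiffAt, pd_pd_norm h.norm_eq hX,
    pd_norm hq0, hX, hRXX, hRX.self_of_nhds, hlin, pd_inner_left, h.norm_eq] at hmul
  have hGq : G q = geodesicRadius (f q) * inner ℝ m q := by
    simp only [hG, h.map_eq, rayExt_coe, h.apply_eq, real_inner_smul_right]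
  rw [hGq] at hmul
  simp only [inner_add_right, real_inner_smul_right]
  linarith

end IsRadialGraphChart

end GraphCharts

/-! ### Time slices, basis sums and the algebra of the curvature formula. -/

noncomputable section GraphMeanCurvature

open Filter Topology Set

lemma fderiv_radial_eq_zero {E V : Type*} [NormedAddCommGroup E] [NormedSpace ℝ E]
    [NormedAddCommGroup V] [NormedSpace ℝ V] {f : E → V} {p : E} (hf : DifferentiableAt ℝ f p)
    (h : ∀ c : ℝ, 0 < c → f (c • p) = f p) : fderiv ℝ f p p = 0 := by
  have h1 : HasDerivAt (fun s : ℝ => s • p) p 1 := by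
    simpa using (hasDerivAt_id (1 : ℝ)).smul_const p
  have h2 : HasFDerivAt f (fderiv ℝ f p) ((1 : ℝ) • p) := by rw [one_smul]; exact hf.hasFDerivAt
  have h3 := h2.comp_hasDerivAt (1 : ℝ) h1
  refine h3.unique ((hasDerivAt_const (1 : ℝ) (f p)).congr_of_eventuallyEq ?_)
  filter_upwards [lt_mem_nhds one_pos] with s hs
  exact h s hs

section Slice

variable {E : Type*} [NormedAddCommGroup E] [InnerProductSpace ℝ E] {φ : ℝ × E → ℝ} {x : ℝ × E}

lemma fderiv_slice {V : Type*} [NormedAddCommGroup V] [NormedSpace ℝ V] {φ : ℝ × E → V}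
    (hφ : DifferentiableAt ℝ φ x) (X : E) :
    fderiv ℝ (fun w => φ (x.1, w)) x.2 X = fderiv ℝ φ x ((0 : ℝ), X) := by
  have h1 : HasFDerivAt (fun w : E => (x.1, w)) (ContinuousLinearMap.inr ℝ ℝ E) x.2 :=
    hasFDerivAt_prodMk_right x.1 x.2
  have h2 : HasFDerivAt φ (fderiv ℝ φ x) (x.1, x.2) := hφ.hasFDerivAt
  have h3 := h2.comp x.2 h1
  rw [show (fun w => φ (x.1, w)) = φ ∘ fun w : E => (x.1, w) from rfl, h3.fderiv]
  simp

lemma pd_pd_slice (hφ : ContDiffAt ℝ 2 φ x) (X : E) :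
    pd X (pd X fun w => φ (x.1, w)) x.2 = spHess φ x X X := by
  have hev : ∀ᶠ w in 𝓝 x.2, DifferentiableAt ℝ φ (x.1, w) := by
    have h1 : Tendsto (fun w : E => (x.1, w)) (𝓝 x.2) (𝓝 x) :=
      (Continuous.prodMk_right x.1).tendsto x.2
    exact (h1.eventually (hφ.eventually (by simp))).mono fun w hw =>
      hw.differentiableAt (by norm_num)
  have h2 : pd X (fun w => φ (x.1, w)) =ᶠ[𝓝 x.2] fun w => pd ((0 : ℝ), X) φ (x.1, w) :=
    hev.mono fun w hw => fderiv_slice (x := (x.1, w)) hw X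
  rw [(pd_congr h2 X).self_of_nhds, spHess_apply hφ]
  exact fderiv_slice ((hφ.pd (m := 1) (by norm_num) _).differentiableAt (by norm_num)) X

end Slice

variable {n : ℕ} {ι : Type*} [Fintype ι] (b : OrthonormalBasis ι ℝ (Cn n))

lemma sum_inner_mul_basis (v w : Cn n) : ∑ i, inner ℝ v (b i) * inner ℝ w (b i) = inner ℝ v w := by
  rw [← b.sum_inner_mul_inner v w]
  exact Finset.sum_congr rfl fun i _ => by rw [real_inner_comm w]

lemma sum_inner_smul_basis (v : Cn n) : ∑ i, inner ℝ v (b i) • b i = v := by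
  conv_rhs => rw [← b.sum_repr v]
  exact Finset.sum_congr rfl fun i _ => by rw [b.repr_apply_apply, real_inner_comm]

include b in
lemma card_basis : (Fintype.card ι : ℝ) = 2 * n := by
  have h1 : Module.finrank ℝ (Cn n) = 2 * n := by
    rw [← Module.finrank_mul_finrank ℝ ℂ (Cn n), Complex.finrank_real_complex]
    simp
  rw [← Module.finrank_eq_card_basis b.toBasis, h1]
  push_cast
  ring

/-- The algebra behind the formula for the mean curvature of a radial graph. -/
lemma graph_curvature_algebra {n L C P τ m Δ Hii Hpi Hpp : ℝ} (hL : 0 < L) (hC : 0 < C)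
    (hCL : C ^ 2 = 1 + L ^ 2) (hm : m ^ 2 * (1 + P - L ^ 2 / C ^ 2 * τ ^ 2) = 1) :
    (-Δ + C * P + C * (2 * n - 1) + 2 * L ^ 2 * C + 2 * (L ^ 2 / C) * τ ^ 2)
      - L ^ 2 / C ^ 2 * (-Hii + C * τ ^ 2 + C + 2 * L ^ 2 * C + 2 * (L ^ 2 / C) * τ * τ)
      - m ^ 2 * (-(Hpp - 2 * (L ^ 2 / C ^ 2) * τ * Hpi + (L ^ 2 / C ^ 2) ^ 2 * τ ^ 2 * Hii)
        + C * (P - L ^ 2 / C ^ 2 * τ ^ 2) ^ 2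
        + C * (P - 2 * (L ^ 2 / C ^ 2) * τ ^ 2 + (L ^ 2 / C ^ 2) ^ 2 * τ ^ 2)
        + 2 * L ^ 2 * C * (τ - L ^ 2 / C ^ 2 * τ) ^ 2
        + 2 * (L ^ 2 / C) * τ * (τ - L ^ 2 / C ^ 2 * τ) * (P - L ^ 2 / C ^ 2 * τ ^ 2))
      = (2 * n - 1) * C + L ^ 2 / C - Δ + L ^ 2 / C ^ 2 * Hii
        + m ^ 2 * (τ ^ 2 * (L ^ 2 / C ^ 3) + Hpp - 2 * (L ^ 2 / C ^ 2) * τ * Hpi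
          + (L ^ 2 / C ^ 2) ^ 2 * τ ^ 2 * Hii) := by
  set κ := L ^ 2 / C ^ 2 with hκ
  have hκ1 : 1 - κ = 1 / C ^ 2 := by rw [hκ]; field_simp; linarith
  have hLκ : L ^ 2 = κ * C ^ 2 := by rw [hκ]; field_simp
  have hC2 : C ^ 2 * (1 - κ) = 1 := by rw [hκ1]; field_simp
  have e1 : L ^ 2 / C = κ * C := by rw [hLκ]; field_simp
  have e2 : L ^ 2 / C ^ 3 = κ / C := by rw [hLκ]; field_simp
  have e3 : κ / C = κ * C * (1 - κ) := by rw [hκ1]; field_simp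
  rw [e1, e2, e3, hLκ]
  linear_combination (2 * κ * C - 2 * m ^ 2 * κ * C * τ ^ 2 * (1 - κ)) * hC2
    - C * (P - κ * τ ^ 2 + 2 * κ * τ ^ 2 * (1 - κ)) * hm

end GraphMeanCurvature

/-! ### Geometry of an oriented graph chart. -/

noncomputable section GraphGeometry

open Filter Topology Set

section Homogeneous

variable {E : Type*} [NormedAddCommGroup E] [InnerProductSpace ℝ E] {φ : ℝ × E → ℝ} {x : ℝ × E}
  (hom : ∀ (t : ℝ) (q : E) (c : ℝ), 0 < c → φ (t, c • q) = φ (t, q))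

include hom

lemma pd_radial_eq_zero (hφ : DifferentiableAt ℝ φ x) : pd ((0 : ℝ), x.2) φ x = 0 := by
  have h1 := hasDerivAt_line hφ ((0 : ℝ), x.2)
  have h2 : ∀ᶠ s in 𝓝 (0 : ℝ), φ (x + s • ((0 : ℝ), x.2)) = φ x := by
    filter_upwards [lt_mem_nhds (show (-1 : ℝ) < 0 by norm_num)] with s hs
    have := hom x.1 x.2 (1 + s) (by linarith)
    rw [add_smul, one_smul] at this
    simpa [Prod.add_def] using this
  exact h1.unique ((hasDerivAt_const (0 : ℝ) (φ x)).congr_of_eventuallyEq h2)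

/-- The identity map as W gives the Euler field; differentiating Euler's relation once more along
the radial direction gives the claim. It removes the radial contribution when the trace on the
sphere is compared with the full Laplacian. -/
lemma spHess_radial_eq_zero (hφ : ContDiffAt ℝ 2 φ x) : spHess φ x x.2 x.2 = 0 := by
  have h1 : rotD 0 (ContinuousLinearMap.id ℝ E) φ =ᶠ[𝓝 x] fun _ => (0 : ℝ) :=
    (hφ.eventually (by simp)).mono fun y hy =>
      pd_radial_eq_zero hom (hy.differentiableAt (by norm_num))
  have h2 := pd_rotD hφ 0 (ContinuousLinearMap.id ℝ E) ((0 : ℝ), x.2)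
  rw [(pd_congr h1 _).self_of_nhds] at h2
  have h3 : pd ((0 : ℝ), x.2) (fun _ : ℝ × E => (0 : ℝ)) x = 0 := by simp [pd]
  rw [h3] at h2
  simp only [ContinuousLinearMap.id_apply, pd_radial_eq_zero hom
    (hφ.differentiableAt (by norm_num)), add_zero] at h2
  rw [spHess_apply hφ]
  exact h2.symm

end Homogeneous

variable {n : ℕ} {ι : Type*} [Fintype ι] (b : OrthonormalBasis ι ℝ (Cn n))

/-- A radial graph chart with a unit normal, at a point where the normal points outward. -/
structure IsOrientedGraphChart (F N : USphere n → Cn n) (φ : ℝ × Cn n → ℝ) (ζ : Cn n → Cn n)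
    (x : ℝ × Cn n) (z : USphere n) : Prop where
  chart : IsRadialGraphChart F (fun w => φ (x.1, w)) ζ x.2 z
  smooth : ContDiffAt ℝ 2 φ x
  homogeneous : ∀ (t : ℝ) (q : Cn n) (c : ℝ), 0 < c → φ (t, c • q) = φ (t, q)
  unit : bergmanMetric (F z) (N z) (N z) = 1
  normal : ∀ X ∈ sphereTangent z, bergmanMetric (F z) (sphereDeriv F z X) (N z) = 0
  radial : ∀ c : ℝ, 0 < c → rayExt F (c • (z : Cn n)) = rayExt F (z : Cn n)
  outward : 0 < inner ℝ x.2 (N z)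

namespace IsOrientedGraphChart

variable {b} {F N : USphere n → Cn n} {φ : ℝ × Cn n → ℝ} {ζ : Cn n → Cn n} {x : ℝ × Cn n}
  {z : USphere n} (h : IsOrientedGraphChart F N φ ζ x z)

lemma mem_sphereTangent {z : USphere n} {X : Cn n} :
    X ∈ sphereTangent z ↔ inner ℝ (z : Cn n) X = 0 :=
  Submodule.mem_orthogonal_singleton_iff_inner_right

include h

lemma differentiable : DifferentiableAt ℝ φ x := h.smooth.differentiableAt (by norm_num)

lemma neg : φ x < 0 := h.chart.neg

lemma position : F z = geodesicRadius (φ x) • x.2 := h.chart.apply_eq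

lemma inner_spGrad_radial : inner ℝ x.2 (spGrad b φ x) = 0 := by
  rw [real_inner_comm, inner_spGrad, pd_radial_eq_zero h.homogeneous h.differentiable]

lemma sphereDeriv_eq {X : Cn n} (hX : inner ℝ x.2 X = 0) : sphereDeriv F z (fderiv ℝ ζ x.2 X)
    = (csinh (φ x) * inner ℝ (spGrad b φ x) X) • x.2 + geodesicRadius (φ x) • X := by
  rw [sphereDeriv, h.chart.deriv_eq, fderiv_slice h.differentiable, hX, zero_smul, sub_zero,
    inner_spGrad]
  rfl

/-- The extension of F is constant on rays, so its differential sees only the tangential part of W.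
-/
lemma normal_deriv (W : Cn n) : bergmanMetric (F z) (fderiv ℝ (rayExt F) (z : Cn n) W) (N z) = 0 := by
  have hF : F z ≠ 0 := by
    rw [h.position]
    exact smul_ne_zero_of_norm_eq_one h.chart.norm_eq (geodesicRadius_pos h.neg)
  have h1 : fderiv ℝ (rayExt F) (z : Cn n) W
      = sphereDeriv F z (W - inner ℝ (z : Cn n) W • (z : Cn n)) := by
    rw [sphereDeriv, map_sub, map_smul, fderiv_radial_eq_zero
      (h.chart.smooth_map.differentiableAt (by norm_num)) h.radial, smul_zero, sub_zero]
  rw [h1]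
  refine h.normal _ (mem_sphereTangent.2 ?_)
  rw [inner_sub_right, real_inner_smul_right, real_inner_self_eq_norm_sq]
  simp

lemma tangent_normal (X : Cn n) (hX : inner ℝ x.2 X = 0) :
    bergmanMetric (geodesicRadius (φ x) • x.2)
      ((csinh (φ x) * inner ℝ (spGrad b φ x) X) • x.2 + geodesicRadius (φ x) • X) (N z) = 0 := by
  rw [← h.sphereDeriv_eq hX, ← h.position]
  exact h.normal_deriv _

lemma normal_eq : N z = inner ℝ x.2 (N z) • (x.2 - (geodesicRadius (φ x) / csinh (φ x)) •
      graphCovector x.2 (spGrad b φ x) (csinh (φ x) ^ 2 / ccosh (φ x) ^ 2)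
        (inner ℝ (spGrad b φ x) (mulI n x.2))) ∧
    inner ℝ x.2 (N z) ^ 2 * slopeSq b (mulI n) φ x = 1 := by
  have hy := h.neg
  have h1 := graph_normal_eq h.chart.norm_eq (geodesicRadius_pos hy)
    (sinh_geodesicRadius (φ x)).symm (ccosh_pos hy) (csinh_pos hy) (ccosh_sq hy)
    (h.inner_spGrad_radial (b := b)) rfl rfl h.tangent_normal (by rw [← h.position]; exact h.unit)
  refine ⟨h1.1, ?_⟩
  rw [slopeSq, ← inner_spGrad_spGrad, rotD_eq_pd, ← inner_spGrad b, ctanhSq]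
  exact h1.2

/-- Pairing the normal formula with the Hopf direction expresses the Hopf derivative of φ through F
and N alone. In particular it vanishes exactly when the normal is Euclidean orthogonal to the Hopf
field. -/
lemma rotD_eq : rotD 0 (mulI n) φ x = -(csinh (φ x) * ccosh (φ x) ^ 2 / geodesicRadius (φ x)
    * inner ℝ (mulI n x.2) (N z) / inner ℝ x.2 (N z)) := by
  have hy := h.neg
  have h1 := (h.normal_eq (b := stdOrthonormalBasis ℝ (Cn n))).1
  set p := spGrad (stdOrthonormalBasis ℝ (Cn n)) φ x with hp
  have h2 := congrArg (fun v => inner ℝ (mulI n x.2) v) h1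
  have h3 : inner ℝ (mulI n x.2) (mulI n x.2) = 1 := by
    rw [real_inner_self_eq_norm_sq, norm_mulI, h.chart.norm_eq, one_pow]
  simp only [graphCovector, inner_sub_right, real_inner_smul_right, inner_mulI_self, h3,
    real_inner_comm p (mulI n x.2)] at h2
  rw [rotD_eq_pd, ← inner_spGrad (stdOrthonormalBasis ℝ (Cn n)), ← hp, h2]
  have e1 := (csinh_pos hy).ne'
  have e2 := (ccosh_pos hy).ne'
  have e3 := (geodesicRadius_pos hy).ne'
  have e4 := h.outward.ne'
  have e5 := ccosh_sq hy
  field_simp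
  rw [e5]
  ring

lemma fderiv_injective {X : Cn n} (hX : inner ℝ x.2 X = 0) (h0 : fderiv ℝ ζ x.2 X = 0) : X = 0 := by
  have h1 := h.sphereDeriv_eq (b := stdOrthonormalBasis ℝ (Cn n)) hX
  rw [h0, sphereDeriv, map_zero] at h1
  have h2 := congrArg (fun v => inner ℝ X v) h1
  simp only [inner_zero_right, inner_add_right, real_inner_smul_right, real_inner_comm x.2 X, hX,
    mul_zero, zero_add] at h2
  exact inner_self_eq_zero.1 ((mul_eq_zero.1 h2.symm).resolve_left (geodesicRadius_pos h.neg).ne')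

/-- The differential of the chart is injective between tangent spaces of equal dimension. -/
lemma fderiv_surjective {Y : Cn n} (hY : Y ∈ sphereTangent z) :
    ∃ X, inner ℝ x.2 X = 0 ∧ fderiv ℝ ζ x.2 X = Y := by
  let q : USphere n := ⟨x.2, by simp [h.chart.norm_eq]⟩
  let A : sphereTangent q →ₗ[ℝ] sphereTangent z :=
    ((fderiv ℝ ζ x.2).toLinearMap.comp (sphereTangent q).subtype).codRestrict (sphereTangent z)
      fun X => mem_sphereTangent.2 (h.chart.tangent _)
  have hA : Function.Injective A := by
    refine (injective_iff_map_eq_zero A).2 fun X hX => ?_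
    refine Subtype.ext (h.fderiv_injective (mem_sphereTangent.1 X.2) ?_)
    exact congrArg Subtype.val hX
  have hdim : ∀ w : USphere n, Module.finrank ℝ (sphereTangent w) + 1 = Module.finrank ℝ (Cn n) := by
    intro w
    have hw : (w : Cn n) ≠ 0 := fun h0 => by
      have : ‖(w : Cn n)‖ = 1 := by simp
      simp [h0] at this
    have := (Submodule.span ℝ {(w : Cn n)}).finrank_add_finrank_orthogonal
    rw [finrank_span_singleton hw, add_comm] at this
    exact this
  obtain ⟨X, hX⟩ := (LinearMap.injective_iff_surjective_of_finrank_eq_finrank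
    (by have := hdim q; have := hdim z; omega)).1 hA ⟨Y, hY⟩
  exact ⟨X, mem_sphereTangent.1 X.2, congrArg Subtype.val hX⟩

lemma inducedMetric_eq {X Y : Cn n} (hX : inner ℝ x.2 X = 0) (hY : inner ℝ x.2 Y = 0) :
    inducedMetric F z (fderiv ℝ ζ x.2 X) (fderiv ℝ ζ x.2 Y)
      = csinh (φ x) ^ 2 * (inner ℝ (spGrad b φ x) X * inner ℝ (spGrad b φ x) Y + inner ℝ X Y
        + csinh (φ x) ^ 2 * (inner ℝ (mulI n x.2) X * inner ℝ (mulI n x.2) Y)) := by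
  have hr := geodesicRadius_pos h.neg
  have h3 : inner ℝ x.2 x.2 = (1 : ℝ) := by rw [real_inner_self_eq_norm_sq, h.chart.norm_eq, one_pow]
  rw [inducedMetric, h.sphereDeriv_eq (b := b) hX, h.sphereDeriv_eq (b := b) hY, h.position,
    bergmanMetric_smul_unit h.chart.norm_eq hr (sinh_geodesicRadius _).symm]
  simp only [inner_add_left, inner_add_right, real_inner_smul_left, real_inner_smul_right, h3, hX,
    hY, real_inner_comm x.2 X, inner_mulI_self]
  field_simp
  ring

/-- The correction vector W of `second_deriv_eq` is annihilated by the normal, so the chart enters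
only through the Hessian of the conformal radius. -/
lemma secondForm_eq {X : Cn n} (hX : inner ℝ x.2 X = 0) {L C τ f η : ℝ} (hL : L = csinh (φ x))
    (hC : C = ccosh (φ x)) (hτ : τ = inner ℝ (spGrad b φ x) (mulI n x.2))
    (hf : f = inner ℝ (spGrad b φ x) X) (hη : η = inner ℝ (mulI n x.2) X) :
    secondFundamentalForm F N z (fderiv ℝ ζ x.2 X) (fderiv ℝ ζ x.2 X)
      = inner ℝ x.2 (N z) * L * (-spHess φ x X X + C * f ^ 2 + C * inner ℝ X X
        + 2 * L ^ 2 * C * η ^ 2 + 2 * (L ^ 2 / C) * τ * η * f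
        + 2 * L ^ 2 * η * inner ℝ (spGrad b φ x) (mulI n X)) := by
  have hy := h.neg
  have hr := geodesicRadius_pos hy
  have hne : F z ≠ 0 := by
    rw [h.position]; exact smul_ne_zero_of_norm_eq_one h.chart.norm_eq hr
  obtain ⟨W, hW⟩ := h.chart.second_deriv_eq hX
  have hp := h.inner_spGrad_radial (b := b)
  have hpf : pd X (fun w => φ (x.1, w)) x.2 = f := by
    rw [hf, inner_spGrad]; exact fderiv_slice h.differentiable X
  rw [pd_pd_slice h.smooth, hpf, Prod.mk.eta] at hW
  obtain ⟨hN, -⟩ := h.normal_eq (b := b)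
  generalize hm : inner ℝ x.2 (N z) = m at hN ⊢
  set Z := fderiv ℝ (fun w : Cn n => fderiv ℝ (rayExt F) w (fderiv ℝ ζ x.2 X)) (z : Cn n)
    (fderiv ℝ ζ x.2 X) with hZ
  have h1 : bergmanMetric (F z) Z (N z) = m * (L * spHess φ x X X + L * C * f ^ 2
      - geodesicRadius (φ x) * inner ℝ X X - 2 * L ^ 2 * f ^ 2 / geodesicRadius (φ x)) := by
    have h2 := bergmanMetric_add_left hne Z (fderiv ℝ (rayExt F) (z : Cn n) W) (N z)
    rw [h.normal_deriv, add_zero] at h2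
    rw [← h2, hW, hN]
    have h3 := fun V => bergmanMetric_graph_normal h.chart.norm_eq hr (sinh_geodesicRadius _).symm
      (ccosh_pos hy) (csinh_pos hy) (ccosh_sq hy) hp rfl (m) V
    rw [h.position, h3]
    have h4 : inner ℝ x.2 x.2 = (1 : ℝ) := by
      rw [real_inner_self_eq_norm_sq, h.chart.norm_eq, one_pow]
    simp only [inner_add_right, real_inner_smul_right, hX, h4, real_inner_comm x.2 (spGrad b φ x), hp,
      ← hf, ← hL, ← hC]
    rw [hL]
    field_simp
    ring
  have h5 := graph_second_form h.chart.norm_eq hr (hL.trans (sinh_geodesicRadius _).symm)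
    (hC.trans (cosh_geodesicRadius hy).symm) hp hτ (m) hX (spHess φ x X X) hf hη
  rw [secondFundamentalForm, ← hZ, h1, ← h5, h.sphereDeriv_eq (b := b) hX, ← hf, ← hL]
  rw [h.position, hN, ← hL, ← hC, ← hτ]

end IsOrientedGraphChart

end GraphGeometry

/-! ### The mean curvature of a radial graph. -/

noncomputable section GraphMeanCurvatureFormula

open Filter Topology Set

variable {n : ℕ} {ι : Type*} [Fintype ι] (b : OrthonormalBasis ι ℝ (Cn n))

lemma sum_inner_sub_radial {q w : Cn n} (hw : inner ℝ q w = 0) :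
    ∑ i, inner ℝ w (b i - inner ℝ q (b i) • q) • (b i - inner ℝ q (b i) • q) = w := by
  have h1 : ∀ i, inner ℝ w (b i - inner ℝ q (b i) • q) = inner ℝ w (b i) := fun i => by
    rw [inner_sub_right, real_inner_smul_right, real_inner_comm q w, hw, mul_zero, sub_zero]
  simp only [h1, smul_sub, Finset.sum_sub_distrib, smul_smul, ← Finset.sum_smul]
  rw [sum_inner_smul_basis, sum_inner_mul_basis, real_inner_comm, hw, zero_smul, sub_zero]

namespace IsOrientedGraphChart

variable {b} {F N : USphere n → Cn n} {φ : ℝ × Cn n → ℝ} {ζ : Cn n → Cn n} {x : ℝ × Cn n}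
  {z : USphere n} (h : IsOrientedGraphChart F N φ ζ x z)

include h

/-- On directions orthogonal to q the induced metric is L²(σ + L² η ⊗ η + dφ ⊗ dφ), two rank one
perturbations of the round metric. Applying the Sherman–Morrison formula twice, its inverse is L⁻²(1
- κ ξ ⊗ ξ - m² Y ⊗ Y) with Y = p - κτ ξ and m² = 1/V². The trace of the second fundamental form is
taken in this frame. -/
lemma meanCurvature_eq : meanCurvature F N z * csinh (φ x) * inner ℝ x.2 (N z)
    = graphCurv b (mulI n) n φ x := by
  have hy := h.neg
  set q := x.2 with hq
  have hq1 : ‖q‖ = 1 := h.chart.norm_eq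
  set p := spGrad b φ x with hp
  set L := csinh (φ x) with hL
  set C := ccosh (φ x) with hC
  have hL0 : 0 < L := csinh_pos hy
  have hC0 : 0 < C := ccosh_pos hy
  have hCL : C ^ 2 = 1 + L ^ 2 := ccosh_sq hy
  set τ := inner ℝ p (mulI n q) with hτ
  set P := inner ℝ p p with hP
  set m := inner ℝ q (N z) with hm
  set κ := L ^ 2 / C ^ 2 with hκ
  set B := spHess φ x with hB
  have hκL : L ^ 2 * (1 - κ) = κ := by
    rw [hκ]; field_simp; rw [hCL]; ring
  have hF : F z ≠ 0 := by
    rw [h.position]; exact smul_ne_zero_of_norm_eq_one hq1 (geodesicRadius_pos hy)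
  have g1 : inner ℝ q (mulI n q) = 0 := by rw [real_inner_comm, inner_mulI_self]
  have g2 : inner ℝ (mulI n q) (mulI n q) = 1 := by
    rw [real_inner_self_eq_norm_sq, norm_mulI, hq1, one_pow]
  have g3 : inner ℝ q q = 1 := by rw [real_inner_self_eq_norm_sq, hq1, one_pow]
  have g4 : inner ℝ (mulI n q) p = τ := by rw [hτ, real_inner_comm]
  have g5 : inner ℝ q p = 0 := h.inner_spGrad_radial
  have g6 : inner ℝ p (mulI n p) = 0 := by rw [real_inner_comm, inner_mulI_self]
  have g7 : inner ℝ p q = 0 := by rw [real_inner_comm, g5]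
  have hrot : rotD 0 (mulI n) φ x = τ := by rw [rotD_eq_pd, ← inner_spGrad b]
  have hv : slopeSq b (mulI n) φ x = 1 + P - κ * τ ^ 2 := by
    rw [slopeSq, ← inner_spGrad_spGrad, hrot, ctanhSq]
  have hmv : m ^ 2 * (1 + P - κ * τ ^ 2) = 1 := by rw [← hv]; exact h.normal_eq.2
  set Y := p - (κ * τ) • mulI n q with hY
  have y0 : inner ℝ q Y = 0 := by
    simp only [hY, inner_sub_right, real_inner_smul_right, g5, g1, mul_zero, sub_zero]
  have y1 : inner ℝ p Y = P - κ * τ ^ 2 := by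
    simp only [hY, inner_sub_right, real_inner_smul_right, ← hτ, ← hP]; ring
  have y2 : inner ℝ (mulI n q) Y = τ - κ * τ := by
    simp only [hY, inner_sub_right, real_inner_smul_right, g2, g4]; ring
  have y3 : inner ℝ Y Y = P - 2 * κ * τ ^ 2 + κ ^ 2 * τ ^ 2 := by
    rw [show inner ℝ Y Y = inner ℝ (p - (κ * τ) • mulI n q) Y by rw [← hY], inner_sub_left,
      real_inner_smul_left, y1, y2]
    ring
  have y4 : inner ℝ p (mulI n Y) = 0 := by
    simp only [hY, map_sub, map_smul, mulI_mulI, inner_sub_right, real_inner_smul_right, g6,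
      inner_neg_right, g7]
    ring
  let X : ι → Cn n := fun i => b i - inner ℝ q (b i) • q
  have hX : ∀ i, inner ℝ q (X i) = 0 := fun i => by
    simp only [X, inner_sub_right, real_inner_smul_right, g3]; ring
  -- The frame consists of the orthonormal basis projected to the tangent space, followed by the two
  -- correction vectors ξ and Y with negative or zero weights.
  let xs : ι ⊕ Bool → Cn n := Sum.elim X fun s => if s then mulI n q else Y
  let cs : ι ⊕ Bool → ℝ := Sum.elim (fun _ => (L ^ 2)⁻¹)
    fun s => if s then -κ * (L ^ 2)⁻¹ else -m ^ 2 * (L ^ 2)⁻¹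
  have hxs : ∀ a, inner ℝ q (xs a) = 0 := by
    rintro (i | s | s)
    · exact hX i
    · exact y0
    · exact g1
  have key := meanCurvature_eq_sum (N := N) hF h.chart.smooth_map cs
    (fun a => fderiv ℝ ζ q (xs a)) (fun a => mem_sphereTangent.2 (h.chart.tangent _)) (by
      intro V hV
      obtain ⟨U, hU, hUV⟩ := h.fderiv_surjective hV
      rw [← hq] at hU hUV
      have hind : ∀ a, inducedMetric F z (fderiv ℝ ζ q (xs a)) V
          = L ^ 2 * (inner ℝ p (xs a) * inner ℝ p U + inner ℝ (xs a) U
            + L ^ 2 * (inner ℝ (mulI n q) (xs a) * inner ℝ (mulI n q) U)) := by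
        intro a
        rw [← hUV]
        exact h.inducedMetric_eq (hxs a) hU
      simp only [hind]
      rw [← hUV]
      simp only [← map_smul, ← map_sum]
      congr 1
      rw [Fintype.sum_sum_type, Fintype.sum_bool]
      simp only [cs, xs, Sum.elim_inl, Sum.elim_inr, if_true, Bool.false_eq_true, if_false,
        y1, y2, g2, ← hτ]
      set f := inner ℝ p U with hf
      set η := inner ℝ (mulI n q) U with hη
      have w0 : inner ℝ q (f • p + U + (L ^ 2 * η) • mulI n q) = 0 := by
        simp only [inner_add_right, real_inner_smul_right, g5, g1, hU, mul_zero, add_zero]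
      have hs := sum_inner_sub_radial b w0
      have e1 : ∀ i, (L ^ 2)⁻¹ * (L ^ 2 * (inner ℝ p (X i) * f + inner ℝ (X i) U
          + L ^ 2 * (inner ℝ (mulI n q) (X i) * η)))
          = inner ℝ (f • p + U + (L ^ 2 * η) • mulI n q) (X i) := by
        intro i
        simp only [inner_add_left, real_inner_smul_left, real_inner_comm (X i) U]
        field_simp
      simp only [e1, X]
      have y5 : inner ℝ Y U = f - κ * τ * η := by
        simp only [hY, inner_sub_left, real_inner_smul_left, ← hf, ← hη]
      have e2 : -κ * (L ^ 2)⁻¹ * (L ^ 2 * (τ * f + η + L ^ 2 * (1 * η)))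
          = -(κ * τ * f) - L ^ 2 * η := by
        have : κ * (1 + L ^ 2) = L ^ 2 := by rw [← hCL, hκ]; field_simp
        field_simp
        linear_combination -η * this
      have e3 : -m ^ 2 * (L ^ 2)⁻¹ * (L ^ 2 * ((P - κ * τ ^ 2) * f + inner ℝ Y U
          + L ^ 2 * ((τ - κ * τ) * η))) = -f := by
        rw [y5]
        field_simp
        linear_combination -f * hmv - m ^ 2 * τ * η * hκL
      rw [hs, e2, e3, hY]
      module)
  have hsf : ∀ a, secondFundamentalForm F N z (fderiv ℝ ζ q (xs a)) (fderiv ℝ ζ q (xs a))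
      = m * L * (-B (xs a) (xs a) + C * inner ℝ p (xs a) ^ 2 + C * inner ℝ (xs a) (xs a)
        + 2 * L ^ 2 * C * inner ℝ (mulI n q) (xs a) ^ 2
        + 2 * (L ^ 2 / C) * τ * inner ℝ (mulI n q) (xs a) * inner ℝ p (xs a)
        + 2 * L ^ 2 * inner ℝ (mulI n q) (xs a) * inner ℝ p (mulI n (xs a))) := fun a =>
    h.secondForm_eq (b := b) (hxs a) hL hC hτ rfl rfl
  simp only [hsf] at key
  rw [Fintype.sum_sum_type, Fintype.sum_bool] at key
  simp only [cs, xs, Sum.elim_inl, Sum.elim_inr, if_true, Bool.false_eq_true, if_false, y1, y2, y3,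
    y4, g2, ← hτ, mulI_mulI, inner_neg_right, g7] at key
  -- Projecting the basis alters the trace of the Hessian by multiples of Hess φ(q, q) only, which
  -- is zero, so the full Laplacian appears. The projected basis contributes 2n - 1 to the trace of
  -- the identity.
  have hlap : ∑ i, (-B (X i) (X i) + C * inner ℝ p (X i) ^ 2 + C * inner ℝ (X i) (X i)
        + 2 * L ^ 2 * C * inner ℝ (mulI n q) (X i) ^ 2
        + 2 * (L ^ 2 / C) * τ * inner ℝ (mulI n q) (X i) * inner ℝ p (X i)
        + 2 * L ^ 2 * inner ℝ (mulI n q) (X i) * inner ℝ p (mulI n (X i)))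
      = -laplace b φ x + C * P + C * (2 * n - 1) + 2 * L ^ 2 * C + 2 * (L ^ 2 / C) * τ ^ 2 := by
    have f1 : ∀ i, inner ℝ p (X i) = inner ℝ p (b i) := fun i => by
      simp only [X, inner_sub_right, real_inner_smul_right, g7, mul_zero, sub_zero]
    have f2 : ∀ i, inner ℝ (mulI n q) (X i) = inner ℝ (mulI n q) (b i) := fun i => by
      simp only [X, inner_sub_right, real_inner_smul_right, inner_mulI_self, mul_zero, sub_zero]
    have f3 : ∀ i, inner ℝ (X i) (X i) = 1 - inner ℝ q (b i) * inner ℝ q (b i) := fun i => by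
      have : inner ℝ (b i) (b i) = (1 : ℝ) := by
        rw [real_inner_self_eq_norm_sq, b.orthonormal.1 i, one_pow]
      simp only [X, inner_sub_right, inner_sub_left, real_inner_smul_right, real_inner_smul_left, g3,
        this, real_inner_comm q (b i)]
      ring
    have f4 : ∀ i, inner ℝ p (mulI n (X i)) = -inner ℝ (mulI n p) (b i) - τ * inner ℝ q (b i) :=
      fun i => by
        simp only [X, map_sub, map_smul, inner_sub_right, real_inner_smul_right, ← hτ,
          inner_mulI_left]
        ring
    have f5 : ∀ i, B (X i) (X i) = B (b i) (b i) - 2 * (inner ℝ q (b i) * B (b i) q)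
        + inner ℝ q (b i) * inner ℝ q (b i) * B q q := fun i => by
      have : B q (b i) = B (b i) q := spHess_comm h.smooth _ _
      simp only [X, map_sub, map_smul, LinearMap.sub_apply, LinearMap.smul_apply, smul_eq_mul, this]
      ring
    have hBq : B q q = 0 := spHess_radial_eq_zero h.homogeneous h.smooth
    have f6 : ∑ i, inner ℝ q (b i) * B (b i) q = B q q := by
      have := congrArg (fun v => B v q) (sum_inner_smul_basis b q)
      simpa only [map_sum, map_smul, LinearMap.sum_apply, LinearMap.smul_apply, smul_eq_mul] using this
    have f7 : inner ℝ (mulI n q) (mulI n p) = 0 := by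
      rw [inner_mulI_left, mulI_mulI, inner_neg_right, g5, neg_zero, neg_zero]
    calc _ = ∑ i, (-B (b i) (b i) + 2 * (inner ℝ q (b i) * B (b i) q)
          + C * (inner ℝ p (b i) * inner ℝ p (b i)) + C * 1
          - C * (inner ℝ q (b i) * inner ℝ q (b i))
          + 2 * L ^ 2 * C * (inner ℝ (mulI n q) (b i) * inner ℝ (mulI n q) (b i))
          + 2 * (L ^ 2 / C) * τ * (inner ℝ (mulI n q) (b i) * inner ℝ p (b i))
          - 2 * L ^ 2 * (inner ℝ (mulI n q) (b i) * inner ℝ (mulI n p) (b i))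
          - 2 * L ^ 2 * τ * (inner ℝ (mulI n q) (b i) * inner ℝ q (b i))) := by
          refine Finset.sum_congr rfl fun i _ => ?_
          rw [f1, f2, f3, f4, f5, hBq]
          ring
      _ = _ := by
          simp only [Finset.sum_add_distrib, Finset.sum_sub_distrib, ← Finset.mul_sum,
            Finset.sum_neg_distrib, sum_inner_mul_basis, f6, hBq, f7, g2, g3, g4, inner_mulI_self]
          rw [laplace_eq b h.smooth, Finset.sum_const, Finset.card_univ, nsmul_eq_mul, card_basis b]
          ring
  have hBY : B Y Y = B p p - 2 * κ * τ * B p (mulI n q)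
      + κ ^ 2 * τ ^ 2 * B (mulI n q) (mulI n q) := by
    have : B (mulI n q) p = B p (mulI n q) := spHess_comm h.smooth _ _
    simp only [hY, map_sub, map_smul, LinearMap.sub_apply, LinearMap.smul_apply, smul_eq_mul, this]
    ring
  have hBi : rotD 0 (mulI n) (rotD 0 (mulI n) φ) x = B (mulI n q) (mulI n q) := by
    have h1 : pd ((0 : ℝ), mulI n (mulI n q)) φ x = 0 := by
      rw [← inner_spGrad b, mulI_mulI, inner_neg_right, ← hp, g7, neg_zero]
    rw [rotD_eq_pd, pd_rotD h.smooth, rotD_eq_pd, hB, spHess_apply h.smooth, ← hq, h1, add_zero]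
  have hBp : gradProd b φ (rotD 0 (mulI n) φ) x = B p (mulI n q) := by
    have h1 : pd ((0 : ℝ), mulI n p) φ x = 0 := by rw [← inner_spGrad b, ← hp, g6]
    rw [gradProd_eq_pd, pd_rotD h.smooth, rotD_eq_pd, hB, spHess_comm h.smooth,
      spHess_apply h.smooth, ← hq, ← hp, h1, add_zero]
  have hBpp : gradProd b φ (gradProd b φ φ) x = 2 * B p p := by
    rw [gradProd_gradProd b h.smooth h.smooth]
    ring
  have halg := graph_curvature_algebra (n := n) (Δ := laplace b φ x) (Hii := B (mulI n q) (mulI n q))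
    (Hpi := B p (mulI n q)) (Hpp := B p p) hL0 hC0 hCL hmv
  rw [graphCurv, hv, hBi, hBp, hBpp, hrot, sphereCurv, ctanhSq, ← hL, ← hC, ← hκ]
  have hv0 : 1 + P - κ * τ ^ 2 = (m ^ 2)⁻¹ := eq_inv_of_mul_eq_one_right hmv
  rw [← Finset.mul_sum, ← Finset.mul_sum, hlap, hBY] at key
  rw [hv0, div_inv_eq_mul, inv_pow, div_inv_eq_mul, key]
  simp only [← hκ] at halg
  have hL2 : L * L * (L ^ 2)⁻¹ = 1 := by field_simp
  linear_combination m ^ 2 * halg + m ^ 2 * (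
    (-laplace b φ x + C * P + C * (2 * n - 1) + 2 * L ^ 2 * C + 2 * (L ^ 2 / C) * τ ^ 2)
      - κ * (-B (mulI n q) (mulI n q) + C * τ ^ 2 + C + 2 * L ^ 2 * C + 2 * (L ^ 2 / C) * τ * τ)
      - m ^ 2 * (-(B p p - 2 * κ * τ * B p (mulI n q) + κ ^ 2 * τ ^ 2 * B (mulI n q) (mulI n q))
        + C * (P - κ * τ ^ 2) ^ 2
        + C * (P - 2 * κ * τ ^ 2 + κ ^ 2 * τ ^ 2)
        + 2 * L ^ 2 * C * (τ - κ * τ) ^ 2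
        + 2 * (L ^ 2 / C) * τ * (τ - κ * τ) * (P - κ * τ ^ 2))) * hL2

end IsOrientedGraphChart

end GraphMeanCurvatureFormula

/-! ### Local parametrization by the radial projection. -/

noncomputable section RadialCharts

open Filter Topology Set

lemma exists_smooth_local_inverse {V : Type*} [NormedAddCommGroup V] [NormedSpace ℝ V]
    [FiniteDimensional ℝ V] {Ψ : V → V} {a : V} (hΨ : ContDiffAt ℝ ∞ Ψ a)
    (hinj : ∀ v, fderiv ℝ Ψ a v = 0 → v = 0) :
    ∃ Θ : V → V, ContDiffAt ℝ ∞ Θ (Ψ a) ∧ Θ (Ψ a) = a ∧ (∀ᶠ y in 𝓝 (Ψ a), Ψ (Θ y) = y) ∧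
      ∀ᶠ x in 𝓝 a, Θ (Ψ x) = x := by
  have : CompleteSpace V := FiniteDimensional.complete ℝ V
  let A : V ≃L[ℝ] V := (LinearEquiv.ofInjectiveEndo (fderiv ℝ Ψ a).toLinearMap
    ((injective_iff_map_eq_zero _).2 hinj)).toContinuousLinearEquiv
  have hA : HasFDerivAt Ψ (A : V →L[ℝ] V) a := by
    have h1 : (A : V →L[ℝ] V) = fderiv ℝ Ψ a := by ext v; rfl
    rw [h1]
    exact (hΨ.differentiableAt (by simp)).hasFDerivAt
  have hn : (∞ : WithTop ℕ∞) ≠ 0 := by simp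
  have hs := hΨ.hasStrictFDerivAt' hA hn
  refine ⟨hΨ.localInverse hA hn, hΨ.to_localInverse hA hn, ?_, ?_, ?_⟩
  · exact hs.localInverse_apply_image
  · exact hs.eventually_right_inverse
  · exact hs.eventually_left_inverse

variable {E : Type*} [NormedAddCommGroup E] [InnerProductSpace ℝ E]

lemma hasFDerivAt_inner_self_eq_zero {X : Type*} [NormedAddCommGroup X] [NormedSpace ℝ X] {f : X → E}
    {x : X} (hf : DifferentiableAt ℝ f x) (h1 : ∀ᶠ y in 𝓝 x, ‖f y‖ = 1) (v : X) :
    inner ℝ (f x) (fderiv ℝ f x v) = 0 := by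
  have h2 := (hf.hasFDerivAt.norm_sq)
  have h3 : HasFDerivAt (fun y => ‖f y‖ ^ 2) (0 : X →L[ℝ] ℝ) x := by
    refine (hasFDerivAt_const (1 : ℝ) x).congr_of_eventuallyEq (h1.mono fun y hy => ?_)
    simp only [hy, one_pow]
  have h4 := congrArg (fun A : X →L[ℝ] ℝ => A v) (h2.unique h3)
  simpa using h4

variable [FiniteDimensional ℝ E]

/-- A time dependent radially transversal immersion can be locally parametrized by the radial
projection. -/
theorem exists_radial_parametrization {G : ℝ × E → E} {t₀ : ℝ} {z₀ : E}
    (hG : ContDiffAt ℝ ∞ G (t₀, z₀))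
    (hz₀ : ‖z₀‖ = 1) (h0 : G (t₀, z₀) ≠ 0)
    (hinj : ∀ X, inner ℝ z₀ X = 0 → ∀ c : ℝ, fderiv ℝ G (t₀, z₀) (0, X) = c • G (t₀, z₀) → X = 0) :
    ∃ ζ : ℝ × E → E, ζ (t₀, ‖G (t₀, z₀)‖⁻¹ • G (t₀, z₀)) = z₀ ∧
      ContDiffAt ℝ ∞ ζ (t₀, ‖G (t₀, z₀)‖⁻¹ • G (t₀, z₀)) ∧
      (∀ (t : ℝ) (q : E) (c : ℝ), 0 < c → ζ (t, c • q) = ζ (t, q)) ∧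
      (∀ᶠ y in 𝓝 (t₀, ‖G (t₀, z₀)‖⁻¹ • G (t₀, z₀)), ‖ζ y‖ = 1 ∧ G (y.1, ζ y) ≠ 0 ∧
        ‖y.2‖ • G (y.1, ζ y) = ‖G (y.1, ζ y)‖ • y.2) ∧
      (∀ᶠ y in 𝓝 (t₀, z₀), ‖y.2‖ = 1 → ζ (y.1, ‖G y‖⁻¹ • G y) = y.2) := by
  have hz0 : z₀ ≠ 0 := fun h => by simp [h] at hz₀
  set g : ℝ × E → E := fun y => ‖G y‖⁻¹ • G y with hg
  have hgs : ContDiffAt ℝ ∞ g (t₀, z₀) :=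
    ((hG.norm ℝ h0).inv (norm_ne_zero_iff.2 h0)).smul hG
  have hg1 : ∀ y, G y ≠ 0 → ‖g y‖ = 1 := fun y hy => by
    rw [hg, norm_smul, norm_inv, norm_norm, inv_mul_cancel₀ (norm_ne_zero_iff.2 hy)]
  have hGne : ∀ᶠ y in 𝓝 (t₀, z₀), G y ≠ 0 := hG.continuousAt.eventually_ne h0
  -- Restoring the radial factor ‖y‖ gives a map between spaces of the same dimension, so the
  -- inverse function theorem applies to the radial projection without charts on the sphere.
  set Ψ : ℝ × E → ℝ × E := fun y => (y.1, ‖y.2‖ • g y) with hΨ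
  have hnorm : ContDiffAt ℝ ∞ (fun y : ℝ × E => ‖y.2‖) (t₀, z₀) := contDiffAt_snd.norm ℝ hz0
  have hΨs : ContDiffAt ℝ ∞ Ψ (t₀, z₀) := contDiffAt_fst.prodMk (hnorm.smul hgs)
  set q₀ := ‖G (t₀, z₀)‖⁻¹ • G (t₀, z₀) with hq₀
  have hq₀1 : ‖q₀‖ = 1 := hg1 _ h0
  have hΨ0 : Ψ (t₀, z₀) = (t₀, q₀) := by simp [hΨ, hz₀, hg, hq₀]
  -- The time component forces s = 0. Pairing with the unit vector g shows that X is tangent to the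
  -- sphere and is killed by the differential of g; then the differential of G at X is radial, which
  -- transversality excludes unless X = 0.
  have hker : ∀ v, fderiv ℝ Ψ (t₀, z₀) v = 0 → v = 0 := by
    rintro ⟨s, X⟩ hv
    have hgd := hgs.differentiableAt (by simp)
    have hnd := hnorm.differentiableAt (by simp)
    have h1 : HasFDerivAt Ψ _ (t₀, z₀) :=
      hasFDerivAt_fst.prodMk (hnd.hasFDerivAt.smul hgd.hasFDerivAt)
    rw [h1.fderiv] at hv
    obtain ⟨hs, h2⟩ := Prod.ext_iff.1 hv
    simp only [ContinuousLinearMap.prod_apply, ContinuousLinearMap.coe_fst', Prod.fst_zero,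
      Prod.snd_zero, add_apply, ContinuousLinearMap.smulRight_apply, hz₀, one_smul] at hs h2
    subst hs
    have h3 := hasFDerivAt_inner_self_eq_zero hgd (hGne.mono hg1) (0, X)
    have h4 : fderiv ℝ (fun y : ℝ × E => ‖y.2‖) (t₀, z₀) (0, X) = 0 := by
      have h5 := congrArg (fun v => inner ℝ (g (t₀, z₀)) v) h2
      simp only [inner_add_right, h3, real_inner_smul_right, real_inner_self_eq_norm_sq,
        hg1 _ h0, inner_zero_right] at h5
      simpa using h5
    have h6 : inner ℝ z₀ X = 0 := by
      have h7 : HasFDerivAt (fun y : ℝ × E => ‖y.2‖)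
          ((fderiv ℝ (fun w : E => ‖w‖) z₀).comp (ContinuousLinearMap.snd ℝ ℝ E)) (t₀, z₀) :=
        HasFDerivAt.comp (g := fun w : E => ‖w‖) (t₀, z₀)
          ((contDiffAt_norm ℝ hz0 (n := 1)).differentiableAt (by norm_num)).hasFDerivAt
          hasFDerivAt_snd
      rw [h7.fderiv] at h4
      have h8 := pd_norm hz0 X
      rw [hz₀, div_one] at h8
      rw [← h8]
      exact h4
    rw [h4, zero_smul, add_zero] at h2
    have h10 := ((hG.norm ℝ h0).differentiableAt (by simp)).hasFDerivAt.smul hgd.hasFDerivAt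
    have h9 := h10.congr_of_eventuallyEq (f₁ := G) (hGne.mono fun y hy => by
      simp only [Pi.smul_apply', hg, smul_smul, mul_inv_cancel₀ (norm_ne_zero_iff.2 hy), one_smul])
    have hX : X = 0 := by
      refine hinj X h6 (fderiv ℝ (fun y => ‖G y‖) (t₀, z₀) (0, X) * ‖G (t₀, z₀)‖⁻¹) ?_
      rw [h9.fderiv]
      simp only [add_apply, smul_apply,
        ContinuousLinearMap.smulRight_apply, h2, smul_zero, zero_add]
      simp only [hg, smul_smul]
    rw [hX]; rfl
  obtain ⟨Θ, hΘs, hΘ0, hΘr, hΘl⟩ := exists_smooth_local_inverse hΨs hker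
  rw [hΨ0] at hΘs hΘ0 hΘr
  have hq0 : q₀ ≠ 0 := fun h => by simp [h] at hq₀1
  -- Normalizing directions before applying the local inverse makes the parametrization constant on
  -- rays at all points, not only near the base point.
  set N : ℝ × E → ℝ × E := fun y => (y.1, ‖y.2‖⁻¹ • y.2) with hN
  have hNs : ContDiffAt ℝ ∞ N (t₀, q₀) := contDiffAt_fst.prodMk
    (((contDiffAt_snd.norm ℝ hq0).inv (norm_ne_zero_iff.2 hq0)).smul contDiffAt_snd)
  have hN0 : N (t₀, q₀) = (t₀, q₀) := by simp [hN, hq₀1]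
  have hNt : Tendsto N (𝓝 (t₀, q₀)) (𝓝 (t₀, q₀)) := by
    have := hNs.continuousAt.tendsto
    rwa [hN0] at this
  have hζs : ContDiffAt ℝ ∞ (fun y => (Θ (N y)).2) (t₀, q₀) := by
    refine ContDiffAt.snd ?_
    refine ContDiffAt.comp (g := Θ) (f := N) _ ?_ hNs
    rwa [hN0]
  have hΘN : Tendsto (fun y => Θ (N y)) (𝓝 (t₀, q₀)) (𝓝 (t₀, z₀)) := by
    have := hΘs.continuousAt.tendsto
    rw [hΘ0] at this
    exact this.comp hNt
  refine ⟨fun y => (Θ (N y)).2, ?_, hζs, ?_, ?_, ?_⟩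
  · simp only [hN0, hΘ0]
  · intro t q c hc
    have : N (t, c • q) = N (t, q) := by
      simp only [hN, norm_smul, Real.norm_of_nonneg hc.le, smul_smul, mul_inv]
      rw [mul_comm c⁻¹, mul_assoc, inv_mul_cancel₀ hc.ne', mul_one]
    simp only [this]
  · filter_upwards [hNt.eventually hΘr, hΘN.eventually hGne,
      (continuousAt_snd (p := ((t₀, q₀) : ℝ × E))).eventually_ne hq0] with y h1 h2 h3
    obtain ⟨h4, h5⟩ := Prod.ext_iff.1 h1
    simp only [hΨ, hN] at h4 h5
    have h6 : Θ (N y) = (y.1, (Θ (N y)).2) := Prod.ext h4 rfl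
    have h7 : ‖(Θ (N y)).2‖ = 1 := by
      have := congrArg norm h5
      rw [norm_smul, norm_norm, hg1 _ h2, mul_one, norm_smul, norm_inv, norm_norm,
        inv_mul_cancel₀ (norm_ne_zero_iff.2 h3)] at this
      exact this
    refine ⟨h7, ?_, ?_⟩
    · rw [← h6]; exact h2
    · rw [← h6]
      have h8 : ‖(Θ (N y)).2‖ • g (Θ (N y)) = ‖y.2‖⁻¹ • y.2 := h5
      rw [h7, one_smul] at h8
      have h9 : ‖y.2‖ • (‖G (Θ (N y))‖ • g (Θ (N y))) = ‖y.2‖ • (‖G (Θ (N y))‖ • (‖y.2‖⁻¹ • y.2)) := by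
        rw [h8]
      simp only [hg, smul_smul] at h9
      rw [mul_inv_cancel₀ (norm_ne_zero_iff.2 h2), mul_one] at h9
      rw [h9]
      congr 1
      have := norm_ne_zero_iff.2 h3
      field_simp
  · filter_upwards [hΘl, hGne] with y h1 h2 hy
    have h3 : N (y.1, ‖G y‖⁻¹ • G y) = Ψ y := by
      have := hg1 _ h2
      simp only [hg] at this
      simp only [hN, hΨ, hg, this, hy, inv_one, one_smul]
    simp only [h3, h1]

end RadialCharts

/-! ### Graph quantities in terms of the parametrized flow. -/

noncomputable section GraphJets

open Filter Topology Set

variable {n : ℕ} {ι : Type*} [Fintype ι] (b : OrthonormalBasis ι ℝ (Cn n))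

lemma hasDerivAt_norm_curve {E : Type*} [NormedAddCommGroup E] [InnerProductSpace ℝ E] {f : ℝ → E}
    {f' : E} {t : ℝ} (hf : HasDerivAt f f' t) (h0 : f t ≠ 0) :
    HasDerivAt (fun s => ‖f s‖) (inner ℝ (f t) f' / ‖f t‖) t := by
  have hr : ‖f t‖ ≠ 0 := norm_ne_zero_iff.2 h0
  have h3 := hf.norm_sq.sqrt (by simpa using hr)
  simp only [Real.sqrt_sq (norm_nonneg _)] at h3
  refine h3.congr_deriv ?_
  field_simp

/-- The tangential component `⟨F, i ν⟩`, normalized: the derivative of the conformal radius of a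
graph along the Hopf field. -/
def flowRot (F ν : ℝ → USphere n → Cn n) (t : ℝ) (z : USphere n) : ℝ :=
  -(Real.sinh ‖F t z‖ * Real.cosh ‖F t z‖ ^ 2 / ‖F t z‖ * inner ℝ (mulI n (F t z)) (ν t z)
    / inner ℝ (F t z) (ν t z))

/-- The squared gradient of the conformal radius. -/
def flowGrad (F ν : ℝ → USphere n → Cn n) (t : ℝ) (z : USphere n) : ℝ :=
  ‖F t z‖ ^ 2 / inner ℝ (F t z) (ν t z) ^ 2 - 1
    + Real.sinh ‖F t z‖ ^ 2 / Real.cosh ‖F t z‖ ^ 2 * flowRot F ν t z ^ 2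

/-- The time derivative of the conformal radius of a graph moving with normal speed `s`. -/
def flowSpeed (F ν : ℝ → USphere n → Cn n) (s : ℝ → USphere n → ℝ) (t : ℝ) (z : USphere n) : ℝ :=
  s t z * ‖F t z‖ / (Real.sinh ‖F t z‖ * inner ℝ (F t z) (ν t z))

namespace IsOrientedGraphChart

variable {b} {F N : USphere n → Cn n} {φ : ℝ × Cn n → ℝ} {ζ : Cn n → Cn n} {x : ℝ × Cn n}
  {z : USphere n} (h : IsOrientedGraphChart F N φ ζ x z)

include h

lemma norm_apply : ‖F z‖ = geodesicRadius (φ x) := by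
  rw [h.position, norm_smul, h.chart.norm_eq, mul_one,
    Real.norm_of_nonneg (geodesicRadius_pos h.neg).le]

/-- The relation ρ(φ(t, f/|f|)) = |f| is differentiated along the path of a particle. The angular
part of the velocity s N contributes -(sm/L)(V² - 1) through the gradient, and m²V² = 1 turns the
sum into the stated graphical speed. -/
lemma speed_eq {f : ℝ → Cn n} {s : ℝ} (hf : HasDerivAt f (s • N z) x.1) (hfx : f x.1 = F z)
    (hφ : ∀ᶠ t in 𝓝 x.1, geodesicRadius (φ (t, ‖f t‖⁻¹ • f t)) = ‖f t‖) :
    pd (1, 0) φ x = s / (csinh (φ x) * inner ℝ x.2 (N z)) := by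
  have hy := h.neg
  have hr := geodesicRadius_pos hy
  have hL := csinh_pos hy
  have hC := ccosh_pos hy
  let b := stdOrthonormalBasis ℝ (Cn n)
  have hm0 := h.outward
  obtain ⟨hN, hv⟩ := h.normal_eq (b := b)
  have hg5 : inner ℝ x.2 (spGrad b φ x) = 0 := h.inner_spGrad_radial
  set m := inner ℝ x.2 (N z) with hm
  set ρ := geodesicRadius (φ x) with hρ
  set L := csinh (φ x) with hL'
  set p := spGrad b φ x with hp
  have hF : F z = ρ • x.2 := h.position
  have hFn : ‖F z‖ = ρ := h.norm_apply
  have hne : f x.1 ≠ 0 := by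
    rw [hfx, ← norm_ne_zero_iff, hFn]; exact hr.ne'
  have h1 : HasDerivAt (fun t => ‖f t‖) (s * m) x.1 := by
    refine (hasDerivAt_norm_curve hf hne).congr_deriv ?_
    rw [hfx, hFn, hF, real_inner_smul_left, real_inner_smul_right, ← hm]
    field_simp
  have hfn : ‖f x.1‖ = ρ := by rw [hfx, hFn]
  have h2 := (h1.inv (by rw [hfn]; exact hr.ne')).smul hf
  rw [Pi.inv_apply, hfn, hfx, hF] at h2
  have h3 : HasDerivAt (fun t => (t, ‖f t‖⁻¹ • f t)) ((1 : ℝ), _) x.1 := (hasDerivAt_id x.1).prodMk h2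
  have hx : (x.1, ‖f x.1‖⁻¹ • f x.1) = x := by
    rw [hfn, hfx, hF, smul_smul, inv_mul_cancel₀ hr.ne', one_smul]
  have h4 : HasFDerivAt φ (fderiv ℝ φ x) (x.1, ‖f x.1‖⁻¹ • f x.1) := by
    rw [hx]; exact h.differentiable.hasFDerivAt
  have h5 := h4.comp_hasDerivAt x.1 h3
  have h6 : HasDerivAt geodesicRadius L (φ (x.1, ‖f x.1‖⁻¹ • f x.1)) := by
    rw [hx]; exact hasDerivAt_geodesicRadius hy
  have h7 := (h6.comp x.1 h5).unique (h1.congr_of_eventuallyEq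
    (f₁ := geodesicRadius ∘ φ ∘ fun t => (t, ‖f t‖⁻¹ • f t)) hφ)
  set γ' := ρ⁻¹ • s • N z + (-(s * m) / ρ ^ 2) • ρ • x.2 with hγ'
  have h8 : fderiv ℝ φ x (1, γ') = pd (1, 0) φ x + inner ℝ p γ' := by
    rw [inner_spGrad, pd, pd, ← map_add]
    simp
  have h9 : inner ℝ p (N z) = -(m * (ρ / L) * (inner ℝ p p - ctanhSq (φ x)
      * inner ℝ p (mulI n x.2) ^ 2)) := by
    conv_lhs => rw [hN]
    simp only [graphCovector, inner_sub_right, real_inner_smul_right, real_inner_comm x.2 p, hg5,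
      ctanhSq]
    ring
  have h10 : inner ℝ p γ' = -(s * m / L) * (slopeSq b (mulI n) φ x - 1) := by
    rw [slopeSq, ← inner_spGrad_spGrad, rotD_eq_pd, ← inner_spGrad b, ← hp, hγ', inner_add_right]
    simp only [real_inner_smul_right, real_inner_comm x.2 p, hg5, h9]
    field_simp
    ring
  rw [h8, h10] at h7
  have hv' : slopeSq b (mulI n) φ x = (m ^ 2)⁻¹ := eq_inv_of_mul_eq_one_right hv
  rw [hv'] at h7
  rw [eq_div_iff (by positivity)]
  have : L * pd (1, 0) φ x = s / m := by
    field_simp at h7 ⊢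
    linear_combination h7
  rw [eq_div_iff hm0.ne'] at this
  linarith

omit h in
lemma jetMatch {F ν : ℝ → USphere n → Cn n} {s : ℝ → USphere n → ℝ}
    (h : IsOrientedGraphChart (F x.1) (ν x.1) φ ζ x z)
    (hs : pd (1, 0) φ x = s x.1 z / (csinh (φ x) * inner ℝ x.2 (ν x.1 z))) :
    JetMatch b (mulI n) (fun t z => conformalRadius ‖F t z‖) (flowGrad F ν) (flowRot F ν)
      (flowSpeed F ν s) φ x z := by
  have hy := h.neg
  have hr := geodesicRadius_pos hy
  have hL := csinh_pos hy
  have hC := ccosh_pos hy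
  have hm := h.outward
  have hFn : ‖F x.1 z‖ = geodesicRadius (φ x) := h.norm_apply
  have hF : F x.1 z = geodesicRadius (φ x) • x.2 := h.position
  have hφ : φ x = conformalRadius ‖F x.1 z‖ := by
    rw [hFn]
    refine strictMonoOn_csinh.injOn hy (conformalRadius_neg hr) ?_
    rw [csinh_conformalRadius, sinh_geodesicRadius]
  have hrot : rotD 0 (mulI n) φ x = flowRot F ν x.1 z := by
    rw [h.rotD_eq, flowRot, hFn, sinh_geodesicRadius, cosh_geodesicRadius hy, hF, map_smul,
      real_inner_smul_left, real_inner_smul_left]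
    field_simp
  refine ⟨hφ, ?_, hrot, ?_⟩
  · have hv := (h.normal_eq (b := b)).2
    have h1 : gradProd b φ φ x = slopeSq b (mulI n) φ x - 1
        + ctanhSq (φ x) * rotD 0 (mulI n) φ x ^ 2 := by rw [slopeSq]; ring
    have hv' : slopeSq b (mulI n) φ x = (inner ℝ x.2 (ν x.1 z) ^ 2)⁻¹ := eq_inv_of_mul_eq_one_right hv
    rw [h.chart.norm_eq, h1, hv', hrot, flowGrad, hFn, sinh_geodesicRadius, cosh_geodesicRadius hy,
      hF, real_inner_smul_left, ctanhSq]
    field_simp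
  · rw [hs, flowSpeed, hFn, sinh_geodesicRadius, hF, real_inner_smul_left]
    field_simp

end IsOrientedGraphChart

section Homogeneous

variable {E : Type*} [NormedAddCommGroup E] [InnerProductSpace ℝ E] {φ : ℝ × E → ℝ}
  {ι : Type*} [Fintype ι] (b : OrthonormalBasis ι ℝ E) {S : Type*} {I : E →L[ℝ] E}
  {fφ fP fτ fu : ℝ → S → ℝ}

lemma fderiv_homogeneous (hom : ∀ (t : ℝ) (q : E) (c : ℝ), 0 < c → φ (t, c • q) = φ (t, q))
    {y : ℝ × E} {c : ℝ} (hc : 0 < c) (hφ : DifferentiableAt ℝ φ (y.1, c • y.2)) (s : ℝ) (X : E) :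
    fderiv ℝ φ y (s, X) = fderiv ℝ φ (y.1, c • y.2) (s, c • X) := by
  have h1 : HasFDerivAt (fun w : ℝ × E => (w.1, c • w.2))
      ((ContinuousLinearMap.fst ℝ ℝ E).prod (c • ContinuousLinearMap.snd ℝ ℝ E)) y :=
    hasFDerivAt_fst.prodMk (hasFDerivAt_snd.const_smul c)
  have h2 := HasFDerivAt.comp y (g := φ) (f := fun w : ℝ × E => (w.1, c • w.2)) hφ.hasFDerivAt h1
  have h3 : φ ∘ (fun w : ℝ × E => (w.1, c • w.2)) = φ := by
    ext w; exact hom w.1 w.2 c hc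
  rw [h3] at h2
  rw [h2.fderiv]
  simp

/-- A chart must match the flow on a full neighbourhood, not only at unit vectors. All four matched
quantities are constant on rays, so the unit case suffices. -/
lemma JetMatch.of_unit (hom : ∀ (t : ℝ) (q : E) (c : ℝ), 0 < c → φ (t, c • q) = φ (t, q))
    {y : ℝ × E} {z : S} (hy : y.2 ≠ 0) (hφ : DifferentiableAt ℝ φ (y.1, ‖y.2‖⁻¹ • y.2))
    (h : JetMatch b I fφ fP fτ fu φ (y.1, ‖y.2‖⁻¹ • y.2) z) : JetMatch b I fφ fP fτ fu φ y z := by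
  have hn : 0 < ‖y.2‖ := norm_pos_iff.2 hy
  have hc : 0 < ‖y.2‖⁻¹ := inv_pos.2 hn
  have hd := fderiv_homogeneous hom hc hφ
  obtain ⟨h1, h2, h3, h4⟩ := h
  have hu : ‖‖y.2‖⁻¹ • y.2‖ = 1 := by
    rw [norm_smul, norm_inv, norm_norm, inv_mul_cancel₀ hn.ne']
  refine ⟨?_, ?_, ?_, ?_⟩
  · rw [← h1, hom _ _ _ hc]
  · rw [← h2]
    simp only [hu, one_pow, one_mul, gradProd, pd, hd, Finset.mul_sum]
    refine Finset.sum_congr rfl fun i _ => ?_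
    rw [show ((0 : ℝ), ‖y.2‖⁻¹ • b i) = ‖y.2‖⁻¹ • ((0 : ℝ), b i) by simp, map_smul, smul_eq_mul]
    field_simp
  · rw [← h3]
    simp only [rotD, hd, map_smul]
  · rw [← h4]
    simp only [pd, hd, smul_zero]

end Homogeneous

end GraphJets

/-! ### Outward mean convex flows are locally graph solutions. -/

noncomputable section OutwardFlow

open Filter Topology Set

variable {n : ℕ} {ι : Type*} [Fintype ι] (b : OrthonormalBasis ι ℝ (Cn n))

/-- A solution of inverse mean curvature flow by mean convex hypersurfaces with outward pointing
normal, on the open time interval `(0, t₂)`. -/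
structure IsOutwardFlow (F ν : ℝ → USphere n → Cn n) (t₂ : ℝ) : Prop where
  smooth : ∀ t ∈ Ioo 0 t₂, ∀ p : Cn n, p ≠ 0 →
    ContDiffAt ℝ ∞ (fun y : ℝ × Cn n => rayExt (F y.1) y.2) (t, p)
  immersion : ∀ t ∈ Ioo 0 t₂, SphereImmersion (F t)
  normal : ∀ t ∈ Ioo 0 t₂, IsUnitNormal (F t) (ν t)
  evolution : ∀ t ∈ Ioo 0 t₂, ∀ z, HasDerivAt (fun s => F s z)
    ((1 / meanCurvature (F t) (ν t) z) • ν t z) t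
  outward : ∀ t ∈ Ioo 0 t₂, ∀ z, 0 < inner ℝ (F t z) (ν t z)
  convex : ∀ t ∈ Ioo 0 t₂, ∀ z, 0 < meanCurvature (F t) (ν t) z

namespace IsOutwardFlow

lemma coe_ne_zero (z : USphere n) : (z : Cn n) ≠ 0 := fun h => by
  have : ‖(z : Cn n)‖ = 1 := by simp
  simp [h] at this

variable {b} {F ν : ℝ → USphere n → Cn n} {t₂ : ℝ} (h : IsOutwardFlow F ν t₂) {t₀ : ℝ} (ht₀ : t₀ ∈ Ioo 0 t₂)

include h ht₀

lemma ne_zero (z : USphere n) : F t₀ z ≠ 0 := fun h0 => by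
  have := h.outward t₀ ht₀ z
  simp [h0] at this

lemma smooth_slice (z : USphere n) : ContDiffAt ℝ ∞ (rayExt (F t₀)) (z : Cn n) := by
  have h1 := h.smooth t₀ ht₀ z (coe_ne_zero z)
  exact ContDiffAt.comp (g := fun y : ℝ × Cn n => rayExt (F y.1) y.2) (f := fun p : Cn n => (t₀, p))
    (z : Cn n) h1 (contDiffAt_const.prodMk contDiffAt_id)

/-- If the differential maps X to cF, pairing with the normal gives c⟨F, ν⟩ = 0, so c = 0 by
outwardness; the immersion property then gives X = 0. -/
lemma transversal (z : USphere n) {X : Cn n} (hX : inner ℝ (z : Cn n) X = 0) {c : ℝ}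
    (hc : sphereDeriv (F t₀) z X = c • F t₀ z) : X = 0 := by
  have hX' : X ∈ sphereTangent z := IsOrientedGraphChart.mem_sphereTangent.2 hX
  have h1 := (h.normal t₀ ht₀ z).2 X hX'
  have hF := h.ne_zero ht₀ z
  rw [hc, bergmanMetric_smul_left hF, bergmanMetric_position hF] at h1
  have h2 : c = 0 := (mul_eq_zero.1 h1).resolve_right (h.outward t₀ ht₀ z).ne'
  rw [h2, zero_smul] at hc
  exact h.immersion t₀ ht₀ z X hX' hc

/-- The flow is locally a radial graph moving by inverse mean curvature. -/
theorem hasGraphChart (z₀ : USphere n) : HasGraphChart b (mulI n) n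
    (fun t z => conformalRadius ‖F t z‖) (flowGrad F ν) (flowRot F ν)
    (flowSpeed F ν fun t z => 1 / meanCurvature (F t) (ν t) z) t₀ z₀ := by
  set G : ℝ × Cn n → Cn n := fun y => rayExt (F y.1) y.2 with hG
  have hGz : ∀ (t : ℝ) (z : USphere n), G (t, z) = F t z := fun t z => rayExt_coe (F t) z
  have hGs := h.smooth t₀ ht₀ z₀ (coe_ne_zero z₀)
  have hF0 := h.ne_zero ht₀ z₀
  obtain ⟨ζ, hζ0, hζs, hζh, hζe, hζl⟩ := exists_radial_parametrization (G := G) (t₀ := t₀)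
    (z₀ := (z₀ : Cn n)) hGs (by simp) (by rw [hGz]; exact hF0) (by
      intro X hX c hc
      rw [hGz] at hc
      refine h.transversal ht₀ z₀ hX (c := c) ?_
      rw [← hc, ← fderiv_slice (x := (t₀, (z₀ : Cn n))) (hGs.differentiableAt (by simp))]
      rfl)
  rw [hGz] at hζ0 hζs hζe
  set q₀ := ‖F t₀ z₀‖⁻¹ • F t₀ z₀ with hq₀
  have hn0 : 0 < ‖F t₀ z₀‖ := norm_pos_iff.2 hF0
  have hq₀1 : ‖q₀‖ = 1 := by rw [hq₀, norm_smul, norm_inv, norm_norm, inv_mul_cancel₀ hn0.ne']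
  have hq00 : q₀ ≠ 0 := fun h => by simp [h] at hq₀1
  set φ : ℝ × Cn n → ℝ := fun y => conformalRadius ‖G (y.1, ζ y)‖ with hφ
  have hφh : ∀ (t : ℝ) (q : Cn n) (c : ℝ), 0 < c → φ (t, c • q) = φ (t, q) := fun t q c hc => by
    simp only [hφ, hζh t q c hc]
  have hφs : ContDiffAt ℝ ∞ φ (t₀, q₀) := by
    have h1 : ContDiffAt ℝ ∞ (fun y : ℝ × Cn n => G (y.1, ζ y)) (t₀, q₀) := by
      refine ContDiffAt.comp (g := G) (f := fun y : ℝ × Cn n => (y.1, ζ y)) (t₀, q₀) ?_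
        (contDiffAt_fst.prodMk hζs)
      simp only [hζ0]
      exact hGs
    have h2 : G ((t₀, q₀).1, ζ (t₀, q₀)) ≠ 0 := by simp only [hζ0, hGz]; exact hF0
    exact ContDiffAt.comp (g := conformalRadius) (f := fun y : ℝ × Cn n => ‖G (y.1, ζ y)‖) (t₀, q₀)
      (contDiffAt_conformalRadius (norm_pos_iff.2 h2)) (h1.norm ℝ h2)
  have ht : Tendsto (fun y : ℝ × Cn n => (y.1, ζ y)) (𝓝 (t₀, q₀)) (𝓝 (t₀, (z₀ : Cn n))) := by
    have := (continuousAt_fst (p := ((t₀, q₀) : ℝ × Cn n))).prodMk hζs.continuousAt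
    rw [ContinuousAt, hζ0] at this
    exact this
  -- The chart and the matching of data are needed at all nearby unit directions, because the scalar
  -- equation is differentiated in space and time.
  have hchart : ∀ᶠ y in 𝓝 (t₀, q₀), ‖y.2‖ = 1 → ∀ z : USphere n, (z : Cn n) = ζ y →
      IsOrientedGraphChart (F y.1) (ν y.1) φ (fun w => ζ (y.1, w)) y z ∧
        y.1 ∈ Ioo 0 t₂ ∧
        JetMatch b (mulI n) (fun t z => conformalRadius ‖F t z‖) (flowGrad F ν) (flowRot F ν)
          (flowSpeed F ν fun t z => 1 / meanCurvature (F t) (ν t) z) φ y z := by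
    filter_upwards [hζe.eventually_nhds, (ht.eventually hζl.eventually_nhds),
      (eventually_contDiffAt_nat hζs 2), (eventually_contDiffAt_nat hφs 2),
      (continuousAt_fst (p := ((t₀, q₀) : ℝ × Cn n))).eventually (Ioo_mem_nhds ht₀.1 ht₀.2)]
      with y h1 h2 h3 h4 h5 hy1 z hz
    have hslice : Tendsto (fun w : Cn n => (y.1, w)) (𝓝 y.2) (𝓝 y) :=
      (Continuous.prodMk_right y.1).tendsto y.2
    have hFz : F y.1 z = ‖F y.1 z‖ • y.2 := by
      have := h1.self_of_nhds.2.2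
      rwa [hy1, one_smul, ← hz, hGz] at this
    have hFn : 0 < ‖F y.1 z‖ := norm_pos_iff.2 (h.ne_zero h5 z)
    have hζ2 : ContDiffAt ℝ 2 (fun w => ζ (y.1, w)) y.2 :=
      ContDiffAt.comp (g := ζ) (f := fun w => (y.1, w)) y.2 h3 (contDiffAt_const.prodMk contDiffAt_id)
    have hO : IsOrientedGraphChart (F y.1) (ν y.1) φ (fun w => ζ (y.1, w)) y z := by
      refine ⟨⟨hy1, hz.symm, (eventually_contDiffAt_nat (h.smooth_slice h5 z) 2).self_of_nhds, hζ2,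
        ContDiffAt.comp (g := φ) (f := fun w => (y.1, w)) y.2 h4
          (contDiffAt_const.prodMk contDiffAt_id), ?_, ?_, ?_⟩, h4, hφh, (h.normal y.1 h5 z).1,
        (h.normal y.1 h5 z).2, fun c hc => rayExt_smul _ hc _, ?_⟩
      · refine conformalRadius_neg ?_
        show 0 < ‖G (y.1, ζ y)‖
        rw [← hz, hGz]
        exact hFn
      · filter_upwards [hslice.eventually h1] with w hw
        rw [geodesicRadius_conformalRadius]
        exact hw.2.2
      · intro X
        have := hasFDerivAt_inner_self_eq_zero (hζ2.differentiableAt (by norm_num))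
          ((hslice.eventually h1).mono fun w hw => hw.1) X
        rwa [show ζ (y.1, y.2) = (z : Cn n) from hz.symm] at this
      · have := h.outward y.1 h5 z
        rw [hFz, real_inner_smul_left] at this
        exact pos_of_mul_pos_right this hFn.le
    refine ⟨hO, h5, hO.jetMatch ?_⟩
    -- The remaining condition says that the graph contains F(t, z) at nearby times. It follows
    -- because ζ recovers the parameter z from the direction of F(t, z).
    refine hO.speed_eq (h.evolution y.1 h5 z) rfl ?_
    have hcurve : Tendsto (fun t : ℝ => (t, (z : Cn n))) (𝓝 y.1) (𝓝 (y.1, ζ y)) := by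
      rw [← hz]
      exact (Continuous.prodMk_left (z : Cn n)).tendsto y.1
    filter_upwards [hcurve.eventually h2] with t ht2
    have h6 := ht2 (by simp)
    simp only [hGz] at h6
    rw [hφ, geodesicRadius_conformalRadius]
    simp only [h6, hGz]
  have hx := hchart.self_of_nhds hq₀1 z₀ hζ0.symm
  have hunit : Tendsto (fun y : ℝ × Cn n => (y.1, ‖y.2‖⁻¹ • y.2)) (𝓝 (t₀, q₀)) (𝓝 (t₀, q₀)) := by
    have hc : ContinuousAt (fun y : ℝ × Cn n => (y.1, ‖y.2‖⁻¹ • y.2)) (t₀, q₀) :=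
      continuousAt_fst.prodMk (((continuousAt_snd.norm).inv₀ (by simpa using hq00)).smul
        continuousAt_snd)
    have := hc.tendsto
    simpa [hq₀1] using this
  refine ⟨φ, (t₀, q₀), rfl, ⟨hφs, hφh, hx.1.neg, hq₀1, ?_, ?_⟩, ?_, ?_⟩
  · rw [hx.2.2.2.2.2, flowSpeed]
    have h1 := h.convex t₀ ht₀ z₀
    have h2 := h.outward t₀ ht₀ z₀
    have h3 := Real.sinh_pos_iff.2 hn0
    positivity
  · filter_upwards [hchart, hζe] with y hy hy1 hyn
    let z : USphere n := ⟨ζ y, by simp [hy1.1]⟩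
    obtain ⟨hO, hyt, hj⟩ := hy hyn z rfl
    have h1 := h.convex y.1 hyt z
    have h2 := hO.outward
    have h3 := csinh_pos hO.neg
    have h4 : pd (1, 0) φ y = 1 / meanCurvature (F y.1) (ν y.1) z
        / (csinh (φ y) * inner ℝ y.2 (ν y.1 z)) := by
      rw [hj.2.2.2, flowSpeed, hO.norm_apply, hO.position, real_inner_smul_left, sinh_geodesicRadius]
      have := geodesicRadius_pos hO.neg
      field_simp
    rw [h4, ← hO.meanCurvature_eq (b := b)]
    field_simp
  · filter_upwards [hunit.eventually hchart, hunit.eventually hζe,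
      hunit.eventually (eventually_contDiffAt_nat hφs 2),
      (continuousAt_snd (p := ((t₀, q₀) : ℝ × Cn n))).eventually_ne hq00] with y h1 h2 h3 h4
    have hn : ‖‖y.2‖⁻¹ • y.2‖ = 1 := by
      rw [norm_smul, norm_inv, norm_norm, inv_mul_cancel₀ (norm_ne_zero_iff.2 h4)]
    let z : USphere n := ⟨ζ (y.1, ‖y.2‖⁻¹ • y.2), by simp [h2.1]⟩
    exact ⟨z, JetMatch.of_unit b hφh h4 (h3.differentiableAt (by norm_num)) (h1 hn z rfl).2.2⟩
  · have hd := h.evolution t₀ ht₀ z₀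
    -- The direction of a fixed particle is the drift curve required by `HasGraphChart`.
    have hγ : DifferentiableAt ℝ (fun t => ‖F t z₀‖⁻¹ • F t z₀) t₀ :=
      ((hasDerivAt_norm_curve hd hF0).differentiableAt.inv hn0.ne').smul hd.differentiableAt
    refine ⟨fun t => ‖F t z₀‖⁻¹ • F t z₀, rfl, hγ, ?_⟩
    have h1 : Tendsto (fun t => (t, ‖F t z₀‖⁻¹ • F t z₀)) (𝓝 t₀) (𝓝 (t₀, q₀)) :=
      (continuousAt_id.prodMk hγ.continuousAt).tendsto
    have h2 : Tendsto (fun t : ℝ => (t, (z₀ : Cn n))) (𝓝 t₀) (𝓝 (t₀, (z₀ : Cn n))) :=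
      (Continuous.prodMk_left (z₀ : Cn n)).tendsto t₀
    filter_upwards [h1.eventually hchart, h2.eventually hζl, hd.continuousAt.eventually_ne hF0]
      with t h3 h4 h5
    have h6 := h4 (by simp)
    simp only [hGz] at h6
    refine (h3 ?_ z₀ h6.symm).2.2
    simp only [norm_smul, norm_inv, norm_norm, inv_mul_cancel₀ (norm_ne_zero_iff.2 h5)]

end IsOutwardFlow

end OutwardFlow

/-! ### Continuity up to the initial time and openness of star-shaped mean convexity. -/

noncomputable section FlowContinuity

open Filter Topology Set

lemma mem_timeInterval_of_le {T : EReal} {s t : ℝ} (ht : t ∈ timeInterval T) (h0 : 0 ≤ s)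
    (hst : s ≤ t) : s ∈ timeInterval T :=
  ⟨h0, lt_of_le_of_lt (EReal.coe_le_coe_iff.2 hst) ht.2⟩

lemma exists_lt_Ico_subset_timeInterval {T : EReal} {t : ℝ} (ht : t ∈ timeInterval T) :
    ∃ t₂, t < t₂ ∧ Ico 0 t₂ ⊆ timeInterval T := by
  obtain ⟨t₂, h1, h2⟩ := EReal.lt_iff_exists_real_btwn.1 ht.2
  exact ⟨t₂, EReal.coe_lt_coe_iff.1 h1, fun s hs =>
    ⟨hs.1, lt_trans (EReal.coe_lt_coe_iff.2 hs.2) h2⟩⟩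

lemma uniqueDiffWithinAt_timeInterval {T : EReal} {t : ℝ} (ht : t ∈ timeInterval T) :
    UniqueDiffWithinAt ℝ (timeInterval T) t := by
  obtain ⟨t₂, h1, h2⟩ := exists_lt_Ico_subset_timeInterval ht
  exact (uniqueDiffOn_Ico 0 t₂ t ⟨ht.1, h1⟩).mono h2

lemma timeInterval_mem_nhds {T : EReal} {t : ℝ} (ht : t ∈ timeInterval T) (h0 : 0 < t) :
    timeInterval T ∈ 𝓝 t := by
  obtain ⟨t₂, h1, h2⟩ := exists_lt_Ico_subset_timeInterval ht
  exact mem_of_superset (Ico_mem_nhds h0 h1) h2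

variable {n : ℕ}

/-- The radial component of a vector is at most its length. For the unit normal this gives ⟨F, ν⟩ ≤
|F|, hence nonnegativity of `flowGrad`. -/
lemma inner_sq_le_bergmanMetric {p : Cn n} (hp : p ≠ 0) (X : Cn n) :
    inner ℝ p X ^ 2 ≤ ‖p‖ ^ 2 * bergmanMetric p X X := by
  have hr : 0 < ‖p‖ := norm_pos_iff.2 hp
  have h1 : 0 ≤ bergerMetric (Real.cosh ‖p‖ ^ 2) (‖p‖⁻¹ • p) (angularPart p X) (angularPart p X) := by
    rw [bergerMetric, Real.cosh_sq, real_inner_self_eq_norm_sq, add_sub_cancel_right]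
    exact add_nonneg (sq_nonneg _) (mul_nonneg (sq_nonneg _) (mul_self_nonneg _))
  rw [bergmanMetric, if_neg hp, real_inner_smul_left]
  have h2 : 0 ≤ ‖p‖ ^ 2 * (Real.sinh ‖p‖ ^ 2 *
      bergerMetric (Real.cosh ‖p‖ ^ 2) (‖p‖⁻¹ • p) (angularPart p X) (angularPart p X)) := by
    positivity
  have h3 : ‖p‖ ^ 2 * (‖p‖⁻¹ * inner ℝ p X * (‖p‖⁻¹ * inner ℝ p X)) = inner ℝ p X ^ 2 := by
    field_simp
  nlinarith

namespace IsInverseMeanCurvatureFlow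

variable {F₀ ν₀ : USphere n → Cn n} {T : EReal} {F ν : ℝ → USphere n → Cn n}
  (h : IsInverseMeanCurvatureFlow F₀ ν₀ T F ν)

lemma mapsTo_coe (T : EReal) : MapsTo (fun p : ℝ × USphere n => (p.1, (p.2 : Cn n)))
    (timeInterval T ×ˢ univ) (timeInterval T ×ˢ {0}ᶜ) :=
  fun p hp => ⟨hp.1, IsOutwardFlow.coe_ne_zero p.2⟩

lemma continuousOn_coe {V : Type*} [NormedAddCommGroup V] {g : ℝ × Cn n → V}
    (hg : ContinuousOn g (timeInterval T ×ˢ {0}ᶜ)) :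
    ContinuousOn (fun p : ℝ × USphere n => g (p.1, (p.2 : Cn n))) (timeInterval T ×ˢ univ) :=
  hg.comp (by fun_prop) (mapsTo_coe T)

include h

lemma zero_mem : (0 : ℝ) ∈ timeInterval T := ⟨le_rfl, by simpa using h.time_pos⟩

lemma continuousOn_map :
    ContinuousOn (fun p : ℝ × USphere n => F p.1 p.2) (timeInterval T ×ˢ univ) :=
  (continuousOn_coe h.smooth.continuousOn).congr fun p _ => (rayExt_coe (F p.1) p.2).symm

lemma continuousOn_normal :
    ContinuousOn (fun p : ℝ × USphere n => ν p.1 p.2) (timeInterval T ×ˢ univ) :=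
  (continuousOn_coe h.smooth_normal.continuousOn).congr fun p _ => (rayExt_coe (ν p.1) p.2).symm

/-- The velocity is the time derivative of the map F, which is smooth up to t = 0. This gives
continuity of ν/H without any continuity of the trace defining H, and even without H ≠ 0. -/
lemma continuousOn_velocity : ContinuousOn (fun p : ℝ × USphere n =>
    (1 / meanCurvature (F p.1) (ν p.1) p.2) • ν p.1 p.2) (timeInterval T ×ˢ univ) := by
  set G : ℝ × Cn n → Cn n := fun q => rayExt (F q.1) q.2 with hG
  have hU : UniqueDiffOn ℝ (timeInterval T ×ˢ ({0}ᶜ : Set (Cn n))) :=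
    UniqueDiffOn.prod (fun t ht => uniqueDiffWithinAt_timeInterval ht)
      isOpen_compl_singleton.uniqueDiffOn
  have h1 : ContinuousOn (fun y => fderivWithin ℝ G (timeInterval T ×ˢ ({0}ᶜ : Set (Cn n))) y (1, 0))
      (timeInterval T ×ˢ {0}ᶜ) :=
    (ContDiffOn.continuousOn_fderivWithin h.smooth hU (by simp)).clm_apply continuousOn_const
  refine (continuousOn_coe h1).congr fun p hp => ?_
  have h2 : HasFDerivWithinAt G _ (timeInterval T ×ˢ ({0}ᶜ : Set (Cn n))) (p.1, (p.2 : Cn n)) :=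
    ((h.smooth _ (mapsTo_coe T hp)).differentiableWithinAt (by simp)).hasFDerivWithinAt
  have h3 : HasDerivWithinAt (fun t : ℝ => (t, (p.2 : Cn n))) ((1 : ℝ), (0 : Cn n)) (timeInterval T) p.1 :=
    (hasDerivWithinAt_id _ _).prodMk (hasDerivWithinAt_const _ _ _)
  have h4 := h2.comp_hasDerivWithinAt p.1 h3 fun t ht => mapsTo_coe T (⟨ht, mem_univ _⟩ :
    (t, p.2) ∈ timeInterval T ×ˢ univ)
  have h5 : HasDerivWithinAt (G ∘ fun t : ℝ => (t, (p.2 : Cn n)))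
      ((1 / meanCurvature (F p.1) (ν p.1) p.2) • ν p.1 p.2) (timeInterval T) p.1 :=
    (h.evolution p.1 hp.1 p.2).congr (fun t _ => rayExt_coe (F t) p.2) (rayExt_coe (F p.1) p.2)
  exact (uniqueDiffWithinAt_timeInterval hp.1).eq_deriv _ h5 h4

end IsInverseMeanCurvatureFlow

/-- The hypersurface `F` is mean convex and star-shaped with respect to the normal `N`. -/
def IsOutwardConvex (F N : USphere n → Cn n) : Prop :=
  ∀ z, 0 < inner ℝ (F z) (N z) ∧ 0 < meanCurvature F N z

/-- Positivity of H is rephrased through the continuous function ⟨F, ν/H⟩; with the convention 1/0 =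
0 the equivalence includes the case H = 0. -/
lemma isOutwardConvex_iff {F N : USphere n → Cn n} : IsOutwardConvex F N ↔
    ∀ z, 0 < inner ℝ (F z) (N z) ∧ 0 < inner ℝ (F z) ((1 / meanCurvature F N z) • N z) := by
  refine forall_congr' fun z => and_congr_right fun h1 => ?_
  rw [real_inner_smul_right, mul_pos_iff_of_pos_right h1, one_div_pos]

namespace IsInverseMeanCurvatureFlow

variable {F₀ ν₀ : USphere n → Cn n} {T : EReal} {F ν : ℝ → USphere n → Cn n}
  (h : IsInverseMeanCurvatureFlow F₀ ν₀ T F ν)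

include h

/-- Strict positivity of two continuous functions on a compact sphere persists for nearby times,
uniformly in z, by the tube lemma. -/
lemma eventually_isOutwardConvex {t₁ : ℝ} (ht₁ : t₁ ∈ timeInterval T)
    (hc : IsOutwardConvex (F t₁) (ν t₁)) :
    ∀ᶠ t in 𝓝 t₁, t ∈ timeInterval T → IsOutwardConvex (F t) (ν t) := by
  have h1 : ∀ᶠ t in 𝓝 t₁, ∀ z ∈ (univ : Set (USphere n)), t ∈ timeInterval T →
      0 < inner ℝ (F t z) (ν t z) ∧
        0 < inner ℝ (F t z) ((1 / meanCurvature (F t) (ν t) z) • ν t z) := by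
    refine isCompact_univ.eventually_forall_of_forall_eventually fun z _ => ?_
    have hz : ((t₁, z) : ℝ × USphere n) ∈ timeInterval T ×ˢ univ := ⟨ht₁, mem_univ _⟩
    have e1 := ((h.continuousOn_map.inner (𝕜 := ℝ) h.continuousOn_normal) _ hz).eventually_const_lt
      (isOutwardConvex_iff.1 hc z).1
    have e2 := ((h.continuousOn_map.inner (𝕜 := ℝ) h.continuousOn_velocity) _ hz).eventually_const_lt
      (isOutwardConvex_iff.1 hc z).2
    filter_upwards [eventually_nhdsWithin_iff.1 e1, eventually_nhdsWithin_iff.1 e2] with p p1 p2 hp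
    exact ⟨p1 ⟨hp, mem_univ _⟩, p2 ⟨hp, mem_univ _⟩⟩
  filter_upwards [h1] with t ht htT
  exact isOutwardConvex_iff.2 fun z => ht z (mem_univ z) htT

variable {t₂ : ℝ} (hsub : Ico 0 t₂ ⊆ timeInterval T)
  (hc : ∀ t ∈ Ico 0 t₂, IsOutwardConvex (F t) (ν t))

include hsub hc

lemma isOutwardFlow : IsOutwardFlow F ν t₂ where
  smooth t ht p hp := by
    have htT := hsub ⟨ht.1.le, ht.2⟩
    exact h.smooth.contDiffAt (prod_mem_nhds (timeInterval_mem_nhds htT ht.1)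
      (isOpen_compl_singleton.mem_nhds hp))
  immersion t ht := h.immersion t (hsub ⟨ht.1.le, ht.2⟩)
  normal t ht := h.normal t (hsub ⟨ht.1.le, ht.2⟩)
  evolution t ht z := (h.evolution t (hsub ⟨ht.1.le, ht.2⟩) z).hasDerivAt
    (timeInterval_mem_nhds (hsub ⟨ht.1.le, ht.2⟩) ht.1)
  outward t ht z := (hc t ⟨ht.1.le, ht.2⟩ z).1
  convex t ht z := (hc t ⟨ht.1.le, ht.2⟩ z).2

theorem graphFlow {ι : Type*} [Fintype ι] (b : OrthonormalBasis ι ℝ (Cn n)) :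
    GraphFlow b (mulI n) n t₂ (fun t z => conformalRadius ‖F t z‖) (flowGrad F ν) (flowRot F ν)
      (flowSpeed F ν fun t z => 1 / meanCurvature (F t) (ν t) z) := by
  have hss : Ico 0 t₂ ×ˢ (univ : Set (USphere n)) ⊆ timeInterval T ×ˢ univ :=
    prod_mono hsub subset_rfl
  have cF := h.continuousOn_map.mono hss
  have cN := h.continuousOn_normal.mono hss
  have cV := h.continuousOn_velocity.mono hss
  have ca := cF.inner (𝕜 := ℝ) cN
  have hne : ∀ p ∈ Ico 0 t₂ ×ˢ (univ : Set (USphere n)), F p.1 p.2 ≠ 0 := fun p hp h0 => by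
    have := (hc p.1 hp.1 p.2).1
    simp [h0] at this
  have hn : ∀ p ∈ Ico 0 t₂ ×ˢ (univ : Set (USphere n)), 0 < ‖F p.1 p.2‖ := fun p hp =>
    norm_pos_iff.2 (hne p hp)
  have ha : ∀ p ∈ Ico 0 t₂ ×ˢ (univ : Set (USphere n)), inner ℝ (F p.1 p.2) (ν p.1 p.2) ≠ 0 :=
    fun p hp => (hc p.1 hp.1 p.2).1.ne'
  have cs : ContinuousOn (fun p : ℝ × USphere n => Real.sinh ‖F p.1 p.2‖) (Ico 0 t₂ ×ˢ univ) :=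
    Real.continuous_sinh.comp_continuousOn cF.norm
  have cc : ContinuousOn (fun p : ℝ × USphere n => Real.cosh ‖F p.1 p.2‖) (Ico 0 t₂ ×ˢ univ) :=
    Real.continuous_cosh.comp_continuousOn cF.norm
  have cr : ContinuousOn (Function.uncurry (flowRot F ν)) (Ico 0 t₂ ×ˢ univ) :=
    (((((cs.mul (cc.pow 2)).div cF.norm fun p hp => (hn p hp).ne').mul
      (((mulI n).continuous.comp_continuousOn cF).inner (𝕜 := ℝ) cN)).div ca ha)).neg
  refine ⟨?_, ?_, cr, ?_, ?_, ?_, ?_, ?_⟩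
  · intro p hp
    exact ContinuousAt.comp_continuousWithinAt (g := conformalRadius)
      (contDiffAt_conformalRadius (m := 0) (hn p hp)).continuousAt (cF.norm p hp)
  · exact ((((cF.norm.pow 2).div (ca.pow 2) fun p hp => pow_ne_zero 2 (ha p hp)).sub
      continuousOn_const).add (((cs.pow 2).div (cc.pow 2) fun p _ =>
        pow_ne_zero 2 (Real.cosh_pos _).ne').mul (cr.pow 2)))
  · have h1 : ContinuousOn (fun p : ℝ × USphere n => inner ℝ (F p.1 p.2)
        ((1 / meanCurvature (F p.1) (ν p.1) p.2) • ν p.1 p.2) / inner ℝ (F p.1 p.2) (ν p.1 p.2)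
        * ‖F p.1 p.2‖ / (Real.sinh ‖F p.1 p.2‖ * inner ℝ (F p.1 p.2) (ν p.1 p.2)))
        (Ico 0 t₂ ×ˢ univ) :=
      (((cF.inner (𝕜 := ℝ) cV).div ca ha).mul cF.norm).div (cs.mul ca) fun p hp =>
        mul_ne_zero (Real.sinh_pos_iff.2 (hn p hp)).ne' (ha p hp)
    refine h1.congr fun p hp => ?_
    simp only [Function.uncurry_def, flowSpeed]
    rw [real_inner_smul_right, mul_div_cancel_right₀ _ (ha p hp)]
  · exact fun t ht z => conformalRadius_neg (hn (t, z) ⟨ht, mem_univ _⟩)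
  · intro t ht z
    have h1 := hn (t, z) ⟨ht, mem_univ _⟩
    have h2 := hc t ht z
    have h3 := Real.sinh_pos_iff.2 h1
    exact div_pos (mul_pos (one_div_pos.2 h2.2) h1) (mul_pos h3 h2.1)
  · intro t ht z
    have h1 := inner_sq_le_bergmanMetric (hne (t, z) ⟨ht, mem_univ _⟩) (ν t z)
    rw [(h.normal t (hsub ht) z).1, mul_one] at h1
    have h2 := (hc t ht z).1
    have h3 : 1 ≤ ‖F t z‖ ^ 2 / inner ℝ (F t z) (ν t z) ^ 2 := by
      rw [one_le_div (by positivity)]; exact h1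
    have h4 : 0 ≤ Real.sinh ‖F t z‖ ^ 2 / Real.cosh ‖F t z‖ ^ 2 * flowRot F ν t z ^ 2 := by positivity
    rw [flowGrad]
    linarith
  · exact fun t ht z => (h.isOutwardFlow hsub hc).hasGraphChart ht z

/-- Particles move away from the origin, since ⟨F, ν/H⟩ > 0. This keeps the hypersurface away from
the origin in the closedness argument. -/
lemma norm_le_norm {t : ℝ} (ht : t ∈ Ico 0 t₂) (z : USphere n) : ‖F 0 z‖ ≤ ‖F t z‖ := by
  have hI : Icc 0 t ⊆ Ico 0 t₂ := fun s hs => ⟨hs.1, hs.2.trans_lt ht.2⟩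
  have h1 : MonotoneOn (fun s => ‖F s z‖ ^ 2) (Icc 0 t) := by
    have hd : ∀ s ∈ Ioo 0 t, HasDerivAt (fun s => ‖F s z‖ ^ 2)
        (2 * inner ℝ (F s z) ((1 / meanCurvature (F s) (ν s) z) • ν s z)) s := fun s hs =>
      ((h.isOutwardFlow hsub hc).evolution s ⟨hs.1, hs.2.trans ht.2⟩ z).norm_sq
    refine monotoneOn_of_deriv_nonneg (convex_Icc 0 t) ?_ ?_ ?_
    · refine ContinuousOn.pow (ContinuousOn.norm ?_) 2
      exact h.continuousOn_map.comp (f := fun s : ℝ => (s, z)) (by fun_prop) fun s hs =>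
        ⟨hsub (hI hs), mem_univ _⟩
    · rw [interior_Icc]
      exact fun s hs => (hd s hs).differentiableAt.differentiableWithinAt
    · rw [interior_Icc]
      intro s hs
      rw [(hd s hs).deriv]
      have := (isOutwardConvex_iff.1 (hc s ⟨hs.1.le, hs.2.trans ht.2⟩) z).2
      linarith
  have h2 := h1 (left_mem_Icc.2 ht.1) (right_mem_Icc.2 ht.1) ht.1
  exact (pow_le_pow_iff_left₀ (norm_nonneg _) (norm_nonneg _) two_ne_zero).1 h2

end IsInverseMeanCurvatureFlow

end FlowContinuity

/-! ### The initial hypersurface and its Hopf symmetry. -/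

noncomputable section InitialHypersurface

open Filter Topology Set

variable {n : ℕ}

lemma CircleInvariant.rayExt_smul_eq {ρ : USphere n → ℝ} (hρ : CircleInvariant ρ) {a : ℂ} (ha : ‖a‖ = 1)
    (p : Cn n) : rayExt ρ (a • p) = rayExt ρ p := by
  by_cases hp : p = 0
  · simp [hp]
  · have ha0 : a ≠ 0 := fun h => by simp [h] at ha
    have hap : a • p ≠ 0 := smul_ne_zero ha0 hp
    rw [rayExt, rayExt, dif_neg hap, dif_neg hp]
    refine hρ a ha _ _ ?_
    simp only [norm_smul, ha, one_mul]
    exact smul_comm _ _ _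

lemma CircleInvariant.fderiv_mulI {ρ : USphere n → ℝ} (hρ : CircleInvariant ρ) {p : Cn n}
    (hd : DifferentiableAt ℝ (rayExt ρ) p) : fderiv ℝ (rayExt ρ) p (mulI n p) = 0 := by
  have h1 : HasDerivAt (fun θ : ℝ => Real.cos θ • p + Real.sin θ • mulI n p) (mulI n p) 0 := by
    have := ((Real.hasDerivAt_cos 0).smul_const p).add ((Real.hasDerivAt_sin 0).smul_const (mulI n p))
    refine this.congr_deriv ?_
    simp
  have h2 : HasFDerivAt (rayExt ρ) (fderiv ℝ (rayExt ρ) p)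
      (Real.cos 0 • p + Real.sin 0 • mulI n p) := by simpa using hd.hasFDerivAt
  have h3 := h2.comp_hasDerivAt (0 : ℝ) h1
  refine h3.unique ((hasDerivAt_const (0 : ℝ) (rayExt ρ p)).congr_of_eventuallyEq
    (Eventually.of_forall fun θ => ?_))
  have h4 : Real.cos θ • p + Real.sin θ • mulI n p = Complex.exp (θ * Complex.I) • p := by
    rw [Complex.exp_mul_I, add_smul, mulI_apply, ← Complex.ofReal_cos, ← Complex.ofReal_sin, mul_smul]
    rfl
  simp only [Function.comp, h4]
  exact hρ.rayExt_smul_eq (by simp) p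

/-- An invariant star-shaped hypersurface avoids the origin, and its normal is orthogonal to the
Hopf field. -/
theorem IsInvariantStarShaped.normal_orthogonal {F₀ ν₀ : USphere n → Cn n} (hF₀ : SphereSmooth F₀)
    (himm : SphereImmersion F₀) (hstar : IsInvariantStarShaped (Set.range F₀))
    (hν₀ : IsUnitNormal F₀ ν₀) (z : USphere n) :
    F₀ z ≠ 0 ∧ inner ℝ (mulI n (F₀ z)) (ν₀ z) = 0 := by
  obtain ⟨ρ, hpos, hsm, hinv, hran⟩ := hstar
  have hgr : ∀ w, 0 < ‖F₀ w‖ ∧ ‖F₀ w‖ = rayExt ρ (F₀ w) := by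
    intro w
    obtain ⟨y, hy⟩ : F₀ w ∈ Set.range fun z : USphere n => ρ z • (z : Cn n) := by
      rw [← hran]; exact ⟨w, rfl⟩
    simp only at hy
    have : ‖F₀ w‖ = ρ y := by
      rw [← hy, norm_smul, Real.norm_of_nonneg (hpos y).le]; simp
    refine ⟨this ▸ hpos y, ?_⟩
    rw [this, ← hy, rayExt_smul ρ (hpos y), rayExt_coe]
  have hp0 : F₀ z ≠ 0 := norm_pos_iff.1 (hgr z).1
  refine ⟨hp0, ?_⟩
  set p := F₀ z with hp
  have hR : DifferentiableAt ℝ (rayExt ρ) p :=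
    (hsm.contDiffAt (isOpen_compl_singleton.mem_nhds hp0)).differentiableAt (by simp)
  have hFd : DifferentiableAt ℝ (rayExt F₀) (z : Cn n) :=
    (hF₀.contDiffAt (isOpen_compl_singleton.mem_nhds
      (IsOutwardFlow.coe_ne_zero z))).differentiableAt (by simp)
  have hn : DifferentiableAt ℝ (fun p : Cn n => ‖p‖) p :=
    (contDiffAt_norm ℝ hp0 (n := 1)).differentiableAt (by norm_num)
  -- Φ is the differential of the defining function |p| - ρ(p/|p|). It annihilates the image of the
  -- differential of F₀ and, by invariance of ρ, the Hopf vector ip, but not the radial vector p.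
  set Φ := fderiv ℝ (fun p : Cn n => ‖p‖) p - fderiv ℝ (rayExt ρ) p with hΦ
  have hΦF : ∀ X, Φ (sphereDeriv F₀ z X) = 0 := by
    have h1 : HasFDerivAt (fun p : Cn n => ‖p‖ - rayExt ρ p) Φ (rayExt F₀ (z : Cn n)) := by
      rw [rayExt_coe]; exact hn.hasFDerivAt.sub hR.hasFDerivAt
    have h2 := h1.comp (z : Cn n) hFd.hasFDerivAt
    have h3 : HasFDerivAt ((fun p : Cn n => ‖p‖ - rayExt ρ p) ∘ rayExt F₀) (0 : Cn n →L[ℝ] ℝ) (z : Cn n) := by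
      refine (hasFDerivAt_const (0 : ℝ) _).congr_of_eventuallyEq ?_
      filter_upwards [isOpen_compl_singleton.mem_nhds (IsOutwardFlow.coe_ne_zero z)] with w hw
      have hw0 : w ≠ 0 := hw
      simp only [Function.comp, rayExt, dif_neg hw0]
      exact sub_eq_zero.2 (hgr _).2
    intro X
    have := congrArg (fun A : Cn n →L[ℝ] ℝ => A X) (h2.unique h3)
    simpa [sphereDeriv] using this
  have hΦp : Φ p = ‖p‖ := by
    have h1 : fderiv ℝ (fun p : Cn n => ‖p‖) p p = ‖p‖ := by
      have := pd_norm hp0 p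
      rw [real_inner_self_eq_norm_sq, sq, mul_self_div_self] at this
      exact this
    rw [hΦ, sub_apply, h1, fderiv_radial_eq_zero hR fun c hc => rayExt_smul ρ hc p,
      sub_zero]
  have hΦI : Φ (mulI n p) = 0 := by
    have h1 : fderiv ℝ (fun p : Cn n => ‖p‖) p (mulI n p) = 0 := by
      have := pd_norm hp0 (mulI n p)
      rw [real_inner_comm, inner_mulI_self, zero_div] at this
      exact this
    rw [hΦ, sub_apply, h1, hinv.fderiv_mulI hR, sub_zero]
  -- The tangent space together with the radial line spans ℂⁿ by dimension count. Writing ip as a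
  -- tangent vector plus cp and applying Φ gives c = 0, so ip is tangent and the normal is
  -- orthogonal to it.
  let A : sphereTangent z × ℝ →ₗ[ℝ] Cn n :=
    ((fderiv ℝ (rayExt F₀) (z : Cn n)).toLinearMap.comp (sphereTangent z).subtype).coprod
      (LinearMap.toSpanSingleton ℝ (Cn n) p)
  have hAv : ∀ X c, A (X, c) = sphereDeriv F₀ z X + c • p := fun X c => by
    simp [A, sphereDeriv]
  have hA : Function.Injective A := by
    refine (injective_iff_map_eq_zero A).2 ?_
    rintro ⟨X, c⟩ hX
    rw [hAv] at hX
    have h1 := congrArg Φ hX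
    rw [map_add, hΦF, map_smul, hΦp, zero_add, map_zero, smul_eq_mul] at h1
    have h2 : c = 0 := (mul_eq_zero.1 h1).resolve_right (norm_ne_zero_iff.2 hp0)
    rw [h2, zero_smul, add_zero] at hX
    have h3 : X = 0 := Subtype.ext (himm z X X.2 hX)
    rw [h2, h3]
    rfl
  have hdim : Module.finrank ℝ (sphereTangent z × ℝ) = Module.finrank ℝ (Cn n) := by
    have := (Submodule.span ℝ {(z : Cn n)}).finrank_add_finrank_orthogonal
    rw [finrank_span_singleton (IsOutwardFlow.coe_ne_zero z), add_comm] at this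
    rw [Module.finrank_prod, Module.finrank_self]
    exact this
  obtain ⟨⟨X, c⟩, hX⟩ := (LinearMap.injective_iff_surjective_of_finrank_eq_finrank hdim).1 hA (mulI n p)
  rw [hAv] at hX
  have h1 := congrArg Φ hX
  rw [map_add, hΦF, map_smul, hΦp, zero_add, hΦI, smul_eq_mul] at h1
  have h2 : c = 0 := (mul_eq_zero.1 h1).resolve_right (norm_ne_zero_iff.2 hp0)
  rw [h2, zero_smul, add_zero] at hX
  have h3 := (hν₀ z).2 X X.2
  rw [hX, ← hp, bergmanMetric_eq hp0, real_inner_comm (mulI n p) p, inner_mulI_self,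
    real_inner_self_eq_norm_sq, norm_mulI] at h3
  have hn0 := (hgr z).1
  have ha : 0 < bergmanFactor p := div_pos (Real.sinh_pos_iff.2 hn0) hn0
  have h4 : (bergmanFactor p ^ 2 + bergmanFactor p ^ 4 * ‖p‖ ^ 2) * inner ℝ (mulI n p) (ν₀ z) = 0 := by
    rw [← h3]; ring
  exact (mul_eq_zero.1 h4).resolve_left (by positivity)

lemma exists_pos_forall_le {S : Type*} [TopologicalSpace S] [CompactSpace S] {f : S → ℝ}
    (hf : Continuous f) (h0 : ∀ z, 0 < f z) : ∃ ε, 0 < ε ∧ ∀ z, ε ≤ f z := by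
  rcases isEmpty_or_nonempty S with hS | hS
  · exact ⟨1, one_pos, fun z => (hS.false z).elim⟩
  · obtain ⟨z, -, hz⟩ := isCompact_univ.exists_isMinOn univ_nonempty hf.continuousOn
    exact ⟨f z, h0 z, fun w => hz (mem_univ w)⟩

lemma exists_pos_forall_ge {S : Type*} [TopologicalSpace S] [CompactSpace S] {f : S → ℝ}
    (hf : Continuous f) : ∃ C, 0 < C ∧ ∀ z, f z ≤ C := by
  obtain ⟨C, hC⟩ := isCompact_univ.exists_bound_of_continuousOn hf.continuousOn
  exact ⟨max C 1, lt_max_of_lt_right one_pos, fun z =>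
    (le_abs_self _).trans ((hC z (mem_univ z)).trans (le_max_left _ _))⟩

end InitialHypersurface

/-! ### Recovering the mean curvature from the graph quantities. -/

noncomputable section CurvatureEstimate

open Filter Topology Set

variable {n : ℕ} {F₀ ν₀ : USphere n → Cn n} {T : EReal} {F ν : ℝ → USphere n → Cn n}

/-- Without Hopf derivative the slope V is √(1+P), so H = V/(φ_t sinh ρ) depends only on quantities
controlled by the graph estimates. -/
lemma sqrt_flowGrad_div {t : ℝ} {z : USphere n} (ha : 0 < inner ℝ (F t z) (ν t z))
    (hH : 0 < meanCurvature (F t) (ν t) z) (hrot : flowRot F ν t z = 0) :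
    √(1 + flowGrad F ν t z) = ‖F t z‖ / inner ℝ (F t z) (ν t z) ∧
    √(1 + flowGrad F ν t z) / (flowSpeed F ν (fun t z => 1 / meanCurvature (F t) (ν t) z) t z
      * csinh (conformalRadius ‖F t z‖)) = meanCurvature (F t) (ν t) z := by
  have hF : F t z ≠ 0 := fun h0 => by simp [h0] at ha
  have hn : 0 < ‖F t z‖ := norm_pos_iff.2 hF
  have hs := Real.sinh_pos_iff.2 hn
  have h1 : √(1 + flowGrad F ν t z) = ‖F t z‖ / inner ℝ (F t z) (ν t z) := by
    have h2 : 1 + flowGrad F ν t z = (‖F t z‖ / inner ℝ (F t z) (ν t z)) ^ 2 := by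
      rw [flowGrad, hrot]; ring
    rw [h2, Real.sqrt_sq (by positivity)]
  refine ⟨h1, ?_⟩
  rw [h1, csinh_conformalRadius, flowSpeed]
  field_simp

end CurvatureEstimate

/-! ### Uniform bounds and the continuation argument. -/

noncomputable section LongTimeEstimates

open Filter Topology Set

variable {n : ℕ} {F₀ ν₀ : USphere n → Cn n} {T : EReal} {F ν : ℝ → USphere n → Cn n}

/-- Uniform estimates for the flow on `[0, t₂)`: the curvature pinching of the conclusion, together
with a gradient bound. -/
def HasFlowBounds (c₁ c₂ c P : ℝ) (F ν : ℝ → USphere n → Cn n) (t : ℝ) : Prop :=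
  ∀ z, ‖F t z‖ ≤ P * inner ℝ (F t z) (ν t z) ∧ c₁ ≤ meanCurvature (F t) (ν t) z ∧
    meanCurvature (F t) (ν t) z ≤ c₂ ∧
    |meanCurvature (F t) (ν t) z - 2 * n| ≤ c * Real.exp (-(t / n))

namespace IsInverseMeanCurvatureFlow

lemma exists_outwardConvex_interval (h : IsInverseMeanCurvatureFlow F₀ ν₀ T F ν)
    (hc : IsOutwardConvex F₀ ν₀) : ∃ t₂, 0 < t₂ ∧ Ico 0 t₂ ⊆ timeInterval T ∧
      ∀ t ∈ Ico 0 t₂, IsOutwardConvex (F t) (ν t) := by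
  obtain ⟨s, hs0, hs⟩ := exists_lt_Ico_subset_timeInterval h.zero_mem
  obtain ⟨ε, hε, hb⟩ := Metric.eventually_nhds_iff.1 (h.eventually_isOutwardConvex h.zero_mem
    (by rw [h.initial, h.initial_normal]; exact hc))
  refine ⟨min s ε, lt_min hs0 hε, (Ico_subset_Ico_right (min_le_left _ _)).trans hs, fun t ht => ?_⟩
  refine hb ?_ (hs ⟨ht.1, ht.2.trans_le (min_le_left _ _)⟩)
  rw [Real.dist_eq, sub_zero, abs_of_nonneg ht.1]
  exact ht.2.trans_le (min_le_right _ _)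

/-- The uniform estimates hold as long as the hypersurfaces are star-shaped and mean convex, with
constants that depend on the initial data only. -/
theorem exists_flow_bounds (hn : 1 ≤ n) {T₁ : EReal} {F₁ ν₁ : ℝ → USphere n → Cn n}
    (h₁ : IsInverseMeanCurvatureFlow F₀ ν₀ T₁ F₁ ν₁) (hc : IsOutwardConvex F₀ ν₀)
    (horth : ∀ z, inner ℝ (mulI n (F₀ z)) (ν₀ z) = 0) :
    ∃ c₁ c₂ c P : ℝ, 0 < c₁ ∧ 0 < c₂ ∧ 0 < c ∧ 0 < P ∧
      ∀ (T : EReal) (F ν : ℝ → USphere n → Cn n), IsInverseMeanCurvatureFlow F₀ ν₀ T F ν →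
        ∀ t₂, Ico 0 t₂ ⊆ timeInterval T → (∀ t ∈ Ico 0 t₂, IsOutwardConvex (F t) (ν t)) →
          ∀ t ∈ Ico 0 t₂, HasFlowBounds c₁ c₂ c P F ν t := by
  let b := stdOrthonormalBasis ℝ (Cn n)
  have hF : ∀ z, 0 < ‖F₀ z‖ := fun z => norm_pos_iff.2 fun h0 => by
    have := (hc z).1
    simp [h0] at this
  -- The flow h₁ serves only to show that the speed at t = 0 is continuous and hence bounded on both
  -- sides. Its values there involve F₀ and ν₀ alone, so the constants apply to every other flow
  -- with the same data.
  obtain ⟨t₁, ht₁, hsub, hcv⟩ := h₁.exists_outwardConvex_interval hc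
  have hG := h₁.graphFlow hsub hcv b
  have hslice : ∀ {f : ℝ → USphere n → ℝ}, ContinuousOn (Function.uncurry f) (Ico 0 t₁ ×ˢ univ) →
      Continuous (f 0) := fun {f} hf => by
    rw [← continuousOn_univ]
    exact hf.comp (f := fun z : USphere n => ((0 : ℝ), z)) (by fun_prop) fun z _ =>
      ⟨⟨le_rfl, ht₁⟩, mem_univ _⟩
  have hFc : Continuous F₀ := by
    have h2 := h₁.continuousOn_map.comp (f := fun z : USphere n => ((0 : ℝ), z)) (s := univ)
      (by fun_prop) fun z _ => ⟨h₁.zero_mem, mem_univ _⟩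
    rw [continuousOn_univ] at h2
    simpa only [Function.comp_def, h₁.initial] using h2
  obtain ⟨L₀, hL₀, hL⟩ := exists_pos_forall_le (Real.continuous_sinh.comp hFc.norm)
    fun z => Real.sinh_pos_iff.2 (hF z)
  obtain ⟨C₀, hC₀, hC⟩ := exists_pos_forall_ge (Real.continuous_cosh.comp hFc.norm)
  obtain ⟨ua, hua, hua'⟩ := exists_pos_forall_le (hslice hG.cont_speed)
    fun z => hG.pos 0 ⟨le_rfl, ht₁⟩ z
  obtain ⟨ub, hub, hub'⟩ := exists_pos_forall_ge (hslice hG.cont_speed)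
  obtain ⟨P₀, hP₀, hP⟩ := exists_pos_forall_ge (hslice hG.cont_grad)
  obtain ⟨c₁, c₂, c, P₁, hc₁, hc₂, hc', hbd⟩ := GraphFlow.exists_uniform_bounds (b := b) hn
    (I := mulI n) (fun v => (norm_mulI v).le) inner_mulI_left hL₀ hC₀ hua hub hP₀.le
  refine ⟨c₁, c₂, c, √(1 + P₁) + 1, hc₁, hc₂, hc', by positivity, fun T F ν h t₂ hs hcc t ht z => ?_⟩
  have e0 : F 0 = F₁ 0 := h.initial.trans h₁.initial.symm
  have e1 : ν 0 = ν₁ 0 := h.initial_normal.trans h₁.initial_normal.symm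
  have key := hbd (h.graphFlow hs hcc b) (fun w => by
      rw [csinh_conformalRadius, h.initial]; exact hL w)
    (fun w => by
      rw [h.initial, ccosh_conformalRadius (hF w)]; exact hC w)
    (fun w => by
      simp only [flowSpeed, e0, e1]; exact hua' w)
    (fun w => by
      simp only [flowSpeed, e0, e1]; exact hub' w)
    (fun w => by
      simp only [flowGrad, flowRot, e0, e1]; exact hP w)
    (fun w => by
      rw [flowRot, h.initial, h.initial_normal, horth, mul_zero, zero_div, neg_zero]) t ht z
  obtain ⟨k1, k2, k3, k4, k5⟩ := key
  have ha := (hcc t ht z).1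
  obtain ⟨r1, r2⟩ := sqrt_flowGrad_div ha (hcc t ht z).2 k1
  rw [r2] at k3 k4 k5
  refine ⟨?_, k3, k4, k5⟩
  have h3 : ‖F t z‖ / inner ℝ (F t z) (ν t z) ≤ √(1 + P₁) + 1 := by
    rw [← r1]
    have h4 := Real.sqrt_le_sqrt (show 1 + flowGrad F ν t z ≤ 1 + P₁ by linarith)
    linarith
  rwa [div_le_iff₀ ha] at h3

/-- Star-shapedness and mean convexity are closed conditions along the flow. -/
lemma isOutwardConvex_of_bounds (h : IsInverseMeanCurvatureFlow F₀ ν₀ T F ν)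
    {t₂ c₁ c₂ c P : ℝ} (hc₁ : 0 < c₁) (hc₂ : 0 < c₂) (hP : 0 < P) (ht₂ : t₂ ∈ timeInterval T) (h0 : 0 < t₂)
    (hcv : ∀ t ∈ Ico 0 t₂, IsOutwardConvex (F t) (ν t))
    (hb : ∀ t ∈ Ico 0 t₂, HasFlowBounds c₁ c₂ c P F ν t) : IsOutwardConvex (F t₂) (ν t₂) := by
  have hsub : Ico 0 t₂ ⊆ timeInterval T := fun s hs => mem_timeInterval_of_le ht₂ hs.1 hs.2.le
  refine isOutwardConvex_iff.2 fun z => ?_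
  have hF0 : 0 < ‖F 0 z‖ := norm_pos_iff.2 fun h1 => by
    have := (hcv 0 ⟨le_rfl, h0⟩ z).1
    simp [h1] at this
  have hne : (𝓝[Ico 0 t₂] t₂).NeBot := by
    rw [← mem_closure_iff_nhdsWithin_neBot, closure_Ico h0.ne]
    exact right_mem_Icc.2 h0.le
  have hlim : ∀ {f : ℝ × USphere n → ℝ}, ContinuousOn f (timeInterval T ×ˢ univ) →
      Tendsto (fun t => f (t, z)) (𝓝[Ico 0 t₂] t₂) (𝓝 (f (t₂, z))) := fun {f} hf => by
    have h1 : ContinuousWithinAt (fun t => f (t, z)) (timeInterval T) t₂ :=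
      (hf.comp (f := fun t : ℝ => (t, z)) (by fun_prop) fun t ht => ⟨ht, mem_univ _⟩) t₂ ht₂
    exact h1.mono hsub
  have l1 := hlim (h.continuousOn_map.inner (𝕜 := ℝ) h.continuousOn_normal)
  have l2 := hlim (h.continuousOn_map.inner (𝕜 := ℝ) h.continuousOn_velocity)
  -- The gradient bound gives ⟨F, ν⟩ ≥ |F|/P, and |F| does not decrease, so the support function
  -- stays away from zero up to the limit time. With 1/H ≥ 1/c₂ the same holds for ⟨F, ν/H⟩.
  have hlow : ∀ t ∈ Ico 0 t₂, ‖F 0 z‖ / P ≤ inner ℝ (F t z) (ν t z) := fun t ht => by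
    rw [div_le_iff₀ hP, mul_comm]
    exact (h.norm_le_norm hsub hcv ht z).trans (hb t ht z).1
  constructor
  · exact (div_pos hF0 hP).trans_le (ge_of_tendsto l1
      (eventually_nhdsWithin_of_forall fun t ht => hlow t ht))
  · refine lt_of_lt_of_le (show 0 < 1 / c₂ * (‖F 0 z‖ / P) by positivity) (ge_of_tendsto l2
      (eventually_nhdsWithin_of_forall fun t ht => ?_))
    have h1 := hb t ht z
    have h2 : 0 < meanCurvature (F t) (ν t) z := hc₁.trans_le h1.2.1
    simp only [real_inner_smul_right]
    refine mul_le_mul (one_div_le_one_div_of_le h2 h1.2.2.1) (hlow t ht) (by positivity) (by positivity)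

/-- A flow with uniform estimates stays star-shaped and mean convex. -/
theorem isOutwardConvex (h : IsInverseMeanCurvatureFlow F₀ ν₀ T F ν) (hc : IsOutwardConvex F₀ ν₀)
    {c₁ c₂ c P : ℝ} (hc₁ : 0 < c₁) (hc₂ : 0 < c₂) (hP : 0 < P)
    (hb : ∀ t₂, Ico 0 t₂ ⊆ timeInterval T → (∀ t ∈ Ico 0 t₂, IsOutwardConvex (F t) (ν t)) →
      ∀ t ∈ Ico 0 t₂, HasFlowBounds c₁ c₂ c P F ν t) :
    ∀ t ∈ timeInterval T, IsOutwardConvex (F t) (ν t) := by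
  by_contra! hcon
  obtain ⟨t₀, ht₀, hbad⟩ := hcon
  -- At the infimum s of the bad times the hypersurface is good, by the initial data if s = 0 and by
  -- closedness otherwise. Openness at s then contradicts the existence of bad times arbitrarily
  -- close to s.
  set B := {t | t ∈ timeInterval T ∧ ¬ IsOutwardConvex (F t) (ν t)} with hB
  have hBne : B.Nonempty := ⟨t₀, ht₀, hbad⟩
  have hBbd : BddBelow B := ⟨0, fun t ht => ht.1.1⟩
  set s := sInf B with hs
  have hs0 : 0 ≤ s := le_csInf hBne fun t ht => ht.1.1
  have hsT : s ∈ timeInterval T := mem_timeInterval_of_le ht₀ hs0 (csInf_le hBbd ⟨ht₀, hbad⟩)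
  have hsub : Ico 0 s ⊆ timeInterval T := fun t ht => mem_timeInterval_of_le hsT ht.1 ht.2.le
  have hcv : ∀ t ∈ Ico 0 s, IsOutwardConvex (F t) (ν t) := fun t ht => by
    by_contra hn
    exact absurd (csInf_le hBbd ⟨hsub ht, hn⟩) (not_le.2 ht.2)
  have hgood : IsOutwardConvex (F s) (ν s) := by
    rcases hs0.eq_or_lt with h0 | h0
    · rw [← h0, h.initial, h.initial_normal]; exact hc
    · exact h.isOutwardConvex_of_bounds hc₁ hc₂ hP hsT h0 hcv (hb s hsub hcv)
  obtain ⟨ε, hε, hball⟩ := Metric.eventually_nhds_iff.1 (h.eventually_isOutwardConvex hsT hgood)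
  obtain ⟨t, ht, hts⟩ := exists_lt_of_csInf_lt hBne (show sInf B < s + ε by linarith)
  refine ht.2 (hball ?_ ht.1)
  rw [Real.dist_eq, abs_of_nonneg (sub_nonneg.2 (csInf_le hBbd ht))]
  linarith

end IsInverseMeanCurvatureFlow

end LongTimeEstimates

/-! ### The curvature estimate for the flow. -/

theorem proposition5p7 (n : ℕ) (hn : 2 ≤ n) (F₀ ν₀ : USphere n → Cn n)
    (hF₀ : SphereSmooth F₀) (hF₀_imm : SphereImmersion F₀) (hF₀_inj : Function.Injective F₀)
    (hF₀_star : IsInvariantStarShaped (Set.range F₀))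
    (hν₀ : IsUnitNormal F₀ ν₀) (hν₀_out : PointsOutward F₀ ν₀)
    (hmc : ∀ z, 0 < meanCurvature F₀ ν₀ z) :
    ∃ c₁ c₂ c : ℝ, 0 < c₁ ∧ 0 < c₂ ∧ 0 < c ∧
      ∀ (T : EReal) (F ν : ℝ → USphere n → Cn n), IsInverseMeanCurvatureFlow F₀ ν₀ T F ν →
        ∀ t ∈ timeInterval T, ∀ z : USphere n,
          (c₁ ≤ meanCurvature (F t) (ν t) z ∧ meanCurvature (F t) (ν t) z ≤ c₂) ∧
          |meanCurvature (F t) (ν t) z - 2 * (n : ℝ)| ≤ c * Real.exp (-(t / (n : ℝ))) := by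
  have hinit := IsInvariantStarShaped.normal_orthogonal hF₀ hF₀_imm hF₀_star hν₀
  have hc : IsOutwardConvex F₀ ν₀ := fun z =>
    ⟨by rw [← bergmanMetric_position (hinit z).1]; exact hν₀_out z, hmc z⟩
  -- The constants are fixed before the flow is given, but they use some flow to control the initial
  -- speed. If no flow with these data exists, the estimate is vacuous and any positive constants
  -- will do.
  by_cases hex : ∃ (T : EReal) (F ν : ℝ → USphere n → Cn n),
      IsInverseMeanCurvatureFlow F₀ ν₀ T F ν
  · obtain ⟨T₁, F₁, ν₁, h₁⟩ := hex
    obtain ⟨c₁, c₂, c, P, hc₁, hc₂, hc', hP, hb⟩ :=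
      IsInverseMeanCurvatureFlow.exists_flow_bounds (by omega) h₁ hc fun z => (hinit z).2
    refine ⟨c₁, c₂, c, hc₁, hc₂, hc', fun T F ν h t ht z => ?_⟩
    have hcv := h.isOutwardConvex hc hc₁ hc₂ hP (hb T F ν h)
    obtain ⟨t₂, htt, hsub⟩ := exists_lt_Ico_subset_timeInterval ht
    have := hb T F ν h t₂ hsub (fun s hs => hcv s (hsub hs)) t ⟨ht.1, htt⟩ z
    exact ⟨⟨this.2.1, this.2.2.1⟩, this.2.2.2⟩
  · exact ⟨1, 1, 1, one_pos, one_pos, one_pos, fun T F ν h => (hex ⟨T, F, ν, h⟩).elim⟩
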